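/- Let $f:(\mathbb C^3,0)\to(\mathbb C^3,0)$ be a holomorphic germ of the form $$f(x,y,z)=\big(x+yz(y-z)+P,\;y+x(x^2-z^2)+Q,\;z+xz(y-z)+R\big),$$ where $P,Q,R$ are holomorphic germs of order at least $4$ at the origin. Denote by $P^{(4)},R^{(4)}$ the homogeneous parts of degree $4$ of $P,R$, and assume that $f$ is generic in the following sense: the coefficient $R_{040}$ of $y^4$ in $R$ is non-zero, $P^{(4)}(1,1,1)\neq R^{(4)}(1,1,1)$ and $P^{(4)}(-1,1,1)\neq -R^{(4)}(-1,1,1)$. Let $\pi_0:X_{\pi_0}\to(\mathbb C^3,0)$ be the composition of the following four blow-ups: of the origin; of the point $p_5$ of the first exceptional divisor corresponding to the direction $[0:1:0]$; of the point over $p_5$ corresponding to the direction $[1:0:0]$, in the coordinates at $p_5$ for which the first blow-up is $(x,y,z)\mapsto(xy,y,yz)$; of the line $L\cong\mathbb P^1$ of the third exceptional divisor formed by the directions $[p:0:r]$, in the coordinates for which the second blow-up is $(x,y,z)\mapsto(x,xy,xz)$. Any modification $\pi:X_\pi\to(\mathbb C^3,0)$ considered here carries the lift $f_\pi$ of $f$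 (the germ along $\pi^{-1}(0)$ of holomorphic map with $\pi\circ f_\pi=f\circ\pi$). At a point $p\in\pi^{-1}(0)$ where the germ of $f_\pi$ is tangent to the identity, its infinitesimal generator is the unique formal vector field $\chi$ of multiplicity at least $2$ with $f_\pi=\exp\chi$, and the saturated infinitesimal generator $\hat\chi_\pi$ is obtained from it by dividing by the greatest common divisor of its coefficients. The singular locus $S_\pi$ is the set of points $p\in\pi^{-1}(0)$ at which $\hat\chi_\pi$ vanishes. Let $\pi:X_\pi\to(\mathbb C^3,0)$ be any point modification over $X_{\pi_0}$ adapted to $f$, i.e. $\pi$ is obtained from $\pi_0$ by a finite (possibly empty) sequence of blow-ups of points, each centre being a point of the singular locus, over the origin, of the saturated infinitesimal generator of the lift of $f$ to the model reached so far. Then the lift $f_\pi$ of $f$ exists, and every positive-dimensional irreducible component $C$ of $S_\pi$ is a smooth compact rational curve, fixed pointwise by $f_\pi$, at every point of which the germ of $f_\pi$ is tangent to the identity and $\hat\chi_\pi$ is singular. Moreover one of the following holds: (1) at every point of $C$ the germ of $f_\pi$ is a simple corner (simple-corner pattern); (2) at all but finitely many points of $C$ the germ of $f_\pi$ is a half corner,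 and at each of the remaining points of $C$ it is a spinning corner (spinning-corner/half-corner pattern). Here, denoting by $\mathfrak m$ the maximal ideal of the ring of germs of holomorphic functions at the origin, a germ is called, if in suitable local holomorphic coordinates $(x,y,z)$ it has the given form with holomorphic $P,Q,R$: - a simple corner: $\big(x+x^ay^bz^c\,x(\lambda+P),\;y+x^ay^bz^c\,y(\mu+Q),\;z+x^ay^bz^cR\big)$ with integers $a,b\geq1$, $c\geq0$, $\lambda\in\mathbb C^*$, $\mu\in\mathbb C\setminus\lambda\mathbb Q_{>0}$, $P,Q,R\in\mathfrak m$, and $z\mid R$ if $c>0$; - a spinning corner: $\big(x+y^bz^c(x+P),\;y+y^{b+1}z^cQ,\;z+y^bz^{c+1}R\big)$ with integers $b,c\geq1$, $P\in\mathfrak m^2$, $Q,R\in\mathfrak m$; - a half corner: $\big(x+z^c(x+P),\;y+z^{c+1}(\beta+Q),\;z+z^{c+2}R\big)$ with an integer $c\geq1$, $\beta\in\mathbb C$, $P\in\mathfrak m^2$, $Q\in\mathfrak m$ and $R$ arbitrary. -/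

import Mathlib

open scoped Manifold ContDiff Topology

noncomputable section

namespace TangentToId

/-- Affine complex three-space, the base of all modifications and the model of all threefolds. -/
abbrev C3 := Fin 3 → ℂ

/-- A (Hausdorff) complex manifold of dimension three. -/
structure Threefold where
  carrier : Type
  [topology : TopologicalSpace carrier]
  [hausdorff : T2Space carrier]
  [charted : ChartedSpace C3 carrier]
  [holomorphic : IsManifold 𝓘(ℂ, C3) ω carrier]

attribute [instance] Threefold.topology Threefold.hausdorff Threefold.charted
  Threefold.holomorphic

instance : CoeSort Threefold Type := ⟨Threefold.carrier⟩

/-- The space `ℂ³` itself as a complex threefold. -/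
abbrev Threefold.affine : Threefold := { carrier := C3 }

/-- Holomorphic charts of a threefold: the elements of the maximal holomorphic atlas. -/
abbrev Chart (X : Threefold) : Set (OpenPartialHomeomorph X C3) :=
  IsManifold.maximalAtlas 𝓘(ℂ, C3) ω X

/-- `u` is a system of local holomorphic coordinates centred at `p`. -/
def IsCoordAt {X : Threefold} (u : OpenPartialHomeomorph X C3) (p : X) : Prop :=
  u ∈ Chart X ∧ p ∈ u.source ∧ u p = 0

/-! ### Blow-ups of smooth centres -/

/-- The standard blow-up map in the `j`-th affine chart, for the centre `{x_i = 0, i ∈ I}`. -/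
def stdBlowUp (I : Finset (Fin 3)) (j : Fin 3) (w : C3) : C3 :=
  fun i => if i ∈ I ∧ i ≠ j then w i * w j else w i

/-- `u` is a chart in which `Z` is the coordinate subspace `{u_i = 0, i ∈ I}`. -/
def IsAdaptedChart {X : Threefold} (Z : Set X) (I : Finset (Fin 3))
    (u : OpenPartialHomeomorph X C3) : Prop :=
  u ∈ Chart X ∧ ∀ x ∈ u.source, x ∈ Z ↔ ∀ i ∈ I, u x i = 0

/-- `ψ` is the `j`-th affine chart of `β : X' → X` over the chart `u`: in the coordinates `ψ`, `u`
the map `β` is the standard blow-up map, over the whole domain of `u`. -/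
def IsAffineChart {X' X : Threefold} (β : X' → X) (u : OpenPartialHomeomorph X C3)
    (I : Finset (Fin 3)) (j : Fin 3) (ψ : OpenPartialHomeomorph X' C3) : Prop :=
  ψ ∈ Chart X' ∧ ψ.target = {w | stdBlowUp I j w ∈ u.target} ∧
    ∀ w ∈ ψ.target, β (ψ.symm w) = u.symm (stdBlowUp I j w)

/-- `β : X' → X` is the blow-up of the closed submanifold `Z` of codimension `k ≥ 2`: it is
bijective off `Z`, and over every chart in which `Z` is a coordinate subspace it is
covered by the standard affine charts. -/
structure IsBlowUp {X' X : Threefold} (k : ℕ) (Z : Set X) (β : X' → X) : Prop where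
  two_le : 2 ≤ k
  isClosed : IsClosed Z
  submanifold : ∀ z ∈ Z, ∃ (I : Finset (Fin 3)) (u : OpenPartialHomeomorph X C3),
    I.card = k ∧ IsAdaptedChart Z I u ∧ z ∈ u.source
  holomorphic : ContMDiff 𝓘(ℂ, C3) 𝓘(ℂ, C3) ω β
  bijOn : Set.BijOn β (β ⁻¹' Zᶜ) Zᶜ
  affine : ∀ (I : Finset (Fin 3)) (u : OpenPartialHomeomorph X C3),
    I.card = k → IsAdaptedChart Z I u → ∀ j ∈ I, ∃ ψ, IsAffineChart β u I j ψ
  cover : ∀ (I : Finset (Fin 3)) (u : OpenPartialHomeomorph X C3),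
    I.card = k → IsAdaptedChart Z I u → ∀ x, β x ∈ u.source →
      ∃ j ∈ I, ∃ ψ, IsAffineChart β u I j ψ ∧ x ∈ ψ.source

/-! ### The model `X_{π₀}` -/

/-- `π : X → ℂ³` is the composition of four blow-ups: of the origin; of the point `p₅`
of the first exceptional divisor with direction `[0:1:0]` (origin of the `y`-chart `u₁`); of the
point with direction `[1:0:0]` over `p₅` (origin of the `x`-chart `u₂`); of the
line of the third exceptional divisor formed by the directions `[p:0:r]` (it is `{x = y = 0}` in
the `x`-chart `u₃` and `{y = z = 0}` in the `z`-chart `v₃`). -/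
def IsResolutionModel (X : Threefold) (π : X → C3) : Prop :=
  ∃ (X₁ X₂ X₃ : Threefold) (β₁ : X₁ → Threefold.affine) (β₂ : X₂ → X₁) (β₃ : X₃ → X₂)
    (β₄ : X → X₃)
    (u₁ : OpenPartialHomeomorph X₁ C3) (u₂ : OpenPartialHomeomorph X₂ C3)
    (u₃ v₃ : OpenPartialHomeomorph X₃ C3),
    IsBlowUp 3 ({(0 : C3)} : Set Threefold.affine) β₁ ∧
    IsAffineChart β₁ (OpenPartialHomeomorph.refl C3) Finset.univ 1 u₁ ∧
    IsBlowUp 3 {u₁.symm 0} β₂ ∧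
    IsAffineChart β₂ u₁ Finset.univ 0 u₂ ∧
    IsBlowUp 3 {u₂.symm 0} β₃ ∧
    IsAffineChart β₃ u₂ Finset.univ 0 u₃ ∧
    IsAffineChart β₃ u₂ Finset.univ 2 v₃ ∧
    IsBlowUp 2 ({q | q ∈ u₃.source ∧ u₃ q 0 = 0 ∧ u₃ q 1 = 0} ∪
      {q | q ∈ v₃.source ∧ v₃ q 1 = 0 ∧ v₃ q 2 = 0}) β₄ ∧
    π = fun x => β₁ (β₂ (β₃ (β₄ x)))

/-! ### Infinitesimal generators and singular points -/

/-- Formal power series in three variables. -/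
abbrev FPS := MvPowerSeries (Fin 3) ℂ

/-- The formal power series `φ` converges to `G` near the origin. -/
def Expands (G : C3 → ℂ) (φ : FPS) : Prop :=
  ∀ᶠ w in 𝓝 (0 : C3), HasSum (fun d : Fin 3 →₀ ℕ => MvPowerSeries.coeff d φ * ∏ i, w i ^ d i) (G w)

/-- The formal vector field `∑ χ_i ∂_i` acting as a derivation. -/
def lieDeriv (χ : Fin 3 → FPS) (φ : FPS) : FPS :=
  ∑ i, χ i * MvPowerSeries.pderiv ℂ i φ

/-- `χ` is the infinitesimal generator of the germ with components `F i`: it has multiplicity at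
least two, and `F = exp χ`, that is `F i = ∑ n, χⁿ(x_i) / n!`. As `χⁿ(x_i)` has order
at least `n + 1`, only the terms with `n ≤ |d|` contribute to the coefficient of degree `d`. -/
def IsInfinitesimalGenerator (χ F : Fin 3 → FPS) : Prop :=
  (∀ i, 2 ≤ (χ i).order) ∧
  ∀ (i : Fin 3) (d : Fin 3 →₀ ℕ), MvPowerSeries.coeff d (F i) =
    ∑ n ∈ Finset.range (d.degree + 1),
      MvPowerSeries.coeff d ((lieDeriv χ)^[n] (MvPowerSeries.X i)) / (n.factorial : ℂ)

/-- `ξ` is a saturation of `χ`: `χ = ℓ ξ` with `ℓ ≠ 0` and the components of `ξ` coprime. -/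
def IsSaturation (ξ χ : Fin 3 → FPS) : Prop :=
  (∃ ℓ : FPS, ℓ ≠ 0 ∧ ∀ i, χ i = ℓ * ξ i) ∧ ∀ m : FPS, (∀ i, m ∣ ξ i) → IsUnit m

/-- The map `g` fixes `p` and its saturated infinitesimal generator at `p` vanishes at `p`. -/
def IsSingularAt {X : Threefold} (g : X → X) (p : X) : Prop :=
  g p = p ∧ ∃ u : OpenPartialHomeomorph X C3, IsCoordAt u p ∧
    ∃ F χ ξ : Fin 3 → FPS,
      (∀ i, Expands (fun w => u (g (u.symm w)) i) (F i)) ∧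
      IsInfinitesimalGenerator χ F ∧ IsSaturation ξ χ ∧
      ∀ i, MvPowerSeries.constantCoeff (ξ i) = 0

/-- `g` is (a representative of) the lift of the germ `f` to the modification `π`: it is defined and
holomorphic near the exceptional divisor `π⁻¹(0)` and `π ∘ g = f ∘ π` there. -/
def IsLift {X : Threefold} (f : C3 → C3) (π : X → C3) (g : X → X) : Prop :=
  ∃ U : Set X, IsOpen U ∧ π ⁻¹' {0} ⊆ U ∧ ContMDiffOn 𝓘(ℂ, C3) 𝓘(ℂ, C3) ω g U ∧
    ∀ x ∈ U, π (g x) = f (π x)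

/-- The singular locus of the lift `g`: the points of the exceptional divisor at which the
saturated infinitesimal generator is singular. -/
def singularLocus {X : Threefold} (π : X → C3) (g : X → X) : Set X :=
  {p | π p = 0 ∧ IsSingularAt g p}

/-- Point modifications adapted to `f` over the model `X_{π₀}`: finite
compositions of blow-ups of points, each centre being a singular point of the saturated infinitesimal
generator of the lift of `f` to the model reached so far. -/
inductive IsAdaptedPointModification (f : C3 → C3) : (X : Threefold) → (X → C3) → Prop
  | base {X : Threefold} {π : X → C3} (h : IsResolutionModel X π) :
      IsAdaptedPointModification f X π
  | blowUp {X X' : Threefold} {π : X → C3} (h : IsAdaptedPointModification f X π)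
      {g : X → X} (hg : IsLift f π g) {p : X} (hp : p ∈ singularLocus π g)
      {β : X' → X} (hβ : IsBlowUp 3 {p} β) :
      IsAdaptedPointModification f X' (fun x => π (β x))

/-! ### Analytic subsets and irreducible components -/

/-- Closed analytic subsets: locally the zero set of finitely many holomorphic functions. -/
def IsAnalyticSubset {X : Threefold} (A : Set X) : Prop :=
  ∀ x : X, ∃ U : Set X, IsOpen U ∧ x ∈ U ∧ ∃ (n : ℕ) (h : Fin n → X → ℂ),
    (∀ k, ContMDiffOn 𝓘(ℂ, C3) 𝓘(ℂ, ℂ) ω (h k) U) ∧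
    ∀ y ∈ U, y ∈ A ↔ ∀ k, h k y = 0

/-- Irreducible analytic subsets. -/
def IsIrreducibleAnalytic {X : Threefold} (A : Set X) : Prop :=
  IsAnalyticSubset A ∧ A.Nonempty ∧
    ∀ A₁ A₂ : Set X, IsAnalyticSubset A₁ → IsAnalyticSubset A₂ → A = A₁ ∪ A₂ → A = A₁ ∨ A = A₂

/-- `C` is an irreducible component of `S`, of positive dimension (an irreducible
analytic set is zero-dimensional exactly when it is a single point). -/
def IsPositiveDimComponent {X : Threefold} (S C : Set X) : Prop :=
  Maximal (fun A : Set X => IsIrreducibleAnalytic A ∧ A ⊆ S) C ∧ C.Nontrivial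

/-! ### Rational curves -/

/-- The chart `t ↦ 1 / t` of the Riemann sphere `ℂ ∪ {∞}` around infinity. -/
def chartInfty (t : ℂ) : OnePoint ℂ := if t = 0 then OnePoint.infty else ((t⁻¹ : ℂ) : OnePoint ℂ)

/-- `C` is a smooth compact rational curve: the image of the Riemann sphere under an injective
holomorphic immersion. -/
def IsSmoothRationalCurve {X : Threefold} (C : Set X) : Prop :=
  ∃ γ : OnePoint ℂ → X, Function.Injective γ ∧ Set.range γ = C ∧
    ContMDiff 𝓘(ℂ, ℂ) 𝓘(ℂ, C3) ω (fun t : ℂ => γ (t : OnePoint ℂ)) ∧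
    ContMDiff 𝓘(ℂ, ℂ) 𝓘(ℂ, C3) ω (fun t : ℂ => γ (chartInfty t)) ∧
    (∀ t : ℂ, mfderiv 𝓘(ℂ, ℂ) 𝓘(ℂ, C3) (fun t : ℂ => γ (t : OnePoint ℂ)) t ≠ 0) ∧
    (∀ t : ℂ, mfderiv 𝓘(ℂ, ℂ) 𝓘(ℂ, C3) (fun t : ℂ => γ (chartInfty t)) t ≠ 0)

/-! ### Families of germs -/

/-- Holomorphic germs `(ℂ³, 0) → ℂ`. -/
def Holo (P : C3 → ℂ) : Prop := AnalyticAt ℂ P 0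

/-- Holomorphic germs in the maximal ideal. -/
def InM (P : C3 → ℂ) : Prop := AnalyticAt ℂ P 0 ∧ P 0 = 0

/-- Holomorphic germs in the square of the maximal ideal. -/
def InM2 (P : C3 → ℂ) : Prop := AnalyticAt ℂ P 0 ∧ P 0 = 0 ∧ fderiv ℂ P 0 = 0

/-- Normal form of simple corners. -/
def SimpleCornerForm (F : C3 → C3) : Prop :=
  ∃ (a b c : ℕ) (lam mu : ℂ) (P Q R : C3 → ℂ),
    1 ≤ a ∧ 1 ≤ b ∧ lam ≠ 0 ∧ (∀ r : ℚ, 0 < r → mu ≠ lam * (r : ℂ)) ∧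
    InM P ∧ InM Q ∧ InM R ∧
    (0 < c → ∃ R' : C3 → ℂ, Holo R' ∧ ∀ᶠ w in 𝓝 (0 : C3), R w = w 2 * R' w) ∧
    ∀ᶠ w in 𝓝 (0 : C3), F w =
      ![w 0 + (w 0 ^ a * w 1 ^ b * w 2 ^ c) * (w 0 * (lam + P w)),
        w 1 + (w 0 ^ a * w 1 ^ b * w 2 ^ c) * (w 1 * (mu + Q w)),
        w 2 + (w 0 ^ a * w 1 ^ b * w 2 ^ c) * R w]

/-- Normal form of spinning corners. -/
def SpinningCornerForm (F : C3 → C3) : Prop :=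
  ∃ (b c : ℕ) (P Q R : C3 → ℂ),
    1 ≤ b ∧ 1 ≤ c ∧ InM2 P ∧ InM Q ∧ InM R ∧
    ∀ᶠ w in 𝓝 (0 : C3), F w =
      ![w 0 + w 1 ^ b * w 2 ^ c * (w 0 + P w),
        w 1 + w 1 ^ (b + 1) * w 2 ^ c * Q w,
        w 2 + w 1 ^ b * w 2 ^ (c + 1) * R w]

/-- Normal form of half corners. -/
def HalfCornerForm (F : C3 → C3) : Prop :=
  ∃ (c : ℕ) (bet : ℂ) (P Q R : C3 → ℂ),
    1 ≤ c ∧ InM2 P ∧ InM Q ∧ Holo R ∧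
    ∀ᶠ w in 𝓝 (0 : C3), F w =
      ![w 0 + w 2 ^ c * (w 0 + P w),
        w 1 + w 2 ^ (c + 1) * (bet + Q w),
        w 2 + w 2 ^ (c + 2) * R w]

/-- The germ of `g` at its fixed point `p` belongs to the family with normal form `N`: it has this
form in suitable local holomorphic coordinates centred at `p`. -/
def GermIn (N : (C3 → C3) → Prop) {X : Threefold} (g : X → X) (p : X) : Prop :=
  g p = p ∧ ∃ u : OpenPartialHomeomorph X C3, IsCoordAt u p ∧ N (fun w => u (g (u.symm w)))

/-- The germ of `g` at its fixed point `p` is tangent to the identity. -/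
def IsTangentToIdAt {X : Threefold} (g : X → X) (p : X) : Prop :=
  g p = p ∧ ∃ u : OpenPartialHomeomorph X C3, IsCoordAt u p ∧
    HasFDerivAt (fun w => u (g (u.symm w))) (ContinuousLinearMap.id ℂ C3) 0

/-! ### Patterns -/

/-- `(X, C, g)` is a (rational) pattern. -/
def IsPattern {X : Threefold} (C : Set X) (g : X → X) : Prop :=
  IsSmoothRationalCurve C ∧
  (∃ U : Set X, IsOpen U ∧ C ⊆ U ∧ ContMDiffOn 𝓘(ℂ, C3) 𝓘(ℂ, C3) ω g U) ∧
  (∀ p ∈ C, IsTangentToIdAt g p) ∧ ∀ p ∈ C, IsSingularAt g p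

/-- `(X, C, g)` is an `S`-`G`-pattern: all but finitely many points of the core `C` are of
type `G` (generic points), and the remaining ones (special points) are of type `S`. -/
def IsPatternOfType (S G : (C3 → C3) → Prop) {X : Threefold} (C : Set X) (g : X → X) : Prop :=
  IsPattern C g ∧ {p | p ∈ C ∧ ¬ GermIn G g p}.Finite ∧ ∀ p ∈ C, ¬ GermIn G g p → GermIn S g p

/-! ### The family of germs -/

/-- The value at `v` of the homogeneous part of degree `n` of a power series. -/
def homogeneousPart (n : ℕ) (φ : FPS) (v : C3) : ℂ :=
  ∑ d ∈ Finset.finsuppAntidiag (Finset.univ : Finset (Fin 3)) n,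
    MvPowerSeries.coeff d φ * ∏ i, v i ^ d i

/-- `f` is the germ `(x + yz(y-z) + P, y + x(x²-z²) + Q, z + xz(y-z) + R)`, where `P`, `Q`, `R` are
(convergent power series) of order at least four. -/
def IsInFamily (f : C3 → C3) (P Q R : FPS) : Prop :=
  4 ≤ P.order ∧ 4 ≤ Q.order ∧ 4 ≤ R.order ∧
  Expands (fun w => f w 0 - (w 0 + w 1 * w 2 * (w 1 - w 2))) P ∧
  Expands (fun w => f w 1 - (w 1 + w 0 * (w 0 ^ 2 - w 2 ^ 2))) Q ∧
  Expands (fun w => f w 2 - (w 2 + w 0 * w 2 * (w 1 - w 2))) R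

/-- The genericity conditions: `R₀₄₀ ≠ 0`, `P⁽⁴⁾(1,1,1) ≠ R⁽⁴⁾(1,1,1)` and
`P⁽⁴⁾(-1,1,1) ≠ -R⁽⁴⁾(-1,1,1)`. -/
def IsGeneric (P R : FPS) : Prop :=
  MvPowerSeries.coeff (Finsupp.single (1 : Fin 3) 4) R ≠ 0 ∧
  homogeneousPart 4 P ![1, 1, 1] ≠ homogeneousPart 4 R ![1, 1, 1] ∧
  homogeneousPart 4 P ![-1, 1, 1] ≠ -homogeneousPart 4 R ![-1, 1, 1]

end TangentToId

end

open TangentToId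

open scoped Manifold ContDiff Topology
noncomputable section
namespace TangentToId

/-! ### Power series expansions of analytic germs -/

/-- The monomial `w ^ d`. -/
def mon (d : Fin 3 →₀ ℕ) (w : C3) : ℂ := ∏ i, w i ^ d i

theorem mon_add (d e : Fin 3 →₀ ℕ) (w : C3) : mon (d + e) w = mon d w * mon e w := by
  simp [mon, pow_add, Finset.prod_mul_distrib]

theorem mon_zero (w : C3) : mon 0 w = 1 := by simp [mon]

theorem mon_single (i : Fin 3) (w : C3) : mon (Finsupp.single i 1) w = w i := by
  rw [mon, Finset.prod_eq_single i]
  · simp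
  · intro b _ hb
    simp [Finsupp.single_eq_of_ne hb]
  · simp

theorem mon_sum {ι : Type*} (s : Finset ι) (f : ι → Fin 3) (w : C3) :
    mon (∑ k ∈ s, Finsupp.single (f k) 1) w = ∏ k ∈ s, w (f k) := by
  classical
  induction s using Finset.induction_on with
  | empty => simp [mon_zero]
  | insert a s ha ih => rw [Finset.sum_insert ha, Finset.prod_insert ha, mon_add, mon_single, ih]

theorem norm_mon_le (d : Fin 3 →₀ ℕ) (w : C3) : ‖mon d w‖ ≤ ‖w‖ ^ d.degree := by
  rw [mon, norm_prod, Finsupp.degree_eq_sum, ← Finset.prod_pow_eq_pow_sum]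
  exact Finset.prod_le_prod (fun _ _ => norm_nonneg _) fun i _ => by
    rw [norm_pow]; exact pow_le_pow_left₀ (norm_nonneg _) (norm_le_pi_norm w i) _

theorem mon_const (d : Fin 3 →₀ ℕ) (r : ℂ) : mon d (fun _ => r) = r ^ d.degree := by
  rw [mon, Finsupp.degree_eq_sum, Finset.prod_pow_eq_pow_sum]

/-- A formal power series with positive radius of convergence. -/
def Conv (φ : FPS) : Prop :=
  ∃ r : ℝ, 0 < r ∧ Summable fun d : Fin 3 →₀ ℕ => ‖MvPowerSeries.coeff d φ‖ * r ^ d.degree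

theorem Expands.conv {G : C3 → ℂ} {φ : FPS} (h : Expands G φ) : Conv φ := by
  obtain ⟨ε, hε, h⟩ := Metric.eventually_nhds_iff.1 h
  refine ⟨ε / 2, by positivity, ?_⟩
  have h1 : dist (fun _ : Fin 3 => ((ε / 2 : ℝ) : ℂ)) 0 < ε := by
    rw [dist_pi_lt_iff hε]
    intro i
    rw [Pi.zero_apply, dist_zero_right, Complex.norm_real, Real.norm_of_nonneg (by positivity)]
    linarith
  have h2 := (h h1).summable.norm
  refine h2.congr fun d => ?_
  rw [norm_mul]
  congr 1
  have := mon_const d ((ε / 2 : ℝ) : ℂ)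
  rw [mon] at this
  rw [this, norm_pow, Complex.norm_real, Real.norm_of_nonneg (by positivity)]

theorem Conv.summable {φ : FPS} {r : ℝ}
    (h : Summable fun d : Fin 3 →₀ ℕ => ‖MvPowerSeries.coeff d φ‖ * r ^ d.degree) {w : C3}
    (hw : ‖w‖ ≤ r) : Summable fun d : Fin 3 →₀ ℕ => MvPowerSeries.coeff d φ * mon d w := by
  refine Summable.of_norm_bounded h fun d => ?_
  rw [norm_mul]
  gcongr
  exact (norm_mon_le d w).trans (pow_le_pow_left₀ (norm_nonneg _) hw _)

theorem Conv.expands {φ : FPS} (h : Conv φ) :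
    Expands (fun w => ∑' d : Fin 3 →₀ ℕ, MvPowerSeries.coeff d φ * mon d w) φ := by
  obtain ⟨r, hr, h⟩ := h
  filter_upwards [Metric.ball_mem_nhds (0 : C3) hr] with w hw
  exact (Conv.summable h (by simpa using (mem_ball_zero_iff.1 hw).le)).hasSum

theorem Expands.congr {G H : C3 → ℂ} {φ : FPS} (h : Expands G φ) (e : G =ᶠ[𝓝 0] H) :
    Expands H φ := by
  filter_upwards [h, e] with w h e
  rwa [← e]

theorem Expands.eventuallyEq {G H : C3 → ℂ} {φ : FPS} (h : Expands G φ) (h' : Expands H φ) :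
    G =ᶠ[𝓝 0] H := by
  filter_upwards [h, h'] with w h h'
  exact h.unique h'

theorem Expands.add {G H : C3 → ℂ} {φ ψ : FPS} (h : Expands G φ) (h' : Expands H ψ) :
    Expands (fun w => G w + H w) (φ + ψ) := by
  filter_upwards [h, h'] with w h h'
  simpa [add_mul] using HasSum.add h h'

theorem Expands.zero : Expands (fun _ => 0) 0 := by
  refine Filter.Eventually.of_forall fun w => ?_
  simp [hasSum_zero]

theorem Expands.sum {ι : Type*} (s : Finset ι) {G : ι → C3 → ℂ} {φ : ι → FPS}
    (h : ∀ i ∈ s, Expands (G i) (φ i)) : Expands (fun w => ∑ i ∈ s, G i w) (∑ i ∈ s, φ i) := by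
  classical
  induction s using Finset.induction_on with
  | empty => simpa using Expands.zero
  | insert a s ha ih =>
    simp only [Finset.sum_insert ha]
    exact (h a (by simp)).add (ih fun i hi => h i (by simp [hi]))

theorem hasSum_mul_antidiagonal {f g : (Fin 3 →₀ ℕ) → ℂ} {a b : ℂ} (h : HasSum f a)
    (h' : HasSum g b) :
    HasSum (fun d => ∑ p ∈ Finset.HasAntidiagonal.antidiagonal d, f p.1 * g p.2) (a * b) := by
  have hs := summable_mul_of_summable_norm h.summable.norm h'.summable.norm
  have key := h.summable.tsum_mul_tsum_eq_tsum_sum_antidiagonal h'.summable hs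
  have hsum := summable_sum_mul_antidiagonal_of_summable_mul hs
  rw [h.tsum_eq, h'.tsum_eq] at key
  rw [key]
  exact hsum.hasSum

theorem coeff_mul_mul_mon (φ ψ : FPS) (d : Fin 3 →₀ ℕ) (w : C3) :
    MvPowerSeries.coeff d (φ * ψ) * mon d w =
      ∑ p ∈ Finset.HasAntidiagonal.antidiagonal d, (MvPowerSeries.coeff p.1 φ * mon p.1 w) *
        (MvPowerSeries.coeff p.2 ψ * mon p.2 w) := by
  rw [MvPowerSeries.coeff_mul, Finset.sum_mul]
  refine Finset.sum_congr rfl fun p hp => ?_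
  rw [← Finset.HasAntidiagonal.mem_antidiagonal.1 hp, mon_add]
  ring

theorem Expands.mul {G H : C3 → ℂ} {φ ψ : FPS} (h : Expands G φ) (h' : Expands H ψ) :
    Expands (fun w => G w * H w) (φ * ψ) := by
  filter_upwards [h, h'] with w hw hw'
  have := hasSum_mul_antidiagonal hw hw'
  refine HasSum.congr_fun this fun d => ?_
  exact coeff_mul_mul_mon φ ψ d w

theorem Expands.coord (i : Fin 3) : Expands (fun w => w i) (MvPowerSeries.X i) := by
  refine Filter.Eventually.of_forall fun w => ?_
  have := hasSum_ite_eq (Finsupp.single i 1) (w i)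
  refine this.congr_fun ?_ |> fun x => x
  intro d
  rw [MvPowerSeries.coeff_X]
  split_ifs with hd
  · subst hd
    rw [one_mul]; exact mon_single i w
  · simp

theorem Expands.constantCoeff {G : C3 → ℂ} {φ : FPS} (h : Expands G φ) :
    MvPowerSeries.constantCoeff φ = G 0 := by
  have h0 := h.self_of_nhds
  have := hasSum_ite_eq (0 : Fin 3 →₀ ℕ) (MvPowerSeries.constantCoeff φ)
  refine this.unique (h0.congr_fun ?_ |> fun x => x)
  intro d
  split_ifs with hd
  · subst hd; simp
  · obtain ⟨i, hi⟩ := Finsupp.ne_iff.1 hd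
    rw [Finset.prod_eq_zero (Finset.mem_univ i), mul_zero]
    simp only [Pi.zero_apply]
    exact zero_pow hi

theorem exists_index (d : Fin 3 →₀ ℕ) : ∃ s : Fin d.degree → Fin 3,
    ∀ v : C3, ∏ k, v (s k) = mon d v := by
  have hl : d.toMultiset.toList.length = d.degree := by
    rw [Multiset.length_toList, Finsupp.card_toMultiset, Finsupp.degree_eq_sum,
      Finsupp.sum_fintype _ _ fun _ => rfl]
    rfl
  refine ⟨fun k => d.toMultiset.toList.get (k.cast hl.symm), fun v => ?_⟩
  have h1 : ∏ k : Fin d.degree, v (d.toMultiset.toList.get (k.cast hl.symm)) =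
      ∏ k : Fin d.toMultiset.toList.length, v (d.toMultiset.toList.get k) :=
    Fintype.prod_equiv (finCongr hl.symm) _ _ fun k => rfl
  rw [h1]
  simp only [List.get_eq_getElem]
  rw [Fin.prod_univ_fun_getElem]
  have h2 : (d.toMultiset.toList.map v).prod = (d.toMultiset.map v).prod := by
    conv_rhs => rw [← Multiset.coe_toList d.toMultiset]
    rw [Multiset.map_coe, Multiset.prod_coe]
  rw [h2, Finsupp.toMultiset_map, Finsupp.prod_toMultiset, Finsupp.prod_mapDomain_index,
    Finsupp.prod_fintype]
  · rfl
  · simp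
  · simp
  · intros; rw [pow_add]

/-- The multilinear form whose diagonal is the monomial `w ^ d`. -/
def monForm (d : Fin 3 →₀ ℕ) : ContinuousMultilinearMap ℂ (fun _ : Fin d.degree => C3) ℂ :=
  (ContinuousMultilinearMap.mkPiAlgebra ℂ (Fin d.degree) ℂ).compContinuousLinearMap
    fun k => ContinuousLinearMap.proj ((exists_index d).choose k)

theorem monForm_diag (d : Fin 3 →₀ ℕ) (v : C3) : monForm d (fun _ => v) = mon d v := by
  simp [monForm, ContinuousMultilinearMap.compContinuousLinearMap_apply,
    (exists_index d).choose_spec v]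

theorem norm_monForm_le (d : Fin 3 →₀ ℕ) : ‖monForm d‖ ≤ 1 := by
  refine ContinuousMultilinearMap.opNorm_le_bound zero_le_one fun m => ?_
  rw [monForm, ContinuousMultilinearMap.compContinuousLinearMap_apply,
    ContinuousMultilinearMap.mkPiAlgebra_apply, norm_prod, one_mul]
  exact Finset.prod_le_prod (fun _ _ => norm_nonneg _) fun k _ => norm_le_pi_norm (m k) _

theorem exists_monForm (d : Fin 3 →₀ ℕ) (n : ℕ) (h : d.degree = n) :
    ∃ m : ContinuousMultilinearMap ℂ (fun _ : Fin n => C3) ℂ, ‖m‖ ≤ 1 ∧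
      ∀ v, m (fun _ => v) = mon d v := by
  subst h
  exact ⟨monForm d, norm_monForm_le d, monForm_diag d⟩

/-- The monomials of degree `n`. -/
def degSet (n : ℕ) : Finset (Fin 3 →₀ ℕ) :=
  Finset.finsuppAntidiag (Finset.univ : Finset (Fin 3)) n

theorem mem_degSet {n : ℕ} {d : Fin 3 →₀ ℕ} : d ∈ degSet n ↔ d.degree = n := by
  rw [degSet, Finset.mem_finsuppAntidiag, Finsupp.degree_eq_sum]
  simp

theorem hasSum_degree {E : Type*} [NormedAddCommGroup E] [CompleteSpace E] {f : (Fin 3 →₀ ℕ) → E}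
    {a : E} (h : HasSum f a) : HasSum (fun n => ∑ d ∈ degSet n, f d) a := by
  have := h.tsum_fiberwise (fun d : Fin 3 →₀ ℕ => d.degree)
  refine this.congr_fun ?_ |> fun x => x
  intro n
  have : (fun d : Fin 3 →₀ ℕ => d.degree) ⁻¹' {n} = (degSet n : Set (Fin 3 →₀ ℕ)) := by
    ext d; simp [mem_degSet]
  rw [this, Finset.tsum_subtype']

theorem Expands.exists_hasFPowerSeriesAt {G : C3 → ℂ} {φ : FPS} (h : Expands G φ) :
    ∃ p : FormalMultilinearSeries ℂ C3 ℂ, HasFPowerSeriesAt G p 0 ∧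
      ∀ n v, p n (fun _ => v) = homogeneousPart n φ v := by
  classical
  choose! m hm1 hm2 using exists_monForm
  let p : FormalMultilinearSeries ℂ C3 ℂ := fun n =>
    ∑ d ∈ degSet n, MvPowerSeries.coeff d φ • m d n
  have hp : ∀ n v, p n (fun _ => v) = homogeneousPart n φ v := by
    intro n v
    simp only [p, homogeneousPart, sum_apply,
      smul_apply, smul_eq_mul]
    refine Finset.sum_congr rfl fun d hd => ?_
    rw [hm2 d n (mem_degSet.1 hd)]; rfl
  refine ⟨p, ?_, hp⟩
  obtain ⟨r, hr, hs⟩ := h.conv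
  obtain ⟨ε, hε, hE⟩ := Metric.eventually_nhds_iff.1 h
  lift r to NNReal using hr.le
  have hrad : (r : ENNReal) ≤ p.radius := by
    apply p.le_radius_of_summable
    have := (hasSum_degree hs.hasSum).summable
    refine Summable.of_nonneg_of_le (fun n => by positivity) (fun n => ?_) this
    simp only [p]
    calc _ ≤ (∑ d ∈ degSet n, ‖MvPowerSeries.coeff d φ‖) * r ^ n := by
          gcongr
          refine (norm_sum_le _ _).trans (Finset.sum_le_sum fun d hd => ?_)
          rw [norm_smul]
          exact mul_le_of_le_one_right (norm_nonneg _) (hm1 d n (mem_degSet.1 hd))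
      _ = _ := by
          rw [Finset.sum_mul]
          refine Finset.sum_congr rfl fun d hd => by rw [mem_degSet.1 hd]
  refine ⟨ENNReal.ofReal (min r ε), ?_, by simpa using ⟨by exact_mod_cast hr, hε⟩, ?_⟩
  · refine le_trans ?_ hrad
    rw [ENNReal.ofReal_le_iff_le_toReal (by simp)]
    simp
  · intro y hy
    rw [Metric.eball_ofReal, mem_ball_zero_iff] at hy
    have := hasSum_degree (hE (y := y) (by rw [dist_zero_right]; exact hy.trans_le (min_le_right _ _)))
    rw [zero_add]
    refine this.congr_fun ?_ |> fun x => x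
    intro n
    rw [hp]; rfl

theorem Expands.analyticAt {G : C3 → ℂ} {φ : FPS} (h : Expands G φ) : AnalyticAt ℂ G 0 := by
  obtain ⟨p, hp, -⟩ := h.exists_hasFPowerSeriesAt
  exact ⟨p, hp⟩

theorem exists_expands {G : C3 → ℂ} (h : AnalyticAt ℂ G 0) : ∃ φ, Expands G φ := by
  classical
  obtain ⟨p, r, hp⟩ := h
  let cnt : (Σ n : ℕ, Fin n → Fin 3) → (Fin 3 →₀ ℕ) := fun x => ∑ k, Finsupp.single (x.2 k) 1
  let c : (Σ n : ℕ, Fin n → Fin 3) → ℂ := fun x => p x.1 fun k => Pi.single (x.2 k) (1 : ℂ)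
  let φ : FPS := fun d => ∑' x : (cnt ⁻¹' {d}), c x
  refine ⟨φ, ?_⟩
  obtain ⟨ρ, hρ0, hρ⟩ := ENNReal.lt_iff_exists_nnreal_btwn.1 hp.r_pos
  have hρpos : 0 < (ρ : ℝ) := by exact_mod_cast hρ0
  obtain ⟨a, ha, K, hK, hb⟩ := p.norm_mul_pow_le_mul_pow_of_lt_radius (hρ.trans_le hp.r_le)
  filter_upwards [Metric.ball_mem_nhds (0 : C3) (show 0 < (ρ : ℝ) / 3 by positivity)] with w hw
  rw [mem_ball_zero_iff] at hw
  have hterm : ∀ x : (Σ n : ℕ, Fin n → Fin 3),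
      p x.1 (fun k => w (x.2 k) • Pi.single (x.2 k) (1 : ℂ)) = c x * mon (cnt x) w := by
    intro x
    rw [ContinuousMultilinearMap.map_smul_univ, mon_sum, smul_eq_mul, mul_comm]
  have hfin : ∀ n, ∑ s : Fin n → Fin 3, c ⟨n, s⟩ * mon (cnt ⟨n, s⟩) w = p n fun _ => w := by
    intro n
    have : (fun _ : Fin n => w) = fun _ : Fin n => ∑ j, w j • (Pi.single j (1 : ℂ) : C3) := by
      funext _
      conv_lhs => rw [pi_eq_sum_univ' w]
    rw [this, ContinuousMultilinearMap.map_sum]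
    exact Finset.sum_congr rfl fun s _ => (hterm ⟨n, s⟩).symm
  have hcn : ∀ n (s : Fin n → Fin 3), ‖c ⟨n, s⟩‖ ≤ ‖p n‖ := by
    intro n s
    refine ((p n).le_opNorm _).trans ?_
    refine mul_le_of_le_one_right (norm_nonneg _) (Finset.prod_le_one (fun _ _ => norm_nonneg _)
      fun k _ => ?_)
    refine (pi_norm_le_iff_of_nonneg zero_le_one).2 fun i => ?_
    by_cases hi : i = s k <;> simp [hi]
  have hcnt : ∀ n (s : Fin n → Fin 3), (cnt ⟨n, s⟩).degree = n := by
    intro n s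
    simp [cnt, map_sum, Finsupp.degree_single]
  have hsummable : Summable fun x : (Σ n : ℕ, Fin n → Fin 3) => c x * mon (cnt x) w := by
    have : Summable fun x : (Σ n : ℕ, Fin n → Fin 3) => ‖p x.1‖ * ‖w‖ ^ x.1 := by
      rw [summable_sigma_of_nonneg (fun x => by positivity)]
      refine ⟨fun n => Summable.of_finite, ?_⟩
      have hg : Summable fun n => K * a ^ n :=
        (summable_geometric_of_lt_one ha.1.le ha.2).mul_left K
      refine Summable.of_nonneg_of_le (fun n => tsum_nonneg fun _ => by positivity) (fun n => ?_) hg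
      refine le_trans ?_ (hb n)
      rw [tsum_fintype]
      change ∑ _b : Fin n → Fin 3, ‖p n‖ * ‖w‖ ^ n ≤ _
      rw [Finset.sum_const, nsmul_eq_mul, Finset.card_univ, Fintype.card_fun,
        Fintype.card_fin, Fintype.card_fin]
      have : ‖w‖ ^ n ≤ ((ρ : ℝ) / 3) ^ n := pow_le_pow_left₀ (norm_nonneg _) hw.le n
      calc ((3 ^ n : ℕ) : ℝ) * (‖p n‖ * ‖w‖ ^ n) ≤ ((3 ^ n : ℕ) : ℝ) * (‖p n‖ * ((ρ : ℝ) / 3) ^ n) := by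
            gcongr
        _ = ‖p n‖ * (ρ : ℝ) ^ n := by
            rw [div_pow]; push_cast; field_simp
    refine Summable.of_norm_bounded this fun x => ?_
    obtain ⟨n, s⟩ := x
    rw [norm_mul]
    gcongr
    · exact hcn n s
    · simpa [hcnt n s] using norm_mon_le (cnt ⟨n, s⟩) w
  have htot : HasSum (fun x : (Σ n : ℕ, Fin n → Fin 3) => c x * mon (cnt x) w) (G w) := by
    have h1 := hsummable.hasSum.sigma fun n => (hasSum_fintype _)
    have h2 : HasSum (fun n => p n fun _ => w) (G w) := by
      have := hp.hasSum (y := w) (by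
        rw [Metric.mem_eball, edist_zero_right]
        refine lt_trans ?_ hρ
        rw [enorm_eq_nnnorm]
        exact_mod_cast (show ‖w‖ < (ρ : ℝ) by linarith))
      simpa using this
    simp only [hfin] at h1
    rw [← h1.unique h2]
    exact hsummable.hasSum
  have := htot.tsum_fiberwise cnt
  refine this.congr_fun ?_ |> fun x => x
  intro d
  change (∑' x : (cnt ⁻¹' {d}), c x) * mon d w = _
  rw [← tsum_mul_right]
  refine tsum_congr fun x => ?_
  rw [show cnt x = d from x.2]

theorem homogeneousPart_eq (n : ℕ) (φ : FPS) (v : C3) :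
    homogeneousPart n φ v = ∑ d ∈ degSet n, MvPowerSeries.coeff d φ * mon d v := rfl

theorem Expands.eq_zero {φ : FPS} (h : Expands (fun _ => 0) φ) : φ = 0 := by
  classical
  obtain ⟨p, hp, hpv⟩ := h.exists_hasFPowerSeriesAt
  ext d
  let q : MvPolynomial (Fin 3) ℂ :=
    ∑ e ∈ degSet d.degree, MvPolynomial.monomial e (MvPowerSeries.coeff e φ)
  have hq : q = 0 := by
    apply MvPolynomial.funext
    intro v
    have h1 := HasFPowerSeriesAt.apply_eq_zero hp d.degree v
    rw [hpv, homogeneousPart_eq] at h1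
    rw [map_zero, ← h1, map_sum]
    refine Finset.sum_congr rfl fun e _ => ?_
    rw [MvPolynomial.eval_monomial, Finsupp.prod_fintype _ _ (by simp)]
    rfl
  have h2 : MvPolynomial.coeff d q = MvPowerSeries.coeff d φ := by
    simp only [q, MvPolynomial.coeff_sum, MvPolynomial.coeff_monomial]
    rw [Finset.sum_ite_eq' _ _ _, if_pos (mem_degSet.2 rfl)]
  rw [← h2, hq]; simp

theorem Expands.unique {G : C3 → ℂ} {φ ψ : FPS} (h : Expands G φ) (h' : Expands G ψ) : φ = ψ := by
  have : Expands (fun _ => 0) (φ - ψ) := by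
    filter_upwards [h, h'] with w h h'
    simpa [sub_mul] using HasSum.sub h h'
  exact sub_eq_zero.1 this.eq_zero

/-- The part of `φ / X k` consisting of the monomials not involving the variables before `k`. -/
def shift (k : Fin 3) (φ : FPS) : FPS := fun d =>
  if ∀ i < k, d i = 0 then MvPowerSeries.coeff (d + Finsupp.single k 1) φ else 0

theorem coeff_shift (k : Fin 3) (φ : FPS) (d : Fin 3 →₀ ℕ) : MvPowerSeries.coeff d (shift k φ) =
    if ∀ i < k, d i = 0 then MvPowerSeries.coeff (d + Finsupp.single k 1) φ else 0 := rfl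

theorem coeff_X_mul' (k : Fin 3) (ψ : FPS) (d : Fin 3 →₀ ℕ) :
    MvPowerSeries.coeff d (MvPowerSeries.X k * ψ) =
      if d k = 0 then 0 else MvPowerSeries.coeff (d - Finsupp.single k 1) ψ := by
  rw [MvPowerSeries.X_def, MvPowerSeries.coeff_monomial_mul]
  simp only [one_mul, Finsupp.single_le_iff]
  by_cases h : d k = 0
  · simp [h]
  · rw [if_pos (by omega), if_neg h]

theorem sum_X_mul_shift {φ : FPS} (h : MvPowerSeries.constantCoeff φ = 0) :
    φ = ∑ k, MvPowerSeries.X k * shift k φ := by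
  ext d
  rw [map_sum]
  simp only [coeff_X_mul', coeff_shift]
  by_cases hd : d = 0
  · subst hd
    simpa using h
  · have hne : d.support.Nonempty := Finsupp.support_nonempty_iff.2 hd
    set k := d.support.min' hne with hk
    have hdk : d k ≠ 0 := Finsupp.mem_support_iff.1 (d.support.min'_mem hne)
    have hlt : ∀ i < k, d i = 0 := by
      intro i hi
      by_contra h0
      exact absurd (d.support.min'_le i (Finsupp.mem_support_iff.2 h0)) (not_le.2 hi)
    rw [Finset.sum_eq_single k]
    · rw [if_neg hdk, if_pos, tsub_add_cancel_of_le]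
      · rw [Finsupp.single_le_iff]; omega
      · intro i hi
        rw [Finsupp.tsub_apply, hlt i hi]; simp
    · intro j _ hj
      split_ifs with h1 h2
      · rfl
      · exfalso
        have hkj : k < j := lt_of_le_of_ne (d.support.min'_le j (Finsupp.mem_support_iff.2 h1)) hj.symm
        have := h2 k hkj
        rw [Finsupp.tsub_apply, Finsupp.single_eq_of_ne hj.symm] at this
        exact hdk (by simpa using this)
      · rfl
    · simp

theorem Conv.shift {φ : FPS} (h : Conv φ) (k : Fin 3) : Conv (shift k φ) := by
  obtain ⟨r, hr, h⟩ := h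
  refine ⟨r, hr, ?_⟩
  have h1 := (h.comp_injective (add_left_injective (Finsupp.single k 1))).mul_left (r⁻¹)
  refine Summable.of_nonneg_of_le (fun d => by positivity) (fun d => ?_) h1
  simp only [Function.comp, map_add, Finsupp.degree_single, pow_succ, coeff_shift]
  split_ifs
  · apply le_of_eq; field_simp
  · simp only [norm_zero, zero_mul]; positivity

theorem order_shift {φ : FPS} {n : ℕ} (h : ((n + 1 : ℕ) : ℕ∞) ≤ φ.order) (k : Fin 3) :
    (n : ℕ∞) ≤ (shift k φ).order := by
  refine MvPowerSeries.nat_le_order fun d hd => ?_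
  rw [coeff_shift]
  split_ifs
  · apply MvPowerSeries.coeff_of_lt_order
    refine lt_of_lt_of_le ?_ h
    rw [map_add, Finsupp.degree_single]
    exact_mod_cast Nat.succ_lt_succ hd
  · rfl

theorem homogeneousPart_X_mul (n : ℕ) (k : Fin 3) (ψ : FPS) (v : C3) :
    homogeneousPart (n + 1) (MvPowerSeries.X k * ψ) v = v k * homogeneousPart n ψ v := by
  simp only [homogeneousPart_eq, coeff_X_mul']
  rw [Finset.mul_sum]
  symm
  refine Finset.sum_of_injOn (fun d => d + Finsupp.single k 1)
    (fun _ _ _ _ h => add_left_injective _ h) ?_ ?_ ?_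
  · intro d hd
    have := mem_degSet.1 hd
    simp [mem_degSet, this]
  · intro d hd hd'
    split_ifs with h
    · simp
    · exfalso
      apply hd'
      refine ⟨d - Finsupp.single k 1, ?_, tsub_add_cancel_of_le ?_⟩
      · have h1 : d - Finsupp.single k 1 + Finsupp.single k 1 = d :=
          tsub_add_cancel_of_le (by rw [Finsupp.single_le_iff]; omega)
        have h2 := mem_degSet.1 hd
        rw [← h1, map_add, Finsupp.degree_single] at h2
        exact mem_degSet.2 (by omega)
      · rw [Finsupp.single_le_iff]; omega
  · intro d _
    simp only [Finsupp.add_apply, Finsupp.single_eq_same, Nat.add_eq_zero_iff, one_ne_zero, and_false,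
      if_false, add_tsub_cancel_right]
    rw [mon_add, mon_single]; ring

theorem homogeneousPart_sum {ι : Type*} (s : Finset ι) (n : ℕ) (φ : ι → FPS) (v : C3) :
    homogeneousPart n (∑ i ∈ s, φ i) v = ∑ i ∈ s, homogeneousPart n (φ i) v := by
  simp only [homogeneousPart_eq, map_sum, Finset.sum_mul]
  rw [Finset.sum_comm]

theorem Expands.decompose {G : C3 → ℂ} {φ : FPS} (h : Expands G φ) (h0 : G 0 = 0) :
    ∃ m : Fin 3 → C3 → ℂ, (∀ k, Expands (m k) (TangentToId.shift k φ)) ∧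
      G =ᶠ[𝓝 0] fun w => ∑ k, w k * m k w := by
  refine ⟨fun k w => ∑' d, MvPowerSeries.coeff d (TangentToId.shift k φ) * mon d w,
    fun k => (h.conv.shift k).expands, ?_⟩
  have h1 := Expands.sum Finset.univ fun k _ =>
    (Expands.coord k).mul (h.conv.shift k).expands
  rw [← sum_X_mul_shift (h.constantCoeff.trans h0)] at h1
  exact h.eventuallyEq h1

theorem hadamard {h : C3 → ℂ} (ha : AnalyticAt ℂ h 0) (h0 : h 0 = 0) :
    ∃ m : Fin 3 → C3 → ℂ, (∀ k, AnalyticAt ℂ (m k) 0) ∧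
      (h =ᶠ[𝓝 0] fun w => ∑ k, m k w * w k) ∧
      ∀ k a, HasDerivAt (fun t : ℂ => h (Pi.single k t)) a 0 → m k 0 = a := by
  obtain ⟨φ, hφ⟩ := exists_expands ha
  obtain ⟨m, hm, he⟩ := hφ.decompose h0
  refine ⟨m, fun k => (hm k).analyticAt, he.trans (by simp [mul_comm]), fun k a hd => ?_⟩
  have hs : Filter.Tendsto (fun t : ℂ => (Pi.single k t : C3)) (𝓝 0) (𝓝 0) := by
    have : Continuous fun t : ℂ => (Pi.single k t : C3) :=
      continuous_pi fun i => by
        by_cases h : i = k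
        · subst h; simpa using continuous_id'
        · simpa [Pi.single_apply, h] using continuous_const
    simpa using this.tendsto 0
  have h1 : HasDerivAt (fun t : ℂ => t * m k (Pi.single k t)) (m k 0) 0 := by
    rw [hasDerivAt_iff_tendsto_slope]
    have h2 : Filter.Tendsto (fun t : ℂ => m k (Pi.single k t)) (𝓝[≠] 0) (𝓝 (m k 0)) :=
      ((hm k).analyticAt.continuousAt.tendsto.comp hs).mono_left nhdsWithin_le_nhds
    refine h2.congr' ?_
    filter_upwards [self_mem_nhdsWithin] with t ht
    have ht' : t ≠ 0 := ht
    simp [slope_def_field, ht']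
  refine h1.unique (hd.congr_of_eventuallyEq ?_)
  filter_upwards [hs.eventually he] with t ht
  rw [ht, Finset.sum_eq_single k]
  · simp
  · intro b _ hb; simp [hb]
  · simp

theorem Expands.restrict {G : C3 → ℂ} {φ : FPS} (h : Expands G φ) (i : Fin 3) :
    Expands (fun w => G (Function.update w i 0))
      (fun d => if d i = 0 then MvPowerSeries.coeff d φ else 0 : FPS) := by
  have hs : Filter.Tendsto (fun w : C3 => Function.update w i 0) (𝓝 0) (𝓝 0) := by
    have : Continuous fun w : C3 => Function.update w i 0 := continuous_id.update i continuous_const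
    simpa using this.tendsto 0
  filter_upwards [hs.eventually h] with w hw
  have e : (fun d : Fin 3 →₀ ℕ => MvPowerSeries.coeff d φ * ∏ k, (Function.update w i 0) k ^ d k) =
      fun d => MvPowerSeries.coeff d (fun d => if d i = 0 then MvPowerSeries.coeff d φ else 0 : FPS) *
        ∏ k, w k ^ d k := by
    funext d
    change _ = (if d i = 0 then MvPowerSeries.coeff d φ else 0) * _
    split_ifs with hd
    · congr 1
      refine Finset.prod_congr rfl fun k _ => ?_
      by_cases hk : k = i
      · subst hk; simp [hd]
      · rw [Function.update_of_ne hk]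
    · rw [Finset.prod_eq_zero (Finset.mem_univ i) (by simp [hd])]; simp
  rwa [← e]

theorem exists_eq_coord_mul {h : C3 → ℂ} (ha : AnalyticAt ℂ h 0) (i : Fin 3)
    (h0 : ∀ᶠ w in 𝓝 (0 : C3), w i = 0 → h w = 0) :
    ∃ k, AnalyticAt ℂ k 0 ∧ h =ᶠ[𝓝 0] fun w => w i * k w := by
  obtain ⟨φ, hφ⟩ := exists_expands ha
  have hs : Filter.Tendsto (fun w : C3 => Function.update w i 0) (𝓝 0) (𝓝 0) := by
    have : Continuous fun w : C3 => Function.update w i 0 := continuous_id.update i continuous_const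
    simpa using this.tendsto 0
  have h1 := ((hφ.restrict i).congr (H := fun _ => 0) (by
    filter_upwards [hs.eventually h0] with w hw
    exact hw (by simp))).eq_zero
  have hX : MvPowerSeries.X i ∣ φ := by
    rw [MvPowerSeries.X_dvd_iff]
    intro d hd
    have : MvPowerSeries.coeff d (fun d => if d i = 0 then MvPowerSeries.coeff d φ else 0 : FPS) = 0 := by
      rw [h1]; simp
    simpa [hd] using (show (if d i = 0 then MvPowerSeries.coeff d φ else 0) = 0 from this)
  obtain ⟨ψ, rfl⟩ := hX
  have hψ : Conv ψ := by
    obtain ⟨r, hr, hsum⟩ := hφ.conv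
    refine ⟨r, hr, ?_⟩
    have h1 := (hsum.comp_injective (add_left_injective (Finsupp.single i 1))).mul_left (r⁻¹)
    refine h1.congr fun d => ?_
    simp only [Function.comp, map_add, Finsupp.degree_single, pow_succ, coeff_X_mul']
    simp
    field_simp
  exact ⟨_, hψ.expands.analyticAt, hφ.eventuallyEq ((Expands.coord i).mul hψ.expands)⟩

theorem Expands.eq_zero_of_X_dvd {G : C3 → ℂ} {φ : FPS} (h : Expands G φ) {i : Fin 3}
    (hd : MvPowerSeries.X i ∣ φ) : ∀ᶠ w in 𝓝 (0 : C3), w i = 0 → G w = 0 := by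
  filter_upwards [h] with w hw hi
  rw [MvPowerSeries.X_dvd_iff] at hd
  refine hw.unique ?_
  convert hasSum_zero (α := ℂ) (β := Fin 3 →₀ ℕ) using 2 with d
  by_cases h0 : d i = 0
  · rw [hd d h0, zero_mul]
  · rw [Finset.prod_eq_zero (Finset.mem_univ i), mul_zero]
    rw [hi]; exact zero_pow h0

/-! ### The blow-up map of a point -/

/-- The blow-up map of the origin in the `j`-th chart. -/
def bl (j : Fin 3) (w : C3) : C3 := fun i => if i = j then w j else w i * w j

theorem stdBlowUp_univ (j : Fin 3) (w : C3) : stdBlowUp Finset.univ j w = bl j w := by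
  funext i
  by_cases h : i = j
  · subst h; simp [stdBlowUp, bl]
  · simp [stdBlowUp, bl, h]

theorem bl_same (j : Fin 3) (w : C3) : bl j w j = w j := by simp [bl]

theorem bl_ne {i j : Fin 3} (h : i ≠ j) (w : C3) : bl j w i = w i * w j := by simp [bl, h]

theorem bl_eq_smul (j : Fin 3) (w : C3) (k : Fin 3) : bl j w k = w j * Function.update w j 1 k := by
  by_cases h : k = j
  · subst h; simp [bl]
  · simp [bl, h, mul_comm]

theorem bl_eq_zero {j : Fin 3} {w : C3} (h : w j = 0) : bl j w = 0 := by
  funext i; simp [bl, h]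

theorem analyticAt_coord (k : Fin 3) (c : C3) : AnalyticAt ℂ (fun w : C3 => w k) c :=
  (ContinuousLinearMap.proj (R := ℂ) (φ := fun _ : Fin 3 => ℂ) k).analyticAt c

theorem analyticAt_c3 {E : Type*} [NormedAddCommGroup E] [NormedSpace ℂ E] {f : E → C3} {c : E} :
    AnalyticAt ℂ f c ↔ ∀ i, AnalyticAt ℂ (fun w => f w i) c := analyticAt_pi_iff

theorem analyticAt_update_one (j k : Fin 3) (c : C3) :
    AnalyticAt ℂ (fun w : C3 => Function.update w j 1 k) c := by
  by_cases h : k = j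
  · subst h; simpa using analyticAt_const
  · simpa [h] using analyticAt_coord k c

theorem analyticAt_bl (j : Fin 3) (c : C3) : AnalyticAt ℂ (bl j) c := by
  rw [analyticAt_c3]
  intro i
  simp only [bl_eq_smul]
  exact (analyticAt_coord j c).mul (analyticAt_update_one j i c)

theorem continuous_bl (j : Fin 3) : Continuous (bl j) :=
  continuous_iff_continuousAt.2 fun c => (analyticAt_bl j c).continuousAt

theorem tendsto_bl {j : Fin 3} {c : C3} (h : c j = 0) : Filter.Tendsto (bl j) (𝓝 c) (𝓝 0) := by
  simpa [bl_eq_zero h] using (continuous_bl j).tendsto c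

theorem analyticAt_comp_bl {E : Type*} [NormedAddCommGroup E] [NormedSpace ℂ E] {G : C3 → E}
    (h : AnalyticAt ℂ G 0) {j : Fin 3} {c : C3} (hc : c j = 0) :
    AnalyticAt ℂ (fun w => G (bl j w)) c := by
  have := bl_eq_zero hc
  exact AnalyticAt.fun_comp (by rwa [this]) (analyticAt_bl j c)

theorem Expands.exists_bl {n : ℕ} {G : C3 → ℂ} {φ : FPS} (h : Expands G φ)
    (hn : (n : ℕ∞) ≤ φ.order) (j : Fin 3) : ∃ K : C3 → ℂ, ∀ c : C3, c j = 0 → AnalyticAt ℂ K c ∧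
      (∀ᶠ w in 𝓝 c, G (bl j w) = w j ^ n * K w) ∧
      K c = homogeneousPart n φ (Function.update c j 1) := by
  induction n generalizing G φ with
  | zero =>
    refine ⟨fun w => G (bl j w), fun c hc => ⟨analyticAt_comp_bl h.analyticAt hc, by simp, ?_⟩⟩
    have h1 : degSet 0 = {0} := by ext d; simp [mem_degSet, Finsupp.degree_eq_zero_iff]
    change G (bl j c) = _
    rw [homogeneousPart_eq, h1, bl_eq_zero hc, ← h.constantCoeff]
    simp [mon_zero]
  | succ n ih =>
    have h0 : MvPowerSeries.constantCoeff φ = 0 := by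
      have := MvPowerSeries.coeff_of_lt_order (f := φ) (d := 0)
        (lt_of_lt_of_le (by simp) hn)
      simpa using this
    obtain ⟨m, hm, he⟩ := h.decompose (h.constantCoeff.symm.trans h0)
    choose K hK using fun k => ih (hm k) (order_shift hn k)
    refine ⟨fun w => ∑ k, Function.update w j 1 k * K k w, fun c hc => ⟨?_, ?_, ?_⟩⟩
    · exact Finset.analyticAt_fun_sum _ fun k _ =>
        (analyticAt_update_one j k c).mul (hK k c hc).1
    · have h1 : ∀ᶠ w in 𝓝 c, ∀ k, m k (bl j w) = w j ^ n * K k w :=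
        Filter.eventually_all.2 fun k => (hK k c hc).2.1
      filter_upwards [(tendsto_bl hc).eventually he, h1] with w hw h1
      rw [hw, Finset.mul_sum]
      refine Finset.sum_congr rfl fun k _ => ?_
      rw [h1, bl_eq_smul]; ring
    · conv_rhs => rw [sum_X_mul_shift h0, homogeneousPart_sum]
      refine Finset.sum_congr rfl fun k _ => ?_
      rw [homogeneousPart_X_mul, (hK k c hc).2.2]

/-! ### Infinitesimal generators of formal germs tangent to the identity -/

/-- The coefficients of degree less than `n` vanish. -/
def VanishBelow (n : ℕ) (φ : FPS) : Prop := ∀ d, d.degree < n → MvPowerSeries.coeff d φ = 0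

theorem vanishBelow_iff {n : ℕ} {φ : FPS} : VanishBelow n φ ↔ (n : ℕ∞) ≤ φ.order := by
  refine ⟨fun h => MvPowerSeries.nat_le_order h, fun h d hd => ?_⟩
  exact MvPowerSeries.coeff_of_lt_order (lt_of_lt_of_le (by exact_mod_cast hd) h)

theorem VanishBelow.mono {m n : ℕ} {φ : FPS} (h : VanishBelow n φ) (hmn : m ≤ n) :
    VanishBelow m φ := fun d hd => h d (hd.trans_le hmn)

theorem VanishBelow.zero (n : ℕ) : VanishBelow n 0 := fun _ _ => by simp

theorem VanishBelow.add {n : ℕ} {φ ψ : FPS} (h : VanishBelow n φ) (h' : VanishBelow n ψ) :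
    VanishBelow n (φ + ψ) := fun d hd => by rw [map_add, h d hd, h' d hd, add_zero]

theorem VanishBelow.sum {ι : Type*} {s : Finset ι} {n : ℕ} {φ : ι → FPS}
    (h : ∀ i ∈ s, VanishBelow n (φ i)) : VanishBelow n (∑ i ∈ s, φ i) := fun d hd => by
  rw [map_sum]; exact Finset.sum_eq_zero fun i hi => h i hi d hd

theorem VanishBelow.mul {m n : ℕ} {φ ψ : FPS} (h : VanishBelow m φ) (h' : VanishBelow n ψ) :
    VanishBelow (m + n) (φ * ψ) := by
  rw [vanishBelow_iff] at *
  push_cast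
  exact (add_le_add h h').trans MvPowerSeries.le_order_mul

theorem VanishBelow.pderiv {n : ℕ} {φ : FPS} (h : VanishBelow n φ) (j : Fin 3) :
    VanishBelow (n - 1) (MvPowerSeries.pderiv ℂ j φ) := fun d hd => by
  rw [MvPowerSeries.coeff_pderiv, h, zero_mul]
  rw [map_add, Finsupp.degree_single]; omega

theorem VanishBelow.lieDeriv {n : ℕ} {φ : FPS} {χ : Fin 3 → FPS} (hχ : ∀ i, VanishBelow 2 (χ i))
    (h : VanishBelow n φ) : VanishBelow (n + 1) (lieDeriv χ φ) :=
  VanishBelow.sum fun i _ => ((hχ i).mul (h.pderiv i)).mono (by omega)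

theorem vanishBelow_X (i : Fin 3) : VanishBelow 1 (MvPowerSeries.X i) := fun d hd => by
  have : d = 0 := by rw [← Finsupp.degree_eq_zero_iff]; omega
  subst this; simp

theorem vanishBelow_iterate {χ : Fin 3 → FPS} (hχ : ∀ i, VanishBelow 2 (χ i)) (i : Fin 3) (n : ℕ) :
    VanishBelow (n + 1) ((lieDeriv χ)^[n] (MvPowerSeries.X i)) := by
  induction n with
  | zero => exact vanishBelow_X i
  | succ n ih => rw [Function.iterate_succ_apply']; exact ih.lieDeriv hχ

theorem lieDeriv_X (χ : Fin 3 → FPS) (i : Fin 3) : lieDeriv χ (MvPowerSeries.X i) = χ i := by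
  classical
  rw [lieDeriv, Finset.sum_eq_single i]
  · rw [MvPowerSeries.pderiv_X_self, mul_one]
  · intro j _ hj
    rw [MvPowerSeries.pderiv_X_of_ne hj.symm, mul_zero]
  · simp

theorem vanishBelow_iterate_sub {χ χ' : Fin 3 → FPS} (hχ : ∀ i, VanishBelow 2 (χ i))
    (hχ' : ∀ i, VanishBelow 2 (χ' i)) {k : ℕ} (h : ∀ i, VanishBelow k (χ i - χ' i)) (i : Fin 3)
    (n : ℕ) : VanishBelow (k + n) ((lieDeriv χ)^[n + 1] (MvPowerSeries.X i) -
      (lieDeriv χ')^[n + 1] (MvPowerSeries.X i)) := by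
  induction n with
  | zero => simpa [lieDeriv_X] using h i
  | succ n ih =>
    rw [Function.iterate_succ_apply' _ (n + 1), Function.iterate_succ_apply' _ (n + 1)]
    set φ := (lieDeriv χ)^[n + 1] (MvPowerSeries.X i)
    set φ' := (lieDeriv χ')^[n + 1] (MvPowerSeries.X i)
    have e : lieDeriv χ φ - lieDeriv χ' φ' = ∑ j, ((χ j - χ' j) * MvPowerSeries.pderiv ℂ j φ +
        χ' j * MvPowerSeries.pderiv ℂ j (φ - φ')) := by
      rw [lieDeriv, lieDeriv, ← Finset.sum_sub_distrib]
      refine Finset.sum_congr rfl fun j _ => ?_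
      rw [map_sub]; ring
    rw [e]
    refine VanishBelow.sum fun j _ => VanishBelow.add ?_ ?_
    · exact ((h j).mul ((vanishBelow_iterate hχ i (n + 1)).pderiv j)).mono (by omega)
    · exact ((hχ' j).mul (ih.pderiv j)).mono (by omega)

/-- The contribution of the terms of order at least two of the exponential series. -/
def expTail (χ : Fin 3 → FPS) (i : Fin 3) : FPS := fun d =>
  ∑ n ∈ Finset.range (d.degree - 1),
    MvPowerSeries.coeff d ((lieDeriv χ)^[n + 2] (MvPowerSeries.X i)) / ((n + 2).factorial : ℂ)

theorem coeff_expTail (χ : Fin 3 → FPS) (i : Fin 3) (d : Fin 3 →₀ ℕ) :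
    MvPowerSeries.coeff d (expTail χ i) = ∑ n ∈ Finset.range (d.degree - 1),
      MvPowerSeries.coeff d ((lieDeriv χ)^[n + 2] (MvPowerSeries.X i)) / ((n + 2).factorial : ℂ) :=
  rfl

theorem vanishBelow_expTail (χ : Fin 3 → FPS) (i : Fin 3) : VanishBelow 2 (expTail χ i) :=
  fun d hd => by
    rw [coeff_expTail, show d.degree - 1 = 0 by omega]; simp

theorem vanishBelow_expTail_sub {χ χ' : Fin 3 → FPS} (hχ : ∀ i, VanishBelow 2 (χ i))
    (hχ' : ∀ i, VanishBelow 2 (χ' i)) {k : ℕ} (h : ∀ i, VanishBelow k (χ i - χ' i)) (i : Fin 3) :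
    VanishBelow (k + 1) (expTail χ i - expTail χ' i) := fun d hd => by
  rw [map_sub, coeff_expTail, coeff_expTail, ← Finset.sum_sub_distrib]
  refine Finset.sum_eq_zero fun n _ => ?_
  have := vanishBelow_iterate_sub hχ hχ' h i (n + 1) d (by omega)
  rw [map_sub] at this
  rw [← sub_div, this, zero_div]

theorem isInfinitesimalGenerator_iff {χ F : Fin 3 → FPS} :
    IsInfinitesimalGenerator χ F ↔ (∀ i, VanishBelow 2 (χ i)) ∧
      ∀ i, F i - MvPowerSeries.X i = χ i + expTail χ i := by
  have key : ∀ (_ : ∀ i, VanishBelow 2 (χ i)) (i : Fin 3) (d : Fin 3 →₀ ℕ),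
      ∑ n ∈ Finset.range (d.degree + 1), MvPowerSeries.coeff d
        ((lieDeriv χ)^[n] (MvPowerSeries.X i)) / (n.factorial : ℂ) =
      MvPowerSeries.coeff d (MvPowerSeries.X i + (χ i + expTail χ i)) := by
    intro hχ i d
    rw [map_add, map_add, coeff_expTail]
    rcases Nat.eq_zero_or_pos d.degree with h0 | h0
    · have h1 := hχ i d (by omega)
      rw [h0, h1]
      simp
    · obtain ⟨m, hm⟩ : ∃ m, d.degree = m + 1 := ⟨d.degree - 1, by omega⟩
      rw [hm, Finset.sum_range_succ', Finset.sum_range_succ', Nat.add_sub_cancel]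
      simp [lieDeriv_X]
      ring
  constructor
  · rintro ⟨h1, h2⟩
    have h1' : ∀ i, VanishBelow 2 (χ i) := fun i => vanishBelow_iff.2 (by exact_mod_cast h1 i)
    refine ⟨h1', fun i => ?_⟩
    rw [sub_eq_iff_eq_add']
    ext d
    rw [h2, key h1']
  · rintro ⟨h1, h2⟩
    refine ⟨fun i => by exact_mod_cast vanishBelow_iff.1 (h1 i), fun i d => ?_⟩
    rw [key h1, ← h2, add_sub_cancel]

/-- Successive approximations of the infinitesimal generator. -/
def approxGenerator (F : Fin 3 → FPS) : ℕ → Fin 3 → FPS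
  | 0 => fun _ => 0
  | m + 1 => fun i => F i - MvPowerSeries.X i - expTail (approxGenerator F m) i

theorem exists_generator {F : Fin 3 → FPS} (hF : ∀ i, VanishBelow 2 (F i - MvPowerSeries.X i)) :
    ∃ χ, IsInfinitesimalGenerator χ F := by
  obtain ⟨s, hs0, hs⟩ : ∃ s : ℕ → Fin 3 → FPS, (∀ i, s 0 i = 0) ∧
      ∀ m i, s (m + 1) i = F i - MvPowerSeries.X i - expTail (s m) i :=
    ⟨approxGenerator F, fun _ => rfl, fun _ _ => rfl⟩
  have hs2 : ∀ m i, VanishBelow 2 (s m i) := by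
    intro m i
    cases m with
    | zero => rw [hs0]; exact VanishBelow.zero 2
    | succ m =>
      intro d hd
      rw [hs, map_sub, hF i d hd, vanishBelow_expTail _ _ d hd, sub_zero]
  have hstep : ∀ m i, VanishBelow m (s (m + 1) i - s m i) := by
    intro m
    induction m with
    | zero => intro i d hd; omega
    | succ m ih =>
      intro i d hd
      have := vanishBelow_expTail_sub (hs2 (m + 1)) (hs2 m) ih i d hd
      rw [hs (m + 1), hs m, sub_sub_sub_cancel_left, ← neg_sub, map_neg, this, neg_zero]
  have hstab : ∀ m i d, d.degree < m →
      MvPowerSeries.coeff d (s m i) = MvPowerSeries.coeff d (s (d.degree + 1) i) := by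
    intro m i d hd
    induction m, (show d.degree + 1 ≤ m from hd) using Nat.le_induction with
    | base => rfl
    | succ m hm ih =>
      have := hstep m i d hm
      rw [map_sub, sub_eq_zero] at this
      rw [this, ih hm]
  obtain ⟨χ, hχ⟩ : ∃ χ : Fin 3 → FPS,
      ∀ i d, MvPowerSeries.coeff d (χ i) = MvPowerSeries.coeff d (s (d.degree + 1) i) :=
    ⟨fun i d => MvPowerSeries.coeff d (s (d.degree + 1) i), fun _ _ => rfl⟩
  have hχ2 : ∀ i, VanishBelow 2 (χ i) := fun i d hd => by rw [hχ, hs2 (d.degree + 1) i d hd]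
  refine ⟨χ, isInfinitesimalGenerator_iff.2 ⟨hχ2, fun i => ?_⟩⟩
  ext d
  have h1 : ∀ j, VanishBelow d.degree (χ j - s d.degree j) := by
    intro j e he
    rw [map_sub, hχ, hstab _ _ _ he, sub_self]
  have h2 := vanishBelow_expTail_sub hχ2 (hs2 _) h1 i d (by omega)
  rw [map_sub, sub_eq_zero] at h2
  rw [map_add, h2, hχ, hs, map_sub _ _ (expTail _ _), sub_add_cancel]

theorem expTail_eq_sum {χ : Fin 3 → FPS} (hχ : ∀ i, VanishBelow 2 (χ i)) (i : Fin 3) :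
    ∃ N : Fin 3 → FPS, (∀ j, MvPowerSeries.constantCoeff (N j) = 0) ∧
      expTail χ i = ∑ j, N j * χ j := by
  let t : ℕ → Fin 3 → FPS := fun n j => MvPowerSeries.C (((n + 2).factorial : ℂ)⁻¹) *
    MvPowerSeries.pderiv ℂ j ((lieDeriv χ)^[n + 1] (MvPowerSeries.X i))
  have ht : ∀ n j, VanishBelow (n + 1) (t n j) := fun n j d hd => by
    rw [MvPowerSeries.coeff_C_mul, (vanishBelow_iterate hχ i (n + 1)).pderiv j d (by omega),
      mul_zero]
  have htc : ∀ n, ∑ j, t n j * χ j = MvPowerSeries.C (((n + 2).factorial : ℂ)⁻¹) *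
      (lieDeriv χ)^[n + 2] (MvPowerSeries.X i) := by
    intro n
    rw [Function.iterate_succ_apply' _ (n + 1), lieDeriv, Finset.mul_sum]
    exact Finset.sum_congr rfl fun j _ => by simp only [t]; ring
  let N : Fin 3 → FPS := fun j d => ∑ n ∈ Finset.range d.degree, MvPowerSeries.coeff d (t n j)
  have hN : ∀ j d, MvPowerSeries.coeff d (N j) =
      ∑ n ∈ Finset.range d.degree, MvPowerSeries.coeff d (t n j) := fun _ _ => rfl
  refine ⟨N, fun j => ?_, ?_⟩
  · rw [← MvPowerSeries.coeff_zero_eq_constantCoeff_apply, hN]; simp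
  · ext d
    have h1 : ∀ j, VanishBelow (d.degree + 1) (N j - ∑ n ∈ Finset.range d.degree, t n j) := by
      intro j e he
      rw [map_sub, hN, map_sum, sub_eq_zero]
      refine Finset.sum_subset (Finset.range_mono (by omega)) fun n _ hn => ?_
      exact ht n j e (by simp at hn; omega)
    have h2 : MvPowerSeries.coeff d (∑ j, N j * χ j) =
        MvPowerSeries.coeff d (∑ j, (∑ n ∈ Finset.range d.degree, t n j) * χ j) := by
      rw [← sub_eq_zero, ← map_sub, ← Finset.sum_sub_distrib]
      refine VanishBelow.sum (n := d.degree + 1) (fun j _ => ?_) d (by omega)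
      rw [← sub_mul]
      exact ((h1 j).mul (hχ j)).mono (by omega)
    rw [h2]
    simp only [Finset.sum_mul]
    rw [Finset.sum_comm]
    simp only [htc]
    rw [map_sum, coeff_expTail]
    simp only [MvPowerSeries.coeff_C_mul]
    have h3 : ∀ n, MvPowerSeries.coeff d ((lieDeriv χ)^[n + 2] (MvPowerSeries.X i)) /
        ((n + 2).factorial : ℂ) = ((n + 2).factorial : ℂ)⁻¹ *
          MvPowerSeries.coeff d ((lieDeriv χ)^[n + 2] (MvPowerSeries.X i)) := fun n => by
      rw [div_eq_inv_mul]
    simp only [h3]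
    refine Finset.sum_subset (Finset.range_mono (by omega)) fun n _ hn => ?_
    rw [vanishBelow_iterate hχ i (n + 2) d (by simp at hn; omega), mul_zero]

theorem IsInfinitesimalGenerator.exists_matrix {χ F : Fin 3 → FPS}
    (h : IsInfinitesimalGenerator χ F) : ∃ N : Matrix (Fin 3) (Fin 3) FPS, IsUnit N.det ∧
      N.map MvPowerSeries.constantCoeff = 1 ∧
      (fun i => F i - MvPowerSeries.X i) = N.mulVec χ := by
  obtain ⟨h1, h2⟩ := isInfinitesimalGenerator_iff.1 h
  choose N hN hN' using expTail_eq_sum h1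
  have hm : (1 + Matrix.of N : Matrix (Fin 3) (Fin 3) FPS).map MvPowerSeries.constantCoeff = 1 := by
    ext i j
    simp [hN, Matrix.one_apply, apply_ite]
  refine ⟨1 + Matrix.of N, ?_, hm, ?_⟩
  · rw [MvPowerSeries.isUnit_iff_constantCoeff, RingHom.map_det]
    change IsUnit (Matrix.det (Matrix.map _ _))
    rw [hm]; simp
  · funext i
    rw [h2, hN', Matrix.add_mulVec, Matrix.one_mulVec]
    rfl

theorem dvd_of_dvd_mulVec {N : Matrix (Fin 3) (Fin 3) FPS} (hN : IsUnit N.det) {m : FPS}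
    {v : Fin 3 → FPS} (h : ∀ i, m ∣ N.mulVec v i) (i : Fin 3) : m ∣ v i := by
  have : v = N⁻¹.mulVec (N.mulVec v) := by
    rw [Matrix.mulVec_mulVec, Matrix.nonsing_inv_mul _ hN, Matrix.one_mulVec]
  rw [this, Matrix.mulVec, dotProduct]
  exact Finset.dvd_sum fun j _ => (h j).mul_left _

theorem constantCoeff_mulVec {N : Matrix (Fin 3) (Fin 3) FPS} {v : Fin 3 → FPS}
    (h : ∀ i, MvPowerSeries.constantCoeff (v i) = 0) (i : Fin 3) :
    MvPowerSeries.constantCoeff (N.mulVec v i) = 0 := by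
  simp [Matrix.mulVec, dotProduct, h]

theorem exists_constantCoeff_ne_zero {F χ ξ : Fin 3 → FPS} (hχ : IsInfinitesimalGenerator χ F)
    (hξ : IsSaturation ξ χ) {l : FPS} {H : Fin 3 → FPS}
    (hF : ∀ i, F i - MvPowerSeries.X i = l * H i) {i₀ : Fin 3}
    (hi₀ : MvPowerSeries.constantCoeff (H i₀) ≠ 0) :
    ∃ i, MvPowerSeries.constantCoeff (ξ i) ≠ 0 := by
  by_contra! hcon
  obtain ⟨N, hdet, -, hN⟩ := hχ.exists_matrix
  obtain ⟨⟨l', hl', hχl⟩, hcop⟩ := hξ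
  have hη : ∀ i, l * H i = l' * N.mulVec ξ i := by
    intro i
    rw [← hF]
    have : F i - MvPowerSeries.X i = N.mulVec χ i := congrFun hN i
    rw [this, show χ = l' • ξ from funext hχl, Matrix.mulVec_smul]
    rfl
  obtain ⟨u, hu⟩ := MvPowerSeries.isUnit_iff_constantCoeff.2 (isUnit_iff_ne_zero.2 hi₀)
  have hdvd : ∀ j, N.mulVec ξ i₀ ∣ N.mulVec ξ j := by
    intro j
    refine ⟨H j * (↑u⁻¹ : FPS), mul_left_cancel₀ hl' ?_⟩
    rw [← mul_assoc, ← hη i₀, ← hη j, ← hu]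
    calc l * H j = l * H j * (u * (↑u⁻¹ : FPS)) := by rw [u.mul_inv, mul_one]
      _ = _ := by ring
  have hunit := hcop _ (dvd_of_dvd_mulVec hdet hdvd)
  rw [MvPowerSeries.isUnit_iff_constantCoeff, constantCoeff_mulVec hcon] at hunit
  simp at hunit

theorem exists_singular_saturation {F : Fin 3 → FPS} {l : FPS} {η : Fin 3 → FPS}
    (hF : ∀ i, F i - MvPowerSeries.X i = l * η i) (hl : l ≠ 0)
    (hl0 : MvPowerSeries.constantCoeff l = 0) (hη : ∀ i, MvPowerSeries.constantCoeff (η i) = 0)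
    (hcop : ∀ m : FPS, (∀ i, m ∣ η i) → IsUnit m) :
    ∃ χ ξ : Fin 3 → FPS, IsInfinitesimalGenerator χ F ∧ IsSaturation ξ χ ∧
      ∀ i, MvPowerSeries.constantCoeff (ξ i) = 0 := by
  have h1 : ∀ φ : FPS, MvPowerSeries.constantCoeff φ = 0 → VanishBelow 1 φ := fun φ h d hd => by
    have : d = 0 := by rw [← Finsupp.degree_eq_zero_iff]; omega
    subst this; simpa using h
  obtain ⟨χ, hχ⟩ := exists_generator (F := F) fun i => by
    rw [hF]; exact (h1 _ hl0).mul (h1 _ (hη i))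
  obtain ⟨N, hdet, -, hN⟩ := hχ.exists_matrix
  have hχe : χ = l • N⁻¹.mulVec η := by
    rw [← Matrix.mulVec_smul, show l • η = N.mulVec χ by rw [← hN]; funext i; exact (hF i).symm,
      Matrix.mulVec_mulVec, Matrix.nonsing_inv_mul _ hdet, Matrix.one_mulVec]
  refine ⟨χ, N⁻¹.mulVec η, hχ, ⟨⟨l, hl, fun i => by rw [hχe]; rfl⟩, fun m hm => hcop m ?_⟩,
    constantCoeff_mulVec hη⟩
  refine dvd_of_dvd_mulVec (N := N⁻¹) ?_ hm
  rw [Matrix.det_nonsing_inv]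
  exact isUnit_ringInverse.2 hdet

/-! ### Integrals of analytic germs and changes of coordinates -/

theorem analyticAt_integral {E E' F : Type*} [NormedAddCommGroup E] [NormedSpace ℂ E]
    [NormedAddCommGroup E'] [NormedSpace ℂ E'] [NormedAddCommGroup F] [NormedSpace ℂ F]
    [CompleteSpace F] {h : E → F} (ha : AnalyticAt ℂ h 0) {D : ℝ → E' →L[ℂ] E}
    (hD : Continuous D) : AnalyticAt ℂ (fun x => ∫ t in (0 : ℝ)..1, h (D t x)) 0 := by
  obtain ⟨p, r, hp⟩ := ha
  obtain ⟨K, hK⟩ := (isCompact_Icc (a := (0 : ℝ)) (b := 1)).exists_bound_of_continuousOn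
    hD.continuousOn
  have hK0 : 0 ≤ K := (norm_nonneg _).trans (hK 0 (by simp))
  obtain ⟨ρ, hρ0, hρ⟩ := ENNReal.lt_iff_exists_nnreal_btwn.1 hp.r_pos
  have hρpos : 0 < (ρ : ℝ) := by exact_mod_cast hρ0
  obtain ⟨a, ha, C, hC, hb⟩ := p.norm_mul_pow_le_mul_pow_of_lt_radius (hρ.trans_le hp.r_le)
  let q : FormalMultilinearSeries ℂ E' F := fun n =>
    ∫ t in (0 : ℝ)..1, (p n).compContinuousLinearMap fun _ => D t
  have hcont : ∀ n, Continuous fun t => (p n).compContinuousLinearMap fun _ => D t := by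
    intro n
    have h1 := (ContinuousMultilinearMap.compContinuousLinearMapContinuousMultilinear ℂ
      (fun _ : Fin n => E') (fun _ : Fin n => E) F).cont.comp
      (continuous_pi fun _ : Fin n => hD)
    exact (ContinuousLinearMap.apply ℂ _ (p n)).continuous.comp h1
  have hnorm : ∀ n, ∀ t ∈ Set.Icc (0 : ℝ) 1,
      ‖(p n).compContinuousLinearMap fun _ => D t‖ ≤ ‖p n‖ * K ^ n := by
    intro n t ht
    refine (ContinuousMultilinearMap.norm_compContinuousLinearMap_le _ _).trans ?_
    gcongr
    refine (Finset.prod_le_prod (fun _ _ => norm_nonneg _) fun _ _ => hK t ht).trans ?_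
    simp
  have hIoc : ∀ t : ℝ, t ∈ Set.uIoc (0 : ℝ) 1 → t ∈ Set.Icc (0 : ℝ) 1 := fun t ht => by
    rw [Set.uIoc_of_le zero_le_one] at ht; exact ⟨ht.1.le, ht.2⟩
  have hq : ∀ n, ‖q n‖ ≤ ‖p n‖ * K ^ n := by
    intro n
    have := intervalIntegral.norm_integral_le_of_norm_le_const (a := (0 : ℝ)) (b := 1)
      (f := fun t => (p n).compContinuousLinearMap fun _ => D t) (C := ‖p n‖ * K ^ n)
      fun t ht => hnorm n t (hIoc t ht)
    simpa using this
  have hqe : ∀ n (x : E'), q n (fun _ => x) = ∫ t in (0 : ℝ)..1, p n fun _ => D t x := by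
    intro n x
    have := ContinuousLinearMap.intervalIntegral_comp_comm
      (ContinuousMultilinearMap.apply ℂ (fun _ : Fin n => E') F fun _ => x)
      (μ := MeasureTheory.volume) ((hcont n).intervalIntegrable 0 1)
    exact this.symm
  set σ : ℝ := ρ / (K + 1) with hσ
  have hσpos : 0 < σ := by positivity
  have hKσ : K * σ ≤ ρ := by
    rw [hσ, mul_div_assoc', div_le_iff₀ (by positivity)]
    nlinarith
  refine ⟨q, ENNReal.ofReal σ, ?_, by simpa using hσpos, ?_⟩
  · have : ENNReal.ofReal σ = ((σ.toNNReal : NNReal) : ENNReal) := rfl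
    rw [this]
    refine q.le_radius_of_bound C fun n => ?_
    rw [Real.coe_toNNReal _ hσpos.le]
    calc ‖q n‖ * σ ^ n ≤ ‖p n‖ * K ^ n * σ ^ n := by gcongr; exact hq n
      _ = ‖p n‖ * (K * σ) ^ n := by rw [mul_pow, mul_assoc]
      _ ≤ ‖p n‖ * ρ ^ n := by gcongr
      _ ≤ C * a ^ n := hb n
      _ ≤ C := mul_le_of_le_one_right hC.le (pow_le_one₀ ha.1.le ha.2.le)
  · intro y hy
    rw [Metric.eball_ofReal, mem_ball_zero_iff] at hy
    rw [zero_add]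
    simp only [hqe]
    have hDy : ∀ t ∈ Set.Icc (0 : ℝ) 1, ‖D t y‖ ≤ ρ := fun t ht =>
      ((D t).le_opNorm y).trans (le_trans (by gcongr; exact hK t ht) hKσ)
    refine intervalIntegral.hasSum_integral_of_dominated_convergence (fun n _ => C * a ^ n) ?_ ?_ ?_
      ?_ ?_
    · intro n
      refine Continuous.aestronglyMeasurable ?_
      exact (p n).cont.comp (continuous_pi fun _ => hD.clm_apply continuous_const)
    · refine fun n => Filter.Eventually.of_forall fun t ht => ?_
      refine le_trans ((p n).le_opNorm _) (le_trans ?_ (hb n))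
      gcongr
      refine (Finset.prod_le_prod (fun _ _ => norm_nonneg _) fun _ _ => hDy t (hIoc t ht)).trans ?_
      simp
    · exact Filter.Eventually.of_forall fun t _ =>
        (summable_geometric_of_lt_one ha.1.le ha.2).mul_left C
    · exact intervalIntegrable_const
    · refine Filter.Eventually.of_forall fun t ht => ?_
      have := hp.hasSum (y := D t y) (by
        rw [Metric.mem_eball, edist_zero_right]
        refine lt_of_le_of_lt ?_ hρ
        rw [enorm_eq_nnnorm]
        exact_mod_cast hDy t (hIoc t ht))
      simpa using this

theorem exists_secant {E F : Type*} [NormedAddCommGroup E] [NormedSpace ℂ E]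
    [NormedAddCommGroup F] [NormedSpace ℂ F] [CompleteSpace F] {φ : E → F}
    (h : AnalyticAt ℂ φ 0) : ∃ M : E × E → E →L[ℂ] F, AnalyticAt ℂ M 0 ∧
      M 0 = fderiv ℂ φ 0 ∧ ∀ᶠ x in 𝓝 (0 : E × E), φ (x.1 + x.2) - φ x.1 = M x x.2 := by
  let D : ℝ → (E × E) →L[ℂ] E := fun t =>
    ContinuousLinearMap.fst ℂ E E + (t : ℂ) • ContinuousLinearMap.snd ℂ E E
  have hD : Continuous D := by fun_prop
  have hDa : ∀ t x, D t x = x.1 + (t : ℂ) • x.2 := fun t x => rfl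
  refine ⟨fun x => ∫ t in (0 : ℝ)..1, fderiv ℂ φ (D t x), analyticAt_integral h.fderiv hD, ?_, ?_⟩
  · simp
  · obtain ⟨ε, hε, hb⟩ := Metric.eventually_nhds_iff.1 h.eventually_analyticAt
    filter_upwards [Metric.ball_mem_nhds (0 : E × E) (half_pos hε)] with x hx
    rw [mem_ball_zero_iff, Prod.norm_def, max_lt_iff] at hx
    have hin : ∀ t ∈ Set.Icc (0 : ℝ) 1, AnalyticAt ℂ φ (D t x) := by
      intro t ht
      apply hb
      rw [dist_zero_right, hDa]
      refine (norm_add_le _ _).trans_lt ?_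
      rw [norm_smul, Complex.norm_real, Real.norm_of_nonneg ht.1]
      nlinarith [norm_nonneg x.2, ht.2, hx.1, hx.2]
    have hIcc : Set.uIcc (0 : ℝ) 1 = Set.Icc 0 1 := Set.uIcc_of_le zero_le_one
    have hcont : ContinuousOn (fun t => fderiv ℂ φ (D t x)) (Set.uIcc 0 1) := by
      rw [hIcc]
      intro t ht
      have h1 : ContinuousAt (fun t => D t x) t := by
        have : Continuous fun t => D t x := by fun_prop
        exact this.continuousAt
      exact ((hin t ht).fderiv.continuousAt.comp_of_eq h1 rfl).continuousWithinAt
    have hderiv : ∀ t ∈ Set.uIcc (0 : ℝ) 1,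
        HasDerivAt (fun t : ℝ => φ (D t x)) (fderiv ℂ φ (D t x) x.2) t := by
      rw [hIcc]
      intro t ht
      have h1 : HasDerivAt (fun t : ℝ => D t x) x.2 t := by
        have := ((Complex.ofRealCLM.hasDerivAt (x := t)).smul_const x.2).const_add x.1
        simpa [hDa] using this
      exact ((hin t ht).differentiableAt.hasFDerivAt.restrictScalars ℝ).comp_hasDerivAt t h1
    have hint := intervalIntegral.integral_eq_sub_of_hasDerivAt hderiv
      ((hcont.clm_apply continuousOn_const).intervalIntegrable)
    simp only [hDa] at hint
    simp only [Complex.ofReal_one, one_smul, Complex.ofReal_zero, zero_smul, add_zero] at hint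
    rw [← hint]
    have := ContinuousLinearMap.intervalIntegral_comp_comm
      (ContinuousLinearMap.apply ℂ F x.2) (μ := MeasureTheory.volume) hcont.intervalIntegrable
    exact this

theorem analyticAt_clm_apply {E F G : Type*} [NormedAddCommGroup E] [NormedSpace ℂ E]
    [NormedAddCommGroup F] [NormedSpace ℂ F] [NormedAddCommGroup G] [NormedSpace ℂ G]
    {N : G → E →L[ℂ] F} {H : G → E} {c : G} (hN : AnalyticAt ℂ N c) (hH : AnalyticAt ℂ H c) :
    AnalyticAt ℂ (fun w => N w (H w)) c :=
  AnalyticAt.fun_comp (f := fun w => (N w, H w))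
    ((ContinuousLinearMap.id ℂ (E →L[ℂ] F)).analyticAt_bilinear (N c, H c)) (hN.prod hH)

theorem conj_form {φ ψ F G : C3 → C3} {l : C3 → ℂ} (hφ : AnalyticAt ℂ φ 0)
    (hψ : AnalyticAt ℂ ψ 0) (hψ0 : ψ 0 = 0) (hφψ : ∀ᶠ w in 𝓝 0, φ (ψ w) = w)
    (hl : AnalyticAt ℂ l 0) (hG : AnalyticAt ℂ G 0) (h0 : l 0 • G 0 = 0)
    (hF : ∀ᶠ w in 𝓝 0, F w = w + l w • G w) :
    ∃ N : C3 → C3 →L[ℂ] C3, AnalyticAt ℂ N 0 ∧ N 0 = fderiv ℂ φ 0 ∧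
      ∀ᶠ w in 𝓝 0, φ (F (ψ w)) = w + l (ψ w) • N w (G (ψ w)) := by
  obtain ⟨M, hM, hM0, hMe⟩ := exists_secant hφ
  have hlψ : AnalyticAt ℂ (fun w => l (ψ w)) 0 := AnalyticAt.fun_comp (by rwa [hψ0]) hψ
  have hGψ : AnalyticAt ℂ (fun w => G (ψ w)) 0 := AnalyticAt.fun_comp (by rwa [hψ0]) hψ
  have hx : AnalyticAt ℂ (fun w => (ψ w, l (ψ w) • G (ψ w))) 0 := hψ.prod (hlψ.fun_smul hGψ)
  have hx0 : (ψ 0, l (ψ 0) • G (ψ 0)) = (0 : C3 × C3) := by rw [hψ0, h0]; rfl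
  refine ⟨fun w => M (ψ w, l (ψ w) • G (ψ w)), AnalyticAt.fun_comp (by rwa [hx0]) hx, ?_, ?_⟩
  · simp only [hx0, hM0]
  · have ht : Filter.Tendsto (fun w => (ψ w, l (ψ w) • G (ψ w))) (𝓝 0) (𝓝 0) := by
      have := hx.continuousAt.tendsto
      rwa [hx0] at this
    have htψ : Filter.Tendsto ψ (𝓝 0) (𝓝 0) := by
      have := hψ.continuousAt.tendsto
      rwa [hψ0] at this
    filter_upwards [ht.eventually hMe, htψ.eventually hF, hφψ] with w h1 h2 h3
    rw [h2, eq_add_of_sub_eq h1, h3, map_smul, add_comm]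

theorem injective_fderiv {φ ψ : C3 → C3} (hφ : AnalyticAt ℂ φ 0) (hψ : AnalyticAt ℂ ψ 0)
    (hφ0 : φ 0 = 0) (hψφ : ∀ᶠ w in 𝓝 0, ψ (φ w) = w) : Function.Injective (fderiv ℂ φ 0) := by
  have h1 : HasFDerivAt (fun w => ψ (φ w)) ((fderiv ℂ ψ 0).comp (fderiv ℂ φ 0)) 0 := by
    have hψ' : HasFDerivAt ψ (fderiv ℂ ψ 0) (φ 0) := by
      rw [hφ0]; exact hψ.differentiableAt.hasFDerivAt
    exact hψ'.comp 0 hφ.differentiableAt.hasFDerivAt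
  have h2 : HasFDerivAt (fun w => ψ (φ w)) (ContinuousLinearMap.id ℂ C3) 0 :=
    (hasFDerivAt_id 0).congr_of_eventuallyEq hψφ
  have h3 := h1.unique h2
  exact Function.LeftInverse.injective (g := fderiv ℂ ψ 0) fun v => by
    simpa using DFunLike.congr_fun h3 v

/-! ### Singular and nonsingular germs -/

/-- The germ `F` is the identity plus a function times a nowhere vanishing vector. -/
def NonsingForm (F : C3 → C3) : Prop :=
  ∃ (l : C3 → ℂ) (H : C3 → C3), AnalyticAt ℂ l 0 ∧ AnalyticAt ℂ H 0 ∧ l 0 = 0 ∧ H 0 ≠ 0 ∧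
    ∀ᶠ w in 𝓝 0, F w = w + l w • H w

/-- The germ `F` has a singular saturated infinitesimal generator. -/
def SingForm (F : C3 → C3) : Prop :=
  ∃ Fh χ ξ : Fin 3 → FPS, (∀ i, Expands (fun w => F w i) (Fh i)) ∧
    IsInfinitesimalGenerator χ Fh ∧ IsSaturation ξ χ ∧
    ∀ i, MvPowerSeries.constantCoeff (ξ i) = 0

theorem isSingularAt_iff {X : Threefold} {g : X → X} {p : X} :
    IsSingularAt g p ↔ GermIn SingForm g p := Iff.rfl

theorem NonsingForm.congr {F F' : C3 → C3} (h : NonsingForm F) (e : F =ᶠ[𝓝 0] F') :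
    NonsingForm F' := by
  obtain ⟨l, H, h1, h2, h3, h4, h5⟩ := h
  refine ⟨l, H, h1, h2, h3, h4, ?_⟩
  filter_upwards [h5, e] with w h5 e
  rw [← e, h5]

theorem SingForm.congr {F F' : C3 → C3} (h : SingForm F) (e : F =ᶠ[𝓝 0] F') : SingForm F' := by
  obtain ⟨Fh, χ, ξ, h1, h2⟩ := h
  refine ⟨Fh, χ, ξ, fun i => (h1 i).congr ?_, h2⟩
  filter_upwards [e] with w e
  rw [e]

theorem NonsingForm.conj {F φ ψ : C3 → C3} (h : NonsingForm F) (hφ : AnalyticAt ℂ φ 0)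
    (hψ : AnalyticAt ℂ ψ 0) (hφ0 : φ 0 = 0) (hψ0 : ψ 0 = 0) (hφψ : ∀ᶠ w in 𝓝 0, φ (ψ w) = w)
    (hψφ : ∀ᶠ w in 𝓝 0, ψ (φ w) = w) : NonsingForm (fun w => φ (F (ψ w))) := by
  obtain ⟨l, H, h1, h2, h3, h4, h5⟩ := h
  obtain ⟨N, hN, hN0, hNe⟩ := conj_form hφ hψ hψ0 hφψ h1 h2 (by rw [h3, zero_smul]) h5
  refine ⟨fun w => l (ψ w), fun w => N w (H (ψ w)), AnalyticAt.fun_comp (by rwa [hψ0]) hψ,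
    analyticAt_clm_apply hN (AnalyticAt.fun_comp (by rwa [hψ0]) hψ), by simp only [hψ0, h3], ?_, hNe⟩
  simp only [hψ0, hN0]
  exact fun h => h4 (injective_fderiv hφ hψ hφ0 hψφ (by rw [h, map_zero]))

theorem NonsingForm.not_singForm {F : C3 → C3} (h : NonsingForm F) : ¬ SingForm F := by
  rintro ⟨Fh, χ, ξ, hF, hχ, hξ, hξ0⟩
  obtain ⟨l, H, h1, h2, h3, h4, h5⟩ := h
  obtain ⟨i₀, hi₀⟩ := Function.ne_iff.1 h4
  obtain ⟨L, hL⟩ := exists_expands h1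
  choose K hK using fun i => exists_expands (analyticAt_c3.1 h2 i)
  have hFe : ∀ i, Fh i = MvPowerSeries.X i + L * K i := by
    intro i
    refine (hF i).unique (((Expands.coord i).add (hL.mul (hK i))).congr ?_)
    filter_upwards [h5] with w hw
    rw [hw]; rfl
  obtain ⟨i, hi⟩ := exists_constantCoeff_ne_zero hχ hξ (l := L) (H := K) (i₀ := i₀)
    (fun i => by rw [hFe, add_sub_cancel_left]) (by rw [(hK i₀).constantCoeff]; exact hi₀)
  exact hi (hξ0 i)

theorem isUnit_or_X_dvd {m : FPS} {i : Fin 3} (h : m ∣ MvPowerSeries.X i) :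
    IsUnit m ∨ MvPowerSeries.X i ∣ m := by
  obtain ⟨n, hn⟩ := h
  by_cases hm : MvPowerSeries.constantCoeff m = 0
  · right
    have hn0 : MvPowerSeries.constantCoeff n ≠ 0 := by
      intro hn0
      have h1 : VanishBelow 1 m := fun d hd => by
        have : d = 0 := by rw [← Finsupp.degree_eq_zero_iff]; omega
        subst this; simpa using hm
      have h2 : VanishBelow 1 n := fun d hd => by
        have : d = 0 := by rw [← Finsupp.degree_eq_zero_iff]; omega
        subst this; simpa using hn0
      have h3 := (h1.mul h2) (Finsupp.single i 1) (by simp)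
      rw [← hn] at h3
      simp at h3
    obtain ⟨u, rfl⟩ := MvPowerSeries.isUnit_iff_constantCoeff.2 (isUnit_iff_ne_zero.2 hn0)
    exact ⟨(↑u⁻¹ : FPS), by rw [hn, mul_assoc, u.mul_inv, mul_one]⟩
  · left
    exact MvPowerSeries.isUnit_iff_constantCoeff.2 (isUnit_iff_ne_zero.2 hm)

theorem singForm_of_coprime {F K : C3 → C3} {l : C3 → ℂ} {N : C3 → C3 →L[ℂ] C3} {i k : Fin 3}
    (hl : AnalyticAt ℂ l 0) (hl0 : l 0 = 0) (hl1 : ¬ ∀ᶠ w in 𝓝 0, l w = 0)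
    (hN : AnalyticAt ℂ N 0) (hNi : Function.Injective (N 0)) (hK : AnalyticAt ℂ K 0)
    (hK0 : K 0 = 0) (hKi : ∀ᶠ w in 𝓝 0, K w i = w i)
    (hk : ¬ ∀ᶠ w in 𝓝 (0 : C3), w i = 0 → K w k = 0)
    (hF : ∀ᶠ w in 𝓝 0, F w = w + l w • N w (K w)) : SingForm F := by
  classical
  obtain ⟨L, hL⟩ := exists_expands hl
  choose Kh hKh using fun i => exists_expands (analyticAt_c3.1 hK i)
  have hNa : ∀ a b, AnalyticAt ℂ (fun w => N w (Pi.single b 1) a) 0 := fun a b =>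
    analyticAt_c3.1 (analyticAt_clm_apply hN analyticAt_const) a
  choose Nh hNh using fun a b => exists_expands (hNa a b)
  have hNK : ∀ w a, N w (K w) a = ∑ b, N w (Pi.single b 1) a * K w b := by
    intro w a
    conv_lhs => rw [pi_eq_sum_univ' (K w), map_sum]
    rw [Finset.sum_apply]
    refine Finset.sum_congr rfl fun b _ => ?_
    rw [map_smul, Pi.smul_apply, smul_eq_mul, mul_comm]
  let Fh : Fin 3 → FPS := fun a => MvPowerSeries.X a + L * (Matrix.of Nh).mulVec Kh a
  have hFh : ∀ a, Expands (fun w => F w a) (Fh a) := by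
    intro a
    refine ((Expands.coord a).add (hL.mul (Expands.sum Finset.univ fun b _ =>
      (hNh a b).mul (hKh b)))).congr ?_
    filter_upwards [hF] with w hw
    rw [hw, Pi.add_apply, Pi.smul_apply, smul_eq_mul, hNK]
  have hKc : ∀ a, MvPowerSeries.constantCoeff (Kh a) = 0 := fun a => by
    rw [(hKh a).constantCoeff, hK0]; rfl
  have hdet : IsUnit (Matrix.of Nh).det := by
    rw [MvPowerSeries.isUnit_iff_constantCoeff, RingHom.map_det]
    have e : (MvPowerSeries.constantCoeff (σ := Fin 3) (R := ℂ)).mapMatrix (Matrix.of Nh) =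
        LinearMap.toMatrix' (N 0 : C3 →ₗ[ℂ] C3) := by
      ext a b
      simp [LinearMap.toMatrix'_apply, (hNh a b).constantCoeff]
    rw [e]
    have : IsUnit (LinearMap.toMatrix' (N 0 : C3 →ₗ[ℂ] C3)) := by
      rw [LinearMap.isUnit_toMatrix'_iff]
      exact (Module.End.isUnit_iff _).2
        ⟨hNi, (LinearMap.injective_iff_surjective (f := (N 0 : C3 →ₗ[ℂ] C3))).1 hNi⟩
    exact (Matrix.isUnit_iff_isUnit_det _).1 this
  have hXi : Kh i = MvPowerSeries.X i := (hKh i).unique ((Expands.coord i).congr (by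
    filter_upwards [hKi] with w hw
    exact hw.symm))
  obtain ⟨χ, ξ, h1, h2, h3⟩ := exists_singular_saturation (F := Fh) (l := L)
    (η := (Matrix.of Nh).mulVec Kh) (fun a => by simp [Fh])
    (fun h => hl1 (by
      subst h
      exact hL.eventuallyEq Expands.zero))
    (by rw [hL.constantCoeff, hl0]) (constantCoeff_mulVec hKc) (by
      intro m hm
      have hm' := dvd_of_dvd_mulVec hdet hm
      rcases isUnit_or_X_dvd (hXi ▸ hm' i) with h | h
      · exact h
      · exact absurd ((hKh k).eq_zero_of_X_dvd (h.trans (hm' k))) hk)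
  exact ⟨Fh, χ, ξ, hFh, h1, h2, h3⟩

/-! ### Local coordinates -/

/-- A local biholomorphism of `ℂ³`. -/
def IsBiholo (e : OpenPartialHomeomorph C3 C3) : Prop :=
  (∀ w ∈ e.source, AnalyticAt ℂ e w) ∧ ∀ w ∈ e.target, AnalyticAt ℂ e.symm w

theorem analyticAt_of_contDiffAt {E F : Type*} [NormedAddCommGroup E] [NormedSpace ℂ E]
    [NormedAddCommGroup F] [NormedSpace ℂ F] [CompleteSpace F] {f : E → F} {c : E}
    (h : ContDiffAt ℂ ω f c) : AnalyticAt ℂ f c := by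
  rw [← contDiffWithinAt_univ] at h
  simpa using contDiffWithinAt_omega_iff_analyticWithinAt.1 h

theorem IsBiholo.mem {e : OpenPartialHomeomorph C3 C3} (h : IsBiholo e) :
    e ∈ contDiffGroupoid ω 𝓘(ℂ, C3) := by
  rw [contDiffGroupoid, mem_groupoid_of_pregroupoid, contDiffPregroupoid]
  simp only [modelWithCornersSelf_coe, modelWithCornersSelf_coe_symm, Function.comp_def, id,
    Set.preimage_id, Set.range_id, Set.inter_univ]
  exact ⟨fun w hw => (h.1 w hw).contDiffAt.contDiffWithinAt,
    fun w hw => (h.2 w hw).contDiffAt.contDiffWithinAt⟩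

theorem isBiholo_of_mem {e : OpenPartialHomeomorph C3 C3}
    (h : e ∈ contDiffGroupoid ω 𝓘(ℂ, C3)) : IsBiholo e := by
  rw [contDiffGroupoid, mem_groupoid_of_pregroupoid, contDiffPregroupoid] at h
  simp only [modelWithCornersSelf_coe, modelWithCornersSelf_coe_symm, Function.comp_def, id,
    Set.preimage_id, Set.range_id, Set.inter_univ] at h
  exact ⟨fun w hw => analyticAt_of_contDiffAt ((h.1 w hw).contDiffAt (e.open_source.mem_nhds hw)),
    fun w hw => analyticAt_of_contDiffAt ((h.2 w hw).contDiffAt (e.open_target.mem_nhds hw))⟩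

theorem isBiholo_transition {X : Threefold} {u v : OpenPartialHomeomorph X C3} (hu : u ∈ Chart X)
    (hv : v ∈ Chart X) : IsBiholo (u.symm.trans v) :=
  isBiholo_of_mem (StructureGroupoid.compatible_of_mem_maximalAtlas hu hv)

theorem analyticAt_transition {X : Threefold} {u v : OpenPartialHomeomorph X C3}
    (hu : u ∈ Chart X) (hv : v ∈ Chart X) {p : X} (hpu : p ∈ u.source) (hpv : p ∈ v.source) :
    AnalyticAt ℂ (fun w => v (u.symm w)) (u p) :=
  (isBiholo_transition hu hv).1 (u p) (by
    rw [OpenPartialHomeomorph.trans_source]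
    exact ⟨u.map_source hpu, by simpa [u.left_inv hpu] using hpv⟩)

theorem trans_mem_chart {X : Threefold} {u : OpenPartialHomeomorph X C3} (hu : u ∈ Chart X)
    {e : OpenPartialHomeomorph C3 C3} (he : IsBiholo e) : u.trans e ∈ Chart X := by
  intro v hv
  constructor
  · have := (contDiffGroupoid ω 𝓘(ℂ, C3)).trans
      ((contDiffGroupoid ω 𝓘(ℂ, C3)).symm he.mem) (hu v hv).1
    rw [OpenPartialHomeomorph.trans_symm_eq_symm_trans_symm, OpenPartialHomeomorph.trans_assoc]
    exact this
  · have := (contDiffGroupoid ω 𝓘(ℂ, C3)).trans (hu v hv).2 he.mem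
    rwa [OpenPartialHomeomorph.trans_assoc] at this

theorem restrOpen_mem_chart {X : Threefold} {u : OpenPartialHomeomorph X C3} (hu : u ∈ Chart X)
    {s : Set X} (hs : IsOpen s) : u.restrOpen s hs ∈ Chart X := by
  have := restr_mem_maximalAtlas (contDiffGroupoid ω 𝓘(ℂ, C3)) hu hs
  refine StructureGroupoid.mem_maximalAtlas_of_eqOnSource ?_ this
  refine ⟨?_, fun _ _ => rfl⟩
  simp [hs.interior_eq]

/-- The translation `w ↦ w - b`. -/
def translate (b : C3) : OpenPartialHomeomorph C3 C3 :=
  (Homeomorph.subRight b).toOpenPartialHomeomorph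

theorem translate_apply (b w : C3) : translate b w = w - b := rfl

theorem isBiholo_translate (b : C3) : IsBiholo (translate b) :=
  ⟨fun w _ => show AnalyticAt ℂ (fun w => w - b) w from analyticAt_id.sub analyticAt_const,
    fun w _ => show AnalyticAt ℂ (fun w => w + b) w from analyticAt_id.add analyticAt_const⟩

theorem isCoordAt_translate {X : Threefold} {u : OpenPartialHomeomorph X C3} (hu : u ∈ Chart X)
    {p : X} (hp : p ∈ u.source) : IsCoordAt (u.trans (translate (u p))) p :=
  ⟨trans_mem_chart hu (isBiholo_translate _), by simpa [translate] using hp, by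
    simp [translate_apply]⟩

/-- A linear automorphism as a local biholomorphism. -/
def linearChange (T : C3 ≃L[ℂ] C3) : OpenPartialHomeomorph C3 C3 :=
  T.toHomeomorph.toOpenPartialHomeomorph

theorem isBiholo_linearChange (T : C3 ≃L[ℂ] C3) : IsBiholo (linearChange T) :=
  ⟨fun w _ => (T : C3 →L[ℂ] C3).analyticAt w, fun w _ => (T.symm : C3 →L[ℂ] C3).analyticAt w⟩

theorem exists_isBiholo {φ : C3 → C3} {c : C3} (hφ : AnalyticAt ℂ φ c)
    (hi : Function.Injective (fderiv ℂ φ c)) :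
    ∃ e : OpenPartialHomeomorph C3 C3, IsBiholo e ∧ c ∈ e.source ∧ ∀ w, e w = φ w := by
  let T : C3 ≃L[ℂ] C3 :=
    (LinearEquiv.ofInjectiveEndo (fderiv ℂ φ c : C3 →ₗ[ℂ] C3) hi).toContinuousLinearEquiv
  have hT : (T : C3 →L[ℂ] C3) = fderiv ℂ φ c := by ext1 v; rfl
  have hd : HasFDerivAt φ (T : C3 →L[ℂ] C3) c := by
    rw [hT]; exact hφ.differentiableAt.hasFDerivAt
  have hc : ContDiffAt ℂ ω φ c := hφ.contDiffAt
  let e₀ := hc.toOpenPartialHomeomorph φ hd (by simp)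
  have hce : c ∈ e₀.source := hc.mem_toOpenPartialHomeomorph_source hd (by simp)
  have hsymm : AnalyticAt ℂ e₀.symm (e₀ c) := analyticAt_of_contDiffAt (hc.to_localInverse hd (by simp))
  have hopen : IsOpen ({w | AnalyticAt ℂ φ w} ∩ (e₀.source ∩ e₀ ⁻¹' {w | AnalyticAt ℂ e₀.symm w})) :=
    (isOpen_analyticAt ℂ φ).inter (e₀.isOpen_inter_preimage (isOpen_analyticAt ℂ e₀.symm))
  refine ⟨e₀.restrOpen _ hopen, ⟨fun w hw => hw.2.1, fun w hw => ?_⟩, ⟨hce, hφ, hce, hsymm⟩,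
    fun w => rfl⟩
  have h1 : e₀.symm w ∈ {w | AnalyticAt ℂ φ w} ∩
    (e₀.source ∩ e₀ ⁻¹' {w | AnalyticAt ℂ e₀.symm w}) := hw.2
  have h2 := h1.2.2
  simp only [Set.mem_preimage, Set.mem_ofPred_eq] at h2
  rw [e₀.right_inv hw.1] at h2
  exact h2

/-! ### Germs of self-maps -/

/-- A property of maps depending only on the germ at the origin. -/
def IsGermProp (N : (C3 → C3) → Prop) : Prop := ∀ F F' : C3 → C3, F =ᶠ[𝓝 0] F' → N F → N F'

theorem isGermProp_singForm : IsGermProp SingForm := fun _ _ e h => h.congr e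

theorem isGermProp_nonsingForm : IsGermProp NonsingForm := fun _ _ e h => h.congr e

theorem tendsto_symm {X : Type*} [TopologicalSpace X] {u : OpenPartialHomeomorph X C3} {p : X}
    (hp : p ∈ u.source) : Filter.Tendsto u.symm (𝓝 (u p)) (𝓝 p) := by
  have := (u.continuousAt_symm (u.map_source hp)).tendsto
  rwa [u.left_inv hp] at this

theorem IsCoordAt.tendsto_symm {X : Threefold} {u : OpenPartialHomeomorph X C3} {p : X}
    (hu : IsCoordAt u p) : Filter.Tendsto u.symm (𝓝 0) (𝓝 p) := by
  have := TangentToId.tendsto_symm hu.2.1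
  rwa [hu.2.2] at this

theorem IsCoordAt.tendsto {X : Threefold} {u : OpenPartialHomeomorph X C3} {p : X}
    (hu : IsCoordAt u p) : Filter.Tendsto u (𝓝 p) (𝓝 0) := by
  have := (u.continuousAt hu.2.1).tendsto
  rwa [hu.2.2] at this

theorem IsCoordAt.symm_zero {X : Threefold} {u : OpenPartialHomeomorph X C3} {p : X}
    (hu : IsCoordAt u p) : u.symm 0 = p := by rw [← hu.2.2, u.left_inv hu.2.1]

theorem GermIn.mono {N N' : (C3 → C3) → Prop} (hN : ∀ F, N F → N' F) {X : Threefold} {g : X → X}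
    {p : X} (h : GermIn N g p) : GermIn N' g p := by
  obtain ⟨h1, u, hu, h2⟩ := h
  exact ⟨h1, u, hu, hN _ h2⟩

theorem germIn_of_chart {N : (C3 → C3) → Prop} {X : Threefold} {g : X → X} {p : X}
    (hg : g p = p) {u : OpenPartialHomeomorph X C3} (hu : u ∈ Chart X) (hp : p ∈ u.source)
    (h : N fun w => u (g (u.symm (w + u p))) - u p) : GermIn N g p :=
  ⟨hg, _, isCoordAt_translate hu hp, h⟩

theorem IsCoordAt.trans {X : Threefold} {u : OpenPartialHomeomorph X C3} {p : X}
    (hu : IsCoordAt u p) {e : OpenPartialHomeomorph C3 C3} (he : IsBiholo e) (h0 : 0 ∈ e.source)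
    (he0 : e 0 = 0) : IsCoordAt (u.trans e) p :=
  ⟨trans_mem_chart hu.1 he, by
    rw [OpenPartialHomeomorph.trans_source]
    exact ⟨hu.2.1, by rw [Set.mem_preimage, hu.2.2]; exact h0⟩, by
    rw [OpenPartialHomeomorph.coe_trans, Function.comp, hu.2.2, he0]⟩

theorem germIn_linearChange {N N' : (C3 → C3) → Prop} {X : Threefold} {g : X → X} {p : X}
    (h : GermIn N g p) (hT : ∀ F, N F → ∃ T : C3 ≃L[ℂ] C3, N' fun w => T (F (T.symm w))) :
    GermIn N' g p := by
  obtain ⟨h1, u, hu, h2⟩ := h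
  obtain ⟨T, hT⟩ := hT _ h2
  exact ⟨h1, u.trans (linearChange T), hu.trans (isBiholo_linearChange T) (Set.mem_univ _)
    (map_zero T), hT⟩

theorem GermIn.change_coord {N : (C3 → C3) → Prop} (hN : IsGermProp N)
    (hconj : ∀ (F φ ψ : C3 → C3), N F → AnalyticAt ℂ φ 0 → AnalyticAt ℂ ψ 0 → φ 0 = 0 → ψ 0 = 0 →
      (∀ᶠ w in 𝓝 0, φ (ψ w) = w) → (∀ᶠ w in 𝓝 0, ψ (φ w) = w) → N fun w => φ (F (ψ w)))
    {X : Threefold} {g : X → X} {p : X} (h : GermIn N g p) (hg : ContinuousAt g p)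
    {v : OpenPartialHomeomorph X C3} (hv : IsCoordAt v p) : N fun w => v (g (v.symm w)) := by
  obtain ⟨h1, u, hu, h2⟩ := h
  have hsrc : ∀ᶠ x in 𝓝 p, x ∈ u.source := u.open_source.mem_nhds hu.2.1
  have hsrc' : ∀ᶠ x in 𝓝 p, x ∈ v.source := v.open_source.mem_nhds hv.2.1
  have hgt : Filter.Tendsto g (𝓝 p) (𝓝 p) := by
    have := hg.tendsto; rwa [h1] at this
  have hφ : AnalyticAt ℂ (fun w => v (u.symm w)) 0 := by
    have := analyticAt_transition hu.1 hv.1 hu.2.1 hv.2.1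
    rwa [hu.2.2] at this
  have hψ : AnalyticAt ℂ (fun w => u (v.symm w)) 0 := by
    have := analyticAt_transition hv.1 hu.1 hv.2.1 hu.2.1
    rwa [hv.2.2] at this
  refine hN _ _ ?_ (hconj _ (fun w => v (u.symm w)) (fun w => u (v.symm w)) h2 hφ hψ
    (by simp only [hu.symm_zero, hv.2.2]) (by simp only [hv.symm_zero, hu.2.2]) ?_ ?_)
  · filter_upwards [hv.tendsto_symm.eventually hsrc,
      hv.tendsto_symm.eventually (hgt.eventually hsrc)] with w h3 h4
    rw [u.left_inv h3, u.left_inv h4]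
  · filter_upwards [hv.tendsto_symm.eventually hsrc, v.open_target.mem_nhds
      (by rw [← hv.2.2]; exact v.map_source hv.2.1)] with w h3 h4
    rw [u.left_inv h3, v.right_inv h4]
  · filter_upwards [hu.tendsto_symm.eventually hsrc', u.open_target.mem_nhds
      (by rw [← hu.2.2]; exact u.map_source hu.2.1)] with w h3 h4
    rw [v.left_inv h3, u.right_inv h4]

theorem GermIn.not_isSingularAt {X : Threefold} {g : X → X} {p : X} (h : GermIn NonsingForm g p)
    (hg : ContinuousAt g p) : ¬ IsSingularAt g p := by
  rintro ⟨h1, v, hv, hs⟩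
  exact (h.change_coord isGermProp_nonsingForm
    (fun F φ ψ hF hφ hψ hφ0 hψ0 h1 h2 => hF.conj hφ hψ hφ0 hψ0 h1 h2) hg hv).not_singForm hs

/-- In the coordinates `u` the germ of `g` at `p` is `w ↦ w + l(w) G(w)`. -/
def HasGermAt {X : Threefold} (g : X → X) (p : X) (u : OpenPartialHomeomorph X C3) (l : C3 → ℂ)
    (G : C3 → C3) : Prop :=
  g p = p ∧ IsCoordAt u p ∧ AnalyticAt ℂ l 0 ∧ AnalyticAt ℂ G 0 ∧ l 0 = 0 ∧
    ∀ᶠ w in 𝓝 0, u (g (u.symm w)) = w + l w • G w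

theorem HasGermAt.eventually_nonsing {X : Threefold} {g : X → X} {p : X}
    {u : OpenPartialHomeomorph X C3} {l : C3 → ℂ} {G : C3 → C3} (h : HasGermAt g p u l G) :
    ∀ᶠ q in 𝓝 p, g q = q → G (u q) ≠ 0 → GermIn NonsingForm g q := by
  obtain ⟨h1, hu, hl, hG, hl0, hF⟩ := h
  filter_upwards [hu.tendsto.eventually hF.eventually_nhds, hu.tendsto.eventually
    hl.eventually_analyticAt, hu.tendsto.eventually hG.eventually_analyticAt,
    u.open_source.mem_nhds hu.2.1] with q h2 h3 h4 h5 hgq hGq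
  refine germIn_of_chart hgq hu.1 h5 ?_
  have hadd : AnalyticAt ℂ (fun w : C3 => w + u q) 0 := analyticAt_id.add analyticAt_const
  have hl' : l (u q) = 0 := by
    have := h2.self_of_nhds
    rw [u.left_inv h5, hgq] at this
    have h6 : l (u q) • G (u q) = 0 := by simpa using this
    exact (smul_eq_zero.1 h6).resolve_right hGq
  refine ⟨fun w => l (w + u q), fun w => G (w + u q), AnalyticAt.fun_comp (by simpa using h3) hadd,
    AnalyticAt.fun_comp (by simpa using h4) hadd, by simpa using hl', by simpa using hGq, ?_⟩
  have ht : Filter.Tendsto (fun w : C3 => w + u q) (𝓝 0) (𝓝 (u q)) := by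
    simpa using hadd.continuousAt.tendsto
  filter_upwards [ht.eventually h2] with w hw
  rw [hw]; abel

theorem HasGermAt.eventually_zero {X : Threefold} {g : X → X} {p : X}
    {u : OpenPartialHomeomorph X C3} {l : C3 → ℂ} {G : C3 → C3} (h : HasGermAt g p u l G)
    (hc : ∀ᶠ q in 𝓝 p, ContinuousAt g q) :
    ∀ᶠ q in 𝓝 p, IsSingularAt g q → G (u q) = 0 := by
  filter_upwards [h.eventually_nonsing, hc] with q h1 h2 h3
  by_contra h4
  exact (h1 h3.1 h4).not_isSingularAt h2 h3

theorem GermIn.hasGermAt {X : Threefold} {g : X → X} {p : X} (h : GermIn NonsingForm g p) :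
    ∃ u l G, HasGermAt g p u l G ∧ G 0 ≠ 0 := by
  obtain ⟨h1, u, hu, l, H, h2, h3, h4, h5, h6⟩ := h
  exact ⟨u, l, H, ⟨h1, hu, h2, h3, h4, h6⟩, h5⟩

theorem GermIn.eventually_nonsing {X : Threefold} {g : X → X} {p : X}
    (h : GermIn NonsingForm g p) : ∀ᶠ q in 𝓝 p, g q = q → GermIn NonsingForm g q := by
  obtain ⟨u, l, G, hg, h0⟩ := h.hasGermAt
  have hu := hg.2.1
  have h1 : ∀ᶠ w in 𝓝 (0 : C3), G w ≠ 0 := hg.2.2.2.1.continuousAt.eventually_ne h0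
  filter_upwards [hg.eventually_nonsing, hu.tendsto.eventually h1] with q h2 h3 h4
  exact h2 h4 h3

theorem nonsing_or_eventually_singular {X : Threefold} {g : X → X} {p : X}
    {u : OpenPartialHomeomorph X C3} {l : C3 → ℂ} {G : C3 → C3} (h : HasGermAt g p u l G)
    (hl1 : ¬ ∀ᶠ w in 𝓝 0, l w = 0) (hG0 : G 0 = 0) {i : Fin 3}
    (hd : fderiv ℂ (fun w => G w i) 0 (Pi.single i 1) ≠ 0) :
    GermIn NonsingForm g p ∨
      ∀ᶠ q in 𝓝 p, g q = q → l (u q) = 0 → G (u q) = 0 → IsSingularAt g q := by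
  obtain ⟨h1, hu, hl, hG, hl0, hF⟩ := h
  let φ : C3 → C3 := fun w => Function.update w i (G w i)
  have hφk : ∀ k, k ≠ i → ∀ w, φ w k = w k := fun k hk w => by simp [φ, hk]
  have hφi : ∀ w, φ w i = G w i := fun w => by simp [φ]
  have hGi := analyticAt_c3.1 hG i
  have hφ : AnalyticAt ℂ φ 0 := by
    rw [analyticAt_c3]
    intro k
    by_cases hk : k = i
    · subst hk; simpa only [hφi] using hGi
    · simpa only [hφk k hk] using analyticAt_coord k 0
  have hφ0 : φ 0 = 0 := by
    funext k
    by_cases hk : k = i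
    · subst hk; rw [hφi, hG0]
    · rw [hφk k hk]
  have hderiv : ∀ k v, fderiv ℂ φ 0 v k = fderiv ℂ (fun w => φ w k) 0 v := fun k v => by
    rw [fderiv_apply hφ.differentiableAt]; rfl
  have hinj : Function.Injective (fderiv ℂ φ 0) := by
    rw [injective_iff_map_eq_zero]
    intro v hv
    have hvk : ∀ k, k ≠ i → v k = 0 := by
      intro k hk
      have h2 := hderiv k v
      rw [hv] at h2
      simp only [hφk k hk] at h2
      have h3 : fderiv ℂ (fun w : C3 => w k) 0 = ContinuousLinearMap.proj k :=
        (ContinuousLinearMap.proj (R := ℂ) (φ := fun _ : Fin 3 => ℂ) k).fderiv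
      rw [h3] at h2
      exact h2.symm
    have hve : v = v i • Pi.single i 1 := by
      funext k
      by_cases hk : k = i
      · subst hk; simp
      · simp [hvk k hk, hk]
    have h2 := hderiv i v
    rw [hv] at h2
    simp only [hφi] at h2
    rw [hve, map_smul, smul_eq_mul] at h2
    have h3 : v i = 0 := by
      rcases mul_eq_zero.1 h2.symm with h | h
      · exact h
      · exact absurd h hd
    rw [hve, h3, zero_smul]
  obtain ⟨e, he, h0e, heφ⟩ := exists_isBiholo hφ hinj
  have he0 : e 0 = 0 := by rw [heφ, hφ0]
  have hψ : AnalyticAt ℂ e.symm 0 := he.2 0 (by rw [← he0]; exact e.map_source h0e)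
  have hψ0 : e.symm 0 = 0 := by
    conv_lhs => rw [← he0]
    exact e.left_inv h0e
  have htgt : ∀ᶠ w in 𝓝 (0 : C3), w ∈ e.target :=
    e.open_target.mem_nhds (by rw [← he0]; exact e.map_source h0e)
  have hφψ : ∀ᶠ w in 𝓝 0, e (e.symm w) = w := htgt.mono fun w hw => e.right_inv hw
  have hea : AnalyticAt ℂ e 0 := he.1 0 h0e
  obtain ⟨N, hN, hN0, hNe⟩ := conj_form hea hψ hψ0 hφψ hl hG (by rw [hl0, zero_smul]) hF
  have hNi : Function.Injective (N 0) := by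
    rw [hN0, show (e : C3 → C3) = φ from funext heφ]; exact hinj
  set l₂ : C3 → ℂ := fun w => l (e.symm w) with hl₂
  set K : C3 → C3 := fun w => G (e.symm w) with hKdef
  have hl₂a : AnalyticAt ℂ l₂ 0 := AnalyticAt.fun_comp (by rwa [hψ0]) hψ
  have hKa : AnalyticAt ℂ K 0 := AnalyticAt.fun_comp (by rwa [hψ0]) hψ
  have hKi : ∀ᶠ w in 𝓝 0, K w i = w i := hφψ.mono fun w hw => by
    rw [hKdef]; simp only; rw [← hφi, ← heφ, hw]
  have hu2 : IsCoordAt (u.trans e) p := hu.trans he h0e he0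
  have hnotl : ¬ ∀ᶠ w in 𝓝 0, l₂ w = 0 := by
    intro hcon
    apply hl1
    have ht : Filter.Tendsto e (𝓝 0) (𝓝 0) := by
      have := hea.continuousAt.tendsto; rwa [he0] at this
    filter_upwards [ht.eventually hcon, e.open_source.mem_nhds h0e] with w h2 h3
    simpa only [hl₂, e.left_inv h3] using h2
  have hinjN : ∀ᶠ w in 𝓝 (0 : C3), Function.Injective (N w) := by
    let T : C3 ≃L[ℂ] C3 :=
      (LinearEquiv.ofInjectiveEndo (N 0 : C3 →ₗ[ℂ] C3) hNi).toContinuousLinearEquiv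
    have hT : (T : C3 →L[ℂ] C3) = N 0 := by ext1 v; rfl
    have h2 := ContinuousLinearEquiv.nhds T
    rw [hT] at h2
    filter_upwards [hN.continuousAt.eventually h2] with w hw
    obtain ⟨S, hS⟩ := hw
    rw [← hS]; exact S.injective
  by_cases hbad : ∀ k, ∀ᶠ w in 𝓝 (0 : C3), w i = 0 → K w k = 0
  · left
    choose m hm hme using fun k => exists_eq_coord_mul (analyticAt_c3.1 hKa k) i (hbad k)
    refine ⟨h1, _, hu2, ?_⟩
    let m' : C3 → C3 := fun w k => if k = i then 1 else m k w
    have hm' : AnalyticAt ℂ m' 0 := by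
      rw [analyticAt_c3]
      intro k
      by_cases hk : k = i
      · simpa [m', hk] using analyticAt_const
      · simpa [m', hk] using hm k
    refine ⟨fun w => l₂ w * w i, fun w => N w (m' w), hl₂a.mul (analyticAt_coord i 0),
      analyticAt_clm_apply hN hm', by simp, ?_, ?_⟩
    · intro h
      have h3 : m' 0 = 0 := hNi (by simpa using h)
      have := congrFun h3 i
      simp [m'] at this
    · have hall : ∀ᶠ w in 𝓝 0, ∀ k, K w k = w i * m k w := Filter.eventually_all.2 fun k => hme k
      filter_upwards [hNe, hall, hKi] with w h2 h3 h4
      refine h2.trans ?_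
      have : G (e.symm w) = w i • m' w := by
        funext k
        by_cases hk : k = i
        · subst hk; simpa [m'] using h4
        · simpa [m', hk] using h3 k
      rw [this, map_smul, smul_smul]
  · right
    push Not at hbad
    obtain ⟨k, hk⟩ := hbad
    obtain ⟨r, hr, hball⟩ := Metric.eventually_nhds_iff_ball.1 ((((hNe.and hKi).and
      (hl₂a.eventually_analyticAt.and hKa.eventually_analyticAt)).and
      (hN.eventually_analyticAt.and hinjN)).and htgt)
    have hpre : IsPreconnected (Metric.ball (0 : C3) r) := (convex_ball 0 r).isPreconnected
    have h0r : (0 : C3) ∈ Metric.ball (0 : C3) r := Metric.mem_ball_self hr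
    filter_upwards [hu2.tendsto.eventually (Metric.ball_mem_nhds (0 : C3) hr),
      (u.trans e).open_source.mem_nhds hu2.2.1] with q hq hqs hgq hlq hGq
    set b := (u.trans e) q with hb
    have hqs' : q ∈ u.source ∧ u q ∈ e.source := by
      simpa [OpenPartialHomeomorph.trans_source] using hqs
    have hbq : e.symm b = u q := by
      rw [hb]; exact e.left_inv hqs'.2
    have hKb : K b = 0 := by rw [hKdef]; simp only [hbq, hGq]
    have hlb : l₂ b = 0 := by rw [hl₂]; simp only [hbq, hlq]
    have hbi : b i = 0 := by
      have := (hball b hq).1.1.1.2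
      rw [hKb] at this; exact this.symm
    have hadd : AnalyticAt ℂ (fun w : C3 => w + b) 0 := analyticAt_id.add analyticAt_const
    have ht : Filter.Tendsto (fun w : C3 => w + b) (𝓝 0) (𝓝 b) := by
      simpa using hadd.continuousAt.tendsto
    have hb0 : (0 : C3) + b = b := zero_add b
    have hbn : ∀ᶠ w in 𝓝 (0 : C3), w + b ∈ Metric.ball (0 : C3) r :=
      ht.eventually (Metric.isOpen_ball.mem_nhds hq)
    refine isSingularAt_iff.2 (germIn_of_chart hgq hu2.1 hqs ?_)
    refine singForm_of_coprime (l := fun w => l₂ (w + b)) (N := fun w => N (w + b))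
      (K := fun w => K (w + b)) (i := i) (k := k) ?_ ?_ ?_ ?_ ?_ ?_ ?_ ?_ ?_ ?_
    · exact AnalyticAt.fun_comp (by rw [hb0]; exact (hball b hq).1.1.2.1) hadd
    · rw [hb0, hlb]
    · intro hcon
      apply hnotl
      have h2 : l₂ =ᶠ[𝓝 b] 0 := by
        have ht' : Filter.Tendsto (fun w : C3 => w - b) (𝓝 b) (𝓝 0) := by
          have : ContinuousAt (fun w : C3 => w - b) b := by fun_prop
          simpa using this.tendsto
        filter_upwards [ht'.eventually hcon] with w hw
        simpa using hw
      have h3 : AnalyticOnNhd ℂ l₂ (Metric.ball 0 r) := fun w hw => (hball w hw).1.1.2.1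
      have h4 := h3.eqOn_zero_of_preconnected_of_eventuallyEq_zero hpre hq h2
      filter_upwards [Metric.ball_mem_nhds (0 : C3) hr] with w hw
      exact h4 hw
    · exact AnalyticAt.fun_comp (by rw [hb0]; exact (hball b hq).1.2.1) hadd
    · rw [hb0]; exact (hball b hq).1.2.2
    · exact AnalyticAt.fun_comp (by rw [hb0]; exact (hball b hq).1.1.2.2) hadd
    · rw [hb0, hKb]
    · filter_upwards [hbn] with w hw
      rw [(hball _ hw).1.1.1.2, Pi.add_apply, hbi, add_zero]
    · intro hcon
      apply hk
      have hmem : ∀ w ∈ Metric.ball (0 : C3) r, Function.update w i 0 ∈ Metric.ball (0 : C3) r := by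
        intro w hw
        rw [mem_ball_zero_iff] at hw ⊢
        refine lt_of_le_of_lt ((pi_norm_le_iff_of_nonneg (norm_nonneg w)).2 fun k => ?_) hw
        by_cases hk : k = i
        · subst hk; simp
        · simpa [hk] using norm_le_pi_norm w k
      have hua : ∀ w, AnalyticAt ℂ (fun w : C3 => Function.update w i 0) w := by
        intro w
        rw [analyticAt_c3]
        intro k
        by_cases hk : k = i
        · subst hk; simpa using analyticAt_const
        · simpa [hk] using analyticAt_coord k w
      have h3 : AnalyticOnNhd ℂ (fun w => K (Function.update w i 0) k) (Metric.ball 0 r) := by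
        intro w hw
        exact AnalyticAt.fun_comp (g := fun w => K w k)
          (analyticAt_c3.1 (hball _ (hmem w hw)).1.1.2.2 k) (hua w)
      have hub : Function.update b i 0 = b := by
        conv_lhs => rw [← hbi]
        exact Function.update_eq_self i b
      have h2 : (fun w => K (Function.update w i 0) k) =ᶠ[𝓝 b] 0 := by
        have ht' : Filter.Tendsto (fun w : C3 => Function.update w i 0 - b) (𝓝 b) (𝓝 0) := by
          have : ContinuousAt (fun w : C3 => Function.update w i 0 - b) b :=
            (hua b).continuousAt.sub continuousAt_const
          simpa [hub] using this.tendsto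
        filter_upwards [ht'.eventually hcon] with w hw
        have := hw (by simp [hbi])
        simpa using this
      have h4 := h3.eqOn_zero_of_preconnected_of_eventuallyEq_zero hpre hq h2
      filter_upwards [Metric.ball_mem_nhds (0 : C3) hr] with w hw hwi'
      obtain ⟨hwi, hne⟩ := hwi'
      apply hne
      have h5 := h4 hw
      have : Function.update w i 0 = w := by
        conv_lhs => rw [← hwi]
        exact Function.update_eq_self i w
      simpa [this] using h5
    · filter_upwards [hbn] with w hw
      have := (hball _ hw).1.1.1.1
      change (e (u (g (u.symm (e.symm (w + b)))))) - b = _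
      rw [this]
      abel

/-! ### Blow-ups away from the centre -/

theorem stdBlowUp_same (I : Finset (Fin 3)) (j : Fin 3) (w : C3) : stdBlowUp I j w j = w j := by
  simp [stdBlowUp]

theorem analyticAt_stdBlowUp (I : Finset (Fin 3)) (j : Fin 3) (c : C3) :
    AnalyticAt ℂ (stdBlowUp I j) c := by
  rw [analyticAt_c3]
  intro k
  by_cases h : k ∈ I ∧ k ≠ j
  · simpa [stdBlowUp, h] using (analyticAt_coord k c).fun_mul (analyticAt_coord j c)
  · simpa only [stdBlowUp, h, if_false] using analyticAt_coord k c

theorem continuous_stdBlowUp (I : Finset (Fin 3)) (j : Fin 3) : Continuous (stdBlowUp I j) :=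
  continuous_iff_continuousAt.2 fun c => (analyticAt_stdBlowUp I j c).continuousAt

/-- The inverse of the standard blow-up map off the exceptional divisor. -/
def stdBlowUpInv (I : Finset (Fin 3)) (j : Fin 3) (w : C3) : C3 :=
  fun i => if i ∈ I ∧ i ≠ j then w i / w j else w i

theorem analyticAt_stdBlowUpInv (I : Finset (Fin 3)) (j : Fin 3) {c : C3} (hc : c j ≠ 0) :
    AnalyticAt ℂ (stdBlowUpInv I j) c := by
  rw [analyticAt_c3]
  intro k
  by_cases h : k ∈ I ∧ k ≠ j
  · simpa [stdBlowUpInv, h] using (analyticAt_coord k c).fun_div (analyticAt_coord j c) hc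
  · simpa only [stdBlowUpInv, h, if_false] using analyticAt_coord k c

theorem stdBlowUpInv_stdBlowUp (I : Finset (Fin 3)) (j : Fin 3) {w : C3} (hw : w j ≠ 0) :
    stdBlowUpInv I j (stdBlowUp I j w) = w := by
  funext i
  by_cases h : i ∈ I ∧ i ≠ j
  · simp [stdBlowUpInv, stdBlowUp, h, hw]
  · simp only [stdBlowUpInv, stdBlowUp, h, if_false]

theorem stdBlowUp_stdBlowUpInv (I : Finset (Fin 3)) (j : Fin 3) {w : C3} (hw : w j ≠ 0) :
    stdBlowUp I j (stdBlowUpInv I j w) = w := by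
  funext i
  by_cases h : i ∈ I ∧ i ≠ j
  · simp [stdBlowUpInv, stdBlowUp, h, hw]
  · simp only [stdBlowUpInv, stdBlowUp, h, if_false]

/-- The standard blow-up map off the exceptional divisor, as a local biholomorphism. -/
def stdBlowUpIso (I : Finset (Fin 3)) (j : Fin 3) : OpenPartialHomeomorph C3 C3 where
  toFun := stdBlowUp I j
  invFun := stdBlowUpInv I j
  source := {w | w j ≠ 0}
  target := {w | w j ≠ 0}
  map_source' w hw := by simpa [stdBlowUp] using hw
  map_target' w hw := by simpa [stdBlowUpInv] using hw
  left_inv' w hw := stdBlowUpInv_stdBlowUp I j hw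
  right_inv' w hw := stdBlowUp_stdBlowUpInv I j hw
  open_source := isOpen_ne_fun (continuous_apply j) continuous_const
  open_target := isOpen_ne_fun (continuous_apply j) continuous_const
  continuousOn_toFun := (continuous_stdBlowUp I j).continuousOn
  continuousOn_invFun w hw := (analyticAt_stdBlowUpInv I j hw).continuousAt.continuousWithinAt

theorem isBiholo_stdBlowUpIso (I : Finset (Fin 3)) (j : Fin 3) : IsBiholo (stdBlowUpIso I j) :=
  ⟨fun w _ => analyticAt_stdBlowUp I j w, fun _ hw => analyticAt_stdBlowUpInv I j hw⟩

theorem IsBlowUp.injective_off {X' X : Threefold} {k : ℕ} {Z : Set X} {β : X' → X}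
    (hβ : IsBlowUp k Z β) {x y : X'} (hx : β x ∉ Z) (h : β x = β y) : x = y :=
  hβ.bijOn.injOn hx (show β y ∉ Z from h ▸ hx) h

/-- Off the centre, charts of the base pull back to charts of the blow-up. -/
theorem IsBlowUp.exists_chart {X' X : Threefold} {k : ℕ} {Z : Set X} {β : X' → X}
    (hβ : IsBlowUp k Z β) (hk : k ≤ 3) {q : X'} (hq : β q ∉ Z)
    {v : OpenPartialHomeomorph X C3} (hv : v ∈ Chart X) (hqv : β q ∈ v.source) :
    ∃ v' ∈ Chart X', q ∈ v'.source ∧ ∀ x ∈ v'.source, β x ∈ v.source ∧ v' x = v (β x) := by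
  obtain ⟨I, -, hI⟩ := Finset.exists_subset_card_eq
    (show k ≤ (Finset.univ : Finset (Fin 3)).card by simpa using hk)
  obtain ⟨j, hj⟩ : I.Nonempty := by
    rw [← Finset.card_pos, hI]; have := hβ.two_le; omega
  set b : C3 := v (β q) - 1 with hb
  have hu1 : v.trans (translate b) ∈ Chart X := trans_mem_chart hv (isBiholo_translate b)
  have hu1s : (v.trans (translate b)).source = v.source := by
    simp [translate]
  set s : Set X := Zᶜ ∩ (v.source ∩ v ⁻¹' {w | ∀ i, (w - b) i ≠ 0}) with hs
  have hso : IsOpen s := by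
    refine hβ.isClosed.isOpen_compl.inter (v.isOpen_inter_preimage ?_)
    simp only [Set.ofPred_forall]
    refine isOpen_iInter_of_finite fun i => isOpen_ne_fun ?_ continuous_const
    fun_prop
  set u := (v.trans (translate b)).restrOpen s hso with hu
  have hus : u.source = v.source ∩ s := by
    rw [hu, OpenPartialHomeomorph.restrOpen_source, hu1s]
  have huv : ∀ x, u x = v x - b := fun x => rfl
  have huc : u ∈ Chart X := restrOpen_mem_chart hu1 hso
  have hqu : β q ∈ u.source := by
    rw [hus]
    refine ⟨hqv, hq, hqv, fun i => ?_⟩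
    simp [hb]
  have hadapt : IsAdaptedChart Z I u := by
    refine ⟨huc, fun x hx => ?_⟩
    rw [hus] at hx
    exact ⟨fun h => absurd h hx.2.1, fun h => absurd (h j hj) (hx.2.2.2 j)⟩
  obtain ⟨ψ, hψ, hψt, hψβ⟩ := hβ.affine I u hI hadapt j hj
  have h1 : stdBlowUp I j (1 : C3) = 1 := by funext i; simp [stdBlowUp]
  have huq : u (β q) = 1 := by rw [huv, hb]; simp
  have h1t : (1 : C3) ∈ ψ.target := by
    rw [hψt, Set.mem_ofPred_eq, h1, ← huq]; exact u.map_source hqu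
  have hq1 : q = ψ.symm 1 := by
    refine hβ.injective_off hq ?_
    rw [hψβ 1 h1t, h1, ← huq, u.left_inv hqu]
  have hqs : q ∈ ψ.source := by rw [hq1]; exact ψ.map_target h1t
  have hψq : ψ q = 1 := by rw [hq1, ψ.right_inv h1t]
  refine ⟨(ψ.trans (stdBlowUpIso I j)).trans (translate (-b)),
    trans_mem_chart (trans_mem_chart hψ (isBiholo_stdBlowUpIso I j)) (isBiholo_translate _), ?_, ?_⟩
  · rw [OpenPartialHomeomorph.trans_source, OpenPartialHomeomorph.trans_source]
    refine ⟨⟨hqs, ?_⟩, trivial⟩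
    change ψ q j ≠ 0
    rw [hψq]; simp
  · intro x hx
    rw [OpenPartialHomeomorph.trans_source, OpenPartialHomeomorph.trans_source] at hx
    have hxs : x ∈ ψ.source := hx.1.1
    have hxt := ψ.map_source hxs
    have h3 := hψβ _ hxt
    rw [ψ.left_inv hxs] at h3
    rw [hψt] at hxt
    have h4 : β x ∈ u.source := by rw [h3]; exact u.map_target hxt
    rw [hus] at h4
    refine ⟨h4.1, ?_⟩
    have h5 : u (β x) = stdBlowUp I j (ψ x) := by rw [h3, u.right_inv hxt]
    rw [huv] at h5
    change stdBlowUp I j (ψ x) - -b = _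
    rw [← h5]; abel

theorem symm_eq_of_chart {X' X : Threefold} {β : X' → X} {v : OpenPartialHomeomorph X C3}
    {v' : OpenPartialHomeomorph X' C3}
    (h : ∀ x ∈ v'.source, β x ∈ v.source ∧ v' x = v (β x)) {w : C3} (hw : w ∈ v'.target) :
    β (v'.symm w) = v.symm w := by
  obtain ⟨h1, h2⟩ := h _ (v'.map_target hw)
  rw [v'.right_inv hw] at h2
  conv_rhs => rw [h2, v.left_inv h1]

theorem IsBlowUp.map_nhds {X' X : Threefold} {k : ℕ} {Z : Set X} {β : X' → X}
    (hβ : IsBlowUp k Z β) (hk : k ≤ 3) {q : X'} (hq : β q ∉ Z) :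
    Filter.map β (𝓝 q) = 𝓝 (β q) := by
  obtain ⟨v', -, hq', h⟩ := hβ.exists_chart hk hq
    (IsManifold.chart_mem_maximalAtlas (I := 𝓘(ℂ, C3)) (n := ω) (β q)) (mem_chart_source C3 (β q))
  set v := chartAt C3 (β q) with hv
  have hqv := (h q hq').1
  have h1 : β =ᶠ[𝓝 q] v.symm ∘ v' := by
    filter_upwards [v'.open_source.mem_nhds hq'] with x hx
    rw [Function.comp, (h x hx).2, v.left_inv (h x hx).1]
  rw [Filter.map_congr h1, ← Filter.map_map, v'.map_nhds_eq hq', (h q hq').2,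
    v.symm.map_nhds_eq (v.map_source hqv), v.left_inv hqv]

theorem GermIn.lift {N : (C3 → C3) → Prop} (hN : IsGermProp N) {X' X : Threefold} {k : ℕ}
    {Z : Set X} {β : X' → X} (hβ : IsBlowUp k Z β) (hk : k ≤ 3) {q : X'} (hq : β q ∉ Z)
    {g : X → X} {g' : X' → X'} (h : GermIn N g (β q)) (hg' : g' q = q) (hc : ContinuousAt g' q)
    (hgg : ∀ᶠ x in 𝓝 q, β (g' x) = g (β x)) : GermIn N g' q := by
  obtain ⟨h1, v, hv, h2⟩ := h
  obtain ⟨v', hv', hq', h3⟩ := hβ.exists_chart hk hq hv.1 hv.2.1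
  have hc' : IsCoordAt v' q := ⟨hv', hq', by rw [(h3 q hq').2, hv.2.2]⟩
  refine ⟨hg', v', hc', hN _ _ ?_ h2⟩
  have hgt : Filter.Tendsto g' (𝓝 q) (𝓝 q) := by have := hc.tendsto; rwa [hg'] at this
  have hsrc := v'.open_source.mem_nhds hq'
  filter_upwards [hc'.tendsto_symm.eventually hgg, hc'.tendsto_symm.eventually (hgt.eventually hsrc),
    v'.open_target.mem_nhds (by rw [← hc'.2.2]; exact v'.map_source hq')] with w h4 h5 h6
  rw [(h3 _ h5).2, h4, symm_eq_of_chart h3 h6]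

theorem GermIn.descend {N : (C3 → C3) → Prop} (hN : IsGermProp N) {X' X : Threefold} {k : ℕ}
    {Z : Set X} {β : X' → X} (hβ : IsBlowUp k Z β) (hk : k ≤ 3) {q : X'} (hq : β q ∉ Z)
    {g : X → X} {g' : X' → X'} (h : GermIn N g' q) (hc : ContinuousAt g' q)
    (hgg : ∀ᶠ x in 𝓝 q, β (g' x) = g (β x)) : GermIn N g (β q) := by
  obtain ⟨h1, v', hv', h2⟩ := h
  have hg : g (β q) = β q := by rw [← hgg.self_of_nhds, h1]
  obtain ⟨v₀', hv₀', hq₀, h3⟩ := hβ.exists_chart hk hq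
    (IsManifold.chart_mem_maximalAtlas (I := 𝓘(ℂ, C3)) (n := ω) (β q)) (mem_chart_source C3 (β q))
  set v₀ := chartAt C3 (β q) with hv₀
  have hv₀c : v₀ ∈ Chart X := IsManifold.chart_mem_maximalAtlas _
  have hv₀q : v₀' q = v₀ (β q) := (h3 q hq₀).2
  have hvs : β q ∈ (v₀.trans (v₀'.symm.trans v')).source := by
    rw [OpenPartialHomeomorph.trans_source, OpenPartialHomeomorph.trans_source]
    refine ⟨(h3 q hq₀).1, ?_⟩
    rw [Set.mem_preimage, ← hv₀q]
    refine ⟨v₀'.map_source hq₀, ?_⟩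
    rw [Set.mem_preimage, v₀'.left_inv hq₀]; exact hv'.2.1
  have hv : IsCoordAt (v₀.trans (v₀'.symm.trans v')) (β q) := by
    refine ⟨trans_mem_chart hv₀c (isBiholo_transition hv₀' hv'.1), hvs, ?_⟩
    change v' (v₀'.symm (v₀ (β q))) = 0
    rw [← hv₀q, v₀'.left_inv hq₀, hv'.2.2]
  refine ⟨hg, _, hv, hN _ _ ?_ h2⟩
  have hgt : Filter.Tendsto g' (𝓝 q) (𝓝 q) := by have := hc.tendsto; rwa [h1] at this
  have key : ∀ x ∈ v₀'.source, (v₀.trans (v₀'.symm.trans v')) (β x) = v' x := fun x hx => by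
    change v' (v₀'.symm (v₀ (β x))) = _
    rw [← (h3 x hx).2, v₀'.left_inv hx]
  have hsrc := v₀'.open_source.mem_nhds hq₀
  have hβv : ∀ᶠ x in 𝓝 q, β x ∈ (v₀.trans (v₀'.symm.trans v')).source :=
    hβ.holomorphic.continuous.continuousAt.eventually
      ((v₀.trans (v₀'.symm.trans v')).open_source.mem_nhds hvs)
  filter_upwards [hv'.tendsto_symm.eventually hgg, hv'.tendsto_symm.eventually hsrc,
    hv'.tendsto_symm.eventually (hgt.eventually hsrc), hv'.tendsto_symm.eventually hβv,
    v'.open_target.mem_nhds (by rw [← hv'.2.2]; exact v'.map_source hv'.2.1)] with w h4 h5 h6 h7 h8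
  rw [← key _ h6, h4]
  have h9 : (v₀.trans (v₀'.symm.trans v')).symm w = β (v'.symm w) := by
    have := key _ h5
    rw [v'.right_inv h8] at this
    conv_lhs => rw [← this, OpenPartialHomeomorph.left_inv _ h7]
  rw [h9]

/-! ### Affine charts of a point blow-up -/

/-- Change of affine charts of a point blow-up, from the `j`-th to the `k`-th chart. -/
def blChange (j k : Fin 3) (w : C3) : C3 := fun i =>
  if i = k then w j * Function.update w j 1 k else Function.update w j 1 i / Function.update w j 1 k

theorem bl_blChange {j k : Fin 3} {w : C3} (h : Function.update w j 1 k ≠ 0) :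
    bl k (blChange j k w) = bl j w := by
  funext i
  rw [bl_eq_smul j w i]
  by_cases hi : i = k
  · subst hi; simp [bl, blChange]
  · simp only [bl, blChange, hi, if_false, if_true]
    field_simp

theorem blChange_same (j : Fin 3) (w : C3) : blChange j j w = w := by
  funext i
  by_cases hi : i = j
  · subst hi; simp [blChange]
  · simp [blChange, hi]

theorem continuousAt_blChange {j k : Fin 3} {w : C3} (h : Function.update w j 1 k ≠ 0) :
    ContinuousAt (blChange j k) w := by
  refine continuousAt_pi.2 fun i => ?_
  by_cases hi : i = k
  · simp only [blChange, hi, if_true]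
    exact (continuous_apply j).continuousAt.mul (analyticAt_update_one j k w).continuousAt
  · simp only [blChange, hi, if_false]
    exact (analyticAt_update_one j i w).continuousAt.div (analyticAt_update_one j k w).continuousAt h

/-- The affine charts of the blow-up of a point `p` in the coordinates `u`. -/
structure IsPointChart {X' X : Threefold} (β : X' → X) (u : OpenPartialHomeomorph X C3) (j : Fin 3)
    (ψ : OpenPartialHomeomorph X' C3) : Prop where
  mem : ψ ∈ Chart X'
  target : ∀ w, w ∈ ψ.target ↔ bl j w ∈ u.target
  eq : ∀ w ∈ ψ.target, β (ψ.symm w) = u.symm (bl j w)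

theorem isPointChart_iff {X' X : Threefold} {β : X' → X} {u : OpenPartialHomeomorph X C3} {j : Fin 3}
    {ψ : OpenPartialHomeomorph X' C3} :
    IsAffineChart β u Finset.univ j ψ ↔ IsPointChart β u j ψ := by
  constructor
  · rintro ⟨h1, h2, h3⟩
    refine ⟨h1, fun w => by rw [h2, Set.mem_ofPred_eq, stdBlowUp_univ], fun w hw => ?_⟩
    rw [h3 w hw, stdBlowUp_univ]
  · rintro ⟨h1, h2, h3⟩
    refine ⟨h1, ?_, fun w hw => ?_⟩
    · ext w; rw [h2, Set.mem_ofPred_eq, stdBlowUp_univ]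
    · rw [h3 w hw, stdBlowUp_univ]

theorem IsCoordAt.isAdaptedChart {X : Threefold} {u : OpenPartialHomeomorph X C3} {p : X}
    (hu : IsCoordAt u p) : IsAdaptedChart {p} Finset.univ u := by
  refine ⟨hu.1, fun x hx => ⟨?_, fun h => ?_⟩⟩
  · rintro rfl i _; rw [hu.2.2]; rfl
  · exact u.injOn hx hu.2.1 (by rw [hu.2.2]; funext i; exact h i (Finset.mem_univ i))

theorem IsCoordAt.zero_mem {X : Threefold} {u : OpenPartialHomeomorph X C3} {p : X}
    (hu : IsCoordAt u p) : 0 ∈ u.target := by rw [← hu.2.2]; exact u.map_source hu.2.1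

theorem IsPointChart.mem_target {X' X : Threefold} {β : X' → X} {u : OpenPartialHomeomorph X C3}
    {p : X} {j : Fin 3} {ψ : OpenPartialHomeomorph X' C3} (h : IsPointChart β u j ψ)
    (hu : IsCoordAt u p) {w : C3} (hw : w j = 0) : w ∈ ψ.target := by
  rw [h.target, bl_eq_zero hw]; exact hu.zero_mem

theorem IsPointChart.eq_center {X' X : Threefold} {β : X' → X} {u : OpenPartialHomeomorph X C3}
    {p : X} {j : Fin 3} {ψ : OpenPartialHomeomorph X' C3} (h : IsPointChart β u j ψ)
    (hu : IsCoordAt u p) {w : C3} (hw : w ∈ ψ.target) : β (ψ.symm w) = p ↔ w j = 0 := by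
  rw [h.eq w hw]
  constructor
  · intro h1
    have h2 : bl j w = 0 := by
      rw [← u.right_inv ((h.target w).1 hw), h1, hu.2.2]
    rw [← bl_same j w, h2]; rfl
  · intro h1; rw [bl_eq_zero h1, hu.symm_zero]

section PointBlowUp

variable {X' X : Threefold} {β : X' → X} {p : X} {u : OpenPartialHomeomorph X C3}

theorem IsPointChart.change (hβ : IsBlowUp 3 {p} β) (hu : IsCoordAt u p) {j k : Fin 3}
    {ψ φ : OpenPartialHomeomorph X' C3} (hψ : IsPointChart β u j ψ) (hφ : IsPointChart β u k φ)
    {w : C3} (hw : w ∈ ψ.target) (h : Function.update w j 1 k ≠ 0) :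
    blChange j k w ∈ φ.target ∧ ψ.symm w = φ.symm (blChange j k w) := by
  have ht : ∀ w, w ∈ ψ.target → Function.update w j 1 k ≠ 0 → blChange j k w ∈ φ.target :=
    fun w hw h => by rw [hφ.target, bl_blChange h, ← hψ.target]; exact hw
  have hoff : ∀ w, w ∈ ψ.target → Function.update w j 1 k ≠ 0 → w j ≠ 0 →
      ψ.symm w = φ.symm (blChange j k w) := by
    intro w hw h hj
    refine hβ.injective_off ?_ ?_
    · rw [Set.mem_singleton_iff, hψ.eq_center hu hw]; exact hj
    · rw [hψ.eq w hw, hφ.eq _ (ht w hw h), bl_blChange h]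
  refine ⟨ht w hw h, ?_⟩
  by_cases hj : w j = 0
  swap
  · exact hoff w hw h hj
  have hup : Filter.Tendsto (fun t : ℂ => Function.update w j t) (𝓝[≠] 0) (𝓝 w) := by
    have : Continuous fun t : ℂ => Function.update w j t := continuous_const.update j continuous_id
    have h2 := this.continuousAt (x := (0 : ℂ))
    rw [ContinuousAt, show Function.update w j 0 = w by rw [← hj, Function.update_eq_self]] at h2
    exact h2.mono_left nhdsWithin_le_nhds
  have e1 := ((ψ.continuousAt_symm hw).tendsto).comp hup
  have e2 := (((φ.continuousAt_symm (ht w hw h)).tendsto).comp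
    (continuousAt_blChange h).tendsto).comp hup
  refine tendsto_nhds_unique_of_eventuallyEq e1 e2 ?_
  filter_upwards [hup.eventually (ψ.open_target.mem_nhds hw), self_mem_nhdsWithin] with t h3 h4
  refine hoff _ h3 ?_ (by simpa using h4)
  simpa using h

theorem IsPointChart.notMem_source (hβ : IsBlowUp 3 {p} β) (hu : IsCoordAt u p) {j k : Fin 3}
    {ψ φ : OpenPartialHomeomorph X' C3} (hψ : IsPointChart β u j ψ) (hφ : IsPointChart β u k φ)
    {w : C3} (hw : w ∈ ψ.target) (h : Function.update w j 1 k = 0) : ψ.symm w ∉ φ.source := by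
  intro hs
  have hjk : k ≠ j := by rintro rfl; simp at h
  have hk0 : w k = 0 := by simpa [hjk] using h
  have hup : Filter.Tendsto (fun t : ℂ => Function.update w k t) (𝓝[≠] 0) (𝓝 w) := by
    have : Continuous fun t : ℂ => Function.update w k t := continuous_const.update k continuous_id
    have h2 := this.continuousAt (x := (0 : ℂ))
    rw [ContinuousAt, show Function.update w k 0 = w by rw [← hk0, Function.update_eq_self]] at h2
    exact h2.mono_left nhdsWithin_le_nhds
  have h1 : Filter.Tendsto (fun t : ℂ => φ (ψ.symm (Function.update w k t)) j) (𝓝[≠] 0)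
      (𝓝 (φ (ψ.symm w) j)) :=
    ((continuous_apply j).tendsto _).comp (((φ.continuousAt hs).tendsto.comp
      (ψ.continuousAt_symm hw).tendsto).comp hup)
  have h2 : (fun t : ℂ => t * φ (ψ.symm (Function.update w k t)) j) =ᶠ[𝓝[≠] 0] fun _ => 1 := by
    filter_upwards [hup.eventually (ψ.open_target.mem_nhds hw), self_mem_nhdsWithin] with t h3 h4
    have h5 : Function.update (Function.update w k t) j 1 k ≠ 0 := by simpa [hjk] using h4
    obtain ⟨h6, h7⟩ := hψ.change hβ hu hφ h3 h5
    rw [h7, φ.right_inv h6]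
    simp only [blChange, hjk.symm, if_false]
    have h4' : t ≠ 0 := h4
    simp [hjk, h4']
  have h3 : Filter.Tendsto (fun t : ℂ => t * φ (ψ.symm (Function.update w k t)) j) (𝓝[≠] 0)
      (𝓝 (0 * φ (ψ.symm w) j)) :=
    (Filter.tendsto_id.mono_right nhdsWithin_le_nhds).mul h1
  have := tendsto_nhds_unique_of_eventuallyEq h3 tendsto_const_nhds h2
  simp at this

theorem IsBlowUp.exists_pointCharts (hβ : IsBlowUp 3 {p} β) (hu : IsCoordAt u p) :
    ∃ ψ : Fin 3 → OpenPartialHomeomorph X' C3, ∀ j, IsPointChart β u j (ψ j) := by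
  choose ψ hψ using fun j => hβ.affine Finset.univ u (by simp) hu.isAdaptedChart j (Finset.mem_univ j)
  exact ⟨ψ, fun j => isPointChart_iff.1 (hψ j)⟩

theorem IsBlowUp.exists_pointChart_eq (hβ : IsBlowUp 3 {p} β) (hu : IsCoordAt u p)
    {ψ : Fin 3 → OpenPartialHomeomorph X' C3} (hψ : ∀ j, IsPointChart β u j (ψ j)) {q : X'}
    (hq : β q = p) : ∃ j c, c j = 0 ∧ q = (ψ j).symm c := by
  obtain ⟨j, -, φ, hφ, hs⟩ := hβ.cover Finset.univ u (by simp) hu.isAdaptedChart q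
    (by rw [hq]; exact hu.2.1)
  rw [isPointChart_iff] at hφ
  have ht := φ.map_source hs
  have h1 := hφ.change hβ hu (hψ j) ht (by simp)
  rw [blChange_same, φ.left_inv hs] at h1
  refine ⟨j, φ q, ?_, h1.2⟩
  rw [← hφ.eq_center hu ht, φ.left_inv hs, hq]

end PointBlowUp

/-! ### Lifts of the germ -/

/-- `F` is the expression near `c`, in the chart `ψ`, of the lift of `f` to the modification `π`. -/
structure IsLocalLift (f : C3 → C3) {X : Threefold} (π : X → C3)
    (ψ : OpenPartialHomeomorph X C3) (F : C3 → C3) (c : C3) : Prop where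
  mem : ψ ∈ Chart X
  target : c ∈ ψ.target
  analytic : AnalyticAt ℂ F c
  eq : ∀ᶠ w in 𝓝 c, π (ψ.symm (F w)) = f (π (ψ.symm w))
  fix : ∀ᶠ w in 𝓝 c, π (ψ.symm w) = 0 → F w = w

/-- The germ has an isolated zero at the origin. -/
def HasIsolatedZero (f : C3 → C3) : Prop := ∀ᶠ v in 𝓝 0, f v = 0 → v = 0

/-- A modification to which the germ `f` lifts. -/
structure IsLiftable (f : C3 → C3) {X : Threefold} (π : X → C3) : Prop where
  isolated : HasIsolatedZero f
  cont : Continuous π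
  inj : ∀ x y, π x ≠ 0 → π x = π y → x = y
  dense : Dense {x | π x ≠ 0}
  lift : ∀ q, π q = 0 → ∃ ψ F c, IsLocalLift f π ψ F c ∧ ψ.symm c = q

section Lift

variable {f : C3 → C3} {X : Threefold} {π : X → C3} {g : X → X}

theorem IsLift.eventually (hg : IsLift f π g) {q : X} (hq : π q = 0) :
    ∀ᶠ x in 𝓝 q, ContMDiffAt 𝓘(ℂ, C3) 𝓘(ℂ, C3) ω g x ∧ π (g x) = f (π x) := by
  obtain ⟨U, hU, hU0, hc, he⟩ := hg
  filter_upwards [hU.mem_nhds (hU0 hq)] with x hx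
  exact ⟨(hc x hx).contMDiffAt (hU.mem_nhds hx), he x hx⟩

theorem isLift_of_eventually (h : ∀ q, π q = 0 → ∀ᶠ x in 𝓝 q,
    ContMDiffAt 𝓘(ℂ, C3) 𝓘(ℂ, C3) ω g x ∧ π (g x) = f (π x)) : IsLift f π g := by
  refine ⟨{q | ∀ᶠ x in 𝓝 q, ContMDiffAt 𝓘(ℂ, C3) 𝓘(ℂ, C3) ω g x ∧ π (g x) = f (π x)},
    isOpen_setOfPred_eventually_nhds, fun q hq => h q hq, fun q hq => ?_, fun q hq => ?_⟩
  · exact (Filter.Eventually.self_of_nhds hq).1.contMDiffWithinAt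
  · exact (Filter.Eventually.self_of_nhds hq).2

theorem IsLocalLift.mem_source {ψ : OpenPartialHomeomorph X C3} {F : C3 → C3} {c : C3}
    (h : IsLocalLift f π ψ F c) : ψ.symm c ∈ ψ.source := ψ.map_target h.target

theorem IsLocalLift.apply_symm {ψ : OpenPartialHomeomorph X C3} {F : C3 → C3} {c : C3}
    (h : IsLocalLift f π ψ F c) : ψ (ψ.symm c) = c := ψ.right_inv h.target

theorem IsLocalLift.tendsto {ψ : OpenPartialHomeomorph X C3} {F : C3 → C3} {c : C3}
    (h : IsLocalLift f π ψ F c) : Filter.Tendsto ψ (𝓝 (ψ.symm c)) (𝓝 c) := by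
  have := (ψ.continuousAt h.mem_source).tendsto
  rwa [h.apply_symm] at this

theorem IsLocalLift.tendsto_symm {ψ : OpenPartialHomeomorph X C3} {F : C3 → C3} {c : C3}
    (h : IsLocalLift f π ψ F c) : Filter.Tendsto ψ.symm (𝓝 c) (𝓝 (ψ.symm c)) :=
  (ψ.continuousAt_symm h.target).tendsto

theorem IsLocalLift.tendsto_self {ψ : OpenPartialHomeomorph X C3} {F : C3 → C3} {c : C3}
    (h : IsLocalLift f π ψ F c) (hc : π (ψ.symm c) = 0) : Filter.Tendsto F (𝓝 c) (𝓝 c) := by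
  have := h.analytic.continuousAt.tendsto
  rwa [h.fix.self_of_nhds hc] at this

theorem IsLiftable.eventually_off (hπ : IsLiftable f π) {q : X} (hq : π q = 0) :
    ∀ᶠ x in 𝓝 q, f (π x) = 0 → π x = 0 := by
  have h1 : Filter.Tendsto π (𝓝 q) (𝓝 0) := by
    have := hπ.cont.continuousAt (x := q); rwa [ContinuousAt, hq] at this
  exact h1.eventually hπ.isolated

theorem IsLocalLift.contMDiffAt {ψ : OpenPartialHomeomorph X C3} {F : C3 → C3} {c : C3}
    (h : IsLocalLift f π ψ F c) (hc : π (ψ.symm c) = 0) :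
    ∀ᶠ x in 𝓝 (ψ.symm c), ContMDiffAt 𝓘(ℂ, C3) 𝓘(ℂ, C3) ω (fun y => ψ.symm (F (ψ y))) x := by
  filter_upwards [ψ.open_source.mem_nhds h.mem_source,
    h.tendsto.eventually h.analytic.eventually_analyticAt,
    h.tendsto.eventually ((h.tendsto_self hc).eventually (ψ.open_target.mem_nhds h.target))]
    with x h1 h2 h3
  have e1 := contMDiffAt_of_mem_maximalAtlas h.mem h1
  have e2 : ContMDiffAt 𝓘(ℂ, C3) 𝓘(ℂ, C3) ω F (ψ x) := h2.contDiffAt.contMDiffAt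
  have e3 := contMDiffAt_symm_of_mem_maximalAtlas h.mem h3
  exact e3.comp x (e2.comp x e1)

theorem IsLiftable.eventually_eq (hπ : IsLiftable f π) (hg : IsLift f π g)
    {ψ : OpenPartialHomeomorph X C3} {F : C3 → C3} {c : C3} (h : IsLocalLift f π ψ F c)
    (hc : π (ψ.symm c) = 0) : ∀ᶠ x in 𝓝 (ψ.symm c), g x = ψ.symm (F (ψ x)) := by
  have h0 := hπ.eventually_off hc
  have h1 : ∀ᶠ x in 𝓝 (ψ.symm c), π x ≠ 0 → g x = ψ.symm (F (ψ x)) := by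
    filter_upwards [h0, hg.eventually hc, h.tendsto.eventually h.eq,
      ψ.open_source.mem_nhds h.mem_source] with x h2 h3 h4 h5 h6
    rw [ψ.left_inv h5] at h4
    exact hπ.inj _ _ (by rw [h3.2]; exact fun h => h6 (h2 h)) (by rw [h3.2, h4])
  filter_upwards [h1.eventually_nhds, hg.eventually hc, h.contMDiffAt hc] with x h2 h3 h4
  have hne : (𝓝[{x | π x ≠ 0}] x).NeBot := mem_closure_iff_nhdsWithin_neBot.1 (hπ.dense x)
  refine tendsto_nhds_unique_of_eventuallyEq (l := 𝓝[{x | π x ≠ 0}] x)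
    (h3.1.continuousAt.tendsto.mono_left nhdsWithin_le_nhds)
    (h4.continuousAt.tendsto.mono_left nhdsWithin_le_nhds) ?_
  filter_upwards [nhdsWithin_le_nhds h2, self_mem_nhdsWithin] with y h5 h6
  exact h5 h6

theorem IsLiftable.fix (hπ : IsLiftable f π) (hg : IsLift f π g) {q : X} (hq : π q = 0) :
    g q = q := by
  obtain ⟨ψ, F, c, h, rfl⟩ := hπ.lift q hq
  have := (hπ.eventually_eq hg h hq).self_of_nhds
  rw [this, h.apply_symm, h.fix.self_of_nhds hq]

theorem IsLiftable.expression (hπ : IsLiftable f π) (hg : IsLift f π g)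
    {ψ : OpenPartialHomeomorph X C3} {F : C3 → C3} {c : C3} (h : IsLocalLift f π ψ F c)
    (hc : π (ψ.symm c) = 0) : ∀ᶠ w in 𝓝 c, ψ (g (ψ.symm w)) = F w := by
  filter_upwards [h.tendsto_symm.eventually (hπ.eventually_eq hg h hc),
    ψ.open_target.mem_nhds h.target,
    (h.tendsto_self hc).eventually (ψ.open_target.mem_nhds h.target)] with w h1 h2 h3
  rw [h1, ψ.right_inv h2, ψ.right_inv h3]

theorem IsLift.continuousAt (hg : IsLift f π g) {q : X} (hq : π q = 0) :
    ∀ᶠ x in 𝓝 q, ContinuousAt g x := (hg.eventually hq).mono fun _ h => h.1.continuousAt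

theorem IsLiftable.analyticAt (hπ : IsLiftable f π) (hg : IsLift f π g) {p : X} (hp : π p = 0)
    {u : OpenPartialHomeomorph X C3} (hu : IsCoordAt u p) :
    AnalyticAt ℂ (fun w => u (g (u.symm w))) 0 := by
  obtain ⟨ψ, F, c, h, rfl⟩ := hπ.lift p hp
  have e1 : AnalyticAt ℂ (fun w => ψ (u.symm w)) 0 := by
    have := analyticAt_transition hu.1 h.mem hu.2.1 h.mem_source
    rwa [hu.2.2] at this
  have e2 : AnalyticAt ℂ (fun w => u (ψ.symm w)) c := by
    have := analyticAt_transition h.mem hu.1 h.mem_source hu.2.1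
    rwa [h.apply_symm] at this
  have h1 : ψ (u.symm 0) = c := by rw [hu.symm_zero, h.apply_symm]
  have h2 : F c = c := h.fix.self_of_nhds hp
  have e3 : AnalyticAt ℂ (fun w => u (ψ.symm (F (ψ (u.symm w))))) 0 := by
    refine AnalyticAt.fun_comp (g := fun w => u (ψ.symm w)) (f := fun w => F (ψ (u.symm w))) ?_
      (AnalyticAt.fun_comp (g := F) ?_ e1)
    · simp only [h1, h2]; exact e2
    · rw [h1]; exact h.analytic
  refine e3.congr ?_
  filter_upwards [hu.tendsto_symm.eventually (hπ.eventually_eq hg h hp)] with w hw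
  rw [hw]

theorem IsLiftable.exists_isLift (hπ : IsLiftable f π) : ∃ g, IsLift f π g := by
  classical
  let g : X → X := fun x => if h : π x ≠ 0 ∧ ∃ y, π y = f (π x) then h.2.choose else x
  refine ⟨g, isLift_of_eventually fun q hq => ?_⟩
  obtain ⟨ψ, F, c, h, rfl⟩ := hπ.lift q hq
  have key : ∀ᶠ x in 𝓝 (ψ.symm c), g x = ψ.symm (F (ψ x)) := by
    filter_upwards [hπ.eventually_off hq, h.tendsto.eventually h.eq, h.tendsto.eventually h.fix,
      ψ.open_source.mem_nhds h.mem_source] with x h1 h2 h3 h4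
    rw [ψ.left_inv h4] at h2 h3
    by_cases hx : π x = 0
    · rw [h3 hx, ψ.left_inv h4]
      simp [g, hx]
    · have h5 : π x ≠ 0 ∧ ∃ y, π y = f (π x) := ⟨hx, _, h2⟩
      have h6 : g x = h5.2.choose := by simp only [g, dif_pos h5]
      have h7 := h5.2.choose_spec
      rw [← h6] at h7
      exact hπ.inj _ _ (by rw [h7]; exact fun h => hx (h1 h)) (by rw [h7, h2])
  have key2 : ∀ᶠ x in 𝓝 (ψ.symm c), π (g x) = f (π x) := by
    filter_upwards [key, h.tendsto.eventually h.eq, ψ.open_source.mem_nhds h.mem_source]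
      with x h1 h2 h3
    rw [ψ.left_inv h3] at h2
    rw [h1, h2]
  filter_upwards [key.eventually_nhds, key2, h.contMDiffAt hq] with x h1 h2 h3
  exact ⟨h3.congr_of_eventuallyEq h1, h2⟩

end Lift

/-! ### Lifts and blow-ups -/

section LiftBlowUp

variable {f : C3 → C3} {X X' : Threefold} {π : X → C3} {β : X' → X} {k : ℕ} {Z : Set X}

theorem isOpen_map_nhds {q : X'} (hβ : IsBlowUp k Z β) (hk : k ≤ 3) (hq : β q ∉ Z) {V : Set X'}
    (hV : V ∈ 𝓝 q) : β '' V ∈ 𝓝 (β q) := by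
  rw [← hβ.map_nhds hk hq]; exact Filter.image_mem_map hV

theorem IsBlowUp.dense_off (hβ : IsBlowUp k Z β) : Dense {x | β x ∉ Z} := by
  intro q
  by_cases hq : β q ∈ Z
  swap
  · exact subset_closure hq
  obtain ⟨I, u, hI, hu, hqu⟩ := hβ.submanifold _ hq
  obtain ⟨j, hj, ψ, hψ, hqψ⟩ := hβ.cover I u hI hu q hqu
  set c := ψ q with hc
  have hct : c ∈ ψ.target := ψ.map_source hqψ
  have hsc : ψ.symm c = q := ψ.left_inv hqψ
  have hup : Filter.Tendsto (fun t : ℂ => ψ.symm (Function.update c j t)) (𝓝[≠] (c j)) (𝓝 q) := by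
    have : Continuous fun t : ℂ => Function.update c j t := continuous_const.update j continuous_id
    have h2 := this.continuousAt (x := c j)
    rw [ContinuousAt, Function.update_eq_self] at h2
    have h3 := (ψ.continuousAt_symm hct).tendsto.comp h2
    rw [hsc] at h3
    exact h3.mono_left nhdsWithin_le_nhds
  have hup2 : Filter.Tendsto (fun t : ℂ => Function.update c j t) (𝓝[≠] (c j)) (𝓝 c) := by
    have : Continuous fun t : ℂ => Function.update c j t := continuous_const.update j continuous_id
    have h2 := this.continuousAt (x := c j)
    rw [ContinuousAt, Function.update_eq_self] at h2
    exact h2.mono_left nhdsWithin_le_nhds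
  have hj0 : c j = 0 := by
    have h1 := hψ.2.2 c hct
    rw [hsc] at h1
    have h2 := hψ.2.1 ▸ hct
    have h3 := (hu.2 _ (u.map_target h2)).1 (h1 ▸ hq) j hj
    rwa [u.right_inv h2, stdBlowUp_same] at h3
  refine mem_closure_of_tendsto hup ?_
  filter_upwards [hup2.eventually (ψ.open_target.mem_nhds hct), self_mem_nhdsWithin] with t h1 h2
  rw [hψ.2.2 _ h1]
  rw [hψ.2.1] at h1
  intro h3
  have h4 := (hu.2 _ (u.map_target h1)).1 h3 j hj
  rw [u.right_inv h1, stdBlowUp_same, Function.update_self] at h4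
  exact h2 (by rw [h4, hj0]; rfl)

theorem IsLocalLift.lift {ψ : OpenPartialHomeomorph X C3} {F : C3 → C3} {c : C3}
    (h : IsLocalLift f π ψ F c) (hc : π (ψ.symm c) = 0) (hβ : IsBlowUp k Z β) (hk : k ≤ 3) {q : X'}
    (hq : β q = ψ.symm c) (hqZ : β q ∉ Z) :
    ∃ ψ' F c, IsLocalLift f (fun x => π (β x)) ψ' F c ∧ ψ'.symm c = q := by
  obtain ⟨v, hv, hqv, h1⟩ := hβ.exists_chart hk hqZ h.mem (hq ▸ h.mem_source)
  have hvq : v q = c := by rw [(h1 q hqv).2, hq, h.apply_symm]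
  have hct : c ∈ v.target := hvq ▸ v.map_source hqv
  have ht := v.open_target.mem_nhds hct
  refine ⟨v, F, c, ⟨hv, hct, h.analytic, ?_, ?_⟩, by rw [← hvq, v.left_inv hqv]⟩
  · filter_upwards [h.eq, ht, (h.tendsto_self hc).eventually ht] with w h2 h3 h4
    rw [symm_eq_of_chart h1 h3, symm_eq_of_chart h1 h4, h2]
  · filter_upwards [h.fix, ht] with w h2 h3
    rw [symm_eq_of_chart h1 h3]; exact h2

theorem IsLiftable.blowUp (hπ : IsLiftable f π) (hβ : IsBlowUp k Z β) (hk : k ≤ 3)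
    (hZ : ∀ z ∈ Z, π z = 0) (hl : ∀ q, β q ∈ Z → ∃ ψ F c,
      IsLocalLift f (fun x => π (β x)) ψ F c ∧ ψ.symm c = q) :
    IsLiftable f (fun x => π (β x)) := by
  have hβc := hβ.holomorphic.continuous
  refine ⟨hπ.isolated, hπ.cont.comp hβc, fun x y hx hxy => ?_, ?_, fun q hq => ?_⟩
  · exact hβ.injective_off (fun h => hx (hZ _ h)) (hπ.inj _ _ hx hxy)
  · intro q
    rw [mem_closure_iff]
    intro V hV hqV
    obtain ⟨x, hxV, hx⟩ := mem_closure_iff.1 (hβ.dense_off q) V hV hqV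
    obtain ⟨y, hy, hy0⟩ := mem_closure_iff_nhds.1 (hπ.dense (β x)) _
      (isOpen_map_nhds hβ hk hx (hV.mem_nhds hxV))
    obtain ⟨z, hz, rfl⟩ := hy
    exact ⟨z, hz, hy0⟩
  · by_cases hqZ : β q ∈ Z
    · exact hl q hqZ
    · obtain ⟨ψ, F, c, h, hc⟩ := hπ.lift (β q) hq
      exact h.lift (by rw [hc]; exact hq) hβ hk hc.symm hqZ

theorem IsLiftable.comm (hπ : IsLiftable f π) (hπ' : IsLiftable f (fun x => π (β x)))
    (hβ : Continuous β) {g : X → X} {g' : X' → X'} (hg : IsLift f π g)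
    (hg' : IsLift f (fun x => π (β x)) g') {q : X'} (hq : π (β q) = 0) :
    ∀ᶠ x in 𝓝 q, β (g' x) = g (β x) := by
  have h1 : Filter.Tendsto (fun x => π (β x)) (𝓝 q) (𝓝 0) := by
    have := hπ'.cont.continuousAt (x := q); rwa [ContinuousAt, hq] at this
  filter_upwards [h1.eventually hπ.isolated, hg'.eventually hq,
    hβ.continuousAt.eventually (hg.eventually hq)] with x h2 h3 h4
  by_cases hx : π (β x) = 0
  · rw [hπ'.fix hg' hx, hπ.fix hg hx]
  · exact hπ.inj _ _ (by rw [h3.2]; exact fun h => hx (h2 h)) (by rw [h3.2, h4.2])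

/-- The lift to the `j`-th affine chart of a point blow-up of the map `F` with
`F (bl j w) = bl j w + w j • N w`. -/
def blLift (j : Fin 3) (N : C3 → C3) (w : C3) : C3 := fun i =>
  if i = j then w j * (1 + N w j) else (w i + N w i) / (1 + N w j)

theorem bl_blLift {j : Fin 3} {N : C3 → C3} {w : C3} (h : 1 + N w j ≠ 0) :
    bl j (blLift j N w) = bl j w + w j • N w := by
  funext i
  by_cases hi : i = j
  · subst hi; simp [bl, blLift]; ring
  · simp only [bl, blLift, hi, if_false, if_true, Pi.add_apply, Pi.smul_apply, smul_eq_mul]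
    field_simp

theorem blLift_eq_self {j : Fin 3} {N : C3 → C3} {w : C3} (h : N w = 0) : blLift j N w = w := by
  funext i
  by_cases hi : i = j
  · subst hi; simp [blLift, h]
  · simp [blLift, hi, h]

theorem analyticAt_blLift {j : Fin 3} {N : C3 → C3} {c : C3} (h : AnalyticAt ℂ N c)
    (h0 : 1 + N c j ≠ 0) : AnalyticAt ℂ (blLift j N) c := by
  rw [analyticAt_c3] at h ⊢
  intro i
  have h1 := analyticAt_const.fun_add (h j) (f := fun _ => (1 : ℂ))
  by_cases hi : i = j
  · simp only [blLift, hi, if_true]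
    exact (analyticAt_coord j c).fun_mul h1
  · simp only [blLift, hi, if_false]
    exact ((analyticAt_coord i c).fun_add (h i)).fun_div h1 h0

theorem IsLiftable.isLocalLift_pointChart (hπ : IsLiftable f π) {g : X → X} (hg : IsLift f π g)
    {p : X} (hp : π p = 0) {u : OpenPartialHomeomorph X C3} (hu : IsCoordAt u p) {j : Fin 3}
    {ψ : OpenPartialHomeomorph X' C3} (hψ : IsPointChart β u j ψ) {c : C3} (hc : c j = 0)
    {N : C3 → C3} (hN : AnalyticAt ℂ N c)
    (hN1 : ∀ᶠ w in 𝓝 c, u (g (u.symm (bl j w))) = bl j w + w j • N w)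
    (hN2 : ∀ᶠ w in 𝓝 c, w j = 0 → N w = 0) :
    IsLocalLift f (fun x => π (β x)) ψ (blLift j N) c := by
  have hNc : N c = 0 := hN2.self_of_nhds hc
  have h1 : AnalyticAt ℂ (blLift j N) c := analyticAt_blLift hN (by simp [hNc])
  have hct : c ∈ ψ.target := hψ.mem_target hu hc
  have ht := ψ.open_target.mem_nhds hct
  have htl : Filter.Tendsto (blLift j N) (𝓝 c) (𝓝 c) := by
    have := h1.continuousAt.tendsto; rwa [blLift_eq_self hNc] at this
  have htb : Filter.Tendsto (bl j) (𝓝 c) (𝓝 0) := by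
    have := (analyticAt_bl j c).continuousAt.tendsto; rwa [bl_eq_zero hc] at this
  have htu : Filter.Tendsto (fun w => u.symm (bl j w)) (𝓝 c) (𝓝 p) := hu.tendsto_symm.comp htb
  have hgt : Filter.Tendsto g (𝓝 p) (𝓝 p) := by
    have := (hg.continuousAt hp).self_of_nhds.tendsto; rwa [hπ.fix hg hp] at this
  have hne : ∀ᶠ w in 𝓝 c, 1 + N w j ≠ 0 := by
    have h2 := (analyticAt_c3.1 hN j).continuousAt
    exact (continuousAt_const.add h2).eventually_ne (by simp [hNc])
  refine ⟨hψ.mem, hct, h1, ?_, ?_⟩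
  · filter_upwards [ht, htl.eventually ht, hne, hN1, htu.eventually (hg.eventually hp),
      htu.eventually (hgt.eventually (u.open_source.mem_nhds hu.2.1))] with w h2 h3 h4 h5 h6 h7
    rw [hψ.eq _ h3, hψ.eq _ h2, bl_blLift h4, ← h5, u.left_inv h7, h6.2]
  · filter_upwards [ht, hN1, hN2, htb.eventually (u.open_target.mem_nhds hu.zero_mem)]
      with w h2 h3 h4 h5 h6
    rw [hψ.eq _ h2] at h6
    refine blLift_eq_self ?_
    by_cases hw : w j = 0
    · exact h4 hw
    · rw [hπ.fix hg h6, u.right_inv h5, left_eq_add, smul_eq_zero] at h3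
      exact h3.resolve_left hw

theorem exists_bl_factor {F : C3 → C3} (hF : AnalyticAt ℂ F 0) (h0 : F 0 = 0)
    (hd : HasFDerivAt F (ContinuousLinearMap.id ℂ C3) 0) (j : Fin 3) {c : C3} (hc : c j = 0) :
    ∃ N : C3 → C3, AnalyticAt ℂ N c ∧ (∀ᶠ w in 𝓝 c, F (bl j w) = bl j w + w j • N w) ∧
      ∀ᶠ w in 𝓝 c, w j = 0 → N w = 0 := by
  have hFi := analyticAt_c3.1 hF
  choose m hm hme hmd using fun i => hadamard ((hFi i).sub (analyticAt_coord i 0)) (by simp [h0])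
  have hm0 : ∀ i k, m i k 0 = 0 := by
    intro i k
    refine hmd i k 0 ?_
    have e1 : HasDerivAt (fun t : ℂ => (Pi.single k t : C3)) (Pi.single k 1) 0 := by
      rw [hasDerivAt_pi]
      intro l
      by_cases hl : l = k
      · subst hl; simpa using hasDerivAt_id' (0 : ℂ)
      · simpa [hl] using hasDerivAt_const (0 : ℂ) (0 : ℂ)
    have e2 : HasDerivAt (fun t : ℂ => F (Pi.single k t)) (Pi.single k 1) 0 := by
      have := HasFDerivAt.comp_hasDerivAt (0 : ℂ) (f := fun t : ℂ => (Pi.single k t : C3))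
        (l := F) (l' := ContinuousLinearMap.id ℂ C3) (by rwa [Pi.single_zero]) e1
      exact this
    have e3 := (hasDerivAt_pi.1 e2 i).sub (hasDerivAt_pi.1 e1 i)
    rw [sub_self] at e3
    exact e3
  have htb : Filter.Tendsto (bl j) (𝓝 c) (𝓝 0) := by
    have := (analyticAt_bl j c).continuousAt.tendsto; rwa [bl_eq_zero hc] at this
  refine ⟨fun w i => ∑ k, m i k (bl j w) * Function.update w j 1 k, ?_, ?_, ?_⟩
  · rw [analyticAt_c3]
    intro i
    refine Finset.analyticAt_fun_sum _ fun k _ => ?_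
    refine AnalyticAt.fun_mul ?_ (analyticAt_update_one j k c)
    exact AnalyticAt.fun_comp (g := m i k) (by rw [bl_eq_zero hc]; exact hm i k) (analyticAt_bl j c)
  · have hall : ∀ᶠ w in 𝓝 (0 : C3), ∀ i, F w i - w i = ∑ k, m i k w * w k :=
      Filter.eventually_all.2 fun i => hme i
    filter_upwards [htb.eventually hall] with w hw
    funext i
    have h1 := hw i
    rw [Pi.add_apply, Pi.smul_apply, smul_eq_mul, Finset.mul_sum, ← sub_eq_iff_eq_add', h1]
    refine Finset.sum_congr rfl fun k _ => ?_
    rw [bl_eq_smul j w k]; ring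
  · refine Filter.Eventually.of_forall fun w hw => ?_
    funext i
    simp [bl_eq_zero hw, hm0]

theorem IsLiftable.pointBlowUp (hπ : IsLiftable f π) {g : X → X} (hg : IsLift f π g) {p : X}
    (hp : π p = 0) (ht : IsTangentToIdAt g p) (hβ : IsBlowUp 3 {p} β) :
    IsLiftable f (fun x => π (β x)) := by
  refine hπ.blowUp hβ le_rfl (by simpa using hp) fun q hq => ?_
  obtain ⟨-, u, hu, hd⟩ := ht
  obtain ⟨ψ, hψ⟩ := hβ.exists_pointCharts hu
  obtain ⟨j, c, hc, rfl⟩ := hβ.exists_pointChart_eq hu hψ hq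
  obtain ⟨N, hN, hN1, hN2⟩ := exists_bl_factor (hπ.analyticAt hg hp hu)
    (by rw [hu.symm_zero, hπ.fix hg hp, hu.2.2]) hd j hc
  exact ⟨ψ j, _, c, hπ.isLocalLift_pointChart hg hp hu (hψ j) hc hN hN1 hN2, rfl⟩

end LiftBlowUp

open scoped Matrix

/-! ### Logarithmic forms -/

/-- The monomial with exponents `e`. -/
def monom (e : Fin 3 → ℕ) (w : C3) : ℂ := ∏ i, w i ^ e i

theorem analyticAt_monom (e : Fin 3 → ℕ) (c : C3) : AnalyticAt ℂ (monom e) c :=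
  Finset.analyticAt_fun_prod _ fun i _ => (analyticAt_coord i c).fun_pow (e i)

theorem monom_eq_zero {e : Fin 3 → ℕ} {w : C3} {i : Fin 3} (he : e i ≠ 0) (hw : w i = 0) :
    monom e w = 0 :=
  Finset.prod_eq_zero (Finset.mem_univ i) (by rw [hw, zero_pow he])

/-- `F` is the map `w ↦ w + U(w) w^e M(w) w`, where `U` is a unit, and the `i`-th component of the
vector field `M(w) w` is divisible by `w_i` whenever `e_i ≠ 0`. -/
structure IsLogForm (F : C3 → C3) (e : Fin 3 → ℕ) (U : C3 → ℂ)
    (M : C3 → Matrix (Fin 3) (Fin 3) ℂ) : Prop where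
  unit : AnalyticAt ℂ U 0
  unit_ne : U 0 ≠ 0
  analytic : ∀ i k, AnalyticAt ℂ (fun w => M w i k) 0
  ne : ∃ i, e i ≠ 0
  log : ∀ i k, e i ≠ 0 → k ≠ i → ∀ᶠ w in 𝓝 0, M w i k = 0
  eq : ∀ᶠ w in 𝓝 0, F w = w + (U w * monom e w) • (M w *ᵥ w)

section LogForm

variable {F : C3 → C3} {e : Fin 3 → ℕ} {U : C3 → ℂ} {M : C3 → Matrix (Fin 3) (Fin 3) ℂ}

theorem analyticAt_mulVec {M : C3 → Matrix (Fin 3) (Fin 3) ℂ} {v : C3 → C3} {c : C3}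
    (hM : ∀ i k, AnalyticAt ℂ (fun w => M w i k) c) (hv : AnalyticAt ℂ v c) :
    AnalyticAt ℂ (fun w => M w *ᵥ v w) c := by
  rw [analyticAt_c3] at hv ⊢
  intro i
  exact Finset.analyticAt_fun_sum (Finset.univ : Finset (Fin 3)) fun k _ => (hM i k).fun_mul (hv k)

theorem IsLogForm.congr {F' : C3 → C3} (h : IsLogForm F e U M) (hF : F =ᶠ[𝓝 0] F') :
    IsLogForm F' e U M :=
  ⟨h.unit, h.unit_ne, h.analytic, h.ne, h.log, by
    filter_upwards [h.eq, hF] with w h1 h2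
    rw [← h2, h1]⟩

theorem IsLogForm.log_zero (h : IsLogForm F e U M) {i k : Fin 3} (hi : e i ≠ 0) (hk : k ≠ i) :
    M 0 i k = 0 := (h.log i k hi hk).self_of_nhds

theorem monom_zero (h : ∃ i, e i ≠ 0) : monom e 0 = 0 := by
  obtain ⟨i, hi⟩ := h
  exact monom_eq_zero hi rfl

theorem IsLogForm.hasGermAt {X : Threefold} {g : X → X} {p : X} {u : OpenPartialHomeomorph X C3}
    (h : IsLogForm (fun w => u (g (u.symm w))) e U M) (hg : g p = p) (hu : IsCoordAt u p) :
    HasGermAt g p u (fun w => U w * monom e w) (fun w => M w *ᵥ w) :=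
  ⟨hg, hu, h.unit.mul (analyticAt_monom e 0), analyticAt_mulVec h.analytic analyticAt_id,
    by simp only [monom_zero h.ne, mul_zero], h.eq⟩

theorem IsLogForm.not_eventually_zero (h : IsLogForm F e U M) :
    ¬ ∀ᶠ w in 𝓝 (0 : C3), U w * monom e w = 0 := by
  intro hcon
  have h1 : ∀ᶠ w in 𝓝 (0 : C3), U w ≠ 0 := h.unit.continuousAt.eventually_ne h.unit_ne
  have ht : Filter.Tendsto (fun t : ℂ => (fun _ => t : C3)) (𝓝[≠] 0) (𝓝 0) := by
    have : Continuous fun t : ℂ => (fun _ => t : C3) := by fun_prop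
    exact (this.tendsto 0).mono_left nhdsWithin_le_nhds
  obtain ⟨t, ⟨h2, h3⟩, h4⟩ := ((ht.eventually (hcon.and h1)).and self_mem_nhdsWithin).exists
  refine (mul_ne_zero h3 ?_) h2
  exact Finset.prod_ne_zero_iff.2 fun i _ => pow_ne_zero _ h4

theorem hasDerivAt_single (k : Fin 3) :
    HasDerivAt (fun t : ℂ => (Pi.single k t : C3)) (Pi.single k 1) 0 := by
  rw [hasDerivAt_pi]
  intro l
  by_cases hl : l = k
  · subst hl; simpa using hasDerivAt_id' (0 : ℂ)
  · simpa [hl] using hasDerivAt_const (0 : ℂ) (0 : ℂ)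

theorem hasDerivAt_sum_single {r : Fin 3 → C3 → ℂ} (hr : ∀ k, AnalyticAt ℂ (r k) 0) (k : Fin 3) :
    HasDerivAt (fun t : ℂ => ∑ l, r l (Pi.single k t) * (Pi.single k t : C3) l) (r k 0) 0 := by
  have h1 : (fun t : ℂ => ∑ l, r l (Pi.single k t) * (Pi.single k t : C3) l) =
      fun t : ℂ => r k (Pi.single k t) * t := by
    funext t
    rw [Finset.sum_eq_single k]
    · simp
    · intro l _ hl; simp [hl]
    · simp
  rw [h1]
  have h2 : HasDerivAt (fun t : ℂ => r k (Pi.single k t)) (fderiv ℂ (r k) 0 (Pi.single k 1)) 0 := by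
    refine HasFDerivAt.comp_hasDerivAt (0 : ℂ) (f := fun t : ℂ => (Pi.single k t : C3)) (l := r k)
      ?_ (hasDerivAt_single k)
    rw [Pi.single_zero]; exact (hr k).differentiableAt.hasFDerivAt
  have h3 := h2.fun_mul (hasDerivAt_id' (0 : ℂ))
  simpa using h3

theorem IsLogForm.fderiv_single (h : IsLogForm F e U M) (i : Fin 3) :
    fderiv ℂ (fun w => (M w *ᵥ w) i) 0 (Pi.single i 1) = M 0 i i := by
  have h1 : AnalyticAt ℂ (fun w => (M w *ᵥ w) i) 0 :=
    analyticAt_c3.1 (analyticAt_mulVec h.analytic analyticAt_id) i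
  have h2 : HasDerivAt (fun t : ℂ => (M (Pi.single i t) *ᵥ (Pi.single i t : C3)) i)
      (fderiv ℂ (fun w => (M w *ᵥ w) i) 0 (Pi.single i 1)) 0 := by
    refine HasFDerivAt.comp_hasDerivAt (0 : ℂ) (f := fun t : ℂ => (Pi.single i t : C3))
      (l := fun w => (M w *ᵥ w) i) ?_ (hasDerivAt_single i)
    rw [Pi.single_zero]; exact h1.differentiableAt.hasFDerivAt
  exact h2.unique (hasDerivAt_sum_single (r := fun k w => M w i k) (h.analytic i) i)

/-- The exponents of the blow-up of a logarithmic form at the point `c` of the `j`-th chart. -/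
def blExp (e : Fin 3 → ℕ) (j : Fin 3) (c : C3) : Fin 3 → ℕ := fun i =>
  if i = j then ∑ k, e k else if c i = 0 then e i else 0

theorem monom_bl (e : Fin 3 → ℕ) (j : Fin 3) (w : C3) :
    monom e (bl j w) = w j ^ (∑ k, e k) * ∏ i, Function.update w j 1 i ^ e i := by
  simp only [monom, bl_eq_smul, mul_pow, Finset.prod_mul_distrib, Finset.prod_pow_eq_pow_sum]

theorem monom_bl_add (e : Fin 3 → ℕ) {j : Fin 3} {c : C3} (hc : c j = 0) (z : C3) :
    monom e (bl j (z + c)) =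
      (∏ i, if i ≠ j ∧ c i ≠ 0 then (z i + c i) ^ e i else 1) * monom (blExp e j c) z := by
  have h1 : (z j) ^ (∑ k, e k) = ∏ i, if i = j then z j ^ (∑ k, e k) else 1 := by simp
  rw [monom_bl, Pi.add_apply, hc, add_zero, h1, monom, ← Finset.prod_mul_distrib,
    ← Finset.prod_mul_distrib]
  refine Finset.prod_congr rfl fun i _ => ?_
  by_cases hi : i = j
  · subst hi; simp [blExp]
  · by_cases h0 : c i = 0 <;> simp [blExp, hi, h0]

/-- The transform of a vector field `V` under the `j`-th chart of a point blow-up. -/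
theorem IsLogForm.blowUp (h : IsLogForm F e U M) {j : Fin 3} {c : C3} (hc : c j = 0) :
    ∃ N : C3 → C3, AnalyticAt ℂ N c ∧ (∀ᶠ w in 𝓝 c, F (bl j w) = bl j w + w j • N w) ∧
      (∀ᶠ w in 𝓝 c, w j = 0 → N w = 0) ∧
      ((∃ i, i ≠ j ∧ (M 0 *ᵥ Function.update c j 1) i ≠ c i * (M 0 *ᵥ Function.update c j 1) j) →
        NonsingForm fun z => blLift j N (z + c) - c) ∧
      ((∀ i, i ≠ j → (M 0 *ᵥ Function.update c j 1) i = c i * (M 0 *ᵥ Function.update c j 1) j) →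
        ∃ U' M', IsLogForm (fun z => blLift j N (z + c) - c) (blExp e j c) U' M' ∧
          M' 0 j j = (M 0 *ᵥ Function.update c j 1) j ∧
          (∀ i k, i ≠ j → k ≠ j → M' 0 i k = M 0 i k -
            (if i = k then (M 0 *ᵥ Function.update c j 1) j else 0) - c i * M 0 j k) ∧
          ∀ᶠ z in 𝓝 0, z j = 0 → M' z j j = (M 0 *ᵥ Function.update (z + c) j 1) j ∧
            ∀ i, i ≠ j → (M' z *ᵥ z) i = (M 0 *ᵥ Function.update (z + c) j 1) i -
              (z + c) i * (M 0 *ᵥ Function.update (z + c) j 1) j) := by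
  set ell : C3 → ℂ := fun w => U (bl j w) * monom e (bl j w) with hell
  set Gh : C3 → C3 := fun w => M (bl j w) *ᵥ Function.update w j 1 with hGh
  set d : C3 → ℂ := fun w => 1 + ell w * Gh w j with hd
  have hblc : bl j c = 0 := bl_eq_zero hc
  have hbl := analyticAt_bl j c
  have htb : Filter.Tendsto (bl j) (𝓝 c) (𝓝 0) := by
    have := hbl.continuousAt.tendsto; rwa [hblc] at this
  have hUa : AnalyticAt ℂ (fun w => U (bl j w)) c :=
    AnalyticAt.fun_comp (g := U) (by rw [hblc]; exact h.unit) hbl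
  have hMa : ∀ i k, AnalyticAt ℂ (fun w => M (bl j w) i k) c := fun i k =>
    AnalyticAt.fun_comp (g := fun w => M w i k) (by rw [hblc]; exact h.analytic i k) hbl
  have hella : AnalyticAt ℂ ell c := hUa.fun_mul
    (AnalyticAt.fun_comp (g := monom e) (analyticAt_monom e _) hbl)
  have hGha : AnalyticAt ℂ Gh c := analyticAt_mulVec hMa
    (analyticAt_c3.2 fun i => analyticAt_update_one j i c)
  have hGhi := analyticAt_c3.1 hGha
  have hda : AnalyticAt ℂ d c := analyticAt_const.fun_add (hella.fun_mul (hGhi j))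
  have hell0 : ∀ w, w j = 0 → ell w = 0 := fun w hw => by
    simp only [hell, bl_eq_zero hw, monom_zero h.ne, mul_zero]
  have hd0 : d c = 1 := by simp [hd, hell0 c hc]
  have hGh0 : ∀ w, w j = 0 → Gh w = M 0 *ᵥ Function.update w j 1 := fun w hw => by
    simp only [hGh, bl_eq_zero hw]
  set G' : C3 → C3 := fun w i => if i = j then w j * (Gh w j * d w) else Gh w i - w i * Gh w j
    with hG'
  have hG'a : ∀ i, AnalyticAt ℂ (fun w => G' w i) c := by
    intro i
    by_cases hi : i = j
    · simp only [hG', hi, if_true]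
      exact (analyticAt_coord j c).fun_mul ((hGhi j).fun_mul hda)
    · simp only [hG', hi, if_false]
      exact (hGhi i).fun_sub ((analyticAt_coord i c).fun_mul (hGhi j))
  have hform : ∀ w, d w ≠ 0 →
      blLift j (fun w => ell w • Gh w) w = w + (ell w / d w) • G' w := by
    intro w hw
    funext i
    have hw' : 1 + ell w * Gh w j ≠ 0 := hw
    by_cases hi : i = j
    · subst hi
      simp only [blLift, if_true, hG', Pi.add_apply, Pi.smul_apply, smul_eq_mul]
      field_simp
    · simp only [blLift, hi, if_false, hG', Pi.add_apply, Pi.smul_apply, smul_eq_mul]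
      simp only [hd]
      field_simp
      ring
  have hadd : AnalyticAt ℂ (fun z : C3 => z + c) 0 := analyticAt_id.add analyticAt_const
  have hadd0 : (0 : C3) + c = c := zero_add c
  have htadd : Filter.Tendsto (fun z : C3 => z + c) (𝓝 0) (𝓝 c) := by
    simpa using hadd.continuousAt.tendsto
  have shift : ∀ {φ : C3 → ℂ}, AnalyticAt ℂ φ c → AnalyticAt ℂ (fun z => φ (z + c)) 0 :=
    fun {φ} hφ => AnalyticAt.fun_comp (g := φ) (by rw [hadd0]; exact hφ) hadd
  have hdne : ∀ᶠ z in 𝓝 (0 : C3), d (z + c) ≠ 0 :=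
    htadd.eventually (hda.continuousAt.eventually_ne (by rw [hd0]; exact one_ne_zero))
  refine ⟨fun w => ell w • Gh w, ?_, ?_, ?_, ?_, ?_⟩
  · rw [analyticAt_c3]
    exact fun i => hella.fun_mul (hGhi i)
  · filter_upwards [htb.eventually h.eq] with w hw
    rw [hw]
    congr 1
    have h1 : bl j w = w j • Function.update w j 1 := funext fun i => bl_eq_smul j w i
    change ell w • (M (bl j w) *ᵥ bl j w) = w j • ell w • (M (bl j w) *ᵥ Function.update w j 1)
    rw [smul_comm (w j), ← Matrix.mulVec_smul _ (w j), ← h1]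
  · exact Filter.Eventually.of_forall fun w hw => by simp only [hell0 w hw, zero_smul]
  · rintro ⟨i, hij, hi⟩
    refine ⟨fun z => ell (z + c) / d (z + c), fun z => G' (z + c),
      (shift hella).fun_div (shift hda) (by rw [hadd0, hd0]; exact one_ne_zero),
      analyticAt_c3.2 fun i => shift (hG'a i), by simp only [hadd0, hell0 c hc, zero_div], ?_, ?_⟩
    · intro hcon
      have := congrFun hcon i
      simp only [hadd0, hG', hij, if_false, hGh0 c hc, Pi.zero_apply] at this
      exact hi (sub_eq_zero.1 this)
    · filter_upwards [hdne] with z hz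
      rw [hform _ hz]; abel
  · intro hτ
    set σ := (M 0 *ᵥ Function.update c j 1) j with hσ
    have hmul : ∀ i k, k ≠ j → HasDerivAt
        (fun t : ℂ => (M 0 *ᵥ Function.update (Pi.single k t + c) j 1) i) (M 0 i k) 0 := by
      intro i k hk
      have h1 : ∀ t : ℂ, Function.update ((Pi.single k t : C3) + c) j 1 =
          Pi.single k t + Function.update c j 1 := by
        intro t
        funext l
        by_cases hl : l = j
        · subst hl; simp [hk.symm]
        · simp [hl]
      have h2 : (fun t : ℂ => (M 0 *ᵥ Function.update ((Pi.single k t : C3) + c) j 1) i) =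
          fun t => M 0 i k * t + (M 0 *ᵥ Function.update c j 1) i := by
        funext t
        rw [h1, Matrix.mulVec_add, Pi.add_apply, Matrix.mulVec_single]
        simp
      rw [h2]
      simpa using ((hasDerivAt_id' (0 : ℂ)).const_mul (M 0 i k)).add_const
        ((M 0 *ᵥ Function.update c j 1) i)
    have hrow : ∀ i, ∃ r : Fin 3 → C3 → ℂ, (∀ k, AnalyticAt ℂ (r k) 0) ∧
        (∀ᶠ z in 𝓝 0, G' (z + c) i = ∑ k, r k z * z k) ∧
        (blExp e j c i ≠ 0 → ∀ k, k ≠ i → ∀ᶠ z in 𝓝 0, r k z = 0) ∧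
        (i = j → r j 0 = σ ∧ ∀ z, z j = 0 → r j z = (M 0 *ᵥ Function.update (z + c) j 1) j) ∧
        (i ≠ j → ∀ k, k ≠ j → r k 0 = M 0 i k - (if i = k then σ else 0) - c i * M 0 j k) := by
      intro i
      have hjz : ∀ z : C3, z j = 0 → (z + c) j = 0 := fun z hz => by simp [hz, hc]
      have hdz : ∀ z : C3, z j = 0 → d (z + c) = 1 := fun z hz => by
        simp [hd, hell0 _ (hjz z hz)]
      by_cases hi : i = j
      · subst hi
        refine ⟨fun k z => if k = i then Gh (z + c) i * d (z + c) else 0, fun k => ?_, ?_, ?_, ?_,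
          fun h => absurd rfl h⟩
        · by_cases hk : k = i
          · simpa only [hk, if_true] using (shift (hGhi i)).fun_mul (shift hda)
          · simpa only [hk, if_false] using analyticAt_const
        · refine Filter.Eventually.of_forall fun z => ?_
          simp [hG', hc]; ring
        · intro _ k hk
          simp [hk]
        · intro _
          have : ∀ z : C3, z i = 0 → (if i = i then Gh (z + c) i * d (z + c) else 0) =
              (M 0 *ᵥ Function.update (z + c) i 1) i := fun z hz => by
            rw [if_pos rfl, hdz z hz, mul_one, hGh0 _ (hjz z hz)]
          exact ⟨(this 0 rfl).trans (by rw [hadd0]), this⟩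
      · have hG'i : ∀ w, G' w i = Gh w i - w i * Gh w j := fun w => by simp only [hG', hi, if_false]
        by_cases hei : blExp e j c i ≠ 0
        · have hci : c i = 0 := by
            by_contra hci
            exact hei (by simp [blExp, hi, hci])
          have hei' : e i ≠ 0 := by simpa [blExp, hi, hci] using hei
          have hdiag : ∀ᶠ z in 𝓝 (0 : C3), Gh (z + c) i = M (bl j (z + c)) i i * z i := by
            have hall : ∀ᶠ w in 𝓝 (0 : C3), ∀ k, k ≠ i → M w i k = 0 := by
              rw [Filter.eventually_all]
              intro k
              by_cases hk : k = i
              · simp [hk]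
              · simpa [hk] using h.log i k hei' hk
            filter_upwards [htadd.eventually (htb.eventually hall)] with z hz
            simp only [hGh, Matrix.mulVec, dotProduct]
            rw [Finset.sum_eq_single i]
            · rw [Function.update_of_ne hi]; simp [hci]
            · intro k _ hk
              rw [hz k hk, zero_mul]
            · simp
          refine ⟨fun k z => if k = i then M (bl j (z + c)) i i - Gh (z + c) j else 0, fun k => ?_,
            ?_, fun _ k hk => by simp [hk], fun h => absurd h hi, ?_⟩
          · by_cases hk : k = i
            · simpa only [hk, if_true] using (shift (hMa i i)).fun_sub (shift (hGhi j))
            · simpa only [hk, if_false] using analyticAt_const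
          · filter_upwards [hdiag] with z hz
            rw [hG'i, hz]
            simp [hci]; ring
          · intro _ k hk
            by_cases hki : k = i
            · subst hki
              simp only [if_true, hadd0, hblc, hGh0 c hc, hci, zero_mul, sub_zero, hσ]
            · have : i ≠ k := fun h => hki h.symm
              simp [hki, this, hci, h.log_zero hei' hki]
        · push Not at hei
          have hG0 : G' (0 + c) i = 0 := by
            rw [hadd0, hG'i, hGh0 c hc, hτ i hi, sub_self]
          obtain ⟨m, hm, hme, hmd⟩ := hadamard (h := fun z => G' (z + c) i) (shift (hG'a i)) hG0
          refine ⟨m, hm, hme, fun h => absurd hei h, fun h => absurd h hi, fun _ k hk => ?_⟩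
          refine hmd k _ ?_
          have h1 : (fun t : ℂ => G' (Pi.single k t + c) i) = fun t : ℂ =>
              (M 0 *ᵥ Function.update ((Pi.single k t : C3) + c) j 1) i -
              ((Pi.single k t : C3) i + c i) *
                (M 0 *ᵥ Function.update ((Pi.single k t : C3) + c) j 1) j := by
            funext t
            rw [hG'i, hGh0 _ (hjz _ (by simp [hk.symm])), Pi.add_apply]
          rw [h1]
          have h2 := (hmul i k hk).fun_sub
            (((hasDerivAt_pi.1 (hasDerivAt_single k) i).add_const (c i)).fun_mul (hmul j k hk))
          refine h2.congr_deriv ?_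
          simp only [Pi.single_zero, Pi.zero_apply, zero_add, ← hσ]
          by_cases hik : i = k
          · subst hik; simp; ring
          · simp [hik]
    choose r hr1 hr2 hr3 hr4 hr5 using hrow
    refine ⟨fun z => U (bl j (z + c)) / d (z + c) *
      ∏ i, (if i ≠ j ∧ c i ≠ 0 then (z i + c i) ^ e i else 1),
      fun z => Matrix.of fun i k => r i k z, ⟨?_, ?_, fun i k => hr1 i k, ⟨j, ?_⟩, ?_, ?_⟩, ?_, ?_, ?_⟩
    · refine ((shift hUa).fun_div (shift hda) (by rw [hadd0, hd0]; exact one_ne_zero)).fun_mul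
        (Finset.analyticAt_fun_prod _ fun i _ => ?_)
      by_cases hi : i ≠ j ∧ c i ≠ 0
      · simp only [if_pos hi]
        simpa using ((analyticAt_coord i 0).fun_add analyticAt_const).fun_pow (e i)
      · simpa only [if_neg hi] using analyticAt_const
    · simp only [hadd0, hblc, hd0, div_one]
      refine mul_ne_zero h.unit_ne (Finset.prod_ne_zero_iff.2 fun i _ => ?_)
      by_cases hi : i ≠ j ∧ c i ≠ 0
      · simp only [if_pos hi]
        simpa using fun h => absurd h hi.2
      · simp only [if_neg hi]; exact one_ne_zero
    · obtain ⟨i, hi⟩ := h.ne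
      rw [show blExp e j c j = ∑ k, e k from if_pos rfl]
      exact fun h => hi (Finset.sum_eq_zero_iff.1 h i (Finset.mem_univ i))
    · exact fun i k hi hk => hr3 i hi k hk
    · have hall : ∀ᶠ z in 𝓝 (0 : C3), ∀ i, G' (z + c) i = ∑ k, r i k z * z k :=
        Filter.eventually_all.2 hr2
      filter_upwards [hdne, hall] with z h1 h2
      rw [hform _ h1]
      have h3 : G' (z + c) = (Matrix.of fun i k => r i k z) *ᵥ z := funext h2
      have h4 : ell (z + c) / d (z + c) = U (bl j (z + c)) / d (z + c) *
          (∏ i, (if i ≠ j ∧ c i ≠ 0 then (z i + c i) ^ e i else 1)) * monom (blExp e j c) z := by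
        change U (bl j (z + c)) * monom e (bl j (z + c)) / _ = _
        rw [monom_bl_add e hc]; ring
      rw [h3, h4]; abel
    · exact (hr4 j rfl).1
    · exact fun i k hi hk => hr5 i hi k hk
    · have hall : ∀ᶠ z in 𝓝 (0 : C3), ∀ i, G' (z + c) i = ∑ k, r i k z * z k :=
        Filter.eventually_all.2 hr2
      filter_upwards [hall] with z h2 hz
      refine ⟨(hr4 j rfl).2 z hz, fun i hi => ?_⟩
      have h3 : ((Matrix.of fun i k => r i k z) *ᵥ z) i = G' (z + c) i := (h2 i).symm
      rw [h3, show G' (z + c) i = Gh (z + c) i - (z + c) i * Gh (z + c) j from if_neg hi]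
      rw [hGh0 (z + c) (by simp [hz, hc])]

end LogForm

/-! ### Linear changes of coordinates in logarithmic forms -/

section Linear

variable {F : C3 → C3} {e : Fin 3 → ℕ} {U : C3 → ℂ} {M : C3 → Matrix (Fin 3) (Fin 3) ℂ}

theorem IsLogForm.linear (h : IsLogForm F e U M) (T : C3 ≃L[ℂ] C3) {e' : Fin 3 → ℕ} {κ : ℂ}
    (hκ : κ ≠ 0) (hm : ∀ z, monom e (T.symm z) = κ * monom e' z) (he' : ∃ i, e' i ≠ 0)
    {M' : C3 → Matrix (Fin 3) (Fin 3) ℂ} (ha : ∀ i k, AnalyticAt ℂ (fun w => M' w i k) 0)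
    (hl : ∀ i k, e' i ≠ 0 → k ≠ i → ∀ᶠ w in 𝓝 0, M' w i k = 0)
    (hM' : ∀ z, M' z *ᵥ z = T (M (T.symm z) *ᵥ T.symm z)) :
    IsLogForm (fun z => T (F (T.symm z))) e' (fun z => κ * U (T.symm z)) M' := by
  have hT : AnalyticAt ℂ T.symm 0 := (T.symm : C3 →L[ℂ] C3).analyticAt 0
  refine ⟨analyticAt_const.fun_mul (AnalyticAt.fun_comp (g := U) (by simpa using h.unit) hT),
    mul_ne_zero hκ (by simpa using h.unit_ne), ha, he', hl, ?_⟩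
  have ht : Filter.Tendsto T.symm (𝓝 0) (𝓝 0) := by simpa using hT.continuousAt.tendsto
  filter_upwards [ht.eventually h.eq] with z hz
  rw [hz, map_add, T.apply_symm_apply, map_smul, hM', hm]
  congr 2
  ring

theorem analyticAt_comp_linear {φ : C3 → ℂ} (hφ : AnalyticAt ℂ φ 0) (T : C3 ≃L[ℂ] C3) :
    AnalyticAt ℂ (fun z => φ (T.symm z)) 0 :=
  AnalyticAt.fun_comp (g := φ) (by simpa using hφ) ((T.symm : C3 →L[ℂ] C3).analyticAt 0)

theorem tendsto_linear (T : C3 ≃L[ℂ] C3) : Filter.Tendsto T.symm (𝓝 0) (𝓝 0) := by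
  simpa using T.symm.continuous.tendsto 0

/-- The permutation of the coordinates by `σ`. -/
def permEquiv (σ : Equiv.Perm (Fin 3)) : C3 ≃L[ℂ] C3 :=
  (LinearEquiv.funCongrLeft ℂ ℂ σ).toContinuousLinearEquiv

theorem permEquiv_symm_apply (σ : Equiv.Perm (Fin 3)) (w : C3) :
    (permEquiv σ).symm w = w ∘ σ.symm := rfl

theorem IsLogForm.perm (h : IsLogForm F e U M) (σ : Equiv.Perm (Fin 3)) :
    IsLogForm (fun z => permEquiv σ (F ((permEquiv σ).symm z))) (e ∘ σ)
      (fun z => 1 * U ((permEquiv σ).symm z))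
      (fun z => (M ((permEquiv σ).symm z)).submatrix σ σ) := by
  refine h.linear (permEquiv σ) one_ne_zero (fun z => ?_) ?_ (fun i k => ?_) (fun i k hi hk => ?_)
    fun z => ?_
  · rw [one_mul, permEquiv_symm_apply, monom, monom, ← Equiv.prod_comp σ]
    simp
  · obtain ⟨i, hi⟩ := h.ne
    exact ⟨σ.symm i, by simpa using hi⟩
  · exact analyticAt_comp_linear (h.analytic (σ i) (σ k)) _
  · exact (tendsto_linear (permEquiv σ)).eventually (h.log (σ i) (σ k) hi (by simpa using hk))
  · rw [Matrix.submatrix_mulVec_equiv]; rfl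

theorem exists_perm {i k l : Fin 3} (hik : i ≠ k) (hil : i ≠ l) (hkl : k ≠ l) :
    ∃ σ : Equiv.Perm (Fin 3), σ 0 = i ∧ σ 1 = k ∧ σ 2 = l := by
  revert i k l; decide

/-- The linear automorphism with matrix `A` and inverse matrix `B`. -/
def matEquiv (A B : Matrix (Fin 3) (Fin 3) ℂ) (h : A * B = 1) (h' : B * A = 1) : C3 ≃L[ℂ] C3 :=
  (Matrix.toLin'OfInv h' h).toContinuousLinearEquiv

theorem matEquiv_apply {A B : Matrix (Fin 3) (Fin 3) ℂ} (h : A * B = 1) (h' : B * A = 1) (w : C3) :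
    matEquiv A B h h' w = A *ᵥ w :=
  Matrix.toLin'_apply A w

theorem matEquiv_symm_apply {A B : Matrix (Fin 3) (Fin 3) ℂ} (h : A * B = 1) (h' : B * A = 1)
    (w : C3) : (matEquiv A B h h').symm w = B *ᵥ w :=
  Matrix.toLin'_apply B w

theorem analyticAt_conj (h : IsLogForm F e U M) {A B : Matrix (Fin 3) (Fin 3) ℂ} (T : C3 ≃L[ℂ] C3)
    (i k : Fin 3) : AnalyticAt ℂ (fun z => (A * M (T.symm z) * B) i k) 0 := by
  simp only [Matrix.mul_apply]
  refine Finset.analyticAt_fun_sum _ fun q _ => AnalyticAt.fun_mul ?_ analyticAt_const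
  exact Finset.analyticAt_fun_sum _ fun r _ => analyticAt_const.fun_mul
    (analyticAt_comp_linear (h.analytic r q) T)

/-- The shear `x ↦ x + s y + t z`. -/
def shearMat (s t : ℂ) : Matrix (Fin 3) (Fin 3) ℂ := 
  Matrix.of fun i k => if i = k then 1 else if i = 0 then (if k = 1 then s else t) else 0

theorem shearMat_mul (s t : ℂ) : shearMat s t * shearMat (-s) (-t) = 1 := by
  ext i j; fin_cases i <;> fin_cases j <;> simp [shearMat, Matrix.mul_apply, Fin.sum_univ_three]

theorem shearMat_mul' (s t : ℂ) : shearMat (-s) (-t) * shearMat s t = 1 := by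
  ext i j; fin_cases i <;> fin_cases j <;> simp [shearMat, Matrix.mul_apply, Fin.sum_univ_three]

/-- The shear `x ↦ x + s y + t z` as a linear automorphism. -/
def shear (s t : ℂ) : C3 ≃L[ℂ] C3 := matEquiv _ _ (shearMat_mul s t) (shearMat_mul' s t)

theorem shear_symm_apply (s t : ℂ) (w : C3) :
    (shear s t).symm w = ![w 0 - s * w 1 - t * w 2, w 1, w 2] := by
  rw [shear, matEquiv_symm_apply]
  funext i
  fin_cases i <;> simp [shearMat, Matrix.mulVec, dotProduct, Fin.sum_univ_three]
  ring

theorem shear_apply (s t : ℂ) (w : C3) :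
    shear s t w = ![w 0 + s * w 1 + t * w 2, w 1, w 2] := by
  rw [shear, matEquiv_apply]
  funext i
  fin_cases i <;> simp [shearMat, Matrix.mulVec, dotProduct, Fin.sum_univ_three]

theorem IsLogForm.shear (h : IsLogForm F e U M) (h0 : e 0 = 0) (s t : ℂ) :
    IsLogForm (fun z => shear s t (F ((shear s t).symm z))) e
      (fun z => 1 * U ((shear s t).symm z))
      (fun z => shearMat s t * M ((shear s t).symm z) * shearMat (-s) (-t)) := by
  refine h.linear (TangentToId.shear s t) one_ne_zero (fun z => ?_) h.ne
    (analyticAt_conj h (TangentToId.shear s t)) (fun i k hi hk => ?_) fun z => ?_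
  · simp [monom, shear_symm_apply, Fin.prod_univ_three, h0]
  · have hi0 : i ≠ 0 := by rintro rfl; exact hi h0
    have hall : ∀ᶠ w in 𝓝 (0 : C3), ∀ k, k ≠ i → M w i k = 0 := by
      rw [Filter.eventually_all]
      intro k
      by_cases hk : k = i
      · simp [hk]
      · simpa [hk] using h.log i k hi hk
    filter_upwards [(tendsto_linear (TangentToId.shear s t)).eventually hall] with z hz
    have h1 := hz 0 hi0.symm
    have h2 := hz k hk
    fin_cases i <;> fin_cases k <;>
      simp_all [shearMat, Matrix.mul_apply]
  · rw [← Matrix.mulVec_mulVec, ← Matrix.mulVec_mulVec, TangentToId.shear, matEquiv_apply,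
      matEquiv_symm_apply]

theorem shearMat_conj (s t : ℂ) (A : Matrix (Fin 3) (Fin 3) ℂ) :
    shearMat s t * A * shearMat (-s) (-t) =
      !![A 0 0 + s * A 1 0 + t * A 2 0,
        A 0 1 + s * A 1 1 + t * A 2 1 - s * (A 0 0 + s * A 1 0 + t * A 2 0),
        A 0 2 + s * A 1 2 + t * A 2 2 - t * (A 0 0 + s * A 1 0 + t * A 2 0);
        A 1 0, A 1 1 - s * A 1 0, A 1 2 - t * A 1 0;
        A 2 0, A 2 1 - s * A 2 0, A 2 2 - t * A 2 0] := by
  ext i j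
  fin_cases i <;> fin_cases j <;>
    simp [shearMat, Matrix.mul_apply, Fin.sum_univ_three] <;> ring

theorem diag_mul {t : C3} (ht : ∀ i, t i ≠ 0) :
    Matrix.diagonal t * Matrix.diagonal t⁻¹ = (1 : Matrix (Fin 3) (Fin 3) ℂ) := by
  rw [Matrix.diagonal_mul_diagonal, ← Matrix.diagonal_one]
  congr 1; funext i; simp [ht i]

theorem diag_mul' {t : C3} (ht : ∀ i, t i ≠ 0) :
    Matrix.diagonal t⁻¹ * Matrix.diagonal t = (1 : Matrix (Fin 3) (Fin 3) ℂ) := by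
  rw [Matrix.diagonal_mul_diagonal, ← Matrix.diagonal_one]
  congr 1; funext i; simp [ht i]

/-- The rescaling of the coordinates by the factors `t i`. -/
def rescale (t : C3) (ht : ∀ i, t i ≠ 0) : C3 ≃L[ℂ] C3 := matEquiv _ _ (diag_mul ht) (diag_mul' ht)

theorem rescale_symm_apply {t : C3} (ht : ∀ i, t i ≠ 0) (w : C3) :
    (rescale t ht).symm w = fun i => (t i)⁻¹ * w i := by
  rw [rescale, matEquiv_symm_apply]
  funext i; simp [Matrix.mulVec_diagonal]

theorem IsLogForm.rescale (h : IsLogForm F e U M) {t : C3} (ht : ∀ i, t i ≠ 0) :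
    IsLogForm (fun z => rescale t ht (F ((rescale t ht).symm z))) e
      (fun z => monom e t⁻¹ * U ((rescale t ht).symm z))
      (fun z => Matrix.diagonal t * M ((rescale t ht).symm z) * Matrix.diagonal t⁻¹) := by
  refine h.linear (TangentToId.rescale t ht) ?_ (fun z => ?_) h.ne
    (analyticAt_conj h (TangentToId.rescale t ht)) (fun i k hi hk => ?_) fun z => ?_
  · exact Finset.prod_ne_zero_iff.2 fun i _ => pow_ne_zero _ (inv_ne_zero (ht i))
  · simp only [monom, rescale_symm_apply, mul_pow, Finset.prod_mul_distrib, Pi.inv_apply]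
  · filter_upwards [(tendsto_linear (TangentToId.rescale t ht)).eventually (h.log i k hi hk)]
      with z hz
    simp [Matrix.diagonal_mul, Matrix.mul_diagonal, hz]
  · rw [← Matrix.mulVec_mulVec, ← Matrix.mulVec_mulVec, TangentToId.rescale, matEquiv_apply,
      matEquiv_symm_apply]

theorem IsLogForm.exists_rescale (h : IsLogForm F e U M) {k : Fin 3} (hk : e k ≠ 0) {a : ℂ}
    (ha : a ≠ 0) : ∃ (t : C3) (_ : ∀ i, t i ≠ 0), (∀ i, i ≠ k → t i = 1) ∧
      monom e t⁻¹ * U 0 * a = 1 := by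
  obtain ⟨ρ, hρ⟩ := IsAlgClosed.exists_pow_nat_eq (U 0 * a) (Nat.pos_of_ne_zero hk)
  have hρ0 : ρ ≠ 0 := by
    rintro rfl
    rw [zero_pow hk] at hρ
    exact mul_ne_zero h.unit_ne ha hρ.symm
  refine ⟨Function.update 1 k ρ, fun i => ?_, fun i hi => by simp [hi], ?_⟩
  · by_cases hi : i = k
    · subst hi; simpa using hρ0
    · simp [hi]
  · have : monom e (Function.update 1 k ρ)⁻¹ = (ρ ^ e k)⁻¹ := by
      rw [monom, Finset.prod_eq_single k]
      · simp
      · intro i _ hi; simp [hi]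
      · simp
    rw [this, hρ, mul_assoc, inv_mul_cancel₀ (mul_ne_zero h.unit_ne ha)]

end Linear

/-! ### Types of logarithmic forms -/

/-- Nondegenerate corners along two exceptional components. -/
def CondA (i k : Fin 3) (e : Fin 3 → ℕ) (M : C3 → Matrix (Fin 3) (Fin 3) ℂ) : Prop :=
  e i ≠ 0 ∧ e k ≠ 0 ∧ M 0 i i ≠ 0 ∧ ∀ r : ℚ, 0 < r → M 0 k k ≠ M 0 i i * (r : ℂ)

/-- A saddle-node whose strong direction is transverse to the exceptional divisor. -/
def CondZ (i k l : Fin 3) (e : Fin 3 → ℕ) (M : C3 → Matrix (Fin 3) (Fin 3) ℂ) : Prop :=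
  e i = 0 ∧ e k ≠ 0 ∧ M 0 i i ≠ 0 ∧ M 0 k k = 0 ∧ M 0 l i = 0 ∧ M 0 l l = 0

/-- Two opposite eigenvalues tangent to the exceptional divisor. -/
def CondD (i k l : Fin 3) (e : Fin 3 → ℕ) (M : C3 → Matrix (Fin 3) (Fin 3) ℂ) : Prop :=
  e i = 0 ∧ e l = 0 ∧ e k ≠ 0 ∧ M 0 i i ≠ 0 ∧ M 0 k k = 0 ∧ M 0 l l = - M 0 i i ∧ M 0 i l = 0 ∧
    M 0 l i = 0

/-- Saddle-nodes on two exceptional components. -/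
def CondB (i k l : Fin 3) (e : Fin 3 → ℕ) (M : C3 → Matrix (Fin 3) (Fin 3) ℂ) : Prop :=
  e i = 0 ∧ e k ≠ 0 ∧ e l ≠ 0 ∧ M 0 i i ≠ 0 ∧ M 0 k k = 0 ∧ M 0 l l = 0

/-- Saddle-nodes at the generic point of a singular curve in one exceptional component. -/
def CondH (i k l : Fin 3) (e : Fin 3 → ℕ) (M : C3 → Matrix (Fin 3) (Fin 3) ℂ) : Prop :=
  e i = 0 ∧ e k ≠ 0 ∧ e l = 0 ∧ M 0 i i ≠ 0 ∧ (∀ᶠ z in 𝓝 0, z k = 0 → M z k k = 0) ∧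
    ∀ᶠ z in 𝓝 0, z k = 0 → (M z *ᵥ z) l = 0

/-- Germs with a logarithmic form satisfying `K`. -/
def LogType (K : (Fin 3 → ℕ) → (C3 → Matrix (Fin 3) (Fin 3) ℂ) → Prop) (F : C3 → C3) : Prop :=
  ∃ e U M, IsLogForm F e U M ∧ K e M

/-- Germs of type `A`. -/
def TypeA (F : C3 → C3) : Prop := ∃ i k, i ≠ k ∧ LogType (CondA i k) F

/-- Germs of type `Z`. -/
def TypeZ (F : C3 → C3) : Prop := ∃ i k l, i ≠ k ∧ i ≠ l ∧ k ≠ l ∧ LogType (CondZ i k l) F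

/-- Germs of type `D`. -/
def TypeD (F : C3 → C3) : Prop := ∃ i k l, i ≠ k ∧ i ≠ l ∧ k ≠ l ∧ LogType (CondD i k l) F

/-- Germs of type `B`. -/
def TypeB (F : C3 → C3) : Prop := ∃ i k l, i ≠ k ∧ i ≠ l ∧ k ≠ l ∧ LogType (CondB i k l) F

/-- Germs of type `H`. -/
def TypeH (F : C3 → C3) : Prop := ∃ i k l, i ≠ k ∧ i ≠ l ∧ k ≠ l ∧ LogType (CondH i k l) F

theorem LogType.congr {K : (Fin 3 → ℕ) → (C3 → Matrix (Fin 3) (Fin 3) ℂ) → Prop} {F F' : C3 → C3}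
    (h : LogType K F) (hF : F =ᶠ[𝓝 0] F') : LogType K F' := by
  obtain ⟨e, U, M, h1, h2⟩ := h
  exact ⟨e, U, M, h1.congr hF, h2⟩

theorem isGermProp_typeA : IsGermProp TypeA := fun _ _ e ⟨i, k, h, h'⟩ => ⟨i, k, h, h'.congr e⟩

theorem isGermProp_typeZ : IsGermProp TypeZ :=
  fun _ _ e ⟨i, k, l, h1, h2, h3, h⟩ => ⟨i, k, l, h1, h2, h3, h.congr e⟩

theorem isGermProp_typeD : IsGermProp TypeD :=
  fun _ _ e ⟨i, k, l, h1, h2, h3, h⟩ => ⟨i, k, l, h1, h2, h3, h.congr e⟩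

theorem isGermProp_typeB : IsGermProp TypeB :=
  fun _ _ e ⟨i, k, l, h1, h2, h3, h⟩ => ⟨i, k, l, h1, h2, h3, h.congr e⟩

theorem isGermProp_typeH : IsGermProp TypeH :=
  fun _ _ e ⟨i, k, l, h1, h2, h3, h⟩ => ⟨i, k, l, h1, h2, h3, h.congr e⟩

theorem TypeB.typeZ {F : C3 → C3} (h : TypeB F) : TypeZ F := by
  obtain ⟨i, k, l, h1, h2, h3, e, U, M, hF, h4, h5, h6, h7, h8, h9⟩ := h
  exact ⟨i, k, l, h1, h2, h3, e, U, M, hF, h4, h5, h7, h8, hF.log_zero h6 h2, h9⟩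

theorem IsLogForm.row_zero {F : C3 → C3} {e : Fin 3 → ℕ} {U : C3 → ℂ}
    {M : C3 → Matrix (Fin 3) (Fin 3) ℂ} (h : IsLogForm F e U M) {k l m : Fin 3} (hm : m ≠ k)
    (h0 : ∀ᶠ z in 𝓝 0, z k = 0 → (M z *ᵥ z) l = 0) : M 0 l m = 0 := by
  have h1 := hasDerivAt_sum_single (r := fun q w => M w l q) (h.analytic l) m
  have h2 : (fun t : ℂ => ∑ q, M (Pi.single m t) l q * (Pi.single m t : C3) q) =ᶠ[𝓝 0]
      fun _ => 0 := by
    have ht : Filter.Tendsto (fun t : ℂ => (Pi.single m t : C3)) (𝓝 0) (𝓝 0) := by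
      have := (hasDerivAt_single m).continuousAt.tendsto
      simpa using this
    filter_upwards [ht.eventually h0] with t h3
    exact h3 (by simp [hm.symm])
  exact (h1.congr_of_eventuallyEq h2.symm).unique (hasDerivAt_const _ _)

theorem TypeH.typeZ {F : C3 → C3} (h : TypeH F) : TypeZ F := by
  obtain ⟨i, k, l, h1, h2, h3, e, U, M, hF, h4, h5, h6, h7, h8, h9⟩ := h
  exact ⟨i, k, l, h1, h2, h3, e, U, M, hF, h4, h5, h7, h8.self_of_nhds rfl, hF.row_zero h1 h9,
    hF.row_zero h3.symm h9⟩

section Normalize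

variable {F : C3 → C3} {e : Fin 3 → ℕ} {U : C3 → ℂ} {M : C3 → Matrix (Fin 3) (Fin 3) ℂ}

theorem shear_conj_mulVec (s t : ℂ) (A : Matrix (Fin 3) (Fin 3) ℂ) (z : C3) :
    (shearMat s t * A * shearMat (-s) (-t)) *ᵥ z = shear s t (A *ᵥ (shear s t).symm z) := by
  rw [← Matrix.mulVec_mulVec, ← Matrix.mulVec_mulVec, shear, matEquiv_apply, matEquiv_symm_apply]

theorem exists_perm_pair {i k : Fin 3} (hik : i ≠ k) :
    ∃ σ : Equiv.Perm (Fin 3), σ 0 = i ∧ σ 1 = k := by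
  revert i k; decide

theorem TypeA.perm (h : TypeA F) :
    ∃ T : C3 ≃L[ℂ] C3, LogType (CondA 0 1) fun z => T (F (T.symm z)) := by
  obtain ⟨i, k, hik, e, U, M, hF, h1, h2, h3, h4⟩ := h
  obtain ⟨σ, rfl, rfl⟩ := exists_perm_pair hik
  exact ⟨_, _, _, _, hF.perm σ, h1, h2, by simpa using h3, by simpa using h4⟩

theorem TypeZ.perm (h : TypeZ F) :
    ∃ T : C3 ≃L[ℂ] C3, LogType (CondZ 0 1 2) fun z => T (F (T.symm z)) := by
  obtain ⟨i, k, l, h1, h2, h3, e, U, M, hF, h4, h5, h6, h7, h8, h9⟩ := h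
  obtain ⟨σ, rfl, rfl, rfl⟩ := exists_perm h1 h2 h3
  exact ⟨_, _, _, _, hF.perm σ, h4, h5, by simpa using h6, by simpa using h7, by simpa using h8,
    by simpa using h9⟩

theorem TypeD.perm (h : TypeD F) :
    ∃ T : C3 ≃L[ℂ] C3, LogType (CondD 0 1 2) fun z => T (F (T.symm z)) := by
  obtain ⟨i, k, l, h1, h2, h3, e, U, M, hF, h4, h5, h6, h7, h8, h9, h10, h11⟩ := h
  obtain ⟨σ, rfl, rfl, rfl⟩ := exists_perm h1 h2 h3
  exact ⟨_, _, _, _, hF.perm σ, h4, h5, h6, by simpa using h7, by simpa using h8,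
    by simpa using h9, by simpa using h10, by simpa using h11⟩

theorem TypeB.perm (h : TypeB F) :
    ∃ T : C3 ≃L[ℂ] C3, LogType (CondB 0 1 2) fun z => T (F (T.symm z)) := by
  obtain ⟨i, k, l, h1, h2, h3, e, U, M, hF, h4, h5, h6, h7, h8, h9⟩ := h
  obtain ⟨σ, rfl, rfl, rfl⟩ := exists_perm h1 h2 h3
  exact ⟨_, _, _, _, hF.perm σ, h4, h5, h6, by simpa using h7, by simpa using h8,
    by simpa using h9⟩

theorem TypeH.perm (h : TypeH F) :
    ∃ T : C3 ≃L[ℂ] C3, LogType (CondH 0 2 1) fun z => T (F (T.symm z)) := by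
  obtain ⟨i, k, l, h1, h2, h3, e, U, M, hF, h4, h5, h6, h7, h8, h9⟩ := h
  obtain ⟨σ, rfl, rfl, rfl⟩ := exists_perm h2 h1 h3.symm
  refine ⟨_, _, _, _, hF.perm σ, h4, h5, h6, by simpa using h7, ?_, ?_⟩
  · filter_upwards [(tendsto_linear (permEquiv σ)).eventually h8] with z hz hz0
    exact hz (by simpa [permEquiv_symm_apply] using hz0)
  · filter_upwards [(tendsto_linear (permEquiv σ)).eventually h9] with z hz hz0
    rw [Matrix.submatrix_mulVec_equiv]
    exact hz (by simpa [permEquiv_symm_apply] using hz0)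

/-- Type `Z` with diagonalized strong direction. -/
def CondZ' (e : Fin 3 → ℕ) (M : C3 → Matrix (Fin 3) (Fin 3) ℂ) : Prop :=
  CondZ 0 1 2 e M ∧ M 0 0 1 = 0 ∧ M 0 0 2 = 0

theorem LogType.shear_Z (h : LogType (CondZ 0 1 2) F) :
    ∃ T : C3 ≃L[ℂ] C3, LogType CondZ' fun z => T (F (T.symm z)) := by
  obtain ⟨e, U, M, hF, h4, h5, h6, h7, h8, h9⟩ := h
  have l1 := hF.log_zero h5 (show (0 : Fin 3) ≠ 1 by decide)
  have l2 := hF.log_zero h5 (show (2 : Fin 3) ≠ 1 by decide)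
  set t := M 0 0 2 / M 0 0 0
  set s := (M 0 0 1 + t * M 0 2 1) / M 0 0 0
  refine ⟨_, _, _, _, hF.shear h4 s t, ⟨h4, h5, ?_, ?_, ?_, ?_⟩, ?_, ?_⟩ <;>
    simp only [map_zero, shearMat_conj] <;> simp [h6, h7, h8, h9, l1, l2]
  · simp only [s]; field_simp; ring
  · simp only [t]; field_simp; ring

/-- Type `B` with diagonalized and normalized strong direction. -/
theorem LogType.shear_B (h : LogType (CondB 0 1 2) F) :
    ∃ T : C3 ≃L[ℂ] C3, LogType (fun e M => CondB 0 1 2 e M ∧ M 0 0 1 = 0 ∧ M 0 0 2 = 0)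
      fun z => T (F (T.symm z)) := by
  obtain ⟨e, U, M, hF, h4, h5, h6, h7, h8, h9⟩ := h
  have l1 := hF.log_zero h5 (show (0 : Fin 3) ≠ 1 by decide)
  have l2 := hF.log_zero h5 (show (2 : Fin 3) ≠ 1 by decide)
  have l3 := hF.log_zero h6 (show (0 : Fin 3) ≠ 2 by decide)
  have l4 := hF.log_zero h6 (show (1 : Fin 3) ≠ 2 by decide)
  set t := M 0 0 2 / M 0 0 0
  set s := M 0 0 1 / M 0 0 0
  refine ⟨_, _, _, _, hF.shear h4 s t, ⟨h4, h5, h6, ?_, ?_, ?_⟩, ?_, ?_⟩ <;>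
    simp only [map_zero, shearMat_conj] <;> simp [h7, h8, h9, l1, l2, l3, l4]
  · simp only [s]; field_simp; ring
  · simp only [t]; field_simp; ring

theorem LogType.shear_H (h : LogType (CondH 0 2 1) F) :
    ∃ T : C3 ≃L[ℂ] C3, LogType (fun e M => CondH 0 2 1 e M ∧ M 0 0 1 = 0 ∧ M 0 0 2 = 0)
      fun z => T (F (T.symm z)) := by
  obtain ⟨e, U, M, hF, h4, h5, h6, h7, h8, h9⟩ := h
  have l1 := hF.row_zero (show (0 : Fin 3) ≠ 2 by decide) h9
  have l2 := hF.row_zero (show (1 : Fin 3) ≠ 2 by decide) h9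
  have l3 := hF.log_zero h5 (show (0 : Fin 3) ≠ 2 by decide)
  have l4 := hF.log_zero h5 (show (1 : Fin 3) ≠ 2 by decide)
  have l5 := h8.self_of_nhds rfl
  set s := M 0 0 1 / M 0 0 0
  set t := (M 0 0 2 + s * M 0 1 2) / M 0 0 0
  refine ⟨_, _, _, _, hF.shear h4 s t, ⟨h4, h5, h6, ?_, ?_, ?_⟩, ?_, ?_⟩
  · simp only [map_zero, shearMat_conj]; simp [h7, l1, l3]
  · filter_upwards [(tendsto_linear (shear s t)).eventually h8, (tendsto_linear
      (shear s t)).eventually (hF.log 2 0 h5 (show (0 : Fin 3) ≠ 2 by decide))] with z h10 h11 h12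
    rw [shearMat_conj]
    simp [h11, h10 (by simpa [shear_symm_apply] using h12)]
  · filter_upwards [(tendsto_linear (shear s t)).eventually h9] with z h10 h12
    rw [shear_conj_mulVec, shear_apply]
    simpa using h10 (by simpa [shear_symm_apply] using h12)
  · simp only [map_zero, shearMat_conj]; simp [l1, l2, l3, l4]
    simp only [s]; field_simp; ring
  · simp only [map_zero, shearMat_conj]; simp [l1, l3, l5]
    simp only [t]; field_simp; ring

theorem IsLogForm.rescale_one (h : IsLogForm F e U M) {k : Fin 3} (hk : e k ≠ 0)
    (h00 : M 0 0 0 ≠ 0) (h01 : M 0 0 1 = 0) (h02 : M 0 0 2 = 0) :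
    ∃ (t : C3) (ht : ∀ i, t i ≠ 0) (U' : C3 → ℂ) (M' : C3 → Matrix (Fin 3) (Fin 3) ℂ),
      IsLogForm (fun z => TangentToId.rescale t ht (F ((TangentToId.rescale t ht).symm z))) e U' M' ∧
      U' 0 * M' 0 0 0 = 1 ∧ M' 0 0 1 = 0 ∧ M' 0 0 2 = 0 ∧
      (∀ z i, M' z i i = M ((TangentToId.rescale t ht).symm z) i i) ∧
      ∀ z, M' z *ᵥ z = fun i => t i * (M ((TangentToId.rescale t ht).symm z) *ᵥ
        (TangentToId.rescale t ht).symm z) i := by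
  obtain ⟨t, ht, -, h2⟩ := h.exists_rescale hk h00
  refine ⟨t, ht, _, _, h.rescale ht, ?_, ?_, ?_, ?_, ?_⟩
  · rw [← h2]; simp [Matrix.diagonal_mul, Matrix.mul_diagonal]
    left; field_simp [ht 0]
  · simp [Matrix.diagonal_mul, Matrix.mul_diagonal, h01]
  · simp [Matrix.diagonal_mul, Matrix.mul_diagonal, h02]
  · intro z i
    simp only [Matrix.diagonal_mul, Matrix.mul_diagonal, Pi.inv_apply]
    field_simp [ht i]
  · intro z
    rw [← Matrix.mulVec_mulVec, ← Matrix.mulVec_mulVec]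
    funext i
    rw [Matrix.mulVec_diagonal, TangentToId.rescale, matEquiv_symm_apply]

theorem hasFDerivAt_sum_coord {r : Fin 3 → C3 → ℂ} (hr : ∀ k, AnalyticAt ℂ (r k) 0) :
    HasFDerivAt (fun w : C3 => ∑ k, r k w * w k)
      (∑ k, r k 0 • (ContinuousLinearMap.proj k : C3 →L[ℂ] ℂ)) 0 := by
  refine HasFDerivAt.fun_sum fun k _ => ?_
  have h1 := (hr k).differentiableAt.hasFDerivAt.fun_mul
    (ContinuousLinearMap.proj (R := ℂ) (φ := fun _ : Fin 3 => ℂ) k).hasFDerivAt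
  refine h1.congr_fderiv ?_
  ext v; simp

theorem IsLogForm.inM2 (h : IsLogForm F e U M) (h0 : U 0 * M 0 0 0 = 1) (h1 : M 0 0 1 = 0)
    (h2 : M 0 0 2 = 0) : InM2 fun w => U w * (M w *ᵥ w) 0 - w 0 := by
  have ha : AnalyticAt ℂ (fun w => (M w *ᵥ w) 0) 0 :=
    analyticAt_c3.1 (analyticAt_mulVec h.analytic analyticAt_id) 0
  have hr : ∀ k, AnalyticAt ℂ (fun w => U w * M w 0 k) 0 := fun k => h.unit.fun_mul (h.analytic 0 k)
  refine ⟨(h.unit.fun_mul ha).fun_sub (analyticAt_coord 0 0), by simp, ?_⟩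
  have e1 : (fun w => U w * (M w *ᵥ w) 0 - w 0) = fun w : C3 =>
      (∑ k, (U w * M w 0 k) * w k) - w 0 := by
    funext w
    simp only [Matrix.mulVec, dotProduct, Finset.mul_sum, mul_assoc]
  rw [e1]
  have e2 := (hasFDerivAt_sum_coord hr).fun_sub
    (ContinuousLinearMap.proj (R := ℂ) (φ := fun _ : Fin 3 => ℂ) 0).hasFDerivAt
  have e3 := e2.fderiv
  simp only [ContinuousLinearMap.proj_apply] at e3
  rw [e3, Fin.sum_univ_three, h0, h1, h2]
  ext v; simp

theorem LogType.rescale_B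
    (h : LogType (fun e M => CondB 0 1 2 e M ∧ M 0 0 1 = 0 ∧ M 0 0 2 = 0) F) :
    ∃ T : C3 ≃L[ℂ] C3, SpinningCornerForm fun z => T (F (T.symm z)) := by
  obtain ⟨e, U, M, hF, ⟨h4, h5, h6, h7, h8, h9⟩, h10, h11⟩ := h
  obtain ⟨t, ht, U', M', hF', h12, h13, h14, h15, -⟩ :=
    hF.rescale_one h5 h7 h10 h11
  refine ⟨rescale t ht, e 1, e 2, _, fun w => U' w * M' w 1 1, fun w => U' w * M' w 2 2,
    Nat.one_le_iff_ne_zero.2 h5, Nat.one_le_iff_ne_zero.2 h6, hF'.inM2 h12 h13 h14,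
    ⟨hF'.unit.fun_mul (hF'.analytic 1 1), by simp [h15, h8]⟩,
    ⟨hF'.unit.fun_mul (hF'.analytic 2 2), by simp [h15, h9]⟩, ?_⟩
  filter_upwards [hF'.eq, hF'.log 1 0 h5 (by decide), hF'.log 1 2 h5 (by decide),
    hF'.log 2 0 h6 (by decide), hF'.log 2 1 h6 (by decide)] with w e1 e2 e3 e4 e5
  rw [e1]
  funext i
  fin_cases i <;>
    simp [monom, Fin.prod_univ_three, h4, Matrix.mulVec, dotProduct, Fin.sum_univ_three, e2, e3,
      e4, e5] <;> ring

theorem LogType.rescale_H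
    (h : LogType (fun e M => CondH 0 2 1 e M ∧ M 0 0 1 = 0 ∧ M 0 0 2 = 0) F) :
    ∃ T : C3 ≃L[ℂ] C3, HalfCornerForm fun z => T (F (T.symm z)) := by
  obtain ⟨e, U, M, hF, ⟨h4, h5, h6, h7, h8, h9⟩, h10, h11⟩ := h
  obtain ⟨t, ht, U', M', hF', h12, h13, h14, h15, h16⟩ :=
    hF.rescale_one h5 h7 h10 h11
  have hz : ∀ z : C3, z 2 = 0 → (rescale t ht).symm z 2 = 0 := fun z hz => by
    simp [rescale_symm_apply, hz]
  obtain ⟨a, ha, hae⟩ := exists_eq_coord_mul (hF'.analytic 2 2) 2 (by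
    filter_upwards [(tendsto_linear (rescale t ht)).eventually h8] with z h1 h2
    rw [h15]; exact h1 (hz z h2))
  obtain ⟨b, hb, hbe⟩ := exists_eq_coord_mul (h := fun z => (M' z *ᵥ z) 1)
    (analyticAt_c3.1 (analyticAt_mulVec hF'.analytic analyticAt_id) 1) 2 (by
    filter_upwards [(tendsto_linear (rescale t ht)).eventually h9] with z h1 h2
    rw [h16]; simp only [h1 (hz z h2), mul_zero])
  refine ⟨rescale t ht, e 2, U' 0 * b 0, _, fun w => U' w * b w - U' 0 * b 0, fun w => U' w * a w,
    Nat.one_le_iff_ne_zero.2 h5, hF'.inM2 h12 h13 h14,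
    ⟨(hF'.unit.fun_mul hb).fun_sub analyticAt_const, by simp⟩, hF'.unit.fun_mul ha, ?_⟩
  filter_upwards [hF'.eq, hae, hbe, hF'.log 2 0 h5 (by decide), hF'.log 2 1 h5 (by decide)]
    with w e1 e2 e3 e4 e5
  have e6 : (M' w *ᵥ w) 2 = w 2 * a w * w 2 := by
    rw [← e2]; simp [Matrix.mulVec, dotProduct, Fin.sum_univ_three, e4, e5]
  have hm : monom e w = w 2 ^ e 2 := by simp [monom, Fin.prod_univ_three, h4, h6]
  rw [e1, hm]
  funext i
  fin_cases i
  · simp; ring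
  · simp [e3]; ring
  · simp [e6]; ring

theorem LogType.simpleCornerForm (h : LogType (CondA 0 1) F) : SimpleCornerForm F := by
  obtain ⟨e, U, M, hF, h1, h2, h3, h4⟩ := h
  have ha : AnalyticAt ℂ (fun w => (M w *ᵥ w) 2) 0 :=
    analyticAt_c3.1 (analyticAt_mulVec hF.analytic analyticAt_id) 2
  refine ⟨e 0, e 1, e 2, U 0 * M 0 0 0, U 0 * M 0 1 1, fun w => U w * M w 0 0 - U 0 * M 0 0 0,
    fun w => U w * M w 1 1 - U 0 * M 0 1 1, fun w => U w * (M w *ᵥ w) 2,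
    Nat.one_le_iff_ne_zero.2 h1, Nat.one_le_iff_ne_zero.2 h2, mul_ne_zero hF.unit_ne h3,
    fun r hr hcon => h4 r hr ?_, ⟨(hF.unit.fun_mul (hF.analytic 0 0)).fun_sub analyticAt_const,
    by simp⟩, ⟨(hF.unit.fun_mul (hF.analytic 1 1)).fun_sub analyticAt_const, by simp⟩,
    ⟨hF.unit.fun_mul ha, by simp⟩, fun hc => ⟨fun w => U w * M w 2 2,
      hF.unit.fun_mul (hF.analytic 2 2), ?_⟩, ?_⟩
  · rw [mul_assoc] at hcon
    exact mul_left_cancel₀ hF.unit_ne hcon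
  · have h5 : e 2 ≠ 0 := hc.ne'
    filter_upwards [hF.log 2 0 h5 (by decide), hF.log 2 1 h5 (by decide)] with w e4 e5
    simp [Matrix.mulVec, dotProduct, Fin.sum_univ_three, e4, e5]; ring
  · filter_upwards [hF.eq, hF.log 0 1 h1 (by decide), hF.log 0 2 h1 (by decide),
      hF.log 1 0 h2 (by decide), hF.log 1 2 h2 (by decide)] with w e1 e2 e3 e4 e5
    have f0 : (M w *ᵥ w) 0 = M w 0 0 * w 0 := by
      simp [Matrix.mulVec, dotProduct, Fin.sum_univ_three, e2, e3]
    have f1 : (M w *ᵥ w) 1 = M w 1 1 * w 1 := by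
      simp [Matrix.mulVec, dotProduct, Fin.sum_univ_three, e4, e5]
    have hm : monom e w = w 0 ^ e 0 * w 1 ^ e 1 * w 2 ^ e 2 := by
      simp [monom, Fin.prod_univ_three]
    rw [e1, hm]
    funext i
    fin_cases i
    · simp [f0]; ring
    · simp [f1]; ring
    · simp; ring

theorem IsLogForm.hasFDerivAt (h : IsLogForm F e U M) :
    HasFDerivAt F (ContinuousLinearMap.id ℂ C3) 0 := by
  have h1 : AnalyticAt ℂ (fun w => U w * monom e w) 0 := h.unit.fun_mul (analyticAt_monom e 0)
  have h2 : AnalyticAt ℂ (fun w => M w *ᵥ w) 0 := analyticAt_mulVec h.analytic analyticAt_id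
  have h3 := (hasFDerivAt_id (𝕜 := ℂ) (0 : C3)).fun_add
    (h1.differentiableAt.hasFDerivAt.fun_smul h2.differentiableAt.hasFDerivAt)
  simp only [monom_zero h.ne, mul_zero, Matrix.mulVec_zero, zero_smul, zero_add, id] at h3
  refine (h3.congr_of_eventuallyEq h.eq).congr_fderiv ?_
  ext1 v
  simp

end Normalize

section Manifold

variable {X : Threefold} {g : X → X} {p : X}

theorem GermIn.tangent {K} (h : GermIn (LogType K) g p) : IsTangentToIdAt g p := by
  obtain ⟨h1, u, hu, e, U, M, hF, -⟩ := h
  exact ⟨h1, u, hu, hF.hasFDerivAt⟩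

theorem GermIn.simpleCorner (h : GermIn TypeA g p) : GermIn SimpleCornerForm g p :=
  (germIn_linearChange h fun _ hF => hF.perm).mono fun _ hF => hF.simpleCornerForm

theorem GermIn.spinningCorner (h : GermIn TypeB g p) : GermIn SpinningCornerForm g p :=
  germIn_linearChange (germIn_linearChange (germIn_linearChange h fun _ hF => hF.perm)
    fun _ hF => hF.shear_B) fun _ hF => hF.rescale_B

theorem GermIn.halfCorner (h : GermIn TypeH g p) : GermIn HalfCornerForm g p :=
  germIn_linearChange (germIn_linearChange (germIn_linearChange h fun _ hF => hF.perm)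
    fun _ hF => hF.shear_H) fun _ hF => hF.rescale_H

theorem GermIn.normalA (h : GermIn TypeA g p) : GermIn (LogType (CondA 0 1)) g p :=
  germIn_linearChange h fun _ hF => hF.perm

theorem GermIn.normalZ (h : GermIn TypeZ g p) : GermIn (LogType CondZ') g p :=
  germIn_linearChange (germIn_linearChange h fun _ hF => hF.perm) fun _ hF => hF.shear_Z

theorem GermIn.normalD (h : GermIn TypeD g p) : GermIn (LogType (CondD 0 1 2)) g p :=
  germIn_linearChange h fun _ hF => hF.perm

/-- The germ of `g` at `p` belongs to one of the families stable under blow-ups. -/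
def IsTyped (g : X → X) (p : X) : Prop := GermIn TypeA g p ∨ GermIn TypeZ g p ∨ GermIn TypeD g p

theorem IsTyped.tangent (h : IsTyped g p) : IsTangentToIdAt g p := by
  rcases h with h | h | h
  · exact h.normalA.tangent
  · exact h.normalZ.tangent
  · exact h.normalD.tangent

end Manifold

/-! ### Blow-ups of points with a logarithmic form -/

/-- The direction of the point `c` of the `j`-th affine chart is an eigenvector of `A`. -/
def IsEigenDir (A : Matrix (Fin 3) (Fin 3) ℂ) (j : Fin 3) (c : C3) : Prop :=
  ∀ i, i ≠ j → (A *ᵥ Function.update c j 1) i = c i * (A *ᵥ Function.update c j 1) j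

/-- Everything given in a blow-up of a fixed point where the lift has a logarithmic form. -/
structure LogBlowUp (f : C3 → C3) {X X' : Threefold} (π : X → C3) (g : X → X) (p : X) (β : X' → X)
    (g' : X' → X') (u : OpenPartialHomeomorph X C3) (ψ : Fin 3 → OpenPartialHomeomorph X' C3)
    (e : Fin 3 → ℕ) (U : C3 → ℂ) (M : C3 → Matrix (Fin 3) (Fin 3) ℂ) : Prop where
  liftable : IsLiftable f π
  isLift : IsLift f π g
  mem : π p = 0
  coord : IsCoordAt u p
  logForm : IsLogForm (fun w => u (g (u.symm w))) e U M
  isBlowUp : IsBlowUp 3 {p} β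
  liftable' : IsLiftable f (fun x => π (β x))
  isLift' : IsLift f (fun x => π (β x)) g'
  charts : ∀ j, IsPointChart β u j (ψ j)

/-- A dichotomy at typed points. -/
theorem IsLogForm.nonsing_or_singular {X : Threefold} {g : X → X} {p : X}
    {u : OpenPartialHomeomorph X C3} {e : Fin 3 → ℕ} {U : C3 → ℂ}
    {M : C3 → Matrix (Fin 3) (Fin 3) ℂ} (h : IsLogForm (fun w => u (g (u.symm w))) e U M)
    (hg : g p = p) (hu : IsCoordAt u p) {i : Fin 3} (hi : M 0 i i ≠ 0) :
    GermIn NonsingForm g p ∨ ∀ᶠ q in 𝓝 p, g q = q → U (u q) * monom e (u q) = 0 →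
      M (u q) *ᵥ u q = 0 → IsSingularAt g q :=
  nonsing_or_eventually_singular (h.hasGermAt hg hu) h.not_eventually_zero (by simp) (i := i)
    (by rw [h.fderiv_single]; exact hi)

theorem GermIn.nonsing_or_singular {X : Threefold} {g : X → X} {p : X}
    {K : (Fin 3 → ℕ) → (C3 → Matrix (Fin 3) (Fin 3) ℂ) → Prop} (h : GermIn (LogType K) g p)
    (hK : ∀ e M, K e M → ∃ i, M 0 i i ≠ 0) : GermIn NonsingForm g p ∨ IsSingularAt g p := by
  obtain ⟨h1, u, hu, e, U, M, hF, hKM⟩ := h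
  obtain ⟨i, hi⟩ := hK _ _ hKM
  refine (hF.nonsing_or_singular h1 hu hi).imp id fun h2 => ?_
  exact h2.self_of_nhds h1 (by rw [hu.2.2, monom_zero hF.ne, mul_zero]) (by rw [hu.2.2]; simp)

theorem IsTyped.nonsing_or_singular {X : Threefold} {g : X → X} {p : X} (h : IsTyped g p) :
    GermIn NonsingForm g p ∨ IsSingularAt g p := by
  rcases h with h | h | h
  · exact h.normalA.nonsing_or_singular fun _ _ hK => ⟨0, hK.2.2.1⟩
  · exact h.normalZ.nonsing_or_singular fun _ _ hK => ⟨0, hK.1.2.2.1⟩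
  · exact h.normalD.nonsing_or_singular fun _ _ hK => ⟨0, hK.2.2.2.1⟩

section LogBlowUp

variable {f : C3 → C3} {X X' : Threefold} {π : X → C3} {g : X → X} {p : X} {β : X' → X}
  {g' : X' → X'} {u : OpenPartialHomeomorph X C3} {ψ : Fin 3 → OpenPartialHomeomorph X' C3}
  {e : Fin 3 → ℕ} {U : C3 → ℂ} {M : C3 → Matrix (Fin 3) (Fin 3) ℂ}

theorem LogBlowUp.mem_target (h : LogBlowUp f π g p β g' u ψ e U M) {j : Fin 3} {c : C3}
    (hc : c j = 0) : c ∈ (ψ j).target := (h.charts j).mem_target h.coord hc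

theorem LogBlowUp.map_center (h : LogBlowUp f π g p β g' u ψ e U M) {j : Fin 3} {c : C3}
    (hc : c j = 0) : β ((ψ j).symm c) = p :=
  ((h.charts j).eq_center h.coord (h.mem_target hc)).2 hc

theorem LogBlowUp.map_zero (h : LogBlowUp f π g p β g' u ψ e U M) {q : X'} (hq : β q = p) :
    π (β q) = 0 := by rw [hq, h.mem]

theorem LogBlowUp.fix (h : LogBlowUp f π g p β g' u ψ e U M) {q : X'} (hq : β q = p) :
    g' q = q := h.liftable'.fix h.isLift' (h.map_zero hq)

theorem LogBlowUp.continuousAt (h : LogBlowUp f π g p β g' u ψ e U M) {q : X'} (hq : β q = p) :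
    ContinuousAt g' q := (h.isLift'.continuousAt (h.map_zero hq)).self_of_nhds

theorem LogBlowUp.analysis (h : LogBlowUp f π g p β g' u ψ e U M) {j : Fin 3} {c : C3}
    (hc : c j = 0) :
    (¬ IsEigenDir (M 0) j c → GermIn NonsingForm g' ((ψ j).symm c)) ∧
    (IsEigenDir (M 0) j c → ∃ U' M',
      IsLogForm (fun z => ψ j (g' ((ψ j).symm (z + c))) - c) (blExp e j c) U' M' ∧
        M' 0 j j = (M 0 *ᵥ Function.update c j 1) j ∧
        (∀ i k, i ≠ j → k ≠ j → M' 0 i k = M 0 i k -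
          (if i = k then (M 0 *ᵥ Function.update c j 1) j else 0) - c i * M 0 j k) ∧
        ∀ᶠ z in 𝓝 0, z j = 0 → M' z j j = (M 0 *ᵥ Function.update (z + c) j 1) j ∧
          ∀ i, i ≠ j → (M' z *ᵥ z) i = (M 0 *ᵥ Function.update (z + c) j 1) i -
            (z + c) i * (M 0 *ᵥ Function.update (z + c) j 1) j) := by
  obtain ⟨N, hN, hN1, hN2, h1, h2⟩ := h.logForm.blowUp hc
  have hL := h.liftable.isLocalLift_pointChart h.isLift h.mem h.coord (h.charts j) hc hN hN1 hN2
  have hE := h.liftable'.expression h.isLift' hL (h.map_zero (h.map_center hc))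
  have ht : Filter.Tendsto (fun z : C3 => z + c) (𝓝 0) (𝓝 c) := by
    have : Continuous fun z : C3 => z + c := by fun_prop
    simpa using this.tendsto 0
  have hE' : (fun z => blLift j N (z + c) - c) =ᶠ[𝓝 0]
      fun z => ψ j (g' ((ψ j).symm (z + c))) - c := by
    filter_upwards [ht.eventually hE] with z hz
    rw [hz]
  constructor
  · intro hne
    unfold IsEigenDir at hne
    push Not at hne
    refine germIn_of_chart (h.fix (h.map_center hc)) (h.charts j).mem
      ((ψ j).map_target (h.mem_target hc)) ?_
    rw [(ψ j).right_inv (h.mem_target hc)]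
    exact (h1 hne).congr hE'
  · intro he
    obtain ⟨U', M', h3, h4⟩ := h2 he
    exact ⟨U', M', h3.congr hE', h4⟩

theorem LogBlowUp.germIn (h : LogBlowUp f π g p β g' u ψ e U M) {j : Fin 3} {c : C3}
    (hc : c j = 0) {N : (C3 → C3) → Prop} (hN : N fun z => ψ j (g' ((ψ j).symm (z + c))) - c) :
    GermIn N g' ((ψ j).symm c) := by
  refine germIn_of_chart (h.fix (h.map_center hc)) (h.charts j).mem
    ((ψ j).map_target (h.mem_target hc)) ?_
  rwa [(ψ j).right_inv (h.mem_target hc)]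

theorem LogBlowUp.change (h : LogBlowUp f π g p β g' u ψ e U M) {j k : Fin 3} {c : C3}
    (hc : c j = 0) (hjk : k ≠ j) (hk : c k ≠ 0) :
    ∃ c', c' k = 0 ∧ (ψ j).symm c = (ψ k).symm c' := by
  obtain ⟨-, h2⟩ := (h.charts j).change h.isBlowUp h.coord (h.charts k) (h.mem_target hc)
    (by simpa [hjk] using hk)
  exact ⟨_, by simp [blChange, hc], h2⟩

theorem LogBlowUp.eventually_singular (h : LogBlowUp f π g p β g' u ψ e U M) {j : Fin 3} {c : C3}
    (hc : c j = 0) (he : IsEigenDir (M 0) j c)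
    (hd : (M 0 *ᵥ Function.update c j 1) j ≠ 0 ∨ ∃ i, i ≠ j ∧ c i = 0 ∧
      M 0 i i ≠ (M 0 *ᵥ Function.update c j 1) j) :
    GermIn NonsingForm g' ((ψ j).symm c) ∨
      ∀ᶠ c' in 𝓝 c, c' j = 0 → IsEigenDir (M 0) j c' → IsSingularAt g' ((ψ j).symm c') := by
  obtain ⟨U', M', h1, h2, h3, h4⟩ := (h.analysis hc).2 he
  obtain ⟨i, hi⟩ : ∃ i, M' 0 i i ≠ 0 := by
    rcases hd with hd | ⟨i, hij, hci, hi⟩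
    · exact ⟨j, by rwa [h2]⟩
    · refine ⟨i, ?_⟩
      rw [h3 i i hij hij, hci]
      simpa using sub_ne_zero.2 hi
  have hct := h.mem_target hc
  set v := (ψ j).trans (translate c) with hv
  have hs := (ψ j).map_target hct
  have hcv : IsCoordAt v ((ψ j).symm c) := by
    have := isCoordAt_translate (h.charts j).mem hs
    rwa [(ψ j).right_inv hct] at this
  refine (IsLogForm.nonsing_or_singular (u := v) h1 (h.fix (h.map_center hc)) hcv hi).imp id
    fun h5 => ?_
  have hz : Filter.Tendsto (fun w : C3 => w - c) (𝓝 c) (𝓝 0) := by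
    have : Continuous fun z : C3 => z - c := by fun_prop
    simpa using this.tendsto c
  have hlog : ∀ᶠ z in 𝓝 (0 : C3), ∀ k, k ≠ j → M' z j k = 0 := by
    rw [Filter.eventually_all]
    intro k
    by_cases hk : k = j
    · simp [hk]
    · have hej : blExp e j c j ≠ 0 := by
        rw [show blExp e j c j = ∑ k, e k from if_pos rfl]
        obtain ⟨i, hi⟩ := h.logForm.ne
        exact fun h => hi (Finset.sum_eq_zero_iff.1 h i (Finset.mem_univ i))
      simpa [hk] using h1.log j k hej hk
  filter_upwards [((ψ j).continuousAt_symm hct).eventually h5, hz.eventually h4,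
    hz.eventually hlog, (ψ j).open_target.mem_nhds hct] with w e1 e2 e3 e4 hw hew
  have hvw : v ((ψ j).symm w) = w - c := by
    change ψ j ((ψ j).symm w) - c = _
    rw [(ψ j).right_inv e4]
  have hwj : (w - c) j = 0 := by simp [hw, hc]
  refine e1 (h.fix (h.map_center hw)) ?_ ?_
  · rw [hvw, monom_eq_zero (i := j) ?_ hwj, mul_zero]
    rw [show blExp e j c j = ∑ k, e k from if_pos rfl]
    obtain ⟨i, hi⟩ := h.logForm.ne
    exact fun h => hi (Finset.sum_eq_zero_iff.1 h i (Finset.mem_univ i))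
  · rw [hvw]
    funext k
    by_cases hk : k = j
    · subst hk
      rw [Matrix.mulVec, dotProduct, Pi.zero_apply]
      refine Finset.sum_eq_zero fun q _ => ?_
      by_cases hq : q = k
      · subst hq; simp only [hwj, mul_zero]
      · simp only [e3 q hq, zero_mul]
    · rw [(e2 hwj).2 k hk, sub_add_cancel, hew k hk, sub_self]; rfl

/-- The line of the exceptional divisor joining the origins of two affine charts. -/
def exLine (ψ : Fin 3 → OpenPartialHomeomorph X' C3) (a b : Fin 3) : Set X' :=
  {q | (∃ t : ℂ, q = (ψ a).symm (Pi.single b t)) ∨ q = (ψ b).symm 0}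

theorem isEigenDir_line {A : Matrix (Fin 3) (Fin 3) ℂ} {a b : Fin 3} (hab : a ≠ b) {σ : ℂ}
    (ha : A *ᵥ Pi.single a 1 = σ • Pi.single a 1) (hb : A *ᵥ Pi.single b 1 = σ • Pi.single b 1)
    (t : ℂ) : A *ᵥ Function.update (Pi.single b t) a 1 =
      σ • Function.update (Pi.single b t) a 1 := by
  have h1 : Function.update (Pi.single b t : C3) a 1 = Pi.single a 1 + t • Pi.single b 1 := by
    funext i
    by_cases hi : i = a
    · subst hi; simp [hab]
    · simp [hi, Pi.single_apply]
  rw [h1, Matrix.mulVec_add, Matrix.mulVec_smul, ha, hb, smul_add, smul_comm]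

theorem symm_single_inv (hβ : IsBlowUp 3 {p} β) (hu : IsCoordAt u p)
    (hψ : ∀ j, IsPointChart β u j (ψ j)) {a b : Fin 3} (hab : a ≠ b) {s : ℂ} (hs : s ≠ 0) :
    (ψ b).symm (Pi.single a s) = (ψ a).symm (Pi.single b s⁻¹) := by
  have h1 : (Pi.single a s : C3) b = 0 := by simp [hab.symm]
  obtain ⟨-, h2⟩ := (hψ b).change hβ hu (hψ a) ((hψ b).mem_target hu h1) (by simpa [hab] using hs)
  rw [h2]
  congr 1
  funext i
  by_cases hia : i = a
  · subst hia; simp [blChange, hab]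
  · by_cases hib : i = b
    · subst hib; simp [blChange, hia, hab]
    · simp [blChange, hia, hib]

theorem LogBlowUp.line_dichotomy (h : LogBlowUp f π g p β g' u ψ e U M) {a b : Fin 3} (hab : a ≠ b)
    {σ : ℂ} (ha : M 0 *ᵥ Pi.single a 1 = σ • Pi.single a 1)
    (hb : M 0 *ᵥ Pi.single b 1 = σ • Pi.single b 1)
    (hd : σ ≠ 0 ∨ ∃ i, i ≠ a ∧ i ≠ b ∧ M 0 i i ≠ σ) :
    (∀ q ∈ exLine ψ a b, IsSingularAt g' q) ∨ ∀ q ∈ exLine ψ a b, ¬ IsSingularAt g' q := by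
  have key : ∀ a b : Fin 3, a ≠ b → M 0 *ᵥ Pi.single a 1 = σ • Pi.single a 1 →
      M 0 *ᵥ Pi.single b 1 = σ • Pi.single b 1 → (σ ≠ 0 ∨ ∃ i, i ≠ a ∧ i ≠ b ∧ M 0 i i ≠ σ) →
      ∀ t : ℂ, GermIn NonsingForm g' ((ψ a).symm (Pi.single b t)) ∨
        ∀ᶠ s in 𝓝 t, IsSingularAt g' ((ψ a).symm (Pi.single b s)) := by
    intro a b hab ha hb hd t
    have hE := isEigenDir_line hab ha hb
    have he : ∀ t, IsEigenDir (M 0) a (Pi.single b t) := by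
      intro t i hi
      rw [hE t]
      simp [hi, mul_comm]
    have h0 : ∀ t : ℂ, (Pi.single b t : C3) a = 0 := fun t => by simp [hab]
    refine (h.eventually_singular (h0 t) (he t) ?_).imp id fun h1 => ?_
    · rw [hE t]
      rcases hd with hd | ⟨i, hia, hib, hi⟩
      · left; simpa using hd
      · right; exact ⟨i, hia, by simp [hib], by simpa using hi⟩
    · have hc : Filter.Tendsto (fun s : ℂ => (Pi.single b s : C3)) (𝓝 t) (𝓝 (Pi.single b t)) :=
        (continuous_single (A := fun _ : Fin 3 => ℂ) b).tendsto t
      filter_upwards [hc.eventually h1] with s hs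
      exact hs (h0 s) (he s)
  have h0 : ∀ (a b : Fin 3), a ≠ b → ∀ t : ℂ, (Pi.single b t : C3) a = 0 :=
    fun a b hab t => by simp [hab]
  have hns : ∀ (a b : Fin 3), a ≠ b → ∀ t : ℂ,
      GermIn NonsingForm g' ((ψ a).symm (Pi.single b t)) →
      ∀ᶠ s in 𝓝 t, ¬ IsSingularAt g' ((ψ a).symm (Pi.single b s)) := by
    intro a b hab t ht
    have hc : Filter.Tendsto (fun s : ℂ => (ψ a).symm (Pi.single b s)) (𝓝 t)
        (𝓝 ((ψ a).symm (Pi.single b t))) :=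
      ((ψ a).continuousAt_symm (h.mem_target (h0 a b hab t))).tendsto.comp
        ((continuous_single (A := fun _ : Fin 3 => ℂ) b).tendsto t)
    filter_upwards [hc.eventually ht.eventually_nonsing] with s hs
    have h3 := h.map_center (h0 a b hab s)
    exact (hs (h.fix h3)).not_isSingularAt (h.continuousAt h3)
  have hline : (∀ t : ℂ, IsSingularAt g' ((ψ a).symm (Pi.single b t))) ∨
      ∀ t : ℂ, ¬ IsSingularAt g' ((ψ a).symm (Pi.single b t)) := by
    set S : Set ℂ := {t | IsSingularAt g' ((ψ a).symm (Pi.single b t))} with hS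
    have hop : IsOpen S := by
      rw [isOpen_iff_mem_nhds]
      intro t ht
      rcases key a b hab ha hb hd t with h1 | h1
      · exact absurd ht (hns a b hab t h1).self_of_nhds
      · exact h1
    have hcl : IsClosed S := by
      rw [← isOpen_compl_iff, isOpen_iff_mem_nhds]
      intro t ht
      rcases key a b hab ha hb hd t with h1 | h1
      · exact hns a b hab t h1
      · exact absurd h1.self_of_nhds ht
    rcases isClopen_iff.1 ⟨hcl, hop⟩ with h1 | h1
    · right; intro t ht
      have : t ∈ S := ht
      rw [h1] at this; exact this
    · left; intro t
      have : t ∈ S := by rw [h1]; trivial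
      exact this
  have hinf : ∀ s : ℂ, s ≠ 0 → (ψ b).symm (Pi.single a s) = (ψ a).symm (Pi.single b s⁻¹) :=
    fun s hs => symm_single_inv h.isBlowUp h.coord h.charts hab hs
  have hpunct : ∀ P : ℂ → Prop, (∀ᶠ s in 𝓝 (0 : ℂ), P s) → ∃ s, s ≠ 0 ∧ P s := by
    intro P hP
    have h1 : ∀ᶠ s in 𝓝[≠] (0 : ℂ), P s := hP.filter_mono nhdsWithin_le_nhds
    obtain ⟨s, hs, hs0⟩ := (h1.and self_mem_nhdsWithin).exists
    exact ⟨s, hs0, hs⟩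
  have hd' : σ ≠ 0 ∨ ∃ i, i ≠ b ∧ i ≠ a ∧ M 0 i i ≠ σ :=
    hd.imp id fun ⟨i, h1, h2, h3⟩ => ⟨i, h2, h1, h3⟩
  have hz : (Pi.single a 0 : C3) = 0 := Pi.single_zero a
  have k0 := key b a hab.symm hb ha hd' 0
  rcases hline with h1 | h1
  · left
    rintro q (⟨t, rfl⟩ | rfl)
    · exact h1 t
    · rcases k0 with h2 | h2
      · obtain ⟨s, hs, hs'⟩ := hpunct _ (hns b a hab.symm 0 h2)
        rw [hinf s hs] at hs'
        exact absurd (h1 _) hs'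
      · rw [← hz]; exact h2.self_of_nhds
  · right
    rintro q (⟨t, rfl⟩ | rfl)
    · exact h1 t
    · rcases k0 with h2 | h2
      · rw [← hz]; exact (hns b a hab.symm 0 h2).self_of_nhds
      · obtain ⟨s, hs, hs'⟩ := hpunct _ h2
        rw [hinf s hs] at hs'
        exact absurd hs' (h1 _)

end LogBlowUp

theorem mulVec_update_zero (A : Matrix (Fin 3) (Fin 3) ℂ) (c : C3) (i : Fin 3) :
    (A *ᵥ Function.update c 0 1) i = A i 0 + A i 1 * c 1 + A i 2 * c 2 := by
  simp [Matrix.mulVec, dotProduct, Fin.sum_univ_three]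

theorem mulVec_update_one (A : Matrix (Fin 3) (Fin 3) ℂ) (c : C3) (i : Fin 3) :
    (A *ᵥ Function.update c 1 1) i = A i 0 * c 0 + A i 1 + A i 2 * c 2 := by
  simp [Matrix.mulVec, dotProduct, Fin.sum_univ_three]

theorem mulVec_update_two (A : Matrix (Fin 3) (Fin 3) ℂ) (c : C3) (i : Fin 3) :
    (A *ᵥ Function.update c 2 1) i = A i 0 * c 0 + A i 1 * c 1 + A i 2 := by
  simp [Matrix.mulVec, dotProduct, Fin.sum_univ_three]

theorem blExp_same {e : Fin 3 → ℕ} (h : ∃ i, e i ≠ 0) (j : Fin 3) (c : C3) : blExp e j c j ≠ 0 := by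
  rw [show blExp e j c j = ∑ k, e k from if_pos rfl]
  obtain ⟨i, hi⟩ := h
  exact fun h => hi (Finset.sum_eq_zero_iff.1 h i (Finset.mem_univ i))

theorem blExp_of_eq_zero {e : Fin 3 → ℕ} {i j : Fin 3} {c : C3} (hi : i ≠ j) (hc : c i = 0) :
    blExp e j c i = e i := by simp [blExp, hi, hc]

theorem blExp_eq_zero {e : Fin 3 → ℕ} {i j : Fin 3} {c : C3} (hi : i ≠ j) (he : e i = 0) :
    blExp e j c i = 0 := by simp [blExp, hi, he]

/-- The types of points along a curve of singular points. -/
def CurveType {X : Threefold} (g : X → X) (C : Set X) : Prop :=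
  (∀ q ∈ C, GermIn TypeA g q) ∨
    ((∀ q ∈ C, GermIn TypeB g q ∨ GermIn TypeH g q) ∧ {q | q ∈ C ∧ ¬ GermIn TypeH g q}.Finite)

theorem GermIn.typeB_typeZ {X : Threefold} {g : X → X} {p : X} (h : GermIn TypeB g p) :
    GermIn TypeZ g p := h.mono fun _ h => h.typeZ

theorem GermIn.typeH_typeZ {X : Threefold} {g : X → X} {p : X} (h : GermIn TypeH g p) :
    GermIn TypeZ g p := h.mono fun _ h => h.typeZ

/-- The singular points on the exceptional divisor of a point blow-up: finitely many points and
lines of constant type. -/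
def ExceptionalSing {X X' : Threefold} (p : X) (β : X' → X) (g' : X' → X')
    (ψ : Fin 3 → OpenPartialHomeomorph X' C3) : Prop :=
  (∀ q, β q = p → IsSingularAt g' q → IsTyped g' q) ∧
  ∃ (T : Set X') (K : Set (Fin 3 × Fin 3)), T.Finite ∧
    (∀ ab ∈ K, ab.1 ≠ ab.2 ∧ (∀ q ∈ exLine ψ ab.1 ab.2, IsSingularAt g' q) ∧
      CurveType g' (exLine ψ ab.1 ab.2)) ∧
    ∀ q, β q = p → IsSingularAt g' q → q ∈ T ∨ ∃ ab ∈ K, q ∈ exLine ψ ab.1 ab.2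

section LogBlowUp

variable {f : C3 → C3} {X X' : Threefold} {π : X → C3} {g : X → X} {p : X} {β : X' → X}
  {g' : X' → X'} {u : OpenPartialHomeomorph X C3} {ψ : Fin 3 → OpenPartialHomeomorph X' C3}
  {e : Fin 3 → ℕ} {U : C3 → ℂ} {M : C3 → Matrix (Fin 3) (Fin 3) ℂ}

theorem LogBlowUp.not_nonsing (h : LogBlowUp f π g p β g' u ψ e U M) {q : X'} (hq : β q = p)
    (hs : IsSingularAt g' q) : ¬ GermIn NonsingForm g' q := fun hn =>
  hn.not_isSingularAt (h.continuousAt hq) hs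

theorem LogBlowUp.isEigenDir (h : LogBlowUp f π g p β g' u ψ e U M) {j : Fin 3} {c : C3}
    (hc : c j = 0) (hs : ¬ GermIn NonsingForm g' ((ψ j).symm c)) : IsEigenDir (M 0) j c := by
  by_contra hne
  exact hs ((h.analysis hc).1 hne)

theorem LogBlowUp.exists_chart (h : LogBlowUp f π g p β g' u ψ e U M) {q : X'} (hq : β q = p)
    {k : Fin 3} : ∃ j c, c j = 0 ∧ q = (ψ j).symm c ∧ (j ≠ k → c k = 0) := by
  obtain ⟨j, c, hc, rfl⟩ := h.isBlowUp.exists_pointChart_eq h.coord h.charts hq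
  by_cases hjk : j = k
  · exact ⟨j, c, hc, rfl, fun h => absurd hjk h⟩
  by_cases hk : c k = 0
  · exact ⟨j, c, hc, rfl, fun _ => hk⟩
  · obtain ⟨c', h1, h2⟩ := h.change hc (Ne.symm hjk) hk
    exact ⟨k, c', h1, h2, fun h => absurd rfl h⟩

theorem exists_good_pair {lam mu γ : ℂ} (hl : lam ≠ 0) (h : ∀ r : ℚ, 0 < r → mu ≠ lam * (r : ℂ)) :
    (lam - γ ≠ 0 ∧ ∀ r : ℚ, 0 < r → mu - γ ≠ (lam - γ) * (r : ℂ)) ∨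
    (γ ≠ 0 ∧ ∀ r : ℚ, 0 < r → lam - γ ≠ γ * (r : ℂ)) ∨
    (γ ≠ 0 ∧ ∀ r : ℚ, 0 < r → mu - γ ≠ γ * (r : ℂ)) := by
  by_cases hγ : γ = 0
  · left; subst hγ; simpa using ⟨hl, h⟩
  by_contra hcon
  push Not at hcon
  obtain ⟨-, h2, h3⟩ := hcon
  obtain ⟨r, hr, hr'⟩ := h2 hγ
  obtain ⟨s, hs, hs'⟩ := h3 hγ
  refine h ((1 + s) / (1 + r)) (by positivity) ?_
  have e1 : lam = γ * (1 + r) := by linear_combination hr'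
  have e2 : mu = γ * (1 + s) := by linear_combination hs'
  have h1r : (1 + (r : ℂ)) ≠ 0 := by
    have : (0 : ℚ) < 1 + r := by positivity
    exact_mod_cast this.ne'
  rw [e1, e2]
  push_cast
  field_simp

theorem LogBlowUp.typeA (h : LogBlowUp f π g p β g' u ψ e U M) (hK : CondA 0 1 e M) {q : X'}
    (hq : β q = p) (hs : ¬ GermIn NonsingForm g' q) : GermIn TypeA g' q := by
  obtain ⟨h0, h1, hl, hμ⟩ := hK
  have a01 := h.logForm.log_zero h0 (show (1 : Fin 3) ≠ 0 by decide)
  have a02 := h.logForm.log_zero h0 (show (2 : Fin 3) ≠ 0 by decide)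
  have a10 := h.logForm.log_zero h1 (show (0 : Fin 3) ≠ 1 by decide)
  have a12 := h.logForm.log_zero h1 (show (2 : Fin 3) ≠ 1 by decide)
  have hne : M 0 1 1 ≠ M 0 0 0 := by simpa using hμ 1 one_pos
  have k0 : ∀ c : C3, c 0 = 0 → ¬ GermIn NonsingForm g' ((ψ 0).symm c) →
      GermIn TypeA g' ((ψ 0).symm c) := by
    intro c hc hs
    have he := h.isEigenDir hc hs
    obtain ⟨U', M', b1, b2, b3, -⟩ := (h.analysis hc).2 he
    have hc1 : c 1 = 0 := by
      have := he 1 (by decide)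
      simp only [mulVec_update_zero, a01, a02, a10, a12] at this
      have h2 : (M 0 1 1 - M 0 0 0) * c 1 = 0 := by linear_combination this
      exact (mul_eq_zero.1 h2).resolve_left (sub_ne_zero.2 hne)
    refine h.germIn hc ⟨0, 1, by decide, _, _, _, b1, blExp_same h.logForm.ne _ _,
      by rwa [blExp_of_eq_zero (by decide) hc1], ?_, fun r hr => ?_⟩
    · rw [b2]; simpa [mulVec_update_zero, a01, a02] using hl
    · rw [b2, b3 1 1 (by decide) (by decide)]
      simp only [mulVec_update_zero, a01, a02, hc1, if_true, zero_mul, add_zero, sub_zero]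
      intro hcon
      refine hμ (1 + r) (by positivity) ?_
      push_cast
      linear_combination hcon
  have k1 : ∀ c : C3, c 1 = 0 → ¬ GermIn NonsingForm g' ((ψ 1).symm c) →
      GermIn TypeA g' ((ψ 1).symm c) := by
    intro c hc hs
    have he := h.isEigenDir hc hs
    obtain ⟨U', M', b1, b2, b3, -⟩ := (h.analysis hc).2 he
    have hc1 : c 0 = 0 := by
      have := he 0 (by decide)
      simp only [mulVec_update_one, a01, a02, a10, a12] at this
      have h2 : (M 0 1 1 - M 0 0 0) * c 0 = 0 := by linear_combination -this
      exact (mul_eq_zero.1 h2).resolve_left (sub_ne_zero.2 hne)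
    refine h.germIn hc ⟨0, 1, by decide, _, _, _, b1,
      by rwa [blExp_of_eq_zero (by decide) hc1], blExp_same h.logForm.ne _ _, ?_, fun r hr => ?_⟩
    · rw [b3 0 0 (by decide) (by decide)]
      simp only [mulVec_update_one, a10, a12, hc1, if_true, zero_mul, add_zero, sub_zero, zero_add]
      exact sub_ne_zero.2 hne.symm
    · rw [b2, b3 0 0 (by decide) (by decide)]
      simp only [mulVec_update_one, a10, a12, hc1, if_true, zero_mul, add_zero, sub_zero, zero_add]
      intro hcon
      have h1r : (1 + (r : ℂ)) ≠ 0 := by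
        have : (0 : ℚ) < 1 + r := by positivity
        exact_mod_cast this.ne'
      refine hμ (r / (1 + r)) (by positivity) ?_
      push_cast
      field_simp
      linear_combination hcon
  obtain ⟨j, c, hc, rfl, -⟩ := h.exists_chart hq (k := 0)
  fin_cases j
  · exact k0 c hc hs
  · exact k1 c hc hs
  · by_cases hc0 : c 0 = 0
    swap
    · obtain ⟨c', h2, h3⟩ := h.change hc (show (0 : Fin 3) ≠ 2 by decide) hc0
      rw [h3] at hs ⊢; exact k0 c' h2 hs
    by_cases hc1 : c 1 = 0
    swap
    · obtain ⟨c', h2, h3⟩ := h.change hc (show (1 : Fin 3) ≠ 2 by decide) hc1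
      rw [h3] at hs ⊢; exact k1 c' h2 hs
    have he := h.isEigenDir hc hs
    obtain ⟨U', M', b1, b2, b3, -⟩ := (h.analysis hc).2 he
    have g0 : M' 0 0 0 = M 0 0 0 - M 0 2 2 := by
      rw [b3 0 0 (by decide) (by decide)]; simp [mulVec_update_two, hc0, hc1]
    have g1 : M' 0 1 1 = M 0 1 1 - M 0 2 2 := by
      rw [b3 1 1 (by decide) (by decide)]; simp [mulVec_update_two, hc0, hc1]
    have g2 : M' 0 2 2 = M 0 2 2 := by
      rw [show M' 0 2 2 = _ from b2]; simp [mulVec_update_two, hc0, hc1]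
    have e0 : blExp e 2 c 0 ≠ 0 := by rwa [blExp_of_eq_zero (by decide) hc0]
    have e1 : blExp e 2 c 1 ≠ 0 := by rwa [blExp_of_eq_zero (by decide) hc1]
    have e2 : blExp e 2 c 2 ≠ 0 := blExp_same h.logForm.ne _ _
    rcases exists_good_pair (γ := M 0 2 2) hl hμ with ⟨f1, f2⟩ | ⟨f1, f2⟩ | ⟨f1, f2⟩
    · exact h.germIn hc ⟨0, 1, by decide, _, _, _, b1, e0, e1, by rwa [g0],
        fun r hr => by rw [g0, g1]; exact f2 r hr⟩
    · exact h.germIn hc ⟨2, 0, by decide, _, _, _, b1, e2, e0, by rwa [g2],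
        fun r hr => by rw [g0, g2]; exact f2 r hr⟩
    · exact h.germIn hc ⟨2, 1, by decide, _, _, _, b1, e2, e1, by rwa [g2],
        fun r hr => by rw [g1, g2]; exact f2 r hr⟩

theorem single_of_two {c : C3} (h0 : c 0 = 0) (h1 : c 1 = 0) : c = Pi.single 2 (c 2) := by
  funext i; fin_cases i <;> simp [h0, h1]

theorem LogBlowUp.exceptionalSing_A (h : LogBlowUp f π g p β g' u ψ e U M) (hK : CondA 0 1 e M) :
    ExceptionalSing p β g' ψ := by
  refine ⟨fun q hq hs => Or.inl (h.typeA hK hq (h.not_nonsing hq hs)), ?_⟩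
  have hA := fun q hq hs => h.typeA hK (q := q) hq (h.not_nonsing hq hs)
  obtain ⟨h0, h1, hl, hμ⟩ := hK
  have a01 := h.logForm.log_zero h0 (show (1 : Fin 3) ≠ 0 by decide)
  have a02 := h.logForm.log_zero h0 (show (2 : Fin 3) ≠ 0 by decide)
  have a10 := h.logForm.log_zero h1 (show (0 : Fin 3) ≠ 1 by decide)
  have a12 := h.logForm.log_zero h1 (show (2 : Fin 3) ≠ 1 by decide)
  have hne : M 0 1 1 ≠ M 0 0 0 := by simpa using hμ 1 one_pos
  have hline : ∀ a : Fin 3, a ≠ 2 → ∀ q ∈ exLine ψ a 2, β q = p := by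
    rintro a ha q (⟨t, rfl⟩ | rfl)
    · exact h.map_center (by simp [ha])
    · exact h.map_center rfl
  have hcand : ∀ a : Fin 3, a ≠ 2 → M 0 a a = M 0 2 2 → M 0 2 a = 0 →
      (∀ q ∈ exLine ψ a 2, IsSingularAt g' q) ∨ ∀ q ∈ exLine ψ a 2, ¬ IsSingularAt g' q := by
    intro a ha h2 h3
    have hd : M 0 2 2 ≠ 0 ∨ ∃ i, i ≠ a ∧ i ≠ 2 ∧ M 0 i i ≠ M 0 2 2 := by
      by_cases ha0 : a = 0
      · subst ha0; left; rw [← h2]; exact hl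
      · have ha1 : a = 1 := by omega
        subst ha1
        right; exact ⟨0, by decide, by decide, fun hc => hne (by rw [h2, hc])⟩
    refine h.line_dichotomy ha (σ := M 0 2 2) ?_ ?_ hd
    · funext i
      fin_cases a <;> fin_cases i <;> simp_all
    · funext i
      fin_cases i <;> simp_all
  let K : Set (Fin 3 × Fin 3) := {ab | ab.1 ≠ 2 ∧ ab.2 = 2 ∧
    ∀ q ∈ exLine ψ ab.1 2, IsSingularAt g' q}
  refine ⟨{(ψ 0).symm (Pi.single 2 (M 0 2 0 / (M 0 0 0 - M 0 2 2))),
    (ψ 1).symm (Pi.single 2 (M 0 2 1 / (M 0 1 1 - M 0 2 2))), (ψ 2).symm 0}, K,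
    by simp, ?_, ?_⟩
  · rintro ⟨a, b⟩ ⟨ha, hb, hs⟩
    simp only at ha hb hs
    subst hb
    exact ⟨ha, hs, Or.inl fun q hq => hA q (hline a ha q hq) (hs q hq)⟩
  · have k0 : ∀ c : C3, c 0 = 0 → IsSingularAt g' ((ψ 0).symm c) → c 1 = 0 ∧
        M 0 2 0 = c 2 * (M 0 0 0 - M 0 2 2) := by
      intro c hc hs
      have he := h.isEigenDir hc (h.not_nonsing (h.map_center hc) hs)
      have hc1 : c 1 = 0 := by
        have := he 1 (by decide)
        simp only [mulVec_update_zero, a01, a02, a10, a12] at this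
        have h2 : (M 0 1 1 - M 0 0 0) * c 1 = 0 := by linear_combination this
        exact (mul_eq_zero.1 h2).resolve_left (sub_ne_zero.2 hne)
      refine ⟨hc1, ?_⟩
      have := he 2 (by decide)
      simp only [mulVec_update_zero, a01, a02, hc1] at this
      linear_combination this
    have k1 : ∀ c : C3, c 1 = 0 → IsSingularAt g' ((ψ 1).symm c) → c 0 = 0 ∧
        M 0 2 1 = c 2 * (M 0 1 1 - M 0 2 2) := by
      intro c hc hs
      have he := h.isEigenDir hc (h.not_nonsing (h.map_center hc) hs)
      have hc1 : c 0 = 0 := by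
        have := he 0 (by decide)
        simp only [mulVec_update_one, a01, a02, a10, a12] at this
        have h2 : (M 0 1 1 - M 0 0 0) * c 0 = 0 := by linear_combination -this
        exact (mul_eq_zero.1 h2).resolve_left (sub_ne_zero.2 hne)
      refine ⟨hc1, ?_⟩
      have := he 2 (by decide)
      simp only [mulVec_update_one, a10, a12, hc1] at this
      linear_combination this
    have kk : ∀ (a : Fin 3) (ha : a ≠ 2) (c : C3), c 0 = 0 → c 1 = 0 →
        M 0 2 a = c 2 * (M 0 a a - M 0 2 2) → IsSingularAt g' ((ψ a).symm c) →
        (ψ a).symm c = (ψ a).symm (Pi.single 2 (M 0 2 a / (M 0 a a - M 0 2 2))) ∨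
        ∃ ab ∈ K, (ψ a).symm c ∈ exLine ψ ab.1 ab.2 := by
      intro a ha c c0 c1 hc hs
      by_cases hd : M 0 a a = M 0 2 2
      · right
        have hmem : (ψ a).symm c ∈ exLine ψ a 2 := Or.inl ⟨c 2, by rw [← single_of_two c0 c1]⟩
        refine ⟨(a, 2), ⟨ha, rfl, ?_⟩, hmem⟩
        rcases hcand a ha hd (by rw [hc, hd]; ring) with h2 | h2
        · exact h2
        · exact absurd hs (h2 _ hmem)
      · left
        have : M 0 2 a / (M 0 a a - M 0 2 2) = c 2 := by
          rw [hc]; field_simp [sub_ne_zero.2 hd]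
        rw [this, ← single_of_two c0 c1]
    have r0 : ∀ c : C3, c 0 = 0 → IsSingularAt g' ((ψ 0).symm c) → _ := fun c hc hs =>
      kk 0 (by decide) c hc (k0 c hc hs).1 (k0 c hc hs).2 hs
    have r1 : ∀ c : C3, c 1 = 0 → IsSingularAt g' ((ψ 1).symm c) → _ := fun c hc hs =>
      kk 1 (by decide) c (k1 c hc hs).1 hc (k1 c hc hs).2 hs
    intro q hq hs
    obtain ⟨j, c, hc, rfl, -⟩ := h.exists_chart hq (k := 0)
    fin_cases j
    · exact (r0 c hc hs).imp (fun h => Or.inl h) id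
    · exact (r1 c hc hs).imp (fun h => Or.inr (Or.inl h)) id
    · by_cases hc0 : c 0 = 0
      swap
      · obtain ⟨c', h2, h3⟩ := h.change hc (show (0 : Fin 3) ≠ 2 by decide) hc0
        rw [h3] at hs ⊢; exact (r0 c' h2 hs).imp (fun h => Or.inl h) id
      by_cases hc1 : c 1 = 0
      swap
      · obtain ⟨c', h2, h3⟩ := h.change hc (show (1 : Fin 3) ≠ 2 by decide) hc1
        rw [h3] at hs ⊢; exact (r1 c' h2 hs).imp (fun h => Or.inr (Or.inl h)) id
      left; right; right
      have : c = 0 := by rw [single_of_two hc0 hc1, show c 2 = 0 from hc, Pi.single_zero]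
      rw [this]; rfl

/-- Points over a point of type `Z` in directions transverse to the strong one. -/
theorem LogBlowUp.typeZ_transverse (h : LogBlowUp f π g p β g' u ψ e U M) (hK : CondZ' e M)
    {j : Fin 3} (hj : j ≠ 0) {c : C3} (hc : c j = 0) (hs : ¬ GermIn NonsingForm g' ((ψ j).symm c)) :
    (GermIn TypeH g' ((ψ j).symm c) ∨ GermIn TypeB g' ((ψ j).symm c) ∧ c = 0) ∧ c 0 = 0 ∧
      ((c 1 ≠ 0 ∨ j = 1) → M 0 2 1 = 0) := by
  obtain ⟨⟨h0, h1, hl, h11, h20, h22⟩, h01, h02⟩ := hK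
  have a10 := h.logForm.log_zero h1 (show (0 : Fin 3) ≠ 1 by decide)
  have a12 := h.logForm.log_zero h1 (show (2 : Fin 3) ≠ 1 by decide)
  have k1 : ∀ c : C3, c 1 = 0 → ¬ GermIn NonsingForm g' ((ψ 1).symm c) →
      (GermIn TypeH g' ((ψ 1).symm c) ∨ GermIn TypeB g' ((ψ 1).symm c) ∧ c = 0) ∧ c 0 = 0 ∧
        M 0 2 1 = 0 := by
    intro c hc hs
    have he := h.isEigenDir hc hs
    obtain ⟨U', M', b1, b2, b3, b4⟩ := (h.analysis hc).2 he
    have hc0 : c 0 = 0 := by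
      have := he 0 (by decide)
      simp only [mulVec_update_one, h01, h02, a10, a12, h11] at this
      have h2 : M 0 0 0 * c 0 = 0 := by linear_combination this
      exact (mul_eq_zero.1 h2).resolve_left hl
    have h21 : M 0 2 1 = 0 := by
      have := he 2 (by decide)
      simp only [mulVec_update_one, h20, h22, a10, a12, h11] at this
      linear_combination this
    have e0 : blExp e 1 c 0 = 0 := blExp_eq_zero (by decide) h0
    have e1 : blExp e 1 c 1 ≠ 0 := blExp_same h.logForm.ne _ _
    have g0 : M' 0 0 0 ≠ 0 := by
      rw [b3 0 0 (by decide) (by decide)]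
      simpa [mulVec_update_one, a10, a12, h11] using hl
    refine ⟨?_, hc0, h21⟩
    by_cases e2 : blExp e 1 c 2 = 0
    · left
      refine h.germIn hc ⟨0, 1, 2, by decide, by decide, by decide, _, _, _, b1, e0, e1, e2, g0, ?_, ?_⟩
      · filter_upwards [b4] with z hz hz1
        rw [(hz hz1).1]; simp [mulVec_update_one, a10, a12, h11]
      · filter_upwards [b4] with z hz hz1
        rw [(hz hz1).2 2 (by decide)]; simp [mulVec_update_one, a10, a12, h11, h20, h22, h21]
    · right
      have hc2 : c 2 = 0 := by
        by_contra hc2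
        exact e2 (by simp [blExp, hc2])
      refine ⟨h.germIn hc ⟨0, 1, 2, by decide, by decide, by decide, _, _, _, b1, e0, e1, e2, g0,
        ?_, ?_⟩, ?_⟩
      · rw [b2]; simp [mulVec_update_one, a10, a12, h11]
      · rw [b3 2 2 (by decide) (by decide)]; simp [mulVec_update_one, a10, a12, h11, h22]
      · funext i; fin_cases i <;> [exact hc0; exact hc; exact hc2]
  fin_cases j
  · exact absurd rfl hj
  · exact ⟨(k1 c hc hs).1, (k1 c hc hs).2.1, fun _ => (k1 c hc hs).2.2⟩
  · have he := h.isEigenDir hc hs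
    have hc' : c 2 = 0 := hc
    have hc0 : c 0 = 0 := by
      have := he 0 (by decide)
      simp only [Fin.reduceFinMk, mulVec_update_two, h01, h02, h20, h22] at this
      by_cases hc1 : c 1 = 0
      · rw [hc1] at this
        have h2 : M 0 0 0 * c 0 = 0 := by linear_combination this
        exact (mul_eq_zero.1 h2).resolve_left hl
      · obtain ⟨-, h3⟩ := (h.charts 2).change h.isBlowUp h.coord (h.charts 1) (h.mem_target hc)
          (by simpa using hc1)
        have hs2 := hs
        rw [show (ψ ⟨2, by decide⟩).symm c = _ from h3] at hs2
        have := (k1 _ (by simp [blChange, hc']) hs2).2.1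
        simpa [blChange, hc1] using this
    by_cases hc1 : c 1 = 0
    · have hcz : c = 0 := by funext i; fin_cases i <;> [exact hc0; exact hc1; exact hc]
      subst hcz
      obtain ⟨U', M', b1, b2, b3, -⟩ := (h.analysis hc).2 he
      refine ⟨Or.inr ⟨h.germIn hc ⟨0, 1, 2, by decide, by decide, by decide, _, _, _, b1,
        blExp_eq_zero (by decide) h0, by rwa [blExp_of_eq_zero (by decide) rfl],
        blExp_same h.logForm.ne _ _, ?_, ?_, ?_⟩, rfl⟩, rfl, ?_⟩
      · rw [b3 0 0 (by decide) (by decide)]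
        simpa [mulVec_update_two, h22] using hl
      · rw [b3 1 1 (by decide) (by decide)]; simp [mulVec_update_two, h22, h11]
      · rw [show M' 0 2 2 = _ from b2]; simp [mulVec_update_two, h22]
      · simp
    · obtain ⟨-, h3⟩ := (h.charts 2).change h.isBlowUp h.coord (h.charts 1) (h.mem_target hc)
        (by simpa using hc1)
      rw [show (ψ ⟨2, by decide⟩).symm c = _ from h3] at hs ⊢
      obtain ⟨h4, h5, h6⟩ := k1 _ (by simp [blChange, hc']) hs
      refine ⟨Or.inl (h4.resolve_right fun h7 => ?_), hc0, fun _ => h6⟩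
      have := congrFun h7.2 2
      simp [blChange, hc1] at this

theorem LogBlowUp.exceptionalSing_Z (h : LogBlowUp f π g p β g' u ψ e U M) (hK : CondZ' e M) :
    ExceptionalSing p β g' ψ := by
  have hT := fun j hj c hc (hs : IsSingularAt g' ((ψ j).symm c)) =>
    h.typeZ_transverse hK (j := j) hj (c := c) hc (h.not_nonsing (h.map_center hc) hs)
  obtain ⟨⟨h0, h1, hl, h11, h20, h22⟩, h01, h02⟩ := hK
  have a10 := h.logForm.log_zero h1 (show (0 : Fin 3) ≠ 1 by decide)
  have a12 := h.logForm.log_zero h1 (show (2 : Fin 3) ≠ 1 by decide)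
  have k0 : ∀ c : C3, c 0 = 0 → IsSingularAt g' ((ψ 0).symm c) → c = 0 ∧
      GermIn TypeA g' ((ψ 0).symm c) := by
    intro c hc hs
    have he := h.isEigenDir hc (h.not_nonsing (h.map_center hc) hs)
    have hc1 : c 1 = 0 := by
      have := he 1 (by decide)
      simp only [mulVec_update_zero, h01, h02, a10, a12, h11] at this
      have h2 : M 0 0 0 * c 1 = 0 := by linear_combination -this
      exact (mul_eq_zero.1 h2).resolve_left hl
    have hc2 : c 2 = 0 := by
      have := he 2 (by decide)
      simp only [mulVec_update_zero, h01, h02, h20, h22, hc1] at this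
      have h2 : M 0 0 0 * c 2 = 0 := by linear_combination -this
      exact (mul_eq_zero.1 h2).resolve_left hl
    have hcz : c = 0 := by funext i; fin_cases i <;> [exact hc; exact hc1; exact hc2]
    subst hcz
    obtain ⟨U', M', b1, b2, b3, -⟩ := (h.analysis hc).2 he
    have g0 : M' 0 0 0 = M 0 0 0 := by rw [b2]; simp [mulVec_update_zero]
    have g1 : M' 0 1 1 = - M 0 0 0 := by
      rw [b3 1 1 (by decide) (by decide)]; simp [mulVec_update_zero, h11]
    refine ⟨rfl, h.germIn hc ⟨0, 1, by decide, _, _, _, b1, blExp_same h.logForm.ne _ _,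
      by rwa [blExp_of_eq_zero (by decide) rfl], by rwa [g0], fun r hr => ?_⟩⟩
    rw [g0, g1]
    intro hcon
    have h2 : M 0 0 0 * (1 + (r : ℂ)) = 0 := by linear_combination -hcon
    rcases mul_eq_zero.1 h2 with h3 | h3
    · exact hl h3
    · have : (0 : ℚ) < 1 + r := by positivity
      exact this.ne' (by exact_mod_cast h3)
  have hline : ∀ q ∈ exLine ψ 1 2, β q = p := by
    rintro q (⟨t, rfl⟩ | rfl)
    · exact h.map_center (by simp)
    · exact h.map_center rfl
  refine ⟨fun q hq hs => ?_, {(ψ 0).symm 0, (ψ 2).symm 0},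
    {ab | ab = (1, 2) ∧ ∀ q ∈ exLine ψ 1 2, IsSingularAt g' q}, by simp, ?_, ?_⟩
  · obtain ⟨j, c, hc, rfl, -⟩ := h.exists_chart hq (k := 0)
    by_cases hj : j = 0
    · subst hj; exact Or.inl (k0 c hc hs).2
    · rcases (hT j hj c hc hs).1 with h2 | ⟨h2, -⟩
      · exact Or.inr (Or.inl h2.typeH_typeZ)
      · exact Or.inr (Or.inl h2.typeB_typeZ)
  · rintro ab ⟨rfl, hs⟩
    have hfin : {q | q ∈ exLine ψ 1 2 ∧ ¬ GermIn TypeH g' q} ⊆ {(ψ 1).symm 0, (ψ 2).symm 0} := by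
      rintro q ⟨hq, hH⟩
      have hsq := hs q hq
      rcases hq with ⟨t, rfl⟩ | rfl
      · left
        have h2 := ((hT 1 (by decide) _ (by simp) hsq).1.resolve_left hH).2
        rw [h2]
      · right; rfl
    refine ⟨by decide, hs, Or.inr ⟨fun q hq => ?_, Set.Finite.subset (by simp) hfin⟩⟩
    have hsq := hs q hq
    rcases hq with ⟨t, rfl⟩ | rfl
    · exact (hT 1 (by decide) _ (by simp) hsq).1.symm.imp (fun h => h.1) id
    · exact (hT 2 (by decide) _ rfl hsq).1.symm.imp (fun h => h.1) id
  · have k1 : ∀ c : C3, c 1 = 0 → IsSingularAt g' ((ψ 1).symm c) → 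
        ∃ ab ∈ {ab : Fin 3 × Fin 3 | ab = (1, 2) ∧ ∀ q ∈ exLine ψ 1 2, IsSingularAt g' q},
          (ψ 1).symm c ∈ exLine ψ ab.1 ab.2 := by
      intro c hc hs
      obtain ⟨-, hc0, h21⟩ := hT 1 (by decide) c hc hs
      have hmem : (ψ 1).symm c ∈ exLine ψ 1 2 := Or.inl ⟨c 2, by rw [← single_of_two hc0 hc]⟩
      refine ⟨(1, 2), ⟨rfl, ?_⟩, hmem⟩
      have := h.line_dichotomy (a := 1) (b := 2) (by decide) (σ := 0) ?_ ?_
        (Or.inr ⟨0, by decide, by decide, hl⟩)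
      · rcases this with h2 | h2
        · exact h2
        · exact absurd hs (h2 _ hmem)
      · funext i; fin_cases i <;> simp [h01, h11, h21 (Or.inr rfl)]
      · funext i; fin_cases i <;> simp [h02, a12, h22]
    intro q hq hs
    obtain ⟨j, c, hc, rfl, hj⟩ := h.exists_chart hq (k := 1)
    fin_cases j
    · left; left
      rw [show c = 0 from (k0 c hc hs).1]; rfl
    · right; exact k1 c hc hs
    · left; right
      have hc1 := hj (by decide)
      have hc0 := (hT 2 (by decide) c hc hs).2.1
      have : c = 0 := by funext i; fin_cases i <;> [exact hc0; exact hc1; exact hc]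
      rw [this]; rfl

theorem LogBlowUp.exceptionalSing_D (h : LogBlowUp f π g p β g' u ψ e U M) (hK : CondD 0 1 2 e M) :
    ExceptionalSing p β g' ψ := by
  obtain ⟨h0, h2, h1, hl, h11, h22, h02, h20⟩ := hK
  have a10 := h.logForm.log_zero h1 (show (0 : Fin 3) ≠ 1 by decide)
  have a12 := h.logForm.log_zero h1 (show (2 : Fin 3) ≠ 1 by decide)
  have hneg : ∀ x : ℂ, x ≠ 0 → ∀ r : ℚ, 0 < r → -x ≠ x * (r : ℂ) := by
    intro x hx r hr hcon
    have h2 : x * (1 + (r : ℂ)) = 0 := by linear_combination -hcon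
    rcases mul_eq_zero.1 h2 with h3 | h3
    · exact hx h3
    · have : (0 : ℚ) < 1 + r := by positivity
      exact this.ne' (by exact_mod_cast h3)
  have key : ∀ q, β q = p → IsSingularAt g' q → IsTyped g' q ∧ q ∈ ({(ψ 0).symm 0,
      (ψ 1).symm ![- M 0 0 1 / M 0 0 0, 0, M 0 2 1 / M 0 0 0], (ψ 2).symm 0} : Set X') := by
    intro q hq hs
    obtain ⟨j, c, hc, rfl, hj⟩ := h.exists_chart hq (k := 1)
    have he := h.isEigenDir hc (h.not_nonsing (h.map_center hc) hs)
    obtain ⟨U', M', b1, b2, b3, -⟩ := (h.analysis hc).2 he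
    fin_cases j
    · have hc1 := hj (by decide)
      have hc2 : c 2 = 0 := by
        have := he 2 (by decide)
        simp only [Fin.zero_eta, mulVec_update_zero, h02, h20, h22, hc1] at this
        have h2 : M 0 0 0 * c 2 = 0 := by linear_combination -(1/2) * this
        exact (mul_eq_zero.1 h2).resolve_left hl
      have hcz : c = 0 := by funext i; fin_cases i <;> [exact hc; exact hc1; exact hc2]
      subst hcz
      refine ⟨Or.inl (h.germIn hc ⟨0, 1, by decide, _, _, _, b1, blExp_same h.logForm.ne _ _,
        by rwa [blExp_of_eq_zero (by decide) rfl], ?_, ?_⟩), Or.inl rfl⟩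
      · rw [show M' 0 0 0 = _ from b2]; simpa [mulVec_update_zero] using hl
      · rw [show M' 0 0 0 = _ from b2, b3 1 1 (by decide) (by decide)]
        simpa [mulVec_update_zero, h11] using hneg _ hl
    · have e0 : c 0 = - M 0 0 1 / M 0 0 0 := by
        have := he 0 (by decide)
        simp only [Fin.mk_one, mulVec_update_one, h02, a10, a12, h11] at this
        field_simp
        linear_combination this
      have e2 : c 2 = M 0 2 1 / M 0 0 0 := by
        have := he 2 (by decide)
        simp only [Fin.mk_one, mulVec_update_one, h20, h22, a10, a12, h11] at this
        field_simp
        linear_combination -this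
      refine ⟨Or.inr (Or.inr (h.germIn hc ⟨0, 1, 2, by decide, by decide, by decide, _, _, _, b1,
        blExp_eq_zero (by decide) h0, blExp_eq_zero (by decide) h2, blExp_same h.logForm.ne _ _,
        ?_, ?_, ?_, ?_, ?_⟩)), Or.inr (Or.inl ?_)⟩
      · rw [b3 0 0 (by decide) (by decide)]; simpa [mulVec_update_one, a10, a12, h11] using hl
      · rw [show M' 0 1 1 = _ from b2]; simp [mulVec_update_one, a10, a12, h11]
      · rw [b3 0 0 (by decide) (by decide), b3 2 2 (by decide) (by decide)]
        simp [mulVec_update_one, a10, a12, h11, h22]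
      · rw [b3 0 2 (by decide) (by decide)]; simp [a12, h02]
      · rw [b3 2 0 (by decide) (by decide)]; simp [a10, h20]
      · congr 1
        funext i; fin_cases i <;> [exact e0; exact hc; exact e2]
    · have hc1 := hj (by decide)
      have hc0 : c 0 = 0 := by
        have := he 0 (by decide)
        simp only [Fin.reduceFinMk, mulVec_update_two, h02, h20, h22, hc1] at this
        have h2 : M 0 0 0 * c 0 = 0 := by linear_combination (1/2) * this
        exact (mul_eq_zero.1 h2).resolve_left hl
      have hcz : c = 0 := by funext i; fin_cases i <;> [exact hc0; exact hc1; exact hc]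
      subst hcz
      refine ⟨Or.inl (h.germIn hc ⟨2, 1, by decide, _, _, _, b1, blExp_same h.logForm.ne _ _,
        by rwa [blExp_of_eq_zero (by decide) rfl], ?_, ?_⟩), Or.inr (Or.inr rfl)⟩
      · rw [show M' 0 2 2 = _ from b2]; simpa [mulVec_update_two, h22] using hl
      · rw [show M' 0 2 2 = _ from b2, b3 1 1 (by decide) (by decide)]
        simpa [mulVec_update_two, h11, h22] using hneg _ (neg_ne_zero.2 hl)
  exact ⟨fun q hq hs => (key q hq hs).1, _, ∅, by simp, by simp,
    fun q hq hs => Or.inl (key q hq hs).2⟩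

end LogBlowUp

section

variable {X X' : Threefold}

/-- The parametrized curve `c` is holomorphic and immersive at `t`. -/
def IsImm (c : ℂ → X) (t : ℂ) : Prop :=
  ContMDiffAt 𝓘(ℂ, ℂ) 𝓘(ℂ, C3) ω c t ∧ mfderiv 𝓘(ℂ, ℂ) 𝓘(ℂ, C3) c t ≠ 0

theorem IsImm.congr {c c' : ℂ → X} {t : ℂ} (h : IsImm c t) (he : c' =ᶠ[𝓝 t] c) : IsImm c' t :=
  ⟨h.1.congr_of_eventuallyEq he, by rw [he.mfderiv_eq]; exact h.2⟩

theorem isImm_iff {c : ℂ → X} {t : ℂ} {v : OpenPartialHomeomorph X C3} (hv : v ∈ Chart X)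
    (ht : c t ∈ v.source) : IsImm c t ↔ ContinuousAt c t ∧ AnalyticAt ℂ (fun s => v (c s)) t ∧
      deriv (fun s => v (c s)) t ≠ 0 := by
  have hvm := contMDiffAt_of_mem_maximalAtlas hv ht
  have hvs := contMDiffAt_symm_of_mem_maximalAtlas hv (v.map_source ht)
  have hback : ContinuousAt c t → c =ᶠ[𝓝 t] fun s => v.symm (v (c s)) := fun hc => by
    filter_upwards [hc.eventually (v.open_source.mem_nhds ht)] with s hs
    exact (v.left_inv hs).symm
  have hsm : ∀ hc : ContinuousAt c t,
      (ContMDiffAt 𝓘(ℂ, ℂ) 𝓘(ℂ, C3) ω c t ↔ AnalyticAt ℂ (fun s => v (c s)) t) := by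
    intro hc
    constructor
    · intro h
      have := hvm.comp t h
      rw [contMDiffAt_iff_contDiffAt] at this
      exact analyticAt_of_contDiffAt this
    · intro h
      exact (ContMDiffAt.comp (g := v.symm) t hvs
        (contMDiffAt_iff_contDiffAt.2 h.contDiffAt)).congr_of_eventuallyEq (hback hc)
  have hder : ∀ (hc : ContinuousAt c t) (_ : AnalyticAt ℂ (fun s => v (c s)) t),
      (mfderiv 𝓘(ℂ, ℂ) 𝓘(ℂ, C3) c t ≠ 0 ↔ deriv (fun s => v (c s)) t ≠ 0) := by
    intro hc ha
    have hcm := ((hsm hc).2 ha).mdifferentiableAt (by simp)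
    have ham : MDifferentiableAt 𝓘(ℂ, ℂ) 𝓘(ℂ, C3) (fun s => v (c s)) t :=
      ha.differentiableAt.mdifferentiableAt
    have e1 := mfderiv_comp t (hvm.mdifferentiableAt (by simp)) hcm
    have e2 := mfderiv_comp t (g := v.symm) (hvs.mdifferentiableAt (by simp)) ham
    have e3 := (hback hc).mfderiv_eq (I := 𝓘(ℂ, ℂ)) (I' := 𝓘(ℂ, C3))
    have e4 : mfderiv 𝓘(ℂ, ℂ) 𝓘(ℂ, C3) (fun s => v (c s)) t = fderiv ℂ (fun s => v (c s)) t :=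
      mfderiv_eq_fderiv
    have e5 : fderiv ℂ (fun s => v (c s)) t = 0 ↔ deriv (fun s => v (c s)) t = 0 := by
      constructor
      · intro h
        rw [← fderiv_apply_one_eq_deriv, h]
        rfl
      · intro h
        ext1
        rw [fderiv_apply_one_eq_deriv, h]
        rfl
    rw [not_iff_not, ← e5]
    constructor
    · intro h
      rw [← e4]
      refine e1.trans ?_
      rw [h]
      exact ContinuousLinearMap.comp_zero _
    · intro h
      rw [e3]
      refine e2.trans ?_
      rw [e4, h]
      exact ContinuousLinearMap.comp_zero _
  constructor
  · rintro ⟨h1, h2⟩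
    have hc := h1.continuousAt
    have ha := (hsm hc).1 h1
    exact ⟨hc, ha, (hder hc ha).1 h2⟩
  · rintro ⟨hc, ha, hd⟩
    exact ⟨(hsm hc).2 ha, (hder hc ha).2 hd⟩

theorem exists_chart (x : X) : ∃ v ∈ Chart X, x ∈ v.source :=
  ⟨chartAt C3 x, IsManifold.chart_mem_maximalAtlas x, mem_chart_source C3 x⟩

theorem IsImm.continuousAt {c : ℂ → X} {t : ℂ} (h : IsImm c t) : ContinuousAt c t :=
  h.1.continuousAt

theorem IsImm.comp {c : ℂ → X} {φ : ℂ → ℂ} {s : ℂ} (h : IsImm c (φ s)) (hφ : AnalyticAt ℂ φ s)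
    (hd : deriv φ s ≠ 0) : IsImm (fun x => c (φ x)) s := by
  obtain ⟨v, hv, hx⟩ := exists_chart (c (φ s))
  obtain ⟨h1, h2, h3⟩ := (isImm_iff hv hx).1 h
  refine (isImm_iff (c := fun x => c (φ x)) hv hx).2
    ⟨ContinuousAt.comp (g := c) h1 hφ.continuousAt, h2.fun_comp hφ, ?_⟩
  have := HasDerivAt.scomp s h2.differentiableAt.hasDerivAt hφ.differentiableAt.hasDerivAt
  have e := this.deriv
  simp only [Function.comp_def] at e
  rw [e]
  exact smul_ne_zero hd h3

theorem isImm_symm {v : OpenPartialHomeomorph X C3} (hv : v ∈ Chart X) {a : ℂ → C3} {t : ℂ}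
    (ha : AnalyticAt ℂ a t) (hd : deriv a t ≠ 0) (ht : a t ∈ v.target) :
    IsImm (fun s => v.symm (a s)) t := by
  have he : (fun s => v (v.symm (a s))) =ᶠ[𝓝 t] a := by
    filter_upwards [ha.continuousAt.eventually (v.open_target.mem_nhds ht)] with s hs
    exact v.right_inv hs
  refine (isImm_iff (c := fun s => v.symm (a s)) hv (v.map_target ht)).2
    ⟨ContinuousAt.comp (g := v.symm) (v.continuousAt_symm ht) ha.continuousAt, ha.congr he.symm, ?_⟩
  rw [he.deriv_eq]
  exact hd

theorem IsImm.lift {k : ℕ} {Z : Set X} {β : X' → X} (hβ : IsBlowUp k Z β) (hk : k ≤ 3)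
    {c : ℂ → X} {c' : ℂ → X'} {t : ℂ} (h : IsImm c t) (hc : ∀ᶠ s in 𝓝 t, β (c' s) = c s)
    (hZ : c t ∉ Z) : IsImm c' t := by
  obtain ⟨v, hv, hx⟩ := exists_chart (c t)
  have ht := hc.self_of_nhds
  have hZ' : β (c' t) ∉ Z := by rwa [ht]
  obtain ⟨v', hv', hq, hvv⟩ := hβ.exists_chart hk hZ' hv (by rwa [ht])
  obtain ⟨h1, h2, h3⟩ := (isImm_iff hv hx).1 h
  have ha : v (c t) ∈ v'.target := by
    rw [← ht, ← (hvv _ hq).2]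
    exact v'.map_source hq
  refine (isImm_symm hv' h2 h3 ha).congr ?_
  have ho : ∀ᶠ s in 𝓝 t, c s ∉ Z := h1.eventually (hβ.isClosed.isOpen_compl.mem_nhds hZ)
  filter_upwards [h2.continuousAt.eventually (v'.open_target.mem_nhds ha), hc, ho,
    h1.eventually (v.open_source.mem_nhds hx)] with s hs hcs hos hvs
  refine hβ.injective_off (by rwa [hcs]) ?_
  rw [symm_eq_of_chart hvv hs, hcs, v.left_inv hvs]

/-! ### Rational curves -/

/-- The inversion `t ↦ 1 / t` of the Riemann sphere. -/
def sphereInv (x : OnePoint ℂ) : OnePoint ℂ := x.elim ((0 : ℂ) : OnePoint ℂ) chartInfty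

theorem sphereInv_coe (t : ℂ) : sphereInv (t : OnePoint ℂ) = chartInfty t := rfl

theorem chartInfty_zero : chartInfty 0 = OnePoint.infty := by simp [chartInfty]

theorem chartInfty_of_ne {t : ℂ} (ht : t ≠ 0) : chartInfty t = ((t⁻¹ : ℂ) : OnePoint ℂ) := by
  simp [chartInfty, ht]

theorem sphereInv_chartInfty (t : ℂ) : sphereInv (chartInfty t) = (t : OnePoint ℂ) := by
  by_cases ht : t = 0
  · subst ht
    rw [chartInfty_zero]
    rfl
  · rw [chartInfty_of_ne ht, sphereInv_coe, chartInfty_of_ne (inv_ne_zero ht), inv_inv]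

theorem sphereInv_sphereInv (x : OnePoint ℂ) : sphereInv (sphereInv x) = x := by
  induction x using OnePoint.rec with
  | infty => exact (sphereInv_coe 0).trans chartInfty_zero
  | coe t => rw [sphereInv_coe, sphereInv_chartInfty]

/-- `γ` is an injective holomorphic immersion of the Riemann sphere with image `C`. -/
structure IsRatParam (γ : OnePoint ℂ → X) (C : Set X) : Prop where
  inj : Function.Injective γ
  range : Set.range γ = C
  coe : ∀ t : ℂ, IsImm (fun t : ℂ => γ (t : OnePoint ℂ)) t
  infty : IsImm (fun t : ℂ => γ (chartInfty t)) 0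

theorem IsRatParam.isImm_chartInfty {γ : OnePoint ℂ → X} {C : Set X} (h : IsRatParam γ C) (t : ℂ) :
    IsImm (fun t : ℂ => γ (chartInfty t)) t := by
  by_cases ht : t = 0
  · rw [ht]
    exact h.infty
  · have := IsImm.comp (φ := fun t : ℂ => t⁻¹) (h.coe t⁻¹) (analyticAt_inv ht)
      (by rw [deriv_inv]; simpa using ht)
    refine this.congr ?_
    filter_upwards [isOpen_ne.mem_nhds ht] with s hs
    rw [chartInfty_of_ne hs]

theorem isSmoothRationalCurve_iff {C : Set X} :
    IsSmoothRationalCurve C ↔ ∃ γ : OnePoint ℂ → X, IsRatParam γ C := by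
  constructor
  · rintro ⟨γ, h1, h2, h3, h4, h5, h6⟩
    exact ⟨γ, h1, h2, fun t => ⟨h3 t, h5 t⟩, h4 0, h6 0⟩
  · rintro ⟨γ, h⟩
    exact ⟨γ, h.inj, h.range, fun t => (h.coe t).1, fun t => (h.isImm_chartInfty t).1,
      fun t => (h.coe t).2, fun t => (h.isImm_chartInfty t).2⟩

theorem IsRatParam.comp_sphereInv {γ : OnePoint ℂ → X} {C : Set X} (h : IsRatParam γ C) :
    IsRatParam (fun x => γ (sphereInv x)) C where
  inj := h.inj.comp (Function.LeftInverse.injective sphereInv_sphereInv)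
  range := by
    rw [← h.range]
    exact (Function.RightInverse.surjective sphereInv_sphereInv).range_comp γ
  coe t := h.isImm_chartInfty t
  infty := by
    simp only [sphereInv_chartInfty]
    exact h.coe 0

theorem IsSmoothRationalCurve.exists_param {C : Set X} (h : IsSmoothRationalCurve C) {p : X}
    (hp : p ∈ C) : ∃ γ : OnePoint ℂ → X, IsRatParam γ C ∧ ∃ t : ℂ, γ t = p := by
  obtain ⟨γ, hγ⟩ := isSmoothRationalCurve_iff.1 h
  rw [← hγ.range] at hp
  obtain ⟨x, rfl⟩ := hp
  induction x using OnePoint.rec with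
  | infty =>
    refine ⟨_, hγ.comp_sphereInv, 0, ?_⟩
    rw [sphereInv_coe, chartInfty_zero]
  | coe t => exact ⟨γ, hγ, t, rfl⟩

theorem deriv_single (b : Fin 3) (t : ℂ) :
    deriv (fun s : ℂ => (Pi.single b s : C3)) t = Pi.single b 1 :=
  (ContinuousLinearMap.single ℂ (fun _ : Fin 3 => ℂ) b).hasDerivAt.deriv

theorem isSmoothRationalCurve_exLine {p : X} {β : X' → X} {u : OpenPartialHomeomorph X C3}
    {ψ : Fin 3 → OpenPartialHomeomorph X' C3} (hβ : IsBlowUp 3 {p} β) (hu : IsCoordAt u p)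
    (hψ : ∀ j, IsPointChart β u j (ψ j)) {a b : Fin 3} (hab : a ≠ b) :
    IsSmoothRationalCurve (exLine ψ a b) := by
  have hline : ∀ {a b : Fin 3}, a ≠ b → ∀ t, IsImm (fun s : ℂ => (ψ a).symm (Pi.single b s)) t := by
    intro a b hab t
    refine isImm_symm (hψ a).mem ?_ ?_ ?_
    · exact (ContinuousLinearMap.single ℂ (fun _ : Fin 3 => ℂ) b).analyticAt t
    · rw [deriv_single]
      simp
    · exact (hψ a).mem_target hu (by simp [hab])
  refine isSmoothRationalCurve_iff.2
    ⟨fun x => x.elim ((ψ b).symm 0) (fun t => (ψ a).symm (Pi.single b t)), ?_, ?_, ?_, ?_⟩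
  · have hm : ∀ t : ℂ, (Pi.single b t : C3) ∈ (ψ a).target := fun t =>
      (hψ a).mem_target hu (by simp [hab])
    have hn : (ψ b).symm 0 ∉ (ψ a).source := by
      refine (hψ b).notMem_source hβ hu (hψ a) ((hψ b).mem_target hu rfl) ?_
      simp [hab]
    intro x y hxy
    induction x using OnePoint.rec with
    | infty =>
      induction y using OnePoint.rec with
      | infty => rfl
      | coe t =>
        simp only [OnePoint.elim_infty, OnePoint.elim_some] at hxy
        exact absurd (hxy ▸ (ψ a).map_target (hm t)) hn
    | coe s =>
      induction y using OnePoint.rec with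
      | infty =>
        simp only [OnePoint.elim_infty, OnePoint.elim_some] at hxy
        exact absurd (hxy ▸ (ψ a).map_target (hm s)) hn
      | coe t =>
        simp only [OnePoint.elim_some] at hxy
        have := congrFun ((ψ a).symm.injOn (hm s) (hm t) hxy) b
        simp only [Pi.single_eq_same] at this
        rw [this]
  · ext q
    constructor
    · rintro ⟨x, rfl⟩
      induction x using OnePoint.rec with
      | infty => exact Or.inr rfl
      | coe t => exact Or.inl ⟨t, rfl⟩
    · rintro (⟨t, rfl⟩ | rfl)
      · exact ⟨(t : OnePoint ℂ), rfl⟩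
      · exact ⟨OnePoint.infty, rfl⟩
  · exact hline hab
  · refine (hline hab.symm 0).congr (Filter.Eventually.of_forall fun s => ?_)
    by_cases hs : s = 0
    · subst hs
      simp [chartInfty_zero]
    · simp only [chartInfty_of_ne hs, OnePoint.elim_some]
      exact (symm_single_inv hβ hu hψ hab hs).symm

end

section

variable {X X' : Threefold} {p : X} {β : X' → X}

theorem IsBlowUp.exists_lift {k : ℕ} {Z : Set X} (hβ : IsBlowUp k Z β) {x : X} (hx : x ∉ Z) :
    ∃ y, β y = x := by
  obtain ⟨y, -, hy⟩ := hβ.bijOn.surjOn hx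
  exact ⟨y, hy⟩

theorem IsSmoothRationalCurve.preimage {C : Set X} (hC : IsSmoothRationalCurve C) (hp : p ∉ C)
    (hβ : IsBlowUp 3 {p} β) : IsSmoothRationalCurve (β ⁻¹' C) := by
  obtain ⟨γ, hγ⟩ := isSmoothRationalCurve_iff.1 hC
  have hne : ∀ x, γ x ∉ ({p} : Set X) := by
    rintro x rfl
    exact hp (hγ.range ▸ Set.mem_range_self x)
  choose γ' hγ' using fun x => hβ.exists_lift (hne x)
  refine isSmoothRationalCurve_iff.2 ⟨γ', fun x y hxy => hγ.inj ?_, ?_, fun t => ?_, ?_⟩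
  · rw [← hγ' x, ← hγ' y, hxy]
  · ext q
    constructor
    · rintro ⟨x, rfl⟩
      rw [Set.mem_preimage, hγ', ← hγ.range]
      exact Set.mem_range_self x
    · intro hq
      rw [Set.mem_preimage, ← hγ.range] at hq
      obtain ⟨x, hx⟩ := hq
      exact ⟨x, hβ.injective_off (by rw [hγ']; exact hne x) (by rw [hγ', hx])⟩
  · exact (hγ.coe t).lift hβ le_rfl (Filter.Eventually.of_forall fun s => hγ' _) (hne _)
  · exact hγ.infty.lift hβ le_rfl (Filter.Eventually.of_forall fun s => hγ' _) (hne _)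

theorem exists_eq_sub_smul {a : ℂ → C3} {t : ℂ} (ha : AnalyticAt ℂ a t) (h0 : a t = 0) :
    ∃ d : ℂ → C3, AnalyticAt ℂ d t ∧ (∀ᶠ s in 𝓝 t, a s = (s - t) • d s) ∧ d t = deriv a t := by
  obtain ⟨d, hd, he⟩ := (natCast_le_analyticOrderAt ha (n := 1)).1
    (by
      rw [Nat.cast_one, Order.one_le_iff_ne_zero]
      exact ha.analyticOrderAt_ne_zero.2 h0)
  simp only [pow_one] at he
  refine ⟨d, hd, he, ?_⟩
  have h1 : HasDerivAt (fun s => (s - t) • d s) ((t - t) • deriv d t + (1 : ℂ) • d t) t :=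
    ((hasDerivAt_id' t).sub_const t).fun_smul hd.differentiableAt.hasDerivAt
  rw [Filter.EventuallyEq.deriv_eq he, h1.deriv]
  simp

/-- The point of the exceptional divisor in the direction `v`, in the `j`-th chart. -/
def dirCoord (j : Fin 3) (v : C3) : C3 := fun i => if i = j then 0 else v i / v j

theorem dirCoord_same (j : Fin 3) (v : C3) : dirCoord j v j = 0 := by simp [dirCoord]

theorem dirCoord_ne {i j : Fin 3} (h : i ≠ j) (v : C3) : dirCoord j v i = v i / v j := by
  simp [dirCoord, h]

theorem IsSmoothRationalCurve.strictTransform {C : Set X} (hC : IsSmoothRationalCurve C)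
    (hp : p ∈ C) (hβ : IsBlowUp 3 {p} β) {u : OpenPartialHomeomorph X C3} (hu : IsCoordAt u p)
    {ψ : Fin 3 → OpenPartialHomeomorph X' C3} (hψ : ∀ j, IsPointChart β u j (ψ j)) :
    ∃ v : C3, v ≠ 0 ∧
      (∀ G : C3 → ℂ, AnalyticAt ℂ G 0 → (∀ᶠ x in 𝓝 p, x ∈ C → G (u x) = 0) →
        fderiv ℂ G 0 v = 0) ∧
      ∀ j, v j ≠ 0 →
        IsSmoothRationalCurve (insert ((ψ j).symm (dirCoord j v)) (β ⁻¹' (C \ {p}))) ∧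
        ∃ᶠ x in 𝓝 ((ψ j).symm (dirCoord j v)), β x ∈ C \ {p} := by
  obtain ⟨γ, hγ, t₀, ht₀⟩ := hC.exists_param hp
  have hmem : γ t₀ ∈ u.source := by rw [ht₀]; exact hu.2.1
  obtain ⟨hcont, ha, hd⟩ := (isImm_iff hu.1 hmem).1 (hγ.coe t₀)
  have ha0 : u (γ t₀) = 0 := by rw [ht₀]; exact hu.2.2
  obtain ⟨d, hda, hde, hd0⟩ := exists_eq_sub_smul ha ha0
  rw [← hd0] at hd
  refine ⟨d t₀, hd, ?_, ?_⟩
  · intro G hG hz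
    have h1 : ∀ᶠ s : ℂ in 𝓝 t₀, G (u (γ s)) = 0 := by
      have hz' : ∀ᶠ x in 𝓝 (γ t₀), x ∈ C → G (u x) = 0 := by rwa [ht₀]
      filter_upwards [hcont.eventually hz'] with s hs
      exact hs (hγ.range ▸ Set.mem_range_self _)
    have h2 : HasFDerivAt G (fderiv ℂ G 0) (u (γ t₀)) := by
      rw [ha0]
      exact hG.differentiableAt.hasFDerivAt
    have h3 := h2.comp_hasDerivAt t₀ ha.differentiableAt.hasDerivAt
    rw [hd0, ← h3.deriv]
    exact (Filter.EventuallyEq.deriv_eq (f := fun _ => (0 : ℂ)) h1).trans (deriv_const _ _)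
  intro j hj
  set c := dirCoord j (d t₀) with hc
  have hcj : c j = 0 := dirCoord_same _ _
  set q := (ψ j).symm c with hq
  have hct := (hψ j).mem_target hu hcj
  have hβq : β q = p := ((hψ j).eq_center hu hct).2 hcj
  have hne : ∀ x, x ≠ (t₀ : OnePoint ℂ) → γ x ∉ ({p} : Set X) := by
    intro x hx h
    exact hx (hγ.inj (h.trans ht₀.symm))
  have hlift : ∀ x, ∃ y, β y = γ x ∧ (x = (t₀ : OnePoint ℂ) → y = q) := by
    intro x
    by_cases hx : x = (t₀ : OnePoint ℂ)
    · exact ⟨q, by rw [hβq, hx, ht₀], fun _ => rfl⟩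
    · obtain ⟨y, hy⟩ := hβ.exists_lift (hne x hx)
      exact ⟨y, hy, fun h => absurd h hx⟩
  choose γ' hγ' hγq using hlift
  have hq' : γ' t₀ = q := hγq _ rfl
  have himm : ∀ {cu : ℂ → OnePoint ℂ} {t : ℂ}, cu t ≠ t₀ → IsImm (fun s => γ (cu s)) t →
      IsImm (fun s => γ' (cu s)) t := fun hcu h =>
    h.lift hβ le_rfl (Filter.Eventually.of_forall fun s => hγ' _) (hne _ hcu)
  have hloc : IsImm (fun t : ℂ => γ' t) t₀ := by
    let b : ℂ → C3 := fun s i => if i = j then u (γ s) j else d s i / d s j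
    have hdi : ∀ i, AnalyticAt ℂ (fun s => d s i) t₀ := analyticAt_pi_iff.1 hda
    have hb : AnalyticAt ℂ b t₀ := by
      refine analyticAt_pi_iff.2 fun i => ?_
      by_cases hi : i = j
      · simpa [b, hi] using analyticAt_pi_iff.1 ha j
      · simpa [b, hi] using (hdi i).fun_div (hdi j) hj
    have hb0 : b t₀ = c := by
      funext i
      by_cases hi : i = j
      · simp [b, hc, hi, ha0, dirCoord_same]
      · simp [b, hc, hi, dirCoord_ne]
    have hbd : deriv b t₀ ≠ 0 := by
      intro h
      have h1 := hasDerivAt_pi.1 hb.differentiableAt.hasDerivAt j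
      have h2 := hasDerivAt_pi.1 ha.differentiableAt.hasDerivAt j
      simp only [b, if_true] at h1
      rw [h] at h1
      rw [← hd0] at h2
      exact hj (h2.unique h1)
    have hbt : b t₀ ∈ (ψ j).target := by rwa [hb0]
    refine (isImm_symm (hψ j).mem hb hbd hbt).congr ?_
    filter_upwards [hde, hb.continuousAt.eventually ((ψ j).open_target.mem_nhds hbt),
      (hdi j).continuousAt.eventually_ne hj, hcont.eventually (u.open_source.mem_nhds hmem)]
      with s h1 h2 h3 h4
    by_cases hs : s = t₀
    · rw [hs, hq', hb0]
    · refine hβ.injective_off (by rw [hγ']; exact hne _ (by simpa using hs)) ?_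
      rw [hγ', (hψ j).eq _ h2]
      have : bl j (b s) = u (γ s) := by
        rw [h1]
        funext i
        by_cases hi : i = j
        · subst hi
          rw [bl_same]
          simp [b, h1]
        · rw [bl_ne hi]
          simp only [b, hi, if_true, if_false, h1, Pi.smul_apply, smul_eq_mul]
          field_simp
      rw [this, u.left_inv h4]
  have hcoe : ∀ t : ℂ, IsImm (fun t : ℂ => γ' t) t := by
    intro t
    by_cases ht : t = t₀
    · rw [ht]
      exact hloc
    · exact himm (cu := fun t : ℂ => (t : OnePoint ℂ)) (by simpa using ht) (hγ.coe t)
  constructor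
  · refine isSmoothRationalCurve_iff.2 ⟨γ', fun x y hxy => hγ.inj ?_, ?_, hcoe, ?_⟩
    · rw [← hγ' x, ← hγ' y, hxy]
    · ext y
      constructor
      · rintro ⟨x, rfl⟩
        by_cases hx : x = (t₀ : OnePoint ℂ)
        · exact Or.inl (hγq x hx)
        · refine Or.inr ⟨?_, ?_⟩
          · rw [hγ', ← hγ.range]
            exact Set.mem_range_self x
          · rw [hγ']
            exact hne x hx
      · rintro (rfl | ⟨h1, h2⟩)
        · exact ⟨_, hq'⟩
        · rw [← hγ.range] at h1
          obtain ⟨x, hx⟩ := h1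
          exact ⟨x, (hβ.injective_off h2 (by rw [hγ', hx])).symm⟩
    · refine himm (cu := chartInfty) ?_ hγ.infty
      rw [chartInfty_zero]
      exact OnePoint.infty_ne_coe _
  · have hcq : Filter.Tendsto (fun t : ℂ => γ' t) (𝓝[≠] t₀) (𝓝 q) := by
      have := hloc.continuousAt.tendsto
      rw [hq'] at this
      exact this.mono_left nhdsWithin_le_nhds
    refine hcq.frequently (Filter.Eventually.frequently ?_)
    filter_upwards [self_mem_nhdsWithin] with s hs
    rw [hγ']
    refine ⟨?_, hne _ (by simpa using hs)⟩
    rw [← hγ.range]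
    exact Set.mem_range_self _

end

/-- The singular locus is finite up to finitely many smooth rational curves, and all its points
are typed, consistently along the curves. -/
def IsTame {X : Threefold} (π : X → C3) (g : X → X) : Prop :=
  (∀ q ∈ singularLocus π g, IsTyped g q) ∧
  ∃ (T : Set X) (K : Set (Set X)), T.Finite ∧ K.Finite ∧
    (∀ q ∈ singularLocus π g, q ∈ T ∨ ∃ C ∈ K, q ∈ C) ∧
    ∀ C ∈ K, IsSmoothRationalCurve C ∧ C ⊆ singularLocus π g ∧ CurveType g C

section BlowUp

variable {f : C3 → C3} {X X' : Threefold} {π : X → C3} {g : X → X} {p : X} {β : X' → X}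
  {g' : X' → X'} {u : OpenPartialHomeomorph X C3} {ψ : Fin 3 → OpenPartialHomeomorph X' C3}
  {e : Fin 3 → ℕ} {U : C3 → ℂ} {M : C3 → Matrix (Fin 3) (Fin 3) ℂ}

theorem exists_logBlowUp (hπ : IsLiftable f π) (hg : IsLift f π g) (hp : π p = 0)
    (hβ : IsBlowUp 3 {p} β) (hπ' : IsLiftable f (fun x => π (β x)))
    (hg' : IsLift f (fun x => π (β x)) g')
    {K : (Fin 3 → ℕ) → (C3 → Matrix (Fin 3) (Fin 3) ℂ) → Prop} (hK : GermIn (LogType K) g p) :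
    ∃ u ψ e U M, LogBlowUp f π g p β g' u ψ e U M ∧ K e M := by
  obtain ⟨-, u, hu, e, U, M, hF, h⟩ := hK
  obtain ⟨ψ, hψ⟩ := hβ.exists_pointCharts hu
  exact ⟨u, ψ, e, U, M, ⟨hπ, hg, hp, hu, hF, hβ, hπ', hg', hψ⟩, h⟩

theorem IsTyped.exists_exceptionalSing (hπ : IsLiftable f π) (hg : IsLift f π g) (hp : π p = 0)
    (ht : IsTyped g p) (hβ : IsBlowUp 3 {p} β) (hπ' : IsLiftable f (fun x => π (β x)))
    (hg' : IsLift f (fun x => π (β x)) g') :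
    ∃ u ψ e U M, LogBlowUp f π g p β g' u ψ e U M ∧ ExceptionalSing p β g' ψ := by
  rcases ht with h | h | h
  · obtain ⟨u, ψ, e, U, M, h1, h2⟩ := exists_logBlowUp hπ hg hp hβ hπ' hg' h.normalA
    exact ⟨u, ψ, e, U, M, h1, h1.exceptionalSing_A h2⟩
  · obtain ⟨u, ψ, e, U, M, h1, h2⟩ := exists_logBlowUp hπ hg hp hβ hπ' hg' h.normalZ
    exact ⟨u, ψ, e, U, M, h1, h1.exceptionalSing_Z h2⟩
  · obtain ⟨u, ψ, e, U, M, h1, h2⟩ := exists_logBlowUp hπ hg hp hβ hπ' hg' h.normalD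
    exact ⟨u, ψ, e, U, M, h1, h1.exceptionalSing_D h2⟩

theorem LogBlowUp.germIn_iff (h : LogBlowUp f π g p β g' u ψ e U M) {N : (C3 → C3) → Prop}
    (hN : IsGermProp N) {q : X'} (hq : β q ≠ p) (hq0 : π (β q) = 0) :
    GermIn N g' q ↔ GermIn N g (β q) := by
  have hc := (h.isLift'.continuousAt hq0).self_of_nhds
  have hgg := h.liftable.comm h.liftable' h.isBlowUp.holomorphic.continuous h.isLift h.isLift' hq0
  exact ⟨fun h1 => h1.descend hN h.isBlowUp le_rfl hq hc hgg,
    fun h1 => h1.lift hN h.isBlowUp le_rfl hq (h.liftable'.fix h.isLift' hq0) hc hgg⟩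

theorem LogBlowUp.isTyped (h : LogBlowUp f π g p β g' u ψ e U M) {q : X'} (hq : β q ≠ p)
    (hq0 : π (β q) = 0) (ht : IsTyped g (β q)) : IsTyped g' q :=
  ht.imp (h.germIn_iff isGermProp_typeA hq hq0).2
    (Or.imp (h.germIn_iff isGermProp_typeZ hq hq0).2 (h.germIn_iff isGermProp_typeD hq hq0).2)

theorem LogBlowUp.mem_singularLocus_iff (h : LogBlowUp f π g p β g' u ψ e U M) {q : X'}
    (hq : β q ≠ p) :
    q ∈ singularLocus (fun x => π (β x)) g' ↔ β q ∈ singularLocus π g :=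
  and_congr_right fun hq0 => h.germIn_iff isGermProp_singForm hq hq0

theorem LogBlowUp.not_nonsing_of_frequently (h : LogBlowUp f π g p β g' u ψ e U M) {C : Set X}
    (hC : C ⊆ singularLocus π g) {q : X'} (hq : β q = p) (hf : ∃ᶠ x in 𝓝 q, β x ∈ C \ {p}) :
    ¬ GermIn NonsingForm g' q := by
  intro hn
  have hc := h.isLift'.continuousAt (h.map_zero hq)
  obtain ⟨x, ⟨hx, hxp⟩, h1, h2⟩ := (hf.and_eventually (hn.eventually_nonsing.and hc)).exists
  have hs := ((h.mem_singularLocus_iff hxp).2 (hC hx)).2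
  exact (h1 hs.1).not_isSingularAt h2 hs

theorem LogBlowUp.eventually_row_zero (h : LogBlowUp f π g p β g' u ψ e U M) {C : Set X}
    (hC : C ⊆ singularLocus π g) :
    ∀ᶠ x in 𝓝 p, x ∈ C → (M (u x) *ᵥ u x) 0 = 0 := by
  filter_upwards [(h.logForm.hasGermAt (h.liftable.fix h.isLift h.mem) h.coord).eventually_zero
    (h.isLift.continuousAt h.mem)] with x hx hxC
  exact congrFun (hx (hC hxC).2) 0

theorem IsLogForm.fderiv_row {F : C3 → C3} (h : IsLogForm F e U M) (v : C3) (i : Fin 3) :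
    fderiv ℂ (fun w => (M w *ᵥ w) i) 0 v = (M 0 *ᵥ v) i := by
  have h1 : ∀ j, AnalyticAt ℂ (fun w => M w i j) 0 := fun j => h.analytic i j
  have h2 : HasFDerivAt (fun w : C3 => ∑ j, M w i j * w j) _ 0 :=
    HasFDerivAt.fun_sum fun j _ => (h1 j).differentiableAt.hasFDerivAt.mul
      (analyticAt_coord j 0).differentiableAt.hasFDerivAt
  have h3 : ∀ j, fderiv ℂ (fun w : C3 => w j) 0 v = v j := fun j => by
    have := (ContinuousLinearMap.proj (R := ℂ) (φ := fun _ : Fin 3 => ℂ) j).hasFDerivAt (x := 0)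
    exact congrArg (fun L => L v) this.fderiv
  have h4 := h2.fderiv
  simp only [Matrix.mulVec, dotProduct]
  rw [h4]
  simp [h3]

/-- The lift of a curve of singular points to the blow-up of a typed point. -/
theorem LogBlowUp.exists_curve (h : LogBlowUp f π g p β g' u ψ e U M) {C : Set X}
    (hC : IsSmoothRationalCurve C) (hS : C ⊆ singularLocus π g) (ht : CurveType g C) :
    ∃ C' : Set X', IsSmoothRationalCurve C' ∧ C' ⊆ singularLocus (fun x => π (β x)) g' ∧
      CurveType g' C' ∧ ∀ q, β q ≠ p → β q ∈ C → q ∈ C' := by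
  have hβ := h.isBlowUp
  by_cases hp : p ∈ C
  swap
  · have hne : ∀ q, β q ∈ C → β q ≠ p := fun q hq hqp => hp (hqp ▸ hq)
    refine ⟨β ⁻¹' C, hC.preimage hp hβ,
      fun q hq => (h.mem_singularLocus_iff (hne q hq)).2 (hS hq), ?_, fun q _ hq => hq⟩
    refine ht.imp (fun hA q hq => (h.germIn_iff isGermProp_typeA (hne q hq) (hS hq).1).2 (hA _ hq))
      fun ⟨hB, hF⟩ => ⟨fun q hq => (hB _ hq).imp
        (h.germIn_iff isGermProp_typeB (hne q hq) (hS hq).1).2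
        (h.germIn_iff isGermProp_typeH (hne q hq) (hS hq).1).2, ?_⟩
    refine Set.Finite.of_injOn (f := β) (fun q hq => ?_) (fun q hq q' _ he =>
      hβ.injective_off (hne q hq.1) he) hF
    exact ⟨hq.1, fun hH => hq.2 ((h.germIn_iff isGermProp_typeH (hne q hq.1) (hS hq.1).1).2 hH)⟩
  rcases ht with hA | ⟨hB, hF⟩
  · obtain ⟨u, ψ, e, U, M, h, hK⟩ := exists_logBlowUp h.liftable h.isLift h.mem hβ h.liftable'
      h.isLift' (hA p hp).normalA
    obtain ⟨v, hv, -, hv2⟩ := hC.strictTransform hp hβ h.coord h.charts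
    obtain ⟨j, hj⟩ := Function.ne_iff.1 hv
    obtain ⟨h1, h2⟩ := hv2 j hj
    set q₀ := (ψ j).symm (dirCoord j v)
    have hq₀ : β q₀ = p := h.map_center (dirCoord_same j v)
    have hn := h.not_nonsing_of_frequently hS hq₀ h2
    have hA₀ := h.typeA hK hq₀ hn
    refine ⟨_, h1, ?_, Or.inl ?_, fun q hq hqC => Or.inr ⟨hqC, hq⟩⟩
    · rintro q (rfl | ⟨hq, hqp⟩)
      · exact ⟨h.map_zero hq₀, (IsTyped.nonsing_or_singular (Or.inl hA₀)).resolve_left hn⟩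
      · exact (h.mem_singularLocus_iff hqp).2 (hS hq)
    · rintro q (rfl | ⟨hq, hqp⟩)
      · exact hA₀
      · exact (h.germIn_iff isGermProp_typeA hqp (hS hq).1).2 (hA _ hq)
  · have hZ : GermIn TypeZ g p := (hB p hp).elim (·.typeB_typeZ) (·.typeH_typeZ)
    obtain ⟨u, ψ, e, U, M, h, hK⟩ := exists_logBlowUp h.liftable h.isLift h.mem hβ h.liftable'
      h.isLift' hZ.normalZ
    obtain ⟨v, hv, hv1, hv2⟩ := hC.strictTransform hp hβ h.coord h.charts
    have hv0 : v 0 = 0 := by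
      have := hv1 (fun w => (M w *ᵥ w) 0)
        (analyticAt_c3.1 (analyticAt_mulVec h.logForm.analytic analyticAt_id) 0)
        (h.eventually_row_zero hS)
      rw [h.logForm.fderiv_row] at this
      simp only [Matrix.mulVec, dotProduct, Fin.sum_univ_three, hK.2.1, hK.2.2] at this
      simpa [hK.1.2.2.1] using this
    obtain ⟨j, hj⟩ := Function.ne_iff.1 hv
    have hj0 : j ≠ 0 := by
      rintro rfl
      exact hj hv0
    obtain ⟨h1, h2⟩ := hv2 j hj
    set q₀ := (ψ j).symm (dirCoord j v)
    have hq₀ : β q₀ = p := h.map_center (dirCoord_same j v)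
    have hn := h.not_nonsing_of_frequently hS hq₀ h2
    have hB₀ : GermIn TypeB g' q₀ ∨ GermIn TypeH g' q₀ :=
      (h.typeZ_transverse hK hj0 (dirCoord_same j v) hn).1.symm.imp (·.1) id
    have hZ₀ : GermIn TypeZ g' q₀ := hB₀.elim (·.typeB_typeZ) (·.typeH_typeZ)
    refine ⟨_, h1, ?_, Or.inr ⟨?_, ?_⟩, fun q hq hqC => Or.inr ⟨hqC, hq⟩⟩
    · rintro q (rfl | ⟨hq, hqp⟩)
      · exact ⟨h.map_zero hq₀, (IsTyped.nonsing_or_singular (Or.inr (Or.inl hZ₀))).resolve_left hn⟩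
      · exact (h.mem_singularLocus_iff hqp).2 (hS hq)
    · rintro q (rfl | ⟨hq, hqp⟩)
      · exact hB₀
      · exact (hB _ hq).imp (h.germIn_iff isGermProp_typeB hqp (hS hq).1).2
          (h.germIn_iff isGermProp_typeH hqp (hS hq).1).2
    · have hfin : {q | β q ≠ p ∧ β q ∈ {x | x ∈ C ∧ ¬ GermIn TypeH g x}}.Finite :=
        Set.Finite.of_injOn (f := β) (fun q hq => hq.2)
          (fun q hq q' _ he => hβ.injective_off hq.1 he) hF
      refine (hfin.insert q₀).subset ?_
      rintro q ⟨rfl | ⟨hq, hqp⟩, hH⟩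
      · exact Or.inl rfl
      · exact Or.inr ⟨hqp, hq, fun h' =>
          hH ((h.germIn_iff isGermProp_typeH hqp (hS hq).1).2 h')⟩

theorem IsTame.blowUp (hπ : IsLiftable f π) (hg : IsLift f π g) (ht : IsTame π g)
    (hp : p ∈ singularLocus π g) (hβ : IsBlowUp 3 {p} β) :
    IsLiftable f (fun x => π (β x)) ∧
      ∀ g', IsLift f (fun x => π (β x)) g' → IsTame (fun x => π (β x)) g' := by
  obtain ⟨ht1, T, K, hT, hK, hTK, hKC⟩ := ht
  have hpt := ht1 p hp
  have hπ' := hπ.pointBlowUp hg hp.1 hpt.tangent hβ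
  refine ⟨hπ', fun g' hg' => ?_⟩
  obtain ⟨u, ψ, e, U, M, h, hE1, T', K', hT', hK', hE2⟩ :=
    hpt.exists_exceptionalSing hπ hg hp.1 hβ hπ' hg'
  choose! C' hC' using fun C (hC : C ∈ K) =>
    h.exists_curve (hKC C hC).1 (hKC C hC).2.1 (hKC C hC).2.2
  have hline : ∀ {a b : Fin 3}, a ≠ b → ∀ q ∈ exLine ψ a b, β q = p := by
    rintro a b hab q (⟨t, rfl⟩ | rfl)
    · exact h.map_center (by simp [hab])
    · exact h.map_center rfl
  refine ⟨fun q hq => ?_, T' ∪ {q | β q ≠ p ∧ β q ∈ T},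
    C' '' K ∪ (fun ab : Fin 3 × Fin 3 => exLine ψ ab.1 ab.2) '' K', ?_, ?_, ?_, ?_⟩
  · by_cases hqp : β q = p
    · exact hE1 q hqp hq.2
    · exact h.isTyped hqp hq.1 (ht1 _ ((h.mem_singularLocus_iff hqp).1 hq))
  · exact hT'.union (Set.Finite.of_injOn (f := β) (fun q hq => hq.2)
      (fun q hq q' _ he => hβ.injective_off hq.1 he) hT)
  · exact (hK.image _).union ((Set.toFinite K').image _)
  · intro q hq
    by_cases hqp : β q = p
    · rcases hE2 q hqp hq.2 with h1 | ⟨ab, h1, h2⟩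
      · exact Or.inl (Or.inl h1)
      · exact Or.inr ⟨_, Or.inr ⟨ab, h1, rfl⟩, h2⟩
    · rcases hTK _ ((h.mem_singularLocus_iff hqp).1 hq) with h1 | ⟨C, h1, h2⟩
      · exact Or.inl (Or.inr ⟨hqp, h1⟩)
      · exact Or.inr ⟨_, Or.inl ⟨C, h1, rfl⟩, (hC' C h1).2.2.2 q hqp h2⟩
  · rintro _ (⟨C, hC, rfl⟩ | ⟨ab, hab, rfl⟩)
    · exact ⟨(hC' C hC).1, (hC' C hC).2.1, (hC' C hC).2.2.1⟩
    · obtain ⟨h1, h2, h3⟩ := hK' ab hab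
      exact ⟨isSmoothRationalCurve_exLine hβ h.coord h.charts h1,
        fun q hq => ⟨h.map_zero (hline h1 q hq), h2 q hq⟩, h3⟩

end BlowUp

section

variable {X : Threefold}

/-! ### Analytic subsets -/

/-- `A` is the zero set of finitely many holomorphic functions near `x`. -/
def IsAnalyticNear (A : Set X) (x : X) : Prop :=
  ∃ (ι : Type) (_ : Fintype ι) (h : ι → X → ℂ),
    (∀ k, ∀ᶠ y in 𝓝 x, ContMDiffAt 𝓘(ℂ, C3) 𝓘(ℂ, ℂ) ω (h k) y) ∧
    ∀ᶠ y in 𝓝 x, y ∈ A ↔ ∀ k, h k y = 0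

theorem isAnalyticSubset_iff {A : Set X} : IsAnalyticSubset A ↔ ∀ x, IsAnalyticNear A x := by
  refine forall_congr' fun x => ⟨?_, ?_⟩
  · rintro ⟨U, hU, hx, n, h, h1, h2⟩
    refine ⟨Fin n, inferInstance, h, fun k => ?_, ?_⟩
    · filter_upwards [hU.mem_nhds hx] with y hy
      exact (h1 k).contMDiffAt (hU.mem_nhds hy)
    · filter_upwards [hU.mem_nhds hx] with y hy
      exact h2 y hy
  · rintro ⟨ι, hι, h, h1, h2⟩
    obtain ⟨U, hU, hUo, hxU⟩ := eventually_nhds_iff.1 ((Filter.eventually_all.2 h1).and h2)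
    let e := Fintype.equivFin ι
    refine ⟨U, hUo, hxU, Fintype.card ι, fun k => h (e.symm k),
      fun k y hy => ((hU y hy).1 _).contMDiffWithinAt, fun y hy => ?_⟩
    rw [(hU y hy).2]
    exact ⟨fun h k => h _, fun h k => by simpa using h (e k)⟩

theorem isAnalyticNear_of_notMem_closure {A : Set X} {x : X} (hx : x ∉ closure A) :
    IsAnalyticNear A x := by
  refine ⟨Unit, inferInstance, fun _ _ => 1,
    fun _ => Filter.Eventually.of_forall fun y => contMDiffAt_const, ?_⟩
  filter_upwards [isClosed_closure.isOpen_compl.mem_nhds hx] with y hy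
  simpa using fun h => hy (subset_closure h)

theorem isAnalyticSubset_of_isClosed {A : Set X} (hA : IsClosed A)
    (h : ∀ x ∈ A, IsAnalyticNear A x) : IsAnalyticSubset A := by
  refine isAnalyticSubset_iff.2 fun x => ?_
  by_cases hx : x ∈ A
  · exact h x hx
  · exact isAnalyticNear_of_notMem_closure (by rwa [hA.closure_eq])

theorem IsAnalyticSubset.isClosed {A : Set X} (hA : IsAnalyticSubset A) : IsClosed A := by
  rw [← isOpen_compl_iff, isOpen_iff_mem_nhds]
  intro x hx
  obtain ⟨ι, hι, h, h1, h2⟩ := isAnalyticSubset_iff.1 hA x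
  have hx' : ¬ ∀ k, h k x = 0 := fun hk => hx (h2.self_of_nhds.2 hk)
  obtain ⟨k, hk⟩ := not_forall.1 hx'
  filter_upwards [h2, (h1 k).self_of_nhds.continuousAt.eventually_ne hk] with y hy hyk hyA
  exact hyk (hy.1 hyA k)

theorem IsAnalyticSubset.inter {A B : Set X} (hA : IsAnalyticSubset A) (hB : IsAnalyticSubset B) :
    IsAnalyticSubset (A ∩ B) := by
  rw [isAnalyticSubset_iff] at *
  intro x
  obtain ⟨ι, _, h, h1, h2⟩ := hA x
  obtain ⟨κ, _, k, k1, k2⟩ := hB x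
  refine ⟨ι ⊕ κ, inferInstance, Sum.elim h k, ?_, ?_⟩
  · rintro (i | i)
    · exact h1 i
    · exact k1 i
  · filter_upwards [h2, k2] with y h3 k3
    simp [h3, k3]

theorem IsAnalyticSubset.union {A B : Set X} (hA : IsAnalyticSubset A) (hB : IsAnalyticSubset B) :
    IsAnalyticSubset (A ∪ B) := by
  rw [isAnalyticSubset_iff] at *
  intro x
  obtain ⟨ι, _, h, h1, h2⟩ := hA x
  obtain ⟨κ, _, k, k1, k2⟩ := hB x
  refine ⟨ι × κ, inferInstance, fun i y => h i.1 y * k i.2 y, fun i => ?_, ?_⟩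
  · filter_upwards [h1 i.1, k1 i.2] with y h3 k3
    exact h3.smul k3
  · filter_upwards [h2, k2] with y h3 k3
    rw [Set.mem_union, h3, k3]
    constructor
    · rintro (h | h) i
      · rw [h, zero_mul]
      · rw [h, mul_zero]
    · intro h
      by_contra! hc
      obtain ⟨⟨i, hi⟩, ⟨j, hj⟩⟩ := hc
      exact (mul_ne_zero hi hj) (h (i, j))

theorem isAnalyticSubset_empty : IsAnalyticSubset (∅ : Set X) :=
  isAnalyticSubset_of_isClosed isClosed_empty (by simp)

theorem isAnalyticSubset_singleton (p : X) : IsAnalyticSubset ({p} : Set X) := by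
  refine isAnalyticSubset_of_isClosed isClosed_singleton ?_
  rintro x rfl
  obtain ⟨v, hv, hx⟩ := exists_chart x
  refine ⟨Fin 3, inferInstance, fun i y => v y i - v x i, fun i => ?_, ?_⟩
  · filter_upwards [v.open_source.mem_nhds hx] with y hy
    have := contMDiffAt_of_mem_maximalAtlas hv hy
    exact (contMDiffAt_pi_space.1 this i).sub contMDiffAt_const
  · filter_upwards [v.open_source.mem_nhds hx] with y hy
    constructor
    · rintro rfl i
      exact sub_self _
    · intro h
      exact v.injOn hy hx (funext fun i => sub_eq_zero.1 (h i))

theorem IsIrreducibleAnalytic.exists_subset {A : Set X} (hA : IsIrreducibleAnalytic A)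
    {F : Set (Set X)} (hF : F.Finite) (hFa : ∀ B ∈ F, IsAnalyticSubset B) (h : A ⊆ ⋃₀ F) :
    ∃ B ∈ F, A ⊆ B := by
  suffices H : ∀ F : Set (Set X), F.Finite → (∀ B ∈ F, IsAnalyticSubset B) →
      IsAnalyticSubset (⋃₀ F) ∧ (A ⊆ ⋃₀ F → ∃ B ∈ F, A ⊆ B) from (H F hF hFa).2 h
  intro F hF
  induction F, hF using Set.Finite.induction_on with
  | empty =>
    intro _
    rw [Set.sUnion_empty]
    exact ⟨isAnalyticSubset_empty, fun h => absurd (Set.subset_empty_iff.1 h) hA.2.1.ne_empty⟩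
  | @insert B F _ _ ih =>
    intro hFa
    have hB := hFa B (Set.mem_insert _ _)
    obtain ⟨h1, h2⟩ := ih fun C hC => hFa C (Set.mem_insert_of_mem _ hC)
    rw [Set.sUnion_insert]
    refine ⟨hB.union h1, fun h => ?_⟩
    rcases hA.2.2 _ _ (hA.1.inter hB) (hA.1.inter h1)
      (by rw [← Set.inter_union_distrib_left, Set.inter_eq_left.2 h]) with h3 | h3
    · exact ⟨B, Set.mem_insert _ _, Set.inter_eq_left.1 h3.symm⟩
    · obtain ⟨C, hC, hAC⟩ := h2 (Set.inter_eq_left.1 h3.symm)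
      exact ⟨C, Set.mem_insert_of_mem _ hC, hAC⟩

/-! ### Rational curves are irreducible -/

theorem IsRatParam.tendsto_infty {γ : OnePoint ℂ → X} {C : Set X} (h : IsRatParam γ C) :
    Filter.Tendsto (fun t : ℂ => γ t) (Bornology.cobounded ℂ) (𝓝 (γ OnePoint.infty)) := by
  have h1 := h.infty.continuousAt.tendsto
  rw [chartInfty_zero] at h1
  refine (h1.comp (Filter.tendsto_inv₀_cobounded (α := ℂ))).congr' ?_
  have h2 : ∀ᶠ t : ℂ in Bornology.cobounded ℂ, t ≠ 0 :=
    Bornology.eventually_ne_cobounded 0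
  filter_upwards [h2] with t ht
  simp [chartInfty_of_ne (inv_ne_zero ht)]

theorem IsRatParam.continuous {γ : OnePoint ℂ → X} {C : Set X} (h : IsRatParam γ C) :
    Continuous γ := by
  rw [continuous_iff_continuousAt]
  intro x
  induction x using OnePoint.rec with
  | infty =>
    rw [OnePoint.continuousAt_infty', Filter.coclosedCompact_eq_cocompact,
      ← Metric.cobounded_eq_cocompact]
    exact h.tendsto_infty
  | coe t => exact (OnePoint.continuousAt_coe).2 (h.coe t).continuousAt

theorem IsRatParam.isClosed {γ : OnePoint ℂ → X} {C : Set X} (h : IsRatParam γ C) : IsClosed C := by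
  rw [← h.range]
  exact (isCompact_range h.continuous).isClosed

/-- Holomorphic local inverses in dimension one. -/
theorem exists_localInverse {a : ℂ → ℂ} {t : ℂ} (ha : AnalyticAt ℂ a t) (hd : deriv a t ≠ 0) :
    ∃ τ : ℂ → ℂ, AnalyticAt ℂ τ (a t) ∧ τ (a t) = t ∧ ∀ᶠ s in 𝓝 t, τ (a s) = s := by
  have hs : HasStrictDerivAt a (deriv a t) t := ha.hasStrictDerivAt
  have h1 : AnalyticAt ℂ (hs.localInverse a (deriv a t) t hd) (a t) :=
    analyticAt_of_contDiffAt (ContDiffAt.to_localInverse (n := ω) ha.contDiffAt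
      (hs.hasStrictFDerivAt_equiv hd).hasFDerivAt (by simp))
  exact ⟨_, h1, HasStrictFDerivAt.localInverse_apply_image (hs.hasStrictFDerivAt_equiv hd),
    hs.eventually_left_inverse hd⟩

theorem IsRatParam.isAnalyticNear {γ : OnePoint ℂ → X} {C : Set X} (hγ : IsRatParam γ C) (t : ℂ) :
    IsAnalyticNear C (γ t) := by
  obtain ⟨v, hv, hx⟩ := exists_chart (γ t)
  obtain ⟨hc, ha, hd⟩ := (isImm_iff hv hx).1 (hγ.coe t)
  set a : ℂ → C3 := fun s => v (γ s) with hadef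
  have hai := fun i => analyticAt_c3.1 ha i
  have hdi : ∀ i, deriv (fun s => a s i) t = deriv a t i := fun i =>
    (hasDerivAt_pi.1 ha.differentiableAt.hasDerivAt i).deriv
  obtain ⟨j, hj⟩ := Function.ne_iff.1 hd
  obtain ⟨τ, hτ, hτt, hτs⟩ := exists_localInverse (hai j) (by rw [hdi]; exact hj)
  have hb : ∀ k, AnalyticAt ℂ (fun w : C3 => w k - a (τ (w j)) k) (a t) := fun k => by
    have h1 : AnalyticAt ℂ (fun w : C3 => τ (w j)) (a t) :=
      AnalyticAt.fun_comp (g := τ) (f := fun w : C3 => w j) hτ (analyticAt_coord j _)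
    have h2 : AnalyticAt ℂ (fun w : C3 => a (τ (w j)) k) (a t) :=
      AnalyticAt.fun_comp (g := fun s => a s k) (f := fun w : C3 => τ (w j))
        (by rw [hτt]; exact hai k) h1
    exact (analyticAt_coord k _).fun_sub h2
  have hvc : Filter.Tendsto v (𝓝 (γ t)) (𝓝 (a t)) := (v.continuousAt hx).tendsto
  refine ⟨Fin 3, inferInstance, fun k y => v y k - a (τ (v y j)) k, fun k => ?_, ?_⟩
  · filter_upwards [v.open_source.mem_nhds hx, hvc.eventually (hb k).eventually_analyticAt]
      with y hy h1
    exact ContMDiffAt.comp (g := fun w : C3 => w k - a (τ (w j)) k) y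
      (contMDiffAt_iff_contDiffAt.2 h1.contDiffAt) (contMDiffAt_of_mem_maximalAtlas hv hy)
  · have hemb : Topology.IsClosedEmbedding γ := hγ.continuous.isClosedEmbedding hγ.inj
    have hW : ∀ᶠ x : OnePoint ℂ in 𝓝 (t : OnePoint ℂ), ∃ s : ℂ, x = s ∧ τ (a s j) = s := by
      rw [OnePoint.nhds_coe_eq, Filter.eventually_map]
      exact hτs.mono fun s hs => ⟨s, rfl, hs⟩
    rw [hemb.nhds_eq_comap, Filter.eventually_comap] at hW
    have hτc : Filter.Tendsto (fun y => τ (v y j)) (𝓝 (γ t)) (𝓝 t) := by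
      have h1 : ContinuousAt (fun w : C3 => τ (w j)) (a t) :=
        ContinuousAt.comp (g := τ) (f := fun w : C3 => w j) hτ.continuousAt
          (analyticAt_coord j _).continuousAt
      have h2 := h1.tendsto.comp hvc
      rwa [hτt] at h2
    filter_upwards [hW, v.open_source.mem_nhds hx,
      hτc.eventually (hc.eventually (v.open_source.mem_nhds hx))] with y hy h1 h2
    constructor
    · intro hyC k
      rw [← hγ.range] at hyC
      obtain ⟨x, rfl⟩ := hyC
      obtain ⟨s, rfl, hs⟩ := hy x rfl
      change a s k - a (τ (a s j)) k = 0
      rw [hs, sub_self]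
    · intro hk
      have : v y = v (γ (τ (v y j) : ℂ)) := funext fun k => sub_eq_zero.1 (hk k)
      rw [v.injOn h1 h2 this, ← hγ.range]
      exact Set.mem_range_self _

theorem IsSmoothRationalCurve.isAnalyticSubset {C : Set X} (hC : IsSmoothRationalCurve C) :
    IsAnalyticSubset C := by
  obtain ⟨γ, hγ⟩ := isSmoothRationalCurve_iff.1 hC
  refine isAnalyticSubset_of_isClosed hγ.isClosed fun x hx => ?_
  obtain ⟨γ, hγ, t, rfl⟩ := hC.exists_param hx
  exact hγ.isAnalyticNear t

/-- An analytic set that accumulates at a point of a curve contains the curve near the point. -/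
theorem IsImm.eventually_mem {c : ℂ → X} {t : ℂ} (hc : IsImm c t) {A : Set X}
    (hA : IsAnalyticSubset A) (hf : ∃ᶠ s in 𝓝[≠] t, c s ∈ A) : ∀ᶠ s in 𝓝 t, c s ∈ A := by
  obtain ⟨ι, hι, h, h1, h2⟩ := isAnalyticSubset_iff.1 hA (c t)
  have h3 := hc.continuousAt.eventually h2
  have h4 : ∀ k, ∀ᶠ s in 𝓝 t, h k (c s) = 0 := by
    intro k
    have ha : AnalyticAt ℂ (fun s => h k (c s)) t :=
      analyticAt_of_contDiffAt (contMDiffAt_iff_contDiffAt.1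
        (ContMDiffAt.comp t (h1 k).self_of_nhds hc.1))
    refine ha.frequently_zero_iff_eventually_zero.1 ?_
    refine (hf.and_eventually (h3.filter_mono nhdsWithin_le_nhds)).mono ?_
    rintro s ⟨hs, hs'⟩
    exact hs'.1 hs k
  filter_upwards [h3, Filter.eventually_all.2 h4] with s h5 h6
  exact h5.2 h6

theorem IsSmoothRationalCurve.isIrreducibleAnalytic {C : Set X} (hC : IsSmoothRationalCurve C) :
    IsIrreducibleAnalytic C := by
  refine ⟨hC.isAnalyticSubset, ?_, ?_⟩
  · obtain ⟨γ, hγ⟩ := isSmoothRationalCurve_iff.1 hC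
    exact ⟨γ OnePoint.infty, hγ.range ▸ Set.mem_range_self _⟩
  intro A B hA hB hAB
  obtain ⟨γ, hγ⟩ := isSmoothRationalCurve_iff.1 hC
  have hmem : ∀ t : ℂ, γ t ∈ A ∪ B := fun t => by
    rw [← hAB, ← hγ.range]
    exact Set.mem_range_self _
  let E : Set X → Set ℂ := fun D => {t | ∀ᶠ s : ℂ in 𝓝 t, γ s ∈ D}
  have hopen : ∀ D, IsOpen (E D) := fun D => isOpen_setOfPred_eventually_nhds
  have hclosed : ∀ D, IsAnalyticSubset D → IsClosed (E D) := by
    intro D hD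
    refine isClosed_of_closure_subset fun t ht => ?_
    refine (hγ.coe t).eventually_mem hD ?_
    rw [mem_closure_iff_frequently] at ht
    intro hcon
    rw [eventually_nhdsWithin_iff] at hcon
    obtain ⟨s, hs, hs2⟩ := (ht.and_eventually hcon.eventually_nhds).exists
    have h1 : ∃ᶠ z in 𝓝[≠] s, z ≠ t := by
      refine Filter.Eventually.frequently ?_
      by_cases hst : s = t
      · rw [hst]
        exact self_mem_nhdsWithin
      · exact nhdsWithin_le_nhds (isOpen_ne.mem_nhds hst)
    obtain ⟨z, hz, hz1, hz2⟩ := (h1.and_eventually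
      ((hs.and hs2).filter_mono nhdsWithin_le_nhds)).exists
    exact hz2 hz hz1
  have hcover : ∀ t, t ∈ E A ∪ E B := by
    intro t
    have h1 : ∃ᶠ s : ℂ in 𝓝[≠] t, γ s ∈ A ∨ γ s ∈ B :=
      (Filter.Eventually.of_forall fun s => hmem s).frequently
    exact (Filter.frequently_or_distrib.1 h1).imp ((hγ.coe t).eventually_mem hA)
      ((hγ.coe t).eventually_mem hB)
  have hfull : ∀ D, IsAnalyticSubset D → D ⊆ C → E D = Set.univ → C = D := by
    intro D hD hDC hE
    have h1 : ∀ t : ℂ, γ t ∈ D := fun t =>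
      (show ∀ᶠ s : ℂ in 𝓝 t, γ s ∈ D from (hE ▸ Set.mem_univ t : t ∈ E D)).self_of_nhds
    refine Set.Subset.antisymm (fun x hx => ?_) hDC
    rw [← hγ.range] at hx
    obtain ⟨x, rfl⟩ := hx
    induction x using OnePoint.rec with
    | infty =>
      exact hD.isClosed.mem_of_tendsto hγ.tendsto_infty (Filter.Eventually.of_forall h1)
    | coe t => exact h1 t
  rcases isClopen_iff.1 ⟨hclosed A hA, hopen A⟩ with h1 | h1
  · right
    refine hfull B hB (hAB ▸ Set.subset_union_right) (Set.eq_univ_of_forall fun t => ?_)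
    exact (hcover t).resolve_left (by rw [h1]; exact Set.notMem_empty t)
  · exact Or.inl (hfull A hA (hAB ▸ Set.subset_union_left) h1)

theorem IsPositiveDimComponent.mem {S C : Set X} (hC : IsPositiveDimComponent S C) {T : Set X}
    {K : Set (Set X)} (hT : T.Finite) (hK : K.Finite) (hS : ∀ q ∈ S, q ∈ T ∨ ∃ D ∈ K, q ∈ D)
    (hKS : ∀ D ∈ K, IsSmoothRationalCurve D ∧ D ⊆ S) : C ∈ K := by
  obtain ⟨⟨⟨hirr, hCS⟩, hmax⟩, hnt⟩ := hC
  have h1 : ∀ B ∈ (fun t : X => ({t} : Set X)) '' T ∪ K, IsAnalyticSubset B := by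
    rintro B (⟨t, -, rfl⟩ | hB)
    · exact isAnalyticSubset_singleton t
    · exact (hKS B hB).1.isAnalyticSubset
  have h2 : C ⊆ ⋃₀ ((fun t : X => ({t} : Set X)) '' T ∪ K) := by
    intro q hq
    rcases hS q (hCS hq) with h | ⟨D, hD, hqD⟩
    · exact ⟨{q}, Or.inl ⟨q, h, rfl⟩, rfl⟩
    · exact ⟨D, Or.inr hD, hqD⟩
  obtain ⟨D, hD, hCD⟩ := hirr.exists_subset ((hT.image _).union hK) h1 h2
  rcases hD with ⟨t, -, rfl⟩ | hD
  · exact absurd hnt (Set.not_nontrivial_iff.2 (Set.subsingleton_singleton.anti hCD))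
  · have := hmax ⟨(hKS D hD).1.isIrreducibleAnalytic, (hKS D hD).2⟩ hCD
    rwa [Set.Subset.antisymm hCD this]

end

section

/-! ### The family of germs -/

/-- The cubic part of the germs of the family. -/
def cubic (v : C3) : C3 :=
  ![v 1 * v 2 * (v 1 - v 2), v 0 * (v 0 ^ 2 - v 2 ^ 2), v 0 * v 2 * (v 1 - v 2)]

theorem analyticAt_cubic (v : C3) : AnalyticAt ℂ cubic v := by
  have h := fun k => analyticAt_coord k v
  refine analyticAt_c3.2 fun i => ?_
  fin_cases i
  · exact ((h 1).fun_mul (h 2)).fun_mul ((h 1).fun_sub (h 2))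
  · exact (h 0).fun_mul (((h 0).fun_pow 2).fun_sub ((h 2).fun_pow 2))
  · exact ((h 0).fun_mul (h 2)).fun_mul ((h 1).fun_sub (h 2))

theorem cubic_smul (t : ℂ) (v : C3) : cubic (t • v) = t ^ 3 • cubic v := by
  funext i
  fin_cases i <;> simp [cubic] <;> ring

theorem bl_eq_smul' (j : Fin 3) (w : C3) : bl j w = w j • Function.update w j 1 :=
  funext fun k => bl_eq_smul j w k

theorem homogeneousPart_single (n : ℕ) (φ : FPS) (j : Fin 3) :
    homogeneousPart n φ (Pi.single j 1) = MvPowerSeries.coeff (Finsupp.single j n) φ := by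
  classical
  rw [homogeneousPart, Finset.sum_eq_single (Finsupp.single j n)]
  · rw [Finset.prod_eq_one, mul_one]
    intro i _
    by_cases hi : i = j
    · subst hi
      simp
    · simp [Ne.symm hi]
  · intro d hd hne
    rw [Finset.mem_finsuppAntidiag] at hd
    obtain ⟨i, hi, hdi⟩ : ∃ i, i ≠ j ∧ d i ≠ 0 := by
      by_contra! hc
      apply hne
      ext i
      by_cases hi : i = j
      · subst hi
        rw [Finsupp.single_eq_same, ← hd.1, Finset.sum_eq_single i (fun k _ hk => hc k hk) (by simp)]
      · rw [hc i hi, Finsupp.single_eq_of_ne hi]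
    rw [Finset.prod_eq_zero (Finset.mem_univ i), mul_zero]
    rw [Pi.single_eq_of_ne hi, zero_pow hdi]
  · intro h
    refine absurd ?_ h
    rw [Finset.mem_finsuppAntidiag]
    refine ⟨?_, Finset.subset_univ _⟩
    rw [Finset.sum_eq_single j (fun k _ hk => Finsupp.single_eq_of_ne hk) (by simp),
      Finsupp.single_eq_same]

/-- The germ in the `j`-th chart of the blow-up of the origin. -/
def IsFamilyChart (f : C3 → C3) (j : Fin 3) (K : C3 → C3) (c : C3) : Prop :=
  AnalyticAt ℂ K c ∧ ∀ᶠ w in 𝓝 c,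
    f (bl j w) = bl j w + w j ^ 3 • (cubic (Function.update w j 1) + w j • K w)

variable {f : C3 → C3} {P Q R : FPS}

theorem IsInFamily.exists_chart (hf : IsInFamily f P Q R) (j : Fin 3) :
    ∃ K : C3 → C3, (∀ c, c j = 0 → IsFamilyChart f j K c) ∧
      K 0 2 = MvPowerSeries.coeff (Finsupp.single j 4) R := by
  obtain ⟨hP, hQ, hR, eP, eQ, eR⟩ := hf
  obtain ⟨K₀, h₀⟩ := eP.exists_bl hP j
  obtain ⟨K₁, h₁⟩ := eQ.exists_bl hQ j
  obtain ⟨K₂, h₂⟩ := eR.exists_bl hR j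
  refine ⟨fun w => ![K₀ w, K₁ w, K₂ w], fun c hc => ⟨analyticAt_c3.2 fun i => ?_, ?_⟩, ?_⟩
  · fin_cases i
    exacts [(h₀ c hc).1, (h₁ c hc).1, (h₂ c hc).1]
  · filter_upwards [(h₀ c hc).2.1, (h₁ c hc).2.1, (h₂ c hc).2.1] with w e0 e1 e2
    have hc3 : w j ^ 3 • cubic (Function.update w j 1) = cubic (bl j w) := by
      rw [bl_eq_smul' j w, cubic_smul]
    rw [smul_add, hc3]
    funext i
    fin_cases i
    · simp [cubic]
      linear_combination e0
    · simp [cubic]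
      linear_combination e1
    · simp [cubic]
      linear_combination e2
  · simp only [Matrix.cons_val]
    rw [(h₂ 0 rfl).2.2, ← homogeneousPart_single]
    rfl

theorem IsInFamily.analyticAt (hf : IsInFamily f P Q R) : AnalyticAt ℂ f 0 := by
  obtain ⟨-, -, -, eP, eQ, eR⟩ := hf
  have h := fun k => analyticAt_coord k (0 : C3)
  have h0 := eP.analyticAt.fun_add ((h 0).fun_add (((h 1).fun_mul (h 2)).fun_mul
    ((h 1).fun_sub (h 2))))
  have h1 := eQ.analyticAt.fun_add ((h 1).fun_add ((h 0).fun_mul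
    (((h 0).fun_pow 2).fun_sub ((h 2).fun_pow 2))))
  have h2 := eR.analyticAt.fun_add ((h 2).fun_add (((h 0).fun_mul (h 2)).fun_mul
    ((h 1).fun_sub (h 2))))
  simp only [sub_add_cancel] at h0 h1 h2
  refine analyticAt_c3.2 fun i => ?_
  fin_cases i
  exacts [h0, h1, h2]

theorem IsInFamily.hasDerivAt_single (hf : IsInFamily f P Q R) (j : Fin 3) :
    f 0 = 0 ∧ HasDerivAt (fun t : ℂ => f (Pi.single j t)) (Pi.single j 1) 0 := by
  obtain ⟨K, hK, -⟩ := hf.exists_chart j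
  obtain ⟨hKa, he⟩ := hK 0 rfl
  have hbl : ∀ t : ℂ, bl j (Pi.single j t) = Pi.single j t := by
    intro t
    funext i
    by_cases hi : i = j
    · subst hi
      simp [bl_same]
    · simp [bl_ne hi, hi]
  have ht : Filter.Tendsto (fun t : ℂ => (Pi.single j t : C3)) (𝓝 0) (𝓝 0) := by
    have := (TangentToId.hasDerivAt_single j).continuousAt.tendsto
    rwa [Pi.single_zero] at this
  have hs : AnalyticAt ℂ (fun t : ℂ => (Pi.single j t : C3)) 0 :=
    (ContinuousLinearMap.single ℂ (fun _ : Fin 3 => ℂ) j).analyticAt 0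
  have hH : AnalyticAt ℂ (fun t : ℂ => cubic (Function.update (Pi.single j t : C3) j 1) +
      (Pi.single j t : C3) j • K (Pi.single j t)) 0 := by
    have h1 : AnalyticAt ℂ (fun t : ℂ => K (Pi.single j t)) 0 :=
      AnalyticAt.fun_comp (g := K) (by simpa using hKa) hs
    simp only [Pi.single_eq_same]
    refine AnalyticAt.fun_add ?_ (analyticAt_id.fun_smul h1)
    have h2 : ∀ t : ℂ, Function.update (Pi.single j t : C3) j 1 = Pi.single j 1 := fun t => by
      simp [Pi.single]
    simp only [h2]
    exact analyticAt_const
  have hc := ht.eventually he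
  simp only [hbl, Pi.single_eq_same] at hc hH
  constructor
  · have := hc.self_of_nhds
    simpa using this
  · have h1 := ((hasDerivAt_id' (0 : ℂ)).fun_pow 3).fun_smul hH.differentiableAt.hasDerivAt
    have h2 := (TangentToId.hasDerivAt_single j).fun_add h1
    refine (h2.congr_of_eventuallyEq hc).congr_deriv ?_
    simp

theorem IsInFamily.hasFDerivAt (hf : IsInFamily f P Q R) :
    HasFDerivAt f (ContinuousLinearMap.id ℂ C3) 0 := by
  have h1 := hf.analyticAt.differentiableAt.hasFDerivAt
  have h2 : fderiv ℂ f 0 = ContinuousLinearMap.id ℂ C3 := by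
    refine ContinuousLinearMap.coe_injective (LinearMap.pi_ext' fun j => LinearMap.ext_ring ?_)
    have h3 : HasDerivAt (fun t : ℂ => f (Pi.single j t)) (fderiv ℂ f 0 (Pi.single j 1)) 0 :=
      HasFDerivAt.comp_hasDerivAt (0 : ℂ) (f := fun t : ℂ => (Pi.single j t : C3)) (l := f)
        (by rwa [Pi.single_zero]) (TangentToId.hasDerivAt_single j)
    exact h3.unique (hf.hasDerivAt_single j).2
  rwa [h2] at h1

/-- A germ tangent to the identity lifts to the trivial modification. -/
theorem isLiftable_id (ha : AnalyticAt ℂ f 0) (h0 : f 0 = 0)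
    (hd : HasFDerivAt f (ContinuousLinearMap.id ℂ C3) 0) :
    IsLiftable f (X := Threefold.affine) (fun x => x) where
  isolated := by
    have h1 := hd.eventually_ne (c := (0 : C3)) ⟨1, fun z => by simp⟩
    rw [eventually_nhdsWithin_iff] at h1
    filter_upwards [h1] with v hv hfv
    by_contra h
    exact hv h hfv
  cont := continuous_id
  inj := fun _ _ _ h => h
  dense := by
    have : {x : C3 | x ≠ 0} = {0}ᶜ := rfl
    change Dense {x : C3 | x ≠ 0}
    rw [this]
    exact dense_compl_singleton 0
  lift := by
    rintro q rfl
    refine ⟨OpenPartialHomeomorph.refl C3, f, 0, ⟨?_, Set.mem_univ _, ha, ?_, ?_⟩, rfl⟩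
    · exact IsManifold.chart_mem_maximalAtlas (I := 𝓘(ℂ, C3)) (n := ω) (0 : C3)
    · exact Filter.Eventually.of_forall fun w => rfl
    · refine Filter.Eventually.of_forall fun w hw => ?_
      have hw' : w = 0 := hw
      rw [hw', h0]

theorem isLift_id (ha : AnalyticAt ℂ f 0) :
    IsLift f (X := Threefold.affine) (fun x => x) f := by
  refine isLift_of_eventually ?_
  rintro q rfl
  have h1 : ∀ᶠ x in 𝓝 (0 : C3), ContMDiffAt 𝓘(ℂ, C3) 𝓘(ℂ, C3) ω f x := by
    filter_upwards [ha.eventually_analyticAt] with x hx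
    exact contMDiffAt_iff_contDiffAt.2 hx.contDiffAt
  exact h1.mono fun x hx => ⟨hx, rfl⟩

theorem isCoordAt_refl :
    IsCoordAt (X := Threefold.affine) (OpenPartialHomeomorph.refl C3) (0 : C3) :=
  ⟨IsManifold.chart_mem_maximalAtlas (I := 𝓘(ℂ, C3)) (n := ω) (0 : C3), Set.mem_univ _, rfl⟩

theorem IsInFamily.isLiftable_blowUp (hf : IsInFamily f P Q R) {X₁ : Threefold}
    {β : X₁ → Threefold.affine} (hβ : IsBlowUp 3 ({(0 : C3)} : Set Threefold.affine) β) :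
    IsLiftable f β := by
  have ha := hf.analyticAt
  have h0 := (hf.hasDerivAt_single 0).1
  exact (isLiftable_id ha h0 hf.hasFDerivAt).pointBlowUp (isLift_id ha) rfl
    ⟨h0, _, isCoordAt_refl, hf.hasFDerivAt⟩ hβ

end

/-! ### Rotations diagonalize to opposite eigenvalues -/

theorem IsLogForm.diagonalize {F : C3 → C3} {e : Fin 3 → ℕ} {U : C3 → ℂ}
    {M : C3 → Matrix (Fin 3) (Fin 3) ℂ} (h : IsLogForm F e U M) (h0 : e 0 = 0) (h2 : e 2 = 0)
    (h00 : M 0 0 0 = 0) (h11 : M 0 1 1 = 0) (h22 : M 0 2 2 = 0) (h02 : M 0 0 2 ≠ 0)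
    (h20 : M 0 2 0 ≠ 0) :
    ∃ T : C3 ≃L[ℂ] C3, TypeD fun z => T (F (T.symm z)) := by
  obtain ⟨m, hm⟩ := IsAlgClosed.exists_pow_nat_eq (M 0 0 2 * M 0 2 0) two_pos
  have hm0 : m ≠ 0 := by
    rintro rfl
    exact mul_ne_zero h02 h20 (by rw [← hm]; ring)
  have h1 : e 1 ≠ 0 := by
    obtain ⟨i, hi⟩ := h.ne
    fin_cases i
    exacts [absurd h0 hi, hi, absurd h2 hi]
  obtain ⟨c, hc⟩ : ∃ c, M 0 2 0 = c := ⟨_, rfl⟩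
  obtain ⟨x, hx⟩ : ∃ x, M 0 0 2 = x := ⟨_, rfl⟩
  rw [hc, hx] at hm
  rw [hc] at h20
  let A : Matrix (Fin 3) (Fin 3) ℂ := !![c, 0, m; 0, 1, 0; c, 0, -m]
  let B : Matrix (Fin 3) (Fin 3) ℂ := !![1 / (2 * c), 0, 1 / (2 * c); 0, 1, 0;
    1 / (2 * m), 0, -1 / (2 * m)]
  have hAB : A * B = 1 := by
    ext i k
    fin_cases i <;> fin_cases k <;>
      simp [A, B, Matrix.mul_apply, Fin.sum_univ_three] <;> field_simp <;> norm_num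
  have hBA : B * A = 1 := by
    ext i k
    fin_cases i <;> fin_cases k <;>
      simp [A, B, Matrix.mul_apply, Fin.sum_univ_three] <;> field_simp <;> norm_num
  let T := matEquiv A B hAB hBA
  have hT1 : ∀ z, T.symm z 1 = z 1 := fun z => by
    rw [matEquiv_symm_apply]
    simp [B, Matrix.mulVec, dotProduct, Fin.sum_univ_three]
  have hlin := h.linear T (κ := 1) one_ne_zero (e' := e) (fun z => by
      simp [monom, Fin.prod_univ_three, h0, h2, hT1]) h.ne (M' := fun z => A * M (T.symm z) * B)
    (analyticAt_conj h T) (fun i k hi hk => ?_) fun z => ?_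
  · have e1 : M 0 1 0 = 0 := h.log_zero h1 (by decide)
    have e2 : M 0 1 2 = 0 := h.log_zero h1 (by decide)
    refine ⟨T, 0, 1, 2, by decide, by decide, by decide, e, _, _, hlin, h0, h2, h1, ?_, ?_, ?_, ?_, ?_⟩
    all_goals simp only [map_zero, Matrix.mul_apply, Fin.sum_univ_three]
    · have : m * c * (c⁻¹ * 2⁻¹) + c * x * (m⁻¹ * 2⁻¹) = m := by
        field_simp
        linear_combination -hm
      simpa [A, B, h00, h22, e1, e2, hc, hx, this] using hm0
    · simp [A, B, h11]
    · simp [A, B, h00, h22, e1, e2, hc, hx]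
      field_simp
      ring
    · simp [A, B, h00, h22, e1, e2, hc, hx]
      field_simp
      linear_combination hm
    · simp [A, B, h00, h22, e1, e2, hc, hx]
      field_simp
      linear_combination -hm
  · have hi1 : i = 1 := by
      fin_cases i
      exacts [absurd h0 hi, rfl, absurd h2 hi]
    subst hi1
    have hall : ∀ᶠ w in 𝓝 (0 : C3), M w 1 0 = 0 ∧ M w 1 2 = 0 :=
      (h.log 1 0 h1 (by decide)).and (h.log 1 2 h1 (by decide))
    filter_upwards [(tendsto_linear T).eventually hall] with z hz
    simp only [Matrix.mul_apply, Fin.sum_univ_three]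
    fin_cases k
    · simp [A, B, hz]
    · exact absurd rfl hk
    · simp [A, B, hz]
  · rw [← Matrix.mulVec_mulVec, ← Matrix.mulVec_mulVec, matEquiv_apply, matEquiv_symm_apply]

/-! ### The blow-up of the origin -/

/-- The cubic part and the remainder in the `j`-th chart. -/
def chartField (j : Fin 3) (K : C3 → C3) (w : C3) : C3 :=
  cubic (Function.update w j 1) + w j • K w

theorem chartField_apply (j : Fin 3) (K : C3 → C3) (w : C3) (i : Fin 3) :
    chartField j K w i = cubic (Function.update w j 1) i + w j * K w i := rfl

theorem analyticAt_update (j : Fin 3) (c : C3) :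
    AnalyticAt ℂ (fun w : C3 => Function.update w j 1) c :=
  analyticAt_c3.2 fun k => analyticAt_update_one j k c

theorem IsFamilyChart.analyticAt {f : C3 → C3} {j : Fin 3} {K : C3 → C3} {c : C3}
    (h : IsFamilyChart f j K c) : AnalyticAt ℂ (chartField j K) c :=
  (AnalyticAt.fun_comp (analyticAt_cubic _) (analyticAt_update j c)).fun_add
    ((analyticAt_coord j c).fun_smul h.1)

/-- The saturated field of the lift in the `j`-th chart. -/
def liftField (j : Fin 3) (K : C3 → C3) (w : C3) : C3 := fun i =>
  if i = j then w j * (chartField j K w j * (1 + w j ^ 2 * chartField j K w j))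
  else chartField j K w i - w i * chartField j K w j

theorem liftField_same (j : Fin 3) (K : C3 → C3) (w : C3) : liftField j K w j =
    w j * (chartField j K w j * (1 + w j ^ 2 * chartField j K w j)) := by simp [liftField]

theorem liftField_ne {i j : Fin 3} (h : i ≠ j) (K : C3 → C3) (w : C3) :
    liftField j K w i = chartField j K w i - w i * chartField j K w j := by simp [liftField, h]

theorem blLift_sq_smul (j : Fin 3) (K : C3 → C3) {w : C3} (h : 1 + w j ^ 2 * chartField j K w j ≠ 0) :
    blLift j (fun w => w j ^ 2 • chartField j K w) w =
      w + ((1 + w j ^ 2 * chartField j K w j)⁻¹ * w j ^ 2) • liftField j K w := by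
  funext i
  by_cases hi : i = j
  · subst hi
    simp only [blLift, if_true, liftField_same, Pi.add_apply, Pi.smul_apply, smul_eq_mul]
    field_simp
  · simp only [blLift, hi, if_false, liftField_ne hi, Pi.add_apply, Pi.smul_apply, smul_eq_mul]
    field_simp
    ring

section FirstBlowUp

variable {f : C3 → C3} {P Q R : FPS} {X : Threefold} {β : X → Threefold.affine} {g : X → X}
  {j : Fin 3} {ψ : OpenPartialHomeomorph X C3} {K : C3 → C3} {c : C3}

theorem IsFamilyChart.germ_eq (h : IsFamilyChart f j K c) (hf : IsInFamily f P Q R)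
    (hβ : IsBlowUp 3 ({(0 : C3)} : Set Threefold.affine) β) (hg : IsLift f (X := X) β g)
    (hψ : IsPointChart β (OpenPartialHomeomorph.refl C3) j ψ) (hc : c j = 0) :
    (g (ψ.symm c) = ψ.symm c) ∧
    (fun z => ψ (g (ψ.symm (z + c))) - c) =ᶠ[𝓝 0] fun z =>
      z + ((1 + (z + c) j ^ 2 * chartField j K (z + c) j)⁻¹ * z j ^ 2) • liftField j K (z + c) := by
  have ha := hf.analyticAt
  have h0 := (hf.hasDerivAt_single 0).1
  have hL : IsLocalLift f (X := X) β ψ (blLift j fun w => w j ^ 2 • chartField j K w) c := by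
    refine (isLiftable_id ha h0 hf.hasFDerivAt).isLocalLift_pointChart (isLift_id ha) rfl
      isCoordAt_refl hψ hc (((analyticAt_coord j c).fun_pow 2).fun_smul h.analyticAt) ?_ ?_
    · filter_upwards [h.2] with w hw
      change f (bl j w) = _
      rw [hw, smul_smul, chartField, ← pow_succ']
    · refine Filter.Eventually.of_forall fun w hw => ?_
      rw [hw]
      simp
  have hz : β (ψ.symm c) = 0 := (hψ.eq_center isCoordAt_refl (hψ.mem_target isCoordAt_refl hc)).2 hc
  have hX := hf.isLiftable_blowUp hβ
  refine ⟨hX.fix hg hz, ?_⟩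
  have ht : Filter.Tendsto (fun z : C3 => z + c) (𝓝 0) (𝓝 c) := by
    have : Continuous fun z : C3 => z + c := by fun_prop
    simpa using this.tendsto 0
  have hne : ∀ᶠ w in 𝓝 c, 1 + w j ^ 2 * chartField j K w j ≠ 0 := by
    have : ContinuousAt (fun w => 1 + w j ^ 2 * chartField j K w j) c :=
      (analyticAt_const.fun_add (((analyticAt_coord j c).fun_pow 2).fun_mul
        (analyticAt_c3.1 h.analyticAt j))).continuousAt
    exact this.eventually_ne (by simp [hc])
  filter_upwards [ht.eventually (hX.expression hg hL hz), ht.eventually hne] with z h1 h2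
  rw [h1, blLift_sq_smul j K h2, add_sub_right_comm, add_sub_cancel_right, Pi.add_apply z c j, hc,
    add_zero]

theorem IsFamilyChart.analyticAt_liftField (h : IsFamilyChart f j K c) :
    AnalyticAt ℂ (liftField j K) c := by
  have hH := fun i => analyticAt_c3.1 h.analyticAt i
  refine analyticAt_c3.2 fun i => ?_
  by_cases hi : i = j
  · subst hi
    simp only [liftField_same]
    exact (analyticAt_coord i c).fun_mul ((hH i).fun_mul (analyticAt_const.fun_add
      (((analyticAt_coord i c).fun_pow 2).fun_mul (hH i))))
  · simp only [liftField_ne hi]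
    exact (hH i).fun_sub ((analyticAt_coord i c).fun_mul (hH j))

theorem IsFamilyChart.analyticAt_unit (h : IsFamilyChart f j K c) (hc : c j = 0) :
    AnalyticAt ℂ (fun z => (1 + (z + c) j ^ 2 * chartField j K (z + c) j)⁻¹) 0 := by
  have hadd : AnalyticAt ℂ (fun z : C3 => z + c) 0 := analyticAt_id.add analyticAt_const
  have h1 : AnalyticAt ℂ (fun w => 1 + w j ^ 2 * chartField j K w j) c :=
    analyticAt_const.fun_add (((analyticAt_coord j c).fun_pow 2).fun_mul
      (analyticAt_c3.1 h.analyticAt j))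
  refine AnalyticAt.fun_comp (g := fun w => (1 + w j ^ 2 * chartField j K w j)⁻¹) ?_ hadd
  rw [zero_add]
  exact h1.fun_inv (by simp [hc])

theorem IsFamilyChart.nonsing (h : IsFamilyChart f j K c) (hf : IsInFamily f P Q R)
    (hβ : IsBlowUp 3 ({(0 : C3)} : Set Threefold.affine) β) (hg : IsLift f (X := X) β g)
    (hψ : IsPointChart β (OpenPartialHomeomorph.refl C3) j ψ) (hc : c j = 0)
    (hne : ∃ i, i ≠ j ∧ cubic (Function.update c j 1) i - c i * cubic (Function.update c j 1) j ≠ 0) :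
    GermIn NonsingForm g (ψ.symm c) := by
  obtain ⟨h1, h2⟩ := h.germ_eq hf hβ hg hψ hc
  have hct := hψ.mem_target isCoordAt_refl hc
  refine germIn_of_chart h1 hψ.mem (ψ.map_target hct) ?_
  rw [ψ.right_inv hct]
  have hadd : AnalyticAt ℂ (fun z : C3 => z + c) 0 := analyticAt_id.add analyticAt_const
  refine ⟨_, _, (h.analyticAt_unit hc).fun_mul ((analyticAt_coord j 0).fun_pow 2),
    AnalyticAt.fun_comp (g := liftField j K) (by rw [zero_add]; exact h.analyticAt_liftField) hadd,
    by simp, fun h0 => ?_, h2⟩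
  obtain ⟨i, hi, hne⟩ := hne
  have := congrFun h0 i
  rw [zero_add, liftField_ne hi] at this
  apply hne
  simpa [chartField_apply, hc] using this

theorem IsFamilyChart.isLogForm (h : IsFamilyChart f j K c) (hf : IsInFamily f P Q R)
    (hβ : IsBlowUp 3 ({(0 : C3)} : Set Threefold.affine) β) (hg : IsLift f (X := X) β g)
    (hψ : IsPointChart β (OpenPartialHomeomorph.refl C3) j ψ) (hc : c j = 0)
    {M : C3 → Matrix (Fin 3) (Fin 3) ℂ} (hM : ∀ i k, AnalyticAt ℂ (fun z => M z i k) 0)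
    (he : ∀ i, i ≠ j → ∀ z, chartField j K (z + c) i - (z + c) i * chartField j K (z + c) j =
      (M z *ᵥ z) i) :
    ∃ U M', IsLogForm (fun z => ψ (g (ψ.symm (z + c))) - c) (Pi.single j 2) U M' ∧
      M' 0 j j = cubic (Function.update c j 1) j ∧ ∀ i k, i ≠ j → M' 0 i k = M 0 i k := by
  obtain ⟨-, h2⟩ := h.germ_eq hf hβ hg hψ hc
  have hadd : AnalyticAt ℂ (fun z : C3 => z + c) 0 := analyticAt_id.add analyticAt_const
  set u : C3 → ℂ := fun w => chartField j K w j * (1 + w j ^ 2 * chartField j K w j) with hu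
  have hua : AnalyticAt ℂ u c := by
    have h1 := analyticAt_c3.1 h.analyticAt j
    exact h1.fun_mul (analyticAt_const.fun_add (((analyticAt_coord j c).fun_pow 2).fun_mul h1))
  have hM'j : ∀ i k z, i ≠ j → (if i = j then if k = j then u (z + c) else 0 else M z i k) =
      M z i k := fun i k z hi => if_neg hi
  refine ⟨_, fun z i k => if i = j then (if k = j then u (z + c) else 0) else M z i k,
    ⟨h.analyticAt_unit hc, by simp [hc], fun i k => ?_, ⟨j, by simp⟩, fun i k hi hk => ?_, ?_⟩, ?_,
    fun i k hi => hM'j i k 0 hi⟩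
  · by_cases hi : i = j
    · by_cases hk : k = j
      · simp only [hi, hk, if_true]
        exact AnalyticAt.fun_comp (g := u) (by rwa [zero_add]) hadd
      · simp only [hi, hk, if_true, if_false]
        exact analyticAt_const
    · simp only [hi, if_false]
      exact hM i k
  · have hij : i = j := by
      by_contra hij
      exact hi (Pi.single_eq_of_ne hij 2)
    subst hij
    simp [hk]
  · filter_upwards [h2] with z hz
    rw [hz]
    congr 2
    · congr 1
      rw [monom, Finset.prod_eq_single j (fun i _ hi => by simp [hi]) (by simp),
        Pi.single_eq_same]
    · funext i
      by_cases hi : i = j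
      · subst hi
        rw [liftField_same, Pi.add_apply, hc, add_zero]
        simp only [Matrix.mulVec, dotProduct, if_true, ite_mul, zero_mul, Finset.sum_ite_eq',
          Finset.mem_univ]
        have hzi : (z + c) i = z i := by rw [Pi.add_apply, hc, add_zero]
        simp only [hu, hzi]
        exact mul_comm _ _
      · rw [liftField_ne hi, he i hi z]
        simp [Matrix.mulVec, dotProduct, hi]
  · simp [hu, chartField_apply, hc]

end FirstBlowUp

theorem cubic_update_zero (w : C3) : cubic (Function.update w 0 1) =
    ![w 1 * w 2 * (w 1 - w 2), 1 - w 2 ^ 2, w 2 * (w 1 - w 2)] := by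
  funext i
  fin_cases i <;> simp [cubic]

theorem cubic_update_one (w : C3) : cubic (Function.update w 1 1) =
    ![w 2 * (1 - w 2), w 0 * (w 0 ^ 2 - w 2 ^ 2), w 0 * w 2 * (1 - w 2)] := by
  funext i
  fin_cases i <;> simp [cubic]

theorem cubic_update_two (w : C3) : cubic (Function.update w 2 1) =
    ![w 1 * (w 1 - 1), w 0 * (w 0 ^ 2 - 1), w 0 * (w 1 - 1)] := by
  funext i
  fin_cases i <;> simp [cubic]

theorem IsBlowUp.exists_pointChart_eq_of_ne {X X' : Threefold} {p : X} {β : X' → X}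
    (hβ : IsBlowUp 3 {p} β) {u : OpenPartialHomeomorph X C3} (hu : IsCoordAt u p)
    {ψ : Fin 3 → OpenPartialHomeomorph X' C3} (hψ : ∀ j, IsPointChart β u j (ψ j)) {q : X'}
    (hq : β q = p) (k : Fin 3) : ∃ j c, c j = 0 ∧ q = (ψ j).symm c ∧ (j ≠ k → c k = 0) := by
  obtain ⟨j, c, hc, rfl⟩ := hβ.exists_pointChart_eq hu hψ hq
  by_cases hjk : j = k
  · exact ⟨j, c, hc, rfl, fun h => absurd hjk h⟩
  by_cases hk : c k = 0
  · exact ⟨j, c, hc, rfl, fun _ => hk⟩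
  · obtain ⟨-, h2⟩ := (hψ j).change hβ hu (hψ k) ((hψ j).mem_target hu hc)
      (by simpa [Ne.symm hjk] using hk)
    exact ⟨k, _, by simp [blChange, hc], h2, fun h => absurd rfl h⟩

section FirstBlowUp

variable {f : C3 → C3} {P Q R : FPS} {X : Threefold} {β : X → Threefold.affine} {g : X → X}
  {ψ : OpenPartialHomeomorph X C3} {K : C3 → C3}

theorem germIn_typeD_of_chart {p : X} {F : C3 → C3} {e : Fin 3 → ℕ} {U : C3 → ℂ}
    {M : C3 → Matrix (Fin 3) (Fin 3) ℂ} (hp : GermIn (fun G => G = F) g p)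
    (h : IsLogForm F e U M) (h0 : e 0 = 0) (h2 : e 2 = 0)
    (h00 : M 0 0 0 = 0) (h11 : M 0 1 1 = 0) (h22 : M 0 2 2 = 0) (h02 : M 0 0 2 ≠ 0)
    (h20 : M 0 2 0 ≠ 0) : GermIn TypeD g p := by
  refine germIn_linearChange hp ?_
  rintro _ rfl
  exact h.diagonalize h0 h2 h00 h11 h22 h02 h20

theorem IsInFamily.base_point (hf : IsInFamily f P Q R)
    (hR : MvPowerSeries.coeff (Finsupp.single (1 : Fin 3) 4) R ≠ 0)
    (hβ : IsBlowUp 3 ({(0 : C3)} : Set Threefold.affine) β) (hg : IsLift f (X := X) β g)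
    (hψ : IsPointChart β (OpenPartialHomeomorph.refl C3) 1 ψ) :
    ∃ U M, IsLogForm (fun w => ψ (g (ψ.symm w))) (Pi.single 1 2) U M ∧ M 0 0 0 = 0 ∧ M 0 0 2 = 1 ∧
      M 0 1 1 = 0 ∧ M 0 2 0 = 0 ∧ M 0 2 1 ≠ 0 ∧ M 0 2 2 = 0 := by
  obtain ⟨K, hK, hK2⟩ := hf.exists_chart 1
  have hKa := fun i => analyticAt_c3.1 (hK 0 rfl).1 i
  have hz := fun k => analyticAt_coord k (0 : C3)
  have hb : AnalyticAt ℂ (fun z : C3 => chartField 1 K z 1) 0 :=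
    analyticAt_c3.1 (hK 0 rfl).analyticAt 1
  obtain ⟨N, hN⟩ : ∃ N : C3 → Matrix (Fin 3) (Fin 3) ℂ, N =
    fun z => !![- chartField 1 K z 1, K z 0, 1 - z 2; 0, 0, 0;
      0, K z 2, z 0 * (1 - z 2) - chartField 1 K z 1] := ⟨_, rfl⟩
  have hNa : ∀ i k, AnalyticAt ℂ (fun z => N z i k) 0 := by
    subst hN
    intro i k
    fin_cases i <;> fin_cases k
    exacts [hb.fun_neg, hKa 0, analyticAt_const.fun_sub (hz 2), analyticAt_const, analyticAt_const,
      analyticAt_const, analyticAt_const, hKa 2,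
      ((hz 0).fun_mul (analyticAt_const.fun_sub (hz 2))).fun_sub hb]
  obtain ⟨U, M, h1, h2, h3⟩ := (hK 0 rfl).isLogForm hf hβ hg hψ rfl hNa (by
    subst hN
    intro i hi z
    simp only [add_zero]
    fin_cases i
    · simp [chartField_apply, cubic_update_one, Matrix.mulVec, dotProduct, Fin.sum_univ_three]
      ring
    · exact absurd rfl hi
    · simp [chartField_apply, cubic_update_one, Matrix.mulVec, dotProduct, Fin.sum_univ_three]
      ring)
  subst hN
  simp only [add_zero, sub_zero] at h1
  refine ⟨U, M, h1, ?_⟩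
  rw [h2, h3 0 0 (by decide), h3 0 2 (by decide), h3 2 0 (by decide), h3 2 1 (by decide),
    h3 2 2 (by decide)]
  simp [chartField_apply, cubic_update_one, hK2, hR]

theorem IsInFamily.typeD_one (hf : IsInFamily f P Q R)
    (hβ : IsBlowUp 3 ({(0 : C3)} : Set Threefold.affine) β) (hg : IsLift f (X := X) β g)
    (hψ : IsPointChart β (OpenPartialHomeomorph.refl C3) 1 ψ) :
    GermIn TypeD g (ψ.symm ![0, 0, 1]) := by
  obtain ⟨K, hK, -⟩ := hf.exists_chart 1
  obtain ⟨c, hc⟩ : ∃ c : C3, c = ![0, 0, 1] := ⟨_, rfl⟩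
  rw [← hc]
  have hc0 : c 0 = 0 := by simp [hc]
  have hc1 : c 1 = 0 := by simp [hc]
  have hc2 : c 2 = 1 := by simp [hc]
  have hadd : AnalyticAt ℂ (fun z : C3 => z + c) 0 := analyticAt_id.add analyticAt_const
  have hKa : ∀ i, AnalyticAt ℂ (fun z => K (z + c) i) 0 := fun i =>
    AnalyticAt.fun_comp (g := fun w => K w i)
      (by rw [zero_add]; exact analyticAt_c3.1 (hK c hc1).1 i) hadd
  have hz := fun k => analyticAt_coord k (0 : C3)
  have hb : AnalyticAt ℂ (fun z : C3 => chartField 1 K (z + c) 1) 0 :=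
    AnalyticAt.fun_comp (g := fun w => chartField 1 K w 1)
      (by rw [zero_add]; exact analyticAt_c3.1 (hK c hc1).analyticAt 1) hadd
  obtain ⟨N, hN⟩ : ∃ N : C3 → Matrix (Fin 3) (Fin 3) ℂ, N =
    fun z => !![- chartField 1 K (z + c) 1, K (z + c) 0, -(1 + z 2); 0, 0, 0;
      -(1 + z 2) * (z 0 ^ 2 - (1 + z 2) ^ 2), K (z + c) 2 - (1 + z 2) * K (z + c) 1,
      - z 0 * (1 + z 2)] := ⟨_, rfl⟩
  have hNa : ∀ i k, AnalyticAt ℂ (fun z => N z i k) 0 := by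
    subst hN
    intro i k
    fin_cases i <;> fin_cases k
    exacts [hb.fun_neg, hKa 0, (analyticAt_const.fun_add (hz 2)).fun_neg, analyticAt_const,
      analyticAt_const, analyticAt_const, (analyticAt_const.fun_add (hz 2)).fun_neg.fun_mul
        (((hz 0).fun_pow 2).fun_sub ((analyticAt_const.fun_add (hz 2)).fun_pow 2)),
      (hKa 2).fun_sub ((analyticAt_const.fun_add (hz 2)).fun_mul (hKa 1)),
      (hz 0).fun_neg.fun_mul (analyticAt_const.fun_add (hz 2))]
  obtain ⟨U, M, h1, h2, h3⟩ := (hK c hc1).isLogForm hf hβ hg hψ hc1 hNa (by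
    subst hN
    intro i hi z
    fin_cases i
    · simp [chartField_apply, cubic_update_one, Matrix.mulVec, dotProduct, Fin.sum_univ_three, hc0, hc1, hc2]
      ring
    · exact absurd rfl hi
    · simp [chartField_apply, cubic_update_one, Matrix.mulVec, dotProduct, Fin.sum_univ_three, hc0, hc1, hc2]
      ring)
  subst hN
  have hct := hψ.mem_target isCoordAt_refl hc1
  refine germIn_typeD_of_chart (germIn_of_chart ((hK c hc1).germ_eq hf hβ hg hψ hc1).1 hψ.mem
    (ψ.map_target hct) (by rw [ψ.right_inv hct])) h1 rfl rfl ?_ ?_ ?_ ?_ ?_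
  · rw [h3 0 0 (by decide)]
    simp [chartField_apply, cubic_update_one, hc0, hc1, hc2]
  · rw [h2]
    simp [cubic_update_one, hc0, hc2]
  · rw [h3 2 2 (by decide)]
    simp
  · rw [h3 0 2 (by decide)]
    simp
  · rw [h3 2 0 (by decide)]
    simp

theorem IsInFamily.typeZ_one (hf : IsInFamily f P Q R)
    (hβ : IsBlowUp 3 ({(0 : C3)} : Set Threefold.affine) β) (hg : IsLift f (X := X) β g)
    (hψ : IsPointChart β (OpenPartialHomeomorph.refl C3) 1 ψ) {s : ℂ} (hs : s ^ 2 = 1) :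
    GermIn TypeZ g (ψ.symm ![s, 0, 1]) := by
  obtain ⟨K, hK, -⟩ := hf.exists_chart 1
  obtain ⟨c, hc⟩ : ∃ c : C3, c = ![s, 0, 1] := ⟨_, rfl⟩
  rw [← hc]
  have hc0 : c 0 = s := by simp [hc]
  have hc1 : c 1 = 0 := by simp [hc]
  have hc2 : c 2 = 1 := by simp [hc]
  have hadd : AnalyticAt ℂ (fun z : C3 => z + c) 0 := analyticAt_id.add analyticAt_const
  have hKa : ∀ i, AnalyticAt ℂ (fun z => K (z + c) i) 0 := fun i =>
    AnalyticAt.fun_comp (g := fun w => K w i)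
      (by rw [zero_add]; exact analyticAt_c3.1 (hK c hc1).1 i) hadd
  have h0 : AnalyticAt ℂ (fun z : C3 => z 0 + s) 0 := (analyticAt_coord 0 _).fun_add analyticAt_const
  have h2 : AnalyticAt ℂ (fun z : C3 => z 2 + 1) 0 := (analyticAt_coord 2 _).fun_add analyticAt_const
  have h0' : AnalyticAt ℂ (fun z : C3 => z 0 + 2 * s) 0 :=
    (analyticAt_coord 0 _).fun_add analyticAt_const
  have h2' : AnalyticAt ℂ (fun z : C3 => z 2 + 2) 0 := (analyticAt_coord 2 _).fun_add analyticAt_const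
  obtain ⟨N, hN⟩ : ∃ N : C3 → Matrix (Fin 3) (Fin 3) ℂ, N =
    fun z => !![-((z 0 + s) ^ 2 * (z 0 + 2 * s)), K (z + c) 0 - (z 0 + s) * K (z + c) 1,
      (z 0 + s) ^ 2 * (z 2 + 2) - (z 2 + 1); 0, 0, 0;
      -((z 2 + 1) * (z 0 + s) * (z 0 + 2 * s)), K (z + c) 2 - (z 2 + 1) * K (z + c) 1,
      (z 2 + 1) * (z 0 + s) * (z 2 + 2) - (z 0 + s) * (z 2 + 1)] := ⟨_, rfl⟩
  have hNa : ∀ i k, AnalyticAt ℂ (fun z => N z i k) 0 := by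
    subst hN
    intro i k
    fin_cases i <;> fin_cases k
    exacts [((h0.fun_pow 2).fun_mul h0').fun_neg, (hKa 0).fun_sub (h0.fun_mul (hKa 1)),
      ((h0.fun_pow 2).fun_mul h2').fun_sub h2, analyticAt_const, analyticAt_const, analyticAt_const,
      ((h2.fun_mul h0).fun_mul h0').fun_neg, (hKa 2).fun_sub (h2.fun_mul (hKa 1)),
      ((h2.fun_mul h0).fun_mul h2').fun_sub (h0.fun_mul h2)]
  obtain ⟨U, M, g1, g2, g3⟩ := (hK c hc1).isLogForm hf hβ hg hψ hc1 hNa (by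
    subst hN
    intro i hi z
    fin_cases i
    · simp [chartField_apply, cubic_update_one, Matrix.mulVec, dotProduct, Fin.sum_univ_three, hc0, hc1, hc2]
      linear_combination -(z 0 + s) ^ 2 * hs
    · exact absurd rfl hi
    · simp [chartField_apply, cubic_update_one, Matrix.mulVec, dotProduct, Fin.sum_univ_three, hc0, hc1, hc2]
      linear_combination -(z 0 + s) * (z 2 + 1) * hs)
  subst hN
  have hct := hψ.mem_target isCoordAt_refl hc1
  refine germIn_linearChange (germIn_of_chart (N := fun G => G = fun z => ψ (g (ψ.symm (z + c))) - c)
    ((hK c hc1).germ_eq hf hβ hg hψ hc1).1 hψ.mem (ψ.map_target hct)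
    (by rw [ψ.right_inv hct])) ?_
  rintro _ rfl
  have hs0 : s ≠ 0 := by
    rintro rfl
    simp at hs
  refine ⟨shear 0 (-s), 2, 1, 0, by decide, by decide, by decide, _, _, _, g1.shear rfl 0 (-s),
    rfl, by simp, ?_, ?_, ?_, ?_⟩
  all_goals simp only [map_zero, shearMat_conj]
  · rw [g3 2 2 (by decide), g3 2 0 (by decide)]
    have : s * 2 - s - s * (s * (2 * s)) = -s := by linear_combination -2 * s * hs
    simp [← sub_eq_add_neg, this, hs0]
  · rw [show M 0 1 1 = _ from g2, g1.log_zero (i := 1) (k := 0) (by simp) (by decide)]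
    simp [cubic_update_one, hc0, hc2, hs]
  · rw [g3 0 2 (by decide), g3 2 2 (by decide), g3 0 0 (by decide), g3 2 0 (by decide)]
    simp
    linear_combination hs
  · rw [g3 0 0 (by decide), g3 2 0 (by decide)]
    simp
    ring

theorem IsInFamily.typeD_two (hf : IsInFamily f P Q R)
    (hβ : IsBlowUp 3 ({(0 : C3)} : Set Threefold.affine) β) (hg : IsLift f (X := X) β g)
    (hψ : IsPointChart β (OpenPartialHomeomorph.refl C3) 2 ψ) :
    GermIn TypeD g (ψ.symm 0) := by
  obtain ⟨K, hK, -⟩ := hf.exists_chart 2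
  have hKa := fun i => analyticAt_c3.1 (hK 0 rfl).1 i
  have hz := fun k => analyticAt_coord k (0 : C3)
  obtain ⟨N, hN⟩ : ∃ N : C3 → Matrix (Fin 3) (Fin 3) ℂ, N =
    fun z => !![- z 0 * (z 1 - 1), z 1 - 1, K z 0 - z 0 * K z 2;
      z 0 ^ 2 - 1 - z 1 * (z 1 - 1), 0, K z 1 - z 1 * K z 2; 0, 0, 0] := ⟨_, rfl⟩
  have hNa : ∀ i k, AnalyticAt ℂ (fun z => N z i k) 0 := by
    subst hN
    intro i k
    fin_cases i <;> fin_cases k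
    exacts [(hz 0).fun_neg.fun_mul ((hz 1).fun_sub analyticAt_const), (hz 1).fun_sub analyticAt_const,
      (hKa 0).fun_sub ((hz 0).fun_mul (hKa 2)), (((hz 0).fun_pow 2).fun_sub analyticAt_const).fun_sub
        ((hz 1).fun_mul ((hz 1).fun_sub analyticAt_const)), analyticAt_const,
      (hKa 1).fun_sub ((hz 1).fun_mul (hKa 2)), analyticAt_const, analyticAt_const, analyticAt_const]
  obtain ⟨U, M, h1, h2, h3⟩ := (hK 0 rfl).isLogForm hf hβ hg hψ rfl hNa (by
    subst hN
    intro i hi z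
    simp only [add_zero]
    fin_cases i
    · simp [chartField_apply, cubic_update_two, Matrix.mulVec, dotProduct, Fin.sum_univ_three]
      ring
    · simp [chartField_apply, cubic_update_two, Matrix.mulVec, dotProduct, Fin.sum_univ_three]
      ring
    · exact absurd rfl hi)
  subst hN
  have hct := hψ.mem_target isCoordAt_refl (w := 0) rfl
  have h4 := germIn_linearChange (N' := fun G => G = _) (germIn_of_chart
    (N := fun G => G = fun z => ψ (g (ψ.symm (z + 0))) - 0)
    ((hK 0 rfl).germ_eq hf hβ hg hψ rfl).1 hψ.mem (ψ.map_target hct)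
    (by rw [ψ.right_inv hct])) (fun F hF => ⟨permEquiv (Equiv.swap 1 2), by rw [hF]⟩)
  have e0 : (Equiv.swap (1 : Fin 3) 2) 0 = 0 := by decide
  refine germIn_typeD_of_chart h4 (h1.perm (Equiv.swap 1 2)) ?_ ?_ ?_ ?_ ?_ ?_ ?_
  all_goals simp only [map_zero, Matrix.submatrix_apply, Function.comp_apply, e0,
    Equiv.swap_apply_left, Equiv.swap_apply_right]
  · simp
  · simp
  · rw [h3 0 0 (by decide)]
    simp
  · rw [h2]
    simp [cubic_update_two]
  · rw [h3 1 1 (by decide)]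
    simp
  · rw [h3 0 1 (by decide)]
    simp
  · rw [h3 1 0 (by decide)]
    simp

end FirstBlowUp

theorem singular_directions {s r : ℂ} (h0 : r * (1 - r) - s * (s * (s ^ 2 - r ^ 2)) = 0)
    (h2 : s * r * (1 - r) - r * (s * (s ^ 2 - r ^ 2)) = 0) :
    (s = 0 ∧ r = 0) ∨ (s = 0 ∧ r = 1) ∨ (s = 1 ∧ r = 1) ∨ (s = -1 ∧ r = 1) := by
  have hr : r = 0 ∨ r = 1 := by
    have h3 : s * (s ^ 2 - r ^ 2) * (s ^ 2 - r) = 0 := by linear_combination h2 - s * h0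
    rcases mul_eq_zero.1 h3 with h | h
    · rw [h] at h0
      have h4 : r * (1 - r) = 0 := by linear_combination h0
      exact (mul_eq_zero.1 h4).imp id fun h => (sub_eq_zero.1 h).symm
    · have h4 : r * (1 - r) ^ 2 = 0 := by linear_combination h0 + (s ^ 2 - r ^ 2 + r) * h
      exact (mul_eq_zero.1 h4).imp id fun h => (sub_eq_zero.1 (pow_eq_zero_iff two_ne_zero |>.1 h)).symm
  rcases hr with rfl | rfl
  · left
    have h4 : s ^ 4 = 0 := by linear_combination -h0
    exact ⟨pow_eq_zero_iff four_ne_zero |>.1 h4, rfl⟩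
  · right
    have h4 : s * ((s - 1) * (s + 1)) = 0 := by linear_combination -h2
    rcases mul_eq_zero.1 h4 with h | h
    · exact Or.inl ⟨h, rfl⟩
    · rcases mul_eq_zero.1 h with h | h
      · exact Or.inr (Or.inl ⟨sub_eq_zero.1 h, rfl⟩)
      · exact Or.inr (Or.inr ⟨eq_neg_of_add_eq_zero_left h, rfl⟩)

theorem IsInFamily.isTyped_firstBlowUp {f : C3 → C3} {P Q R : FPS} (hf : IsInFamily f P Q R)
    {X : Threefold} {β : X → Threefold.affine} {g : X → X}
    (hβ : IsBlowUp 3 ({(0 : C3)} : Set Threefold.affine) β) (hg : IsLift f (X := X) β g)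
    {u : OpenPartialHomeomorph X C3} (hu : IsPointChart β (OpenPartialHomeomorph.refl C3) 1 u) :
    ∃ T : Set X, T.Finite ∧ ∀ q, β q = (0 : C3) → IsSingularAt g q →
      q = u.symm 0 ∨ q ∈ T ∧ IsTyped g q := by
  obtain ⟨ψ₀, hψ₀⟩ := hβ.exists_pointCharts isCoordAt_refl
  obtain ⟨ψ, hψ, rfl⟩ : ∃ ψ : Fin 3 → OpenPartialHomeomorph X C3,
      (∀ j, IsPointChart β (OpenPartialHomeomorph.refl C3) j (ψ j)) ∧ ψ 1 = u := by
    refine ⟨Function.update ψ₀ 1 u, fun j => ?_, by simp⟩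
    by_cases hj : j = 1
    · subst hj
      simpa using hu
    · simpa [hj] using hψ₀ j
  have hX := hf.isLiftable_blowUp hβ
  have key : ∀ j c, c j = 0 → IsSingularAt g ((ψ j).symm c) → ∀ i, i ≠ j →
      cubic (Function.update c j 1) i - c i * cubic (Function.update c j 1) j = 0 := by
    intro j c hc hs i hi
    by_contra hne
    obtain ⟨K, hK, -⟩ := hf.exists_chart j
    have hz : β ((ψ j).symm c) = (0 : C3) :=
      ((hψ j).eq_center isCoordAt_refl ((hψ j).mem_target isCoordAt_refl hc)).2 hc
    exact ((hK c hc).nonsing hf hβ hg (hψ j) hc ⟨i, hi, hne⟩).not_isSingularAt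
      (hg.continuousAt hz).self_of_nhds hs
  have key2 : ∀ c : C3, c 2 = 0 → c 1 = 0 → IsSingularAt g ((ψ 2).symm c) → c = 0 := by
    intro c h2 h1 hs
    have h := key 2 c h2 hs 0 (by decide)
    rw [cubic_update_two] at h
    simp only [Matrix.cons_val, h1] at h
    have h0 : c 0 = 0 := by
      have : c 0 ^ 2 = 0 := by linear_combination h
      exact pow_eq_zero_iff two_ne_zero |>.1 this
    funext i
    fin_cases i
    exacts [h0, h1, h2]
  refine ⟨{(ψ 1).symm ![0, 0, 1], (ψ 1).symm ![1, 0, 1], (ψ 1).symm ![-1, 0, 1], (ψ 2).symm 0},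
    by simp, fun q hq hs => ?_⟩
  obtain ⟨j, c, hc, rfl, hc1⟩ := hβ.exists_pointChart_eq_of_ne isCoordAt_refl hψ hq 1
  have h2q : ∀ c : C3, c 2 = 0 → c 1 = 0 → IsSingularAt g ((ψ 2).symm c) →
      (ψ 2).symm c = (ψ 2).symm 0 ∧ IsTyped g ((ψ 2).symm c) := by
    intro c h2 h1 hs
    rw [key2 c h2 h1 hs]
    exact ⟨rfl, Or.inr (Or.inr (hf.typeD_two hβ hg (hψ 2)))⟩
  match j, hc, hc1, hs with
  | 0, hc, hc1, hs =>
    right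
    have hc1 := hc1 (by decide)
    by_cases h2 : c 2 = 0
    · exfalso
      have h := key 0 c hc hs 1 (by decide)
      rw [cubic_update_zero] at h
      simp [h2, hc1] at h
    · obtain ⟨-, h3⟩ := (hψ 0).change hβ isCoordAt_refl (hψ 2)
        ((hψ 0).mem_target isCoordAt_refl hc) (by simpa using h2)
      rw [h3] at hs ⊢
      obtain ⟨h4, h5⟩ := h2q _ (by simp [blChange, hc]) (by simp [blChange, hc1]) hs
      exact ⟨by rw [h4]; simp, h5⟩
  | 1, hc, _, hs =>
    have h0 := key 1 c hc hs 0 (by decide)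
    have h2 := key 1 c hc hs 2 (by decide)
    rw [cubic_update_one] at h0 h2
    simp only [Matrix.cons_val] at h0 h2
    have hce : c = ![c 0, 0, c 2] := by
      funext i
      fin_cases i
      exacts [rfl, hc, rfl]
    rcases singular_directions h0 h2 with ⟨e0, e2⟩ | ⟨e0, e2⟩ | ⟨e0, e2⟩ | ⟨e0, e2⟩
    · left
      rw [hce, e0, e2]
      congr 1
      funext i
      fin_cases i <;> rfl
    all_goals
      right
      rw [hce, e0, e2]
      refine ⟨by simp, ?_⟩
    · exact Or.inr (Or.inr (hf.typeD_one hβ hg (hψ 1)))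
    · exact Or.inr (Or.inl (hf.typeZ_one hβ hg (hψ 1) (by norm_num)))
    · exact Or.inr (Or.inl (hf.typeZ_one hβ hg (hψ 1) (by norm_num)))
  | 2, hc, hc1, hs =>
    right
    obtain ⟨h4, h5⟩ := h2q c hc (hc1 (by decide)) hs
    exact ⟨by rw [h4]; simp, h5⟩

/-! ### Monomial charts -/

/-- `T = 1 + ℓ B` near `c`, with `B c = τ`. -/
def IsOneAdd (l : C3 → ℂ) (c : C3) (T : C3 → ℂ) (τ : ℂ) : Prop :=
  ∃ B : C3 → ℂ, AnalyticAt ℂ B c ∧ B c = τ ∧ ∀ᶠ w in 𝓝 c, T w = 1 + l w * B w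

section OneAdd

variable {l : C3 → ℂ} {c : C3} {T T' : C3 → ℂ} {τ τ' : ℂ}

theorem isOneAdd {A : C3 → ℂ} (hA : AnalyticAt ℂ A c) :
    IsOneAdd l c (fun w => 1 + l w * A w) (A c) :=
  ⟨A, hA, rfl, Filter.Eventually.of_forall fun _ => rfl⟩

theorem IsOneAdd.mul (hl : AnalyticAt ℂ l c) (h0 : l c = 0) (h : IsOneAdd l c T τ)
    (h' : IsOneAdd l c T' τ') : IsOneAdd l c (fun w => T w * T' w) (τ + τ') := by
  obtain ⟨B, hB, rfl, e⟩ := h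
  obtain ⟨B', hB', rfl, e'⟩ := h'
  refine ⟨fun w => B w + B' w + l w * (B w * B' w),
    (hB.fun_add hB').fun_add (hl.fun_mul (hB.fun_mul hB')), by simp [h0], ?_⟩
  filter_upwards [e, e'] with w h h'
  rw [h, h']
  ring

theorem IsOneAdd.pow (hl : AnalyticAt ℂ l c) (h0 : l c = 0) (h : IsOneAdd l c T τ) (n : ℕ) :
    IsOneAdd l c (fun w => T w ^ n) (n * τ) := by
  induction n with
  | zero => exact ⟨fun _ => 0, analyticAt_const, by simp, by simp⟩
  | succ n ih =>
    have := ih.mul hl h0 h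
    simp only [← pow_succ] at this
    convert this using 1
    push_cast
    ring

theorem IsOneAdd.inv (hl : AnalyticAt ℂ l c) (h0 : l c = 0) (h : IsOneAdd l c T τ) :
    IsOneAdd l c (fun w => (T w)⁻¹) (-τ) := by
  obtain ⟨B, hB, rfl, e⟩ := h
  have h1 : AnalyticAt ℂ (fun w => 1 + l w * B w) c := analyticAt_const.fun_add (hl.fun_mul hB)
  have h2 : 1 + l c * B c ≠ 0 := by simp [h0]
  refine ⟨fun w => - B w * (1 + l w * B w)⁻¹, hB.fun_neg.fun_mul (h1.fun_inv h2), by simp [h0], ?_⟩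
  filter_upwards [e, h1.continuousAt.eventually_ne h2] with w h h'
  rw [h]
  field_simp
  ring

theorem IsOneAdd.eventually_ne (hl : AnalyticAt ℂ l c) (h0 : l c = 0) (h : IsOneAdd l c T τ) :
    ∀ᶠ w in 𝓝 c, T w ≠ 0 := by
  obtain ⟨B, hB, rfl, e⟩ := h
  filter_upwards [e, (analyticAt_const.fun_add (hl.fun_mul hB) :
    AnalyticAt ℂ (fun w => 1 + l w * B w) c).continuousAt.eventually_ne
      (by simp [h0] : 1 + l c * B c ≠ 0)] with w h h'
  rwa [h]

end OneAdd

/-- A vector field which is toric up to a term in the direction of the last coordinate. -/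
def toricField (B : C3 → C3) (D : C3 → ℂ) (w : C3) : C3 := fun k =>
  w k * B w k + if k = 2 then D w else 0

theorem analyticAt_toricField {B : C3 → C3} {D : C3 → ℂ} {c : C3} (hB : AnalyticAt ℂ B c)
    (hD : AnalyticAt ℂ D c) : AnalyticAt ℂ (toricField B D) c := by
  refine analyticAt_c3.2 fun k => ?_
  refine ((analyticAt_coord k c).fun_mul (analyticAt_c3.1 hB k)).fun_add ?_
  by_cases hk : k = 2
  · simpa only [hk, if_true] using hD
  · simpa only [hk, if_false] using analyticAt_const

/-- The lift of `f` in the `y`-chart of the blow-up of the origin. -/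
def familyLift (K : C3 → C3) : C3 → C3 := blLift 1 fun v => v 1 ^ 2 • chartField 1 K v

theorem IsFamilyChart.exists_localLift {f : C3 → C3} {K : C3 → C3} (h : IsFamilyChart f 1 K 0)
    {X : Threefold} {π : X → C3} {ψ : OpenPartialHomeomorph X C3} (hψ : ψ ∈ Chart X) {c : C3}
    (hc : c ∈ ψ.target) {μ : C3 → C3} (hμ : ∀ w ∈ ψ.target, π (ψ.symm w) = bl 1 (μ w))
    (hμc : ContinuousAt μ c) (hμ0 : μ c = 0) {l : C3 → ℂ} (hl : AnalyticAt ℂ l c)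
    (hl0 : ∀ w, μ w 1 = 0 → l w = 0) {T : Fin 3 → C3 → ℂ} {τ : C3} {D : C3 → ℂ}
    (hT : ∀ k, IsOneAdd l c (T k) (τ k)) (hD : AnalyticAt ℂ D c)
    (he : ∀ᶠ w in 𝓝 c, μ (fun k => w k * T k w + if k = 2 then l w * D w else 0) =
      familyLift K (μ w)) :
    ∃ B : C3 → C3, AnalyticAt ℂ B c ∧ B c = τ ∧
      IsLocalLift f π ψ (fun w => w + l w • toricField B D w) c := by
  choose B hB hτ hTB using hT
  have hBa : AnalyticAt ℂ (fun w k => B k w) c := analyticAt_c3.2 hB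
  refine ⟨fun w k => B k w, hBa, funext hτ, hψ, hc, ?_, ?_, ?_⟩
  · exact analyticAt_id.fun_add (hl.fun_smul (analyticAt_toricField hBa hD))
  · have hlc : l c = 0 := hl0 c (by rw [hμ0]; rfl)
    have hF : ContinuousAt (fun w => w + l w • toricField (fun w k => B k w) D w) c :=
      (analyticAt_id.fun_add (hl.fun_smul (analyticAt_toricField hBa hD))).continuousAt
    have hFt : ∀ᶠ w in 𝓝 c, w + l w • toricField (fun w k => B k w) D w ∈ ψ.target :=
      hF (by
        simp only [hlc, zero_smul, add_zero]
        exact ψ.open_target.mem_nhds hc)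
    have hne : ∀ᶠ v in 𝓝 (0 : C3), 1 + v 1 ^ 2 * chartField 1 K v 1 ≠ 0 := by
      have : ContinuousAt (fun v => 1 + v 1 ^ 2 * chartField 1 K v 1) 0 :=
        (analyticAt_const.fun_add (((analyticAt_coord 1 0).fun_pow 2).fun_mul
          (analyticAt_c3.1 h.analyticAt 1))).continuousAt
      exact this.eventually_ne (by simp)
    have ht : Filter.Tendsto μ (𝓝 c) (𝓝 0) := by rw [← hμ0]; exact hμc
    filter_upwards [he, hFt, ψ.open_target.mem_nhds hc, Filter.eventually_all.2 hTB, ht.eventually hne,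
      ht.eventually h.2] with w h1 h2 h3 h4 h5 h6
    rw [hμ _ h2, hμ _ h3, h6]
    have h7 : (w + l w • toricField (fun w k => B k w) D w) =
        fun k => w k * T k w + if k = 2 then l w * D w else 0 := by
      funext k
      rw [h4]
      simp only [toricField, Pi.add_apply, Pi.smul_apply, smul_eq_mul]
      split_ifs <;> ring
    rw [h7, h1, familyLift, bl_blLift (by simpa using h5), smul_smul, ← pow_succ']
    rfl
  · filter_upwards [ψ.open_target.mem_nhds hc] with w hw h0
    rw [hμ w hw] at h0
    have h1 := congrFun h0 1
    rw [bl_same] at h1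
    rw [hl0 w h1, zero_smul, add_zero]

section Germ

variable {f : C3 → C3} {X : Threefold} {π : X → C3} {g : X → X} {ψ : OpenPartialHomeomorph X C3}
  {c : C3} {F : C3 → C3}

theorem IsLocalLift.germIn (h : IsLocalLift f π ψ F c) (hπ : IsLiftable f π) (hg : IsLift f π g)
    (hc : π (ψ.symm c) = 0) {N : (C3 → C3) → Prop} (hN : IsGermProp N)
    (hF : N fun z => F (z + c) - c) : GermIn N g (ψ.symm c) := by
  refine germIn_of_chart (hπ.fix hg hc) h.mem h.mem_source ?_
  rw [h.apply_symm]
  refine hN _ _ ?_ hF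
  have ht : Filter.Tendsto (fun z : C3 => z + c) (𝓝 0) (𝓝 c) := by
    have : Continuous fun z : C3 => z + c := by fun_prop
    simpa using this.tendsto 0
  filter_upwards [ht.eventually (hπ.expression hg h hc)] with z hz
  rw [hz]

theorem nonsingForm_translate {l : C3 → ℂ} {V : C3 → C3} (hl : AnalyticAt ℂ l c) (hl0 : l c = 0)
    (hV : AnalyticAt ℂ V c) (hV0 : V c ≠ 0) :
    NonsingForm fun z => (z + c + l (z + c) • V (z + c)) - c := by
  have hadd : AnalyticAt ℂ (fun z : C3 => z + c) 0 := analyticAt_id.add analyticAt_const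
  refine ⟨fun z => l (z + c), fun z => V (z + c), AnalyticAt.fun_comp (g := l) (by rwa [zero_add]) hadd,
    AnalyticAt.fun_comp (g := V) (by rwa [zero_add]) hadd, by simpa, by simpa,
    Filter.Eventually.of_forall fun z => ?_⟩
  funext i
  simp only [Pi.add_apply, Pi.sub_apply]
  ring

theorem isLogForm_toricField {n : Fin 3 → ℕ} (hn : ∃ i, n i ≠ 0) (h2 : n 2 = 0) {B : C3 → C3}
    {D m0 m1 m2 : C3 → ℂ} (hB : AnalyticAt ℂ B 0) (h0 : AnalyticAt ℂ m0 0)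
    (h1 : AnalyticAt ℂ m1 0) (h2' : AnalyticAt ℂ m2 0)
    (hD : ∀ w, D w = w 0 * m0 w + w 1 * m1 w + w 2 * m2 w) :
    IsLogForm (fun w => w + monom n w • toricField B D w) n (fun _ => 1)
      (fun w => !![B w 0, 0, 0; 0, B w 1, 0; m0 w, m1 w, B w 2 + m2 w]) where
  unit := analyticAt_const
  unit_ne := one_ne_zero
  analytic i k := by
    have hB := fun k => analyticAt_c3.1 hB k
    fin_cases i <;> fin_cases k
    exacts [hB 0, analyticAt_const, analyticAt_const, analyticAt_const, hB 1, analyticAt_const, h0, h1,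
      (hB 2).fun_add h2']
  ne := hn
  log i k hi hk := by
    refine Filter.Eventually.of_forall fun w => ?_
    fin_cases i
    · fin_cases k
      exacts [absurd rfl hk, rfl, rfl]
    · fin_cases k
      exacts [rfl, absurd rfl hk, rfl]
    · exact absurd h2 hi
  eq := by
    refine Filter.Eventually.of_forall fun w => ?_
    rw [one_mul]
    congr 2
    funext i
    fin_cases i
    · simp [toricField, Matrix.mulVec, dotProduct, Fin.sum_univ_three]
      ring
    · simp [toricField, Matrix.mulVec, dotProduct, Fin.sum_univ_three]
      ring
    · simp [toricField, Matrix.mulVec, dotProduct, Fin.sum_univ_three, hD]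
      ring

theorem typeA_toricField {n : Fin 3 → ℕ} {B : C3 → C3} (hB : AnalyticAt ℂ B c)
    (hB0 : ∀ k, c k * B c k = 0) {i k : Fin 3} (hik : i ≠ k) (hi : c i = 0) (hk : c k = 0)
    (hni : n i ≠ 0) (hnk : n k ≠ 0) (hBi : B c i ≠ 0)
    (hBk : ∀ r : ℚ, 0 < r → B c k ≠ B c i * (r : ℂ)) :
    TypeA fun z => (z + c + monom n (z + c) • toricField B (fun _ => 0) (z + c)) - c := by
  have hadd : AnalyticAt ℂ (fun z : C3 => z + c) 0 := analyticAt_id.add analyticAt_const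
  have hBa : ∀ r, AnalyticAt ℂ (fun z => B (z + c) r) 0 := fun r =>
    AnalyticAt.fun_comp (g := fun w => B w r) (by rw [zero_add]; exact analyticAt_c3.1 hB r) hadd
  have hza : ∀ r, AnalyticAt ℂ (fun z : C3 => (z + c) r) 0 := fun r => analyticAt_c3.1 hadd r
  have hm := fun r => hadamard (h := fun z => (z + c) r * B (z + c) r) ((hza r).fun_mul (hBa r))
    (by simpa using hB0 r)
  choose m hma hme _ using hm
  refine ⟨i, k, hik, fun r => if c r = 0 then n r else 0,
    fun z => ∏ r, if c r = 0 then 1 else (z + c) r ^ n r,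
    fun z r s => if c r = 0 then (if s = r then B (z + c) r else 0) else m r s z,
    ⟨?_, ?_, fun r s => ?_, ⟨i, by simpa [hi]⟩, fun r s hr hs => ?_, ?_⟩, ?_⟩
  · refine Finset.analyticAt_fun_prod _ fun r _ => ?_
    by_cases hr : c r = 0
    · simpa only [hr, if_true] using analyticAt_const
    · simp only [hr, if_false]
      exact (hza r).fun_pow _
  · refine Finset.prod_ne_zero_iff.2 fun r _ => ?_
    by_cases hr : c r = 0 <;> simp [hr]
  · by_cases hr : c r = 0
    · by_cases hs : s = r
      · simp only [hr, hs, if_true]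
        exact hBa r
      · simp only [hr, hs, if_true, if_false]
        exact analyticAt_const
    · simp only [hr, if_false]
      exact hma r s
  · have hr0 : c r = 0 := by
      by_contra h
      exact hr (if_neg h)
    simp [hr0, hs]
  · filter_upwards [Filter.eventually_all.2 hme] with z hz
    have h1 : monom n (z + c) = (∏ r, if c r = 0 then 1 else (z + c) r ^ n r) *
        monom (fun r => if c r = 0 then n r else 0) z := by
      rw [monom, monom, ← Finset.prod_mul_distrib]
      refine Finset.prod_congr rfl fun r _ => ?_
      by_cases hr : c r = 0 <;> simp [hr]
    rw [h1]
    have h2 : toricField B (fun _ => 0) (z + c) = Matrix.mulVec (fun r s =>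
        if c r = 0 then (if s = r then B (z + c) r else 0) else m r s z) z := by
      funext r
      simp only [toricField, ite_self, add_zero, Matrix.mulVec, dotProduct]
      by_cases hr : c r = 0
      · simp [hr, mul_comm]
      · simp only [hr, if_false]
        exact hz r
    rw [h2]
    funext r
    simp only [Pi.add_apply, Pi.sub_apply]
    ring
  · exact ⟨by simpa [hi], by simpa [hk], by simpa [hi], by simpa [hi, hk] using hBk⟩

end Germ

section

theorem familyLift_eq {K : C3 → C3} {v : C3} {L₀ L₁ ρ : ℂ}
    (e0 : v 0 + v 1 ^ 2 * (v 2 * (1 - v 2) + v 1 * K v 0) = v 0 * L₀)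
    (e1 : 1 + v 1 ^ 2 * (v 0 * (v 0 ^ 2 - v 2 ^ 2) + v 1 * K v 1) = L₁)
    (e2 : v 2 + v 1 ^ 2 * (v 0 * v 2 * (1 - v 2) + v 1 * K v 2) = ρ) :
    familyLift K v = ![v 0 * L₀ / L₁, v 1 * L₁, ρ / L₁] := by
  subst e1 e2
  funext i
  fin_cases i <;> simp [familyLift, blLift, chartField_apply, cubic_update_one, e0]

theorem monom_vec (a b d : ℕ) (w : C3) : monom ![a, b, d] w = w 0 ^ a * w 1 ^ b * w 2 ^ d := by
  simp [monom, Fin.prod_univ_three]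

theorem IsOneAdd.zpow {l : C3 → ℂ} {c : C3} {T : C3 → ℂ} {τ : ℂ} (hl : AnalyticAt ℂ l c)
    (h0 : l c = 0) (h : IsOneAdd l c T τ) (n : ℤ) : IsOneAdd l c (fun w => T w ^ n) (n * τ) := by
  obtain ⟨m, rfl | rfl⟩ := n.eq_nat_or_neg
  · simpa using h.pow hl h0 m
  · simpa using (h.pow hl h0 m).inv hl h0

theorem analyticAt_vec {F₀ F₁ F₂ : C3 → ℂ} {c : C3} (h0 : AnalyticAt ℂ F₀ c)
    (h1 : AnalyticAt ℂ F₁ c) (h2 : AnalyticAt ℂ F₂ c) :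
    AnalyticAt ℂ (fun w => (![F₀ w, F₁ w, F₂ w] : C3)) c := by
  refine analyticAt_c3.2 fun i => ?_
  fin_cases i
  exacts [h0, h1, h2]

variable {f K : C3 → C3} {X : Threefold} {π : X → C3} {ψ : OpenPartialHomeomorph X C3} {c : C3}

theorem IsFamilyChart.exists_monomialLift (h : IsFamilyChart f 1 K 0) (hψ : ψ ∈ Chart X)
    (hc : c ∈ ψ.target) {μ : C3 → C3} (hμ : ∀ w ∈ ψ.target, π (ψ.symm w) = bl 1 (μ w))
    (hμa : AnalyticAt ℂ μ c) (hμ0 : μ c = 0) {n : Fin 3 → ℕ}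
    (hl0 : ∀ w, μ w 1 = 0 → monom n w = 0) {A : C3 → C3} (hA : AnalyticAt ℂ A c) {D : C3 → ℂ}
    (hD : AnalyticAt ℂ D c) (E : Matrix (Fin 3) (Fin 3) ℤ)
    (he : ∀ w (L : C3), (∀ j, L j = 1 + monom n w * A w j) → (∀ j, L j ≠ 0) →
      μ (fun k => (w k + if k = 2 then monom n w * D w else 0) *
        (L 0 ^ E k 0 * L 1 ^ E k 1 * L 2 ^ E k 2)) = familyLift K (μ w)) :
    ∃ (B : C3 → C3) (S : C3 → ℂ), AnalyticAt ℂ B c ∧ AnalyticAt ℂ S c ∧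
      (B c = fun k => E k 0 * A c 0 + E k 1 * A c 1 + E k 2 * A c 2) ∧ S c = 1 ∧
      IsLocalLift f π ψ (fun w => w + monom n w • toricField B (fun w => D w * S w) w) c := by
  have hl := analyticAt_monom n c
  have hlc : monom n c = 0 := hl0 c (by rw [hμ0]; rfl)
  have o : ∀ j, IsOneAdd (monom n) c (fun w => 1 + monom n w * A w j) (A c j) := fun j =>
    isOneAdd (A := fun w => A w j) (analyticAt_c3.1 hA j)
  have hT : ∀ k, IsOneAdd (monom n) c (fun w => (1 + monom n w * A w 0) ^ E k 0 *
      (1 + monom n w * A w 1) ^ E k 1 * (1 + monom n w * A w 2) ^ E k 2)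
      (E k 0 * A c 0 + E k 1 * A c 1 + E k 2 * A c 2) := fun k =>
    (((o 0).zpow hl hlc _).mul hl hlc ((o 1).zpow hl hlc _)).mul hl hlc ((o 2).zpow hl hlc _)
  obtain ⟨B₂, hB₂, -, hS⟩ := hT 2
  have hSa : AnalyticAt ℂ (fun w => 1 + monom n w * B₂ w) c :=
    analyticAt_const.fun_add (hl.fun_mul hB₂)
  obtain ⟨B, hB, hBc, hL⟩ := h.exists_localLift hψ hc hμ hμa.continuousAt hμ0 hl hl0 hT
    (hD.fun_mul hSa) (by
      filter_upwards [hS, Filter.eventually_all.2 fun j => (o j).eventually_ne hl hlc] with w h1 h2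
      rw [← he w (fun j => 1 + monom n w * A w j) (fun _ => rfl) h2]
      congr 1
      funext k
      by_cases hk : k = 2
      · subst hk
        simp only [if_true, ← h1]
        ring
      · simp [hk])
  exact ⟨B, _, hB, hSa, hBc, by simp [hlc], hL⟩

theorem IsFamilyChart.localLift_xx (h : IsFamilyChart f 1 K 0) (hψ : ψ ∈ Chart X)
    (hc : c ∈ ψ.target)
    (hμ : ∀ w ∈ ψ.target, π (ψ.symm w) = bl 1 ![w 0, w 0 ^ 3 * w 1, w 0 ^ 2 * w 2])
    (hc0 : c 0 = 0) (hc2 : c 2 = 0) : ∃ (B : C3 → C3) (m₁ m₂ : C3 → ℂ), AnalyticAt ℂ B c ∧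
      AnalyticAt ℂ m₁ c ∧ AnalyticAt ℂ m₂ c ∧ B c = 0 ∧ m₁ c = K 0 2 ∧ m₂ c = 1 ∧
      IsLocalLift f π ψ (fun w => w + monom ![7, 2, 0] w •
        toricField B (fun w => w 0 * 0 + w 1 * m₁ w + w 2 * m₂ w) w) c := by
  have hx := analyticAt_coord 0 c
  have hy := analyticAt_coord 1 c
  have hz := analyticAt_coord 2 c
  set μ : C3 → C3 := fun w => ![w 0, w 0 ^ 3 * w 1, w 0 ^ 2 * w 2] with hμd
  have hμa : AnalyticAt ℂ μ c := analyticAt_vec hx ((hx.fun_pow 3).fun_mul hy)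
    ((hx.fun_pow 2).fun_mul hz)
  have hμ0 : μ c = 0 := by
    funext i
    fin_cases i <;> simp [hμd, hc0]
  have hk : ∀ i, AnalyticAt ℂ (fun w => K (μ w) i) c := fun i =>
    AnalyticAt.fun_comp (g := fun w => K w i) (by rw [hμ0]; exact analyticAt_c3.1 h.1 i) hμa
  have hr : AnalyticAt ℂ (fun w => 1 - w 0 ^ 2 * w 2) c :=
    analyticAt_const.fun_sub ((hx.fun_pow 2).fun_mul hz)
  obtain ⟨B, S, hB, hS, hBc, hSc, hL⟩ := h.exists_monomialLift hψ hc hμ hμa hμ0 (n := ![7, 2, 0])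
    (fun w hw => by
      have : w 0 = 0 ∨ w 1 = 0 := by simpa [hμd] using hw
      rcases this with h | h <;> simp [monom_vec, h])
    (analyticAt_vec ((hz.fun_mul hr).fun_add ((hx.fun_mul hy).fun_mul (hk 0)))
      ((hx.fun_pow 2).fun_mul ((analyticAt_const.fun_sub ((hx.fun_pow 2).fun_mul
        (hz.fun_pow 2))).fun_add (hy.fun_mul (hk 1)))) (analyticAt_const (v := (0 : ℂ))) :
      AnalyticAt ℂ (fun w => ![w 2 * (1 - w 0 ^ 2 * w 2) + w 0 * w 1 * K (μ w) 0,
        w 0 ^ 2 * (1 - w 0 ^ 2 * w 2 ^ 2 + w 1 * K (μ w) 1), 0]) c)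
    ((hy.fun_mul (hk 2)).fun_add (hz.fun_mul hr))
    !![1, -1, 0; -3, 4, 0; -2, 1, 0] (fun w L hL hL0 => by
      have e0 := hL0 0
      have e1 := hL0 1
      rw [familyLift_eq (K := K) (v := μ w) (L₀ := L 0) (L₁ := L 1) (ρ := w 0 ^ 2 *
        (w 2 + monom ![7, 2, 0] w * (w 1 * K (μ w) 2 + w 2 * (1 - w 0 ^ 2 * w 2))))
        (by rw [hL 0]; simp only [monom_vec]; generalize K (μ w) 0 = k; simp [hμd]; ring)
        (by rw [hL 1]; simp only [monom_vec]; generalize K (μ w) 1 = k; simp [hμd]; ring)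
        (by simp only [monom_vec]; generalize K (μ w) 2 = k; simp [hμd]; ring)]
      generalize K (μ w) 2 = k
      funext i
      fin_cases i <;> simp [hμd] <;> field_simp)
  refine ⟨B, _, _, hB, (hk 2).fun_mul hS, hr.fun_mul hS, ?_, ?_, ?_, ?_⟩
  · rw [hBc]
    funext k
    simp [hc0, hc2]
  · simp [hSc, hμ0]
  · simp [hSc, hc0]
  · convert hL using 6
    ring

end

section

variable {f K : C3 → C3} {X : Threefold} {π : X → C3} {ψ : OpenPartialHomeomorph X C3} {c : C3}

theorem IsFamilyChart.localLift_x (h : IsFamilyChart f 1 K 0) (hψ : ψ ∈ Chart X)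
    (hc : c ∈ ψ.target)
    (hμ : ∀ w ∈ ψ.target, π (ψ.symm w) = bl 1 ![w 0, w 0 * w 1, w 0 * w 2])
    (hc0 : c = 0) : ∃ (B : C3 → C3) (m₀ m₁ : C3 → ℂ), AnalyticAt ℂ B c ∧
      AnalyticAt ℂ m₀ c ∧ AnalyticAt ℂ m₁ c ∧ B c = 0 ∧ m₀ c = 0 ∧ m₁ c = K 0 2 ∧
      IsLocalLift f π ψ (fun w => w + monom ![2, 2, 0] w •
        toricField B (fun w => w 0 * m₀ w + w 1 * m₁ w + w 2 * 0) w) c := by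
  have hx := analyticAt_coord 0 c
  have hy := analyticAt_coord 1 c
  have hz := analyticAt_coord 2 c
  set μ : C3 → C3 := fun w => ![w 0, w 0 * w 1, w 0 * w 2] with hμd
  have hμa : AnalyticAt ℂ μ c := analyticAt_vec hx (hx.fun_mul hy) (hx.fun_mul hz)
  have hμ0 : μ c = 0 := by
    funext i
    fin_cases i <;> simp [hμd, hc0]
  have hk : ∀ i, AnalyticAt ℂ (fun w => K (μ w) i) c := fun i =>
    AnalyticAt.fun_comp (g := fun w => K w i) (by rw [hμ0]; exact analyticAt_c3.1 h.1 i) hμa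
  have hr : AnalyticAt ℂ (fun w => 1 - w 0 * w 2) c := analyticAt_const.fun_sub (hx.fun_mul hz)
  obtain ⟨B, S, hB, hS, hBc, hSc, hL⟩ := h.exists_monomialLift hψ hc hμ hμa hμ0 (n := ![2, 2, 0])
    (fun w hw => by
      have := hw
      simp at this
      simp [monom_vec]
      tauto)
    (analyticAt_vec ((hz.fun_mul hr).fun_add (hy.fun_mul (hk 0))) (hx.fun_mul (((hx.fun_pow 2).fun_sub
      ((hx.fun_pow 2).fun_mul (hz.fun_pow 2))).fun_add (hy.fun_mul (hk 1)))) (analyticAt_const (v := (0 : ℂ))) :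
      AnalyticAt ℂ (fun w => ![w 2 * (1 - w 0 * w 2) + w 1 * K (μ w) 0, w 0 * (w 0 ^ 2 - w 0 ^ 2 * w 2 ^ 2 + w 1 * K (μ w) 1), 0]) c)
    ((hx.fun_mul (hz.fun_mul hr)).fun_add (hy.fun_mul (hk 2)))
    !![1, -1, 0; -1, 2, 0; -1, 0, 0] (fun w L hL hL0 => by
      have e0 := hL0 0
      have e1 := hL0 1
      rw [familyLift_eq (K := K) (v := μ w) (L₀ := L 0) (L₁ := L 1) (ρ := w 0 *
        (w 2 + monom ![2, 2, 0] w * (w 0 * (w 2 * (1 - w 0 * w 2)) + w 1 * K (μ w) 2)))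
        (by rw [hL 0]; simp only [monom_vec]; generalize K (μ w) 0 = k; simp [hμd]; ring)
        (by rw [hL 1]; simp only [monom_vec]; generalize K (μ w) 1 = k; simp [hμd]; ring)
        (by simp only [monom_vec]; generalize K (μ w) 2 = k; simp [hμd]; ring)]
      generalize K (μ w) 2 = k
      funext i
      fin_cases i <;> simp [hμd] <;> field_simp)
  refine ⟨B, _, _, hB, (hz.fun_mul hr).fun_mul hS, (hk 2).fun_mul hS, ?_, ?_, ?_, ?_⟩
  · rw [hBc]
    funext k
    simp [hc0]
  · simp [hc0]
  · simp [hSc, hμ0]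
  · convert hL using 6
    ring

theorem IsFamilyChart.localLift_xy (h : IsFamilyChart f 1 K 0) (hψ : ψ ∈ Chart X)
    (hc : c ∈ ψ.target)
    (hμ : ∀ w ∈ ψ.target, π (ψ.symm w) = bl 1 ![w 0 * w 1, w 0 ^ 2 * w 1 ^ 3, w 0 ^ 2 * w 1 ^ 2 * w 2])
    (hc1 : c 1 = 0) (hc2 : c 2 = 0) : ∃ (B : C3 → C3) (D : C3 → ℂ), AnalyticAt ℂ B c ∧
      AnalyticAt ℂ D c ∧ D c = K 0 2 ∧
      IsLocalLift f π ψ (fun w => w + monom ![4, 7, 0] w • toricField B D w) c := by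
  have hx := analyticAt_coord 0 c
  have hy := analyticAt_coord 1 c
  have hz := analyticAt_coord 2 c
  set μ : C3 → C3 := fun w => ![w 0 * w 1, w 0 ^ 2 * w 1 ^ 3, w 0 ^ 2 * w 1 ^ 2 * w 2] with hμd
  have hμa : AnalyticAt ℂ μ c := analyticAt_vec (hx.fun_mul hy) ((hx.fun_pow 2).fun_mul (hy.fun_pow 3))
    (((hx.fun_pow 2).fun_mul (hy.fun_pow 2)).fun_mul hz)
  have hμ0 : μ c = 0 := by
    funext i
    fin_cases i <;> simp [hμd, hc1]
  have hk : ∀ i, AnalyticAt ℂ (fun w => K (μ w) i) c := fun i =>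
    AnalyticAt.fun_comp (g := fun w => K w i) (by rw [hμ0]; exact analyticAt_c3.1 h.1 i) hμa
  have hr : AnalyticAt ℂ (fun w => 1 - w 0 ^ 2 * w 1 ^ 2 * w 2) c := 
    analyticAt_const.fun_sub (((hx.fun_pow 2).fun_mul (hy.fun_pow 2)).fun_mul hz)
  obtain ⟨B, S, hB, hS, hBc, hSc, hL⟩ := h.exists_monomialLift hψ hc hμ hμa hμ0 (n := ![4, 7, 0])
    (fun w hw => by
      have := hw
      simp at this
      simp [monom_vec]
      tauto)
    (analyticAt_vec (((hx.fun_mul hz).fun_mul hr).fun_add ((hx.fun_mul hy).fun_mul (hk 0)))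
      (hx.fun_mul ((((hx.fun_pow 2).fun_mul (hy.fun_pow 2)).fun_sub (((hx.fun_pow 4).fun_mul
        (hy.fun_pow 4)).fun_mul (hz.fun_pow 2))).fun_add ((hx.fun_mul (hy.fun_pow 2)).fun_mul (hk 1))))
      (analyticAt_const (v := (0 : ℂ))) :
      AnalyticAt ℂ (fun w => ![w 0 * w 2 * (1 - w 0 ^ 2 * w 1 ^ 2 * w 2) + w 0 * w 1 * K (μ w) 0,
        w 0 * (w 0 ^ 2 * w 1 ^ 2 - w 0 ^ 4 * w 1 ^ 4 * w 2 ^ 2 + w 0 * w 1 ^ 2 * K (μ w) 1), 0]) c)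
    (((hx.fun_mul hz).fun_mul hr).fun_add (hk 2))
    !![3, -4, 0; -2, 3, 0; -2, 1, 0] (fun w L hL hL0 => by
      have e0 := hL0 0
      have e1 := hL0 1
      rw [familyLift_eq (K := K) (v := μ w) (L₀ := L 0) (L₁ := L 1) (ρ := w 0 ^ 2 * w 1 ^ 2 *
        (w 2 + monom ![4, 7, 0] w * (w 0 * w 2 * (1 - w 0 ^ 2 * w 1 ^ 2 * w 2) + K (μ w) 2)))
        (by rw [hL 0]; simp only [monom_vec]; generalize K (μ w) 0 = k; simp [hμd]; ring)
        (by rw [hL 1]; simp only [monom_vec]; generalize K (μ w) 1 = k; simp [hμd]; ring)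
        (by simp only [monom_vec]; generalize K (μ w) 2 = k; simp [hμd]; ring)]
      generalize K (μ w) 2 = k
      funext i
      fin_cases i <;> simp [hμd] <;> field_simp)
  refine ⟨B, _, hB, (((hx.fun_mul hz).fun_mul hr).fun_add (hk 2)).fun_mul hS, ?_, hL⟩
  simp only [hSc, hμ0]
  simp [hc2]

theorem IsFamilyChart.localLift_zz (h : IsFamilyChart f 1 K 0) (hψ : ψ ∈ Chart X)
    (hc : c ∈ ψ.target)
    (hμ : ∀ w ∈ ψ.target, π (ψ.symm w) = bl 1 ![w 0 * w 2, w 0 * w 1 * w 2 ^ 3, w 0 * w 2 ^ 2])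
    (hc2 : c 2 = 0) : ∃ B : C3 → C3, AnalyticAt ℂ B c ∧
      B c = ![2 - K 0 2 * c 1 - c 0, 1 - 2 * K 0 2 * c 1 - 2 * c 0, K 0 2 * c 1 + c 0 - 1] ∧
      IsLocalLift f π ψ (fun w => w + monom ![2, 2, 7] w • toricField B (fun _ => 0) w) c := by
  have hx := analyticAt_coord 0 c
  have hy := analyticAt_coord 1 c
  have hz := analyticAt_coord 2 c
  set μ : C3 → C3 := fun w => ![w 0 * w 2, w 0 * w 1 * w 2 ^ 3, w 0 * w 2 ^ 2] with hμd
  have hμa : AnalyticAt ℂ μ c := analyticAt_vec (hx.fun_mul hz) ((hx.fun_mul hy).fun_mul (hz.fun_pow 3))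
    (hx.fun_mul (hz.fun_pow 2))
  have hμ0 : μ c = 0 := by
    funext i
    fin_cases i <;> simp [hμd, hc2]
  have hk : ∀ i, AnalyticAt ℂ (fun w => K (μ w) i) c := fun i =>
    AnalyticAt.fun_comp (g := fun w => K w i) (by rw [hμ0]; exact analyticAt_c3.1 h.1 i) hμa
  have hr : AnalyticAt ℂ (fun w => 1 - w 0 * w 2 ^ 2) c := 
    analyticAt_const.fun_sub (hx.fun_mul (hz.fun_pow 2))
  obtain ⟨B, S, hB, hS, hBc, hSc, hL⟩ := h.exists_monomialLift hψ hc hμ hμa hμ0 (n := ![2, 2, 7])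
    (fun w hw => by
      have := hw
      simp at this
      simp [monom_vec]
      tauto)
    (analyticAt_vec (hr.fun_add ((hy.fun_mul hz).fun_mul (hk 0)))
      (hx.fun_mul ((((hx.fun_pow 2).fun_mul (hz.fun_pow 2)).fun_sub ((hx.fun_pow 2).fun_mul
        (hz.fun_pow 4))).fun_add ((hy.fun_mul (hz.fun_pow 2)).fun_mul (hk 1))))
      ((hx.fun_mul hr).fun_add (hy.fun_mul (hk 2))) :
      AnalyticAt ℂ (fun w => ![(1 - w 0 * w 2 ^ 2) + w 1 * w 2 * K (μ w) 0,
        w 0 * (w 0 ^ 2 * w 2 ^ 2 - w 0 ^ 2 * w 2 ^ 4 + w 1 * w 2 ^ 2 * K (μ w) 1),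
        w 0 * (1 - w 0 * w 2 ^ 2) + w 1 * K (μ w) 2]) c)
    (analyticAt_const (v := (0 : ℂ)))
    !![2, -1, -1; 1, 2, -2; -1, 0, 1] (fun w L hL hL0 => by
      have e0 := hL0 0
      have e1 := hL0 1
      have e2 := hL0 2
      rw [familyLift_eq (K := K) (v := μ w) (L₀ := L 0) (L₁ := L 1) (ρ := w 0 * w 2 ^ 2 * L 2)
        (by rw [hL 0]; simp only [monom_vec]; generalize K (μ w) 0 = k; simp [hμd]; ring)
        (by rw [hL 1]; simp only [monom_vec]; generalize K (μ w) 1 = k; simp [hμd]; ring)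
        (by rw [hL 2]; simp only [monom_vec]; generalize K (μ w) 2 = k; simp [hμd]; ring)]
      generalize K (μ w) 2 = k
      funext i
      fin_cases i <;> simp [hμd] <;> field_simp)
  refine ⟨B, hB, ?_, by simpa using hL⟩
  rw [hBc, hμ0]
  funext k
  fin_cases k <;> simp [hc2] <;> ring

theorem IsFamilyChart.localLift_zy (h : IsFamilyChart f 1 K 0) (hψ : ψ ∈ Chart X)
    (hc : c ∈ ψ.target)
    (hμ : ∀ w ∈ ψ.target, π (ψ.symm w) = bl 1 ![w 0 * w 1 * w 2, w 0 * w 1 ^ 3 * w 2 ^ 2, w 0 * w 1 ^ 2 * w 2 ^ 2])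
    (hc1 : c 1 = 0) : ∃ B : C3 → C3, AnalyticAt ℂ B c ∧
      B c = ![2 * c 2 - c 0 * c 2 - K 0 2, - (c 0 * c 2 + K 0 2), 2 * (c 0 * c 2 + K 0 2) - c 2] ∧
      IsLocalLift f π ψ (fun w => w + monom ![2, 7, 4] w • toricField B (fun _ => 0) w) c := by
  have hx := analyticAt_coord 0 c
  have hy := analyticAt_coord 1 c
  have hz := analyticAt_coord 2 c
  set μ : C3 → C3 := fun w => ![w 0 * w 1 * w 2, w 0 * w 1 ^ 3 * w 2 ^ 2, w 0 * w 1 ^ 2 * w 2 ^ 2] with hμd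
  have hμa : AnalyticAt ℂ μ c := analyticAt_vec ((hx.fun_mul hy).fun_mul hz)
    ((hx.fun_mul (hy.fun_pow 3)).fun_mul (hz.fun_pow 2)) ((hx.fun_mul (hy.fun_pow 2)).fun_mul (hz.fun_pow 2))
  have hμ0 : μ c = 0 := by
    funext i
    fin_cases i <;> simp [hμd, hc1]
  have hk : ∀ i, AnalyticAt ℂ (fun w => K (μ w) i) c := fun i =>
    AnalyticAt.fun_comp (g := fun w => K w i) (by rw [hμ0]; exact analyticAt_c3.1 h.1 i) hμa
  have hr : AnalyticAt ℂ (fun w => 1 - w 0 * w 1 ^ 2 * w 2 ^ 2) c := 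
    analyticAt_const.fun_sub ((hx.fun_mul (hy.fun_pow 2)).fun_mul (hz.fun_pow 2))
  obtain ⟨B, S, hB, hS, hBc, hSc, hL⟩ := h.exists_monomialLift hψ hc hμ hμa hμ0 (n := ![2, 7, 4])
    (fun w hw => by
      have := hw
      simp at this
      simp [monom_vec]
      tauto)
    (analyticAt_vec ((hz.fun_mul hr).fun_add ((hy.fun_mul hz).fun_mul (hk 0)))
      ((hx.fun_mul hz).fun_mul (((((hx.fun_pow 2).fun_mul (hy.fun_pow 2)).fun_mul (hz.fun_pow 2)).fun_sub
        (((hx.fun_pow 2).fun_mul (hy.fun_pow 4)).fun_mul (hz.fun_pow 4))).fun_add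
        (((hy.fun_pow 2).fun_mul hz).fun_mul (hk 1))))
      (((hx.fun_mul hz).fun_mul hr).fun_add (hk 2)) :
      AnalyticAt ℂ (fun w => ![w 2 * (1 - w 0 * w 1 ^ 2 * w 2 ^ 2) + w 1 * w 2 * K (μ w) 0,
        w 0 * w 2 * (w 0 ^ 2 * w 1 ^ 2 * w 2 ^ 2 - w 0 ^ 2 * w 1 ^ 4 * w 2 ^ 4 + w 1 ^ 2 * w 2 * K (μ w) 1),
        w 0 * w 2 * (1 - w 0 * w 1 ^ 2 * w 2 ^ 2) + K (μ w) 2]) c)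
    (analyticAt_const (v := (0 : ℂ)))
    !![2, -1, -1; 0, 2, -1; -1, -2, 2] (fun w L hL hL0 => by
      have e0 := hL0 0
      have e1 := hL0 1
      have e2 := hL0 2
      rw [familyLift_eq (K := K) (v := μ w) (L₀ := L 0) (L₁ := L 1) (ρ := w 0 * w 1 ^ 2 * w 2 ^ 2 * L 2)
        (by rw [hL 0]; simp only [monom_vec]; generalize K (μ w) 0 = k; simp [hμd]; ring)
        (by rw [hL 1]; simp only [monom_vec]; generalize K (μ w) 1 = k; simp [hμd]; ring)
        (by rw [hL 2]; simp only [monom_vec]; generalize K (μ w) 2 = k; simp [hμd]; ring)]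
      generalize K (μ w) 2 = k
      funext i
      fin_cases i <;> simp [hμd] <;> field_simp)
  refine ⟨B, hB, ?_, by simpa using hL⟩
  rw [hBc, hμ0]
  funext k
  fin_cases k <;> simp [hc1] <;> ring

end

section

theorem IsBlowUp.affineChart_symm_eq {X X' : Threefold} {k : ℕ} {Z : Set X} {β : X' → X}
    (hβ : IsBlowUp k Z β) {u : OpenPartialHomeomorph X C3} {I : Finset (Fin 3)} {j : Fin 3}
    {ψ φ : OpenPartialHomeomorph X' C3} (hψ : IsAffineChart β u I j ψ)
    (hφ : IsAffineChart β u I j φ) {q : X'} (hq : q ∈ ψ.source) : φ.symm (ψ q) = q := by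
  have ht : φ.target = ψ.target := hφ.2.1.trans hψ.2.1.symm
  by_contra hne
  have hc : ContinuousAt (fun x => φ.symm (ψ x)) q :=
    (φ.continuousAt_symm (ht ▸ ψ.map_source hq)).comp (ψ.continuousAt hq)
  have h1 : ∀ᶠ x in 𝓝 q, φ.symm (ψ x) ≠ x :=
    (hc.ne_iff_eventually_ne continuousAt_id).1 hne
  obtain ⟨x, hxZ, hx, hxs⟩ := (mem_closure_iff_frequently.1 (hβ.dense_off q)).and_eventually
    (h1.and (ψ.open_source.mem_nhds hq)) |>.exists
  have hxt := ψ.map_source hxs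
  have h2 : β (φ.symm (ψ x)) = β x := by
    rw [hφ.2.2 _ (ht ▸ hxt), ← hψ.2.2 _ hxt, ψ.left_inv hxs]
  exact hx (hβ.injective_off hxZ h2.symm).symm

/-- The singular points off `W` are typed and finite in number. -/
def IsTameOff {X : Threefold} (π : X → C3) (g : X → X) (W : Set X) : Prop :=
  ∃ T : Set X, T.Finite ∧ ∀ q ∈ singularLocus π g, q ∈ W ∨ q ∈ T ∧ IsTyped g q

theorem IsTameOff.isTame {X : Threefold} {π : X → C3} {g : X → X} (h : IsTameOff π g ∅) :
    IsTame π g := by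
  obtain ⟨T, hT, h⟩ := h
  have h' := fun q hq => (h q hq).resolve_left (Set.notMem_empty q)
  exact ⟨fun q hq => (h' q hq).2, T, ∅, hT, Set.finite_empty, fun q hq => Or.inl (h' q hq).1,
    fun C hC => absurd hC (Set.notMem_empty C)⟩

theorem IsTameOff.blowUp {f : C3 → C3} {X X' : Threefold} {π : X → C3} {g : X → X} {k : ℕ}
    {Z : Set X} {β : X' → X} {g' : X' → X'} (hπ : IsLiftable f π) (hg : IsLift f π g)
    (hβ : IsBlowUp k Z β) (hk : k ≤ 3) (hπ' : IsLiftable f (fun x => π (β x)))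
    (hg' : IsLift f (fun x => π (β x)) g') (h : IsTameOff π g Z) {W T₀ : Set X'} (hT₀ : T₀.Finite)
    (hW : ∀ q, β q ∈ Z → π (β q) = 0 → IsSingularAt g' q → q ∈ W ∨ q ∈ T₀ ∧ IsTyped g' q) :
    IsTameOff (fun x => π (β x)) g' W := by
  obtain ⟨T, hT, h⟩ := h
  have hinj : Set.InjOn β (β ⁻¹' (T \ Z)) := fun x hx y _ hxy => hβ.injective_off hx.2 hxy
  refine ⟨β ⁻¹' (T \ Z) ∪ T₀, ((hT.subset Set.sdiff_subset).preimage hinj).union hT₀,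
    fun q ⟨hq0, hs⟩ => ?_⟩
  by_cases hq : β q ∈ Z
  · exact (hW q hq hq0 hs).imp id fun h => ⟨Or.inr h.1, h.2⟩
  have hc := (hg'.continuousAt hq0).self_of_nhds
  have hgg := hπ.comm hπ' hβ.holomorphic.continuous hg hg' hq0
  have hl : ∀ {N : (C3 → C3) → Prop}, IsGermProp N → GermIn N g (β q) → GermIn N g' q := fun hN h =>
    h.lift hN hβ hk hq (hπ'.fix hg' hq0) hc hgg
  rcases h (β q) ⟨hq0, GermIn.descend isGermProp_singForm hβ hk hq hs hc hgg⟩ with h1 | ⟨h1, h2⟩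
  · exact absurd h1 hq
  · exact Or.inr ⟨Or.inl ⟨h1, hq⟩, h2.imp (hl isGermProp_typeA)
      (Or.imp (hl isGermProp_typeZ) (hl isGermProp_typeD))⟩

/-! ### Singular points in the monomial charts -/

theorem not_posRat_mul_of_eq_neg {a b : ℂ} {s : ℚ} (ha : a ≠ 0) (hs : 0 ≤ s) (h : b = -(s : ℂ) * a) :
    ∀ r : ℚ, 0 < r → b ≠ a * (r : ℂ) := by
  intro r hr hb
  have h1 : a * ((r + s : ℚ) : ℂ) = 0 := by
    push_cast
    linear_combination h - hb
  rcases mul_eq_zero.1 h1 with h2 | h2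
  · exact ha h2
  · have : r + s = 0 := by exact_mod_cast h2
    linarith

variable {f K : C3 → C3} {X : Threefold} {π : X → C3} {g : X → X}
  {ψ : OpenPartialHomeomorph X C3} {c : C3}

theorem IsLocalLift.toricField_eq_zero {n : Fin 3 → ℕ} {B : C3 → C3} {D : C3 → ℂ}
    (h : IsLocalLift f π ψ (fun w => w + monom n w • toricField B D w) c) (hπ : IsLiftable f π)
    (hg : IsLift f π g) (hc : π (ψ.symm c) = 0) (hB : AnalyticAt ℂ B c) (hD : AnalyticAt ℂ D c)
    (hn : monom n c = 0) (hs : IsSingularAt g (ψ.symm c)) : toricField B D c = 0 := by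
  by_contra h0
  have := h.germIn hπ hg hc isGermProp_nonsingForm (nonsingForm_translate (analyticAt_monom n c) hn
    (analyticAt_toricField hB hD) h0)
  exact this.not_isSingularAt (hg.continuousAt hc).self_of_nhds hs

theorem IsLocalLift.typeA {n : Fin 3 → ℕ} {B : C3 → C3}
    (h : IsLocalLift f π ψ (fun w => w + monom n w • toricField B (fun _ => 0) w) c)
    (hπ : IsLiftable f π) (hg : IsLift f π g) (hc : π (ψ.symm c) = 0) (hB : AnalyticAt ℂ B c)
    (hB0 : ∀ k, c k * B c k = 0) {i k : Fin 3} (hik : i ≠ k) (hi : c i = 0) (hk : c k = 0)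
    (hni : n i ≠ 0) (hnk : n k ≠ 0) (hBi : B c i ≠ 0) {s : ℚ} (hs : 0 ≤ s)
    (hBk : B c k = -(s : ℂ) * B c i) : IsTyped g (ψ.symm c) :=
  Or.inl (h.germIn hπ hg hc isGermProp_typeA (typeA_toricField hB hB0 hik hi hk hni hnk hBi
    (not_posRat_mul_of_eq_neg hBi hs hBk)))

theorem vec_eq {a b d : ℂ} (h0 : c 0 = a) (h1 : c 1 = b) (h2 : c 2 = d) : c = ![a, b, d] := by
  funext i
  fin_cases i
  exacts [h0, h1, h2]

theorem IsFamilyChart.singular_zz (h : IsFamilyChart f 1 K 0) (hR : K 0 2 ≠ 0) (hψ : ψ ∈ Chart X)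
    (hc : c ∈ ψ.target)
    (hμ : ∀ w ∈ ψ.target, π (ψ.symm w) = bl 1 ![w 0 * w 2, w 0 * w 1 * w 2 ^ 3, w 0 * w 2 ^ 2])
    (hc2 : c 2 = 0) (hπ : IsLiftable f π) (hg : IsLift f π g) (hs : IsSingularAt g (ψ.symm c)) :
    (c = ![0, 0, 0] ∨ c = ![0, (2 * K 0 2)⁻¹, 0] ∨ c = ![2, 0, 0]) ∧ IsTyped g (ψ.symm c) := by
  obtain ⟨B, hB, hBc, hL⟩ := h.localLift_zz hψ hc hμ hc2
  have hz : π (ψ.symm c) = 0 := by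
    rw [hμ c hc, bl_eq_zero (by simp [hc2])]
  have h0 := hL.toricField_eq_zero hπ hg hz hB analyticAt_const (by simp [monom_vec, hc2]) hs
  have hB0 : ∀ k, c k * B c k = 0 := fun k => by simpa [toricField] using congrFun h0 k
  have e0 := hB0 0
  have e1 := hB0 1
  have b0 := congrFun hBc 0
  have b1 := congrFun hBc 1
  have b2 := congrFun hBc 2
  simp only [Matrix.cons_val] at b0 b1 b2
  rw [b0] at e0
  rw [b1] at e1
  rcases mul_eq_zero.1 e0 with x0 | x0 <;> rcases mul_eq_zero.1 e1 with y0 | y0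
  · refine ⟨Or.inl (vec_eq x0 y0 hc2), hL.typeA hπ hg hz hB hB0 (i := 0) (k := 2) (s := 1 / 2)
      (by decide) x0 hc2 (by simp) (by simp) ?_ (by norm_num) ?_⟩
    · simp [b0, x0, y0]
    · rw [b0, b2, x0, y0]
      norm_num
  · have hy : K 0 2 * c 1 = 1 / 2 := by
      rw [x0] at y0
      linear_combination (-1 / 2 : ℂ) * y0
    refine ⟨Or.inr (Or.inl (vec_eq x0 ?_ hc2)), hL.typeA hπ hg hz hB hB0 (i := 0) (k := 2)
      (s := 1 / 3) (by decide) x0 hc2 (by simp) (by simp) ?_ (by norm_num) ?_⟩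
    · field_simp
      linear_combination 2 * hy
    · rw [b0, x0, hy]
      norm_num
    · rw [b0, b2, x0, hy]
      norm_num
  · have hx : c 0 = 2 := by
      rw [y0] at x0
      linear_combination -x0
    refine ⟨Or.inr (Or.inr (vec_eq hx y0 hc2)), hL.typeA hπ hg hz hB hB0 (i := 1) (k := 2)
      (s := 1 / 3) (by decide) y0 hc2 (by simp) (by simp) ?_ (by norm_num) ?_⟩
    · rw [b1, hx, y0]
      norm_num
    · rw [b1, b2, hx, y0]
      norm_num
  · exfalso
    have : (3 : ℂ) = 0 := by linear_combination 2 * x0 - y0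
    norm_num at this

theorem IsFamilyChart.singular_zy (h : IsFamilyChart f 1 K 0) (hR : K 0 2 ≠ 0) (hψ : ψ ∈ Chart X)
    (hc : c ∈ ψ.target)
    (hμ : ∀ w ∈ ψ.target, π (ψ.symm w) =
      bl 1 ![w 0 * w 1 * w 2, w 0 * w 1 ^ 3 * w 2 ^ 2, w 0 * w 1 ^ 2 * w 2 ^ 2])
    (hc1 : c 1 = 0) (hπ : IsLiftable f π) (hg : IsLift f π g) (hs : IsSingularAt g (ψ.symm c)) :
    (c = ![0, 0, 0] ∨ c = ![0, 0, 2 * K 0 2]) ∧ IsTyped g (ψ.symm c) := by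
  obtain ⟨B, hB, hBc, hL⟩ := h.localLift_zy hψ hc hμ hc1
  have hz : π (ψ.symm c) = 0 := by
    rw [hμ c hc, bl_eq_zero (by simp [hc1])]
  have h0 := hL.toricField_eq_zero hπ hg hz hB analyticAt_const (by simp [monom_vec, hc1]) hs
  have hB0 : ∀ k, c k * B c k = 0 := fun k => by simpa [toricField] using congrFun h0 k
  have e0 := hB0 0
  have e2 := hB0 2
  have b0 := congrFun hBc 0
  have b1 := congrFun hBc 1
  have b2 := congrFun hBc 2
  simp only [Matrix.cons_val] at b0 b1 b2
  rw [b0] at e0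
  rw [b2] at e2
  rcases mul_eq_zero.1 e0 with x0 | x0 <;> rcases mul_eq_zero.1 e2 with z0 | z0
  · refine ⟨Or.inl (vec_eq x0 hc1 z0), hL.typeA hπ hg hz hB hB0 (i := 0) (k := 2) (s := 2)
      (by decide) x0 z0 (by simp) (by simp) ?_ (by norm_num) ?_⟩
    · simp [b0, x0, z0, hR]
    · rw [b0, b2, x0, z0]
      push_cast
      ring
  · have hz2 : c 2 = 2 * K 0 2 := by
      rw [x0] at z0
      linear_combination -z0
    refine ⟨Or.inr (vec_eq x0 hc1 hz2), hL.typeA hπ hg hz hB hB0 (i := 0) (k := 1) (s := 1 / 3)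
      (by decide) x0 hc1 (by simp) (by simp) ?_ (by norm_num) ?_⟩
    · rw [b0, x0, hz2]
      intro h3
      have : 3 * K 0 2 = 0 := by linear_combination h3
      exact hR (by simpa using this)
    · rw [b0, b1, x0, hz2]
      push_cast
      ring
  · exfalso
    rw [z0] at x0
    exact hR (by linear_combination -x0)
  · exfalso
    have h3 : c 2 = 0 := by linear_combination (2 / 3 : ℂ) * x0 + (1 / 3 : ℂ) * z0
    rw [h3] at x0
    exact hR (by linear_combination -x0)

theorem IsFamilyChart.singular_xx (h : IsFamilyChart f 1 K 0) (hR : K 0 2 ≠ 0) (hψ : ψ ∈ Chart X)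
    (hc : c ∈ ψ.target)
    (hμ : ∀ w ∈ ψ.target, π (ψ.symm w) = bl 1 ![w 0, w 0 ^ 3 * w 1, w 0 ^ 2 * w 2])
    (hc0 : c 0 = 0) (hc2 : c 2 = 0) (hπ : IsLiftable f π) (hg : IsLift f π g)
    (hs : IsSingularAt g (ψ.symm c)) : c = ![0, 0, 0] ∧ IsTyped g (ψ.symm c) := by
  obtain ⟨B, m₁, m₂, hB, h1, h2, hBc, h1c, h2c, hL⟩ := h.localLift_xx hψ hc hμ hc0 hc2
  have hz : π (ψ.symm c) = 0 := by
    rw [hμ c hc, bl_eq_zero (by simp [hc0])]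
  have hco := fun k => analyticAt_coord k c
  have hv := hL.toricField_eq_zero hπ hg hz hB
    ((((hco 0).fun_mul analyticAt_const).fun_add ((hco 1).fun_mul h1)).fun_add ((hco 2).fun_mul h2))
    (by simp [monom_vec, hc0]) hs
  have hc1 : c 1 = 0 := by
    have := congrFun hv 2
    simpa [toricField, hc2, h1c, hR] using this
  have hce := vec_eq hc0 hc1 hc2
  have hc00 : c = 0 := by
    rw [hce]
    funext i
    fin_cases i <;> rfl
  refine ⟨hce, Or.inr (Or.inl ?_)⟩
  subst hc00
  refine hL.germIn hπ hg hz isGermProp_typeZ ?_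
  simp only [add_zero, sub_zero]
  exact ⟨2, 0, 1, by decide, by decide, by decide, _, _, _,
    isLogForm_toricField ⟨0, by simp⟩ rfl hB analyticAt_const h1 h2 fun w => rfl, rfl, by simp,
    by simp [hBc, h2c], by simp [hBc], by simp, by simp [hBc]⟩

theorem IsFamilyChart.not_singular_xy (h : IsFamilyChart f 1 K 0) (hR : K 0 2 ≠ 0) (hψ : ψ ∈ Chart X)
    (hc : c ∈ ψ.target)
    (hμ : ∀ w ∈ ψ.target, π (ψ.symm w) =
      bl 1 ![w 0 * w 1, w 0 ^ 2 * w 1 ^ 3, w 0 ^ 2 * w 1 ^ 2 * w 2])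
    (hc1 : c 1 = 0) (hc2 : c 2 = 0) (hπ : IsLiftable f π) (hg : IsLift f π g) :
    ¬ IsSingularAt g (ψ.symm c) := by
  intro hs
  obtain ⟨B, D, hB, hD, hDc, hL⟩ := h.localLift_xy hψ hc hμ hc1 hc2
  have hz : π (ψ.symm c) = 0 := by
    rw [hμ c hc, bl_eq_zero (by simp [hc1])]
  have hv := congrFun (hL.toricField_eq_zero hπ hg hz hB hD (by simp [monom_vec, hc1]) hs) 2
  simp [toricField, hc2, hDc, hR] at hv

end

theorem IsPointChart.update {X X' : Threefold} {β : X' → X} {u : OpenPartialHomeomorph X C3}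
    {ψ : Fin 3 → OpenPartialHomeomorph X' C3} (hψ : ∀ j, IsPointChart β u j (ψ j)) {k : Fin 3}
    {v : OpenPartialHomeomorph X' C3} (hv : IsPointChart β u k v) (j : Fin 3) :
    IsPointChart β u j (Function.update ψ k v j) := by
  by_cases hj : j = k
  · subst hj
    simpa using hv
  · simpa [hj] using hψ j

theorem IsPointChart.isCoordAt {X X' : Threefold} {β : X' → X} {u : OpenPartialHomeomorph X C3}
    {j : Fin 3} {ψ : OpenPartialHomeomorph X' C3} (h : IsPointChart β u j ψ)
    (hψ : ∀ w, w ∈ ψ.target) : IsCoordAt ψ (ψ.symm 0) :=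
  ⟨h.mem, ψ.map_target (hψ 0), ψ.right_inv (hψ 0)⟩

section Eigen

variable {f : C3 → C3} {X X' : Threefold} {π : X → C3} {g : X → X} {p : X} {β : X' → X}
  {g' : X' → X'} {u : OpenPartialHomeomorph X C3} {ψ : Fin 3 → OpenPartialHomeomorph X' C3}
  {e : Fin 3 → ℕ} {U : C3 → ℂ} {M : C3 → Matrix (Fin 3) (Fin 3) ℂ}

theorem LogBlowUp.eq_of_nilpotent (h : LogBlowUp f π g p β g' u ψ e U M) (he : e 1 ≠ 0)
    (h00 : M 0 0 0 = 0) (h02 : M 0 0 2 = 1) (h11 : M 0 1 1 = 0) (h20 : M 0 2 0 = 0)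
    (h21 : M 0 2 1 ≠ 0) (h22 : M 0 2 2 = 0) {q : X'} (hq : β q = p) (hs : IsSingularAt g' q) :
    q = (ψ 0).symm 0 := by
  obtain ⟨j, c, hc, rfl, hc0⟩ := h.exists_chart hq (k := 0)
  have hE := h.isEigenDir hc (h.not_nonsing hq hs)
  have h10 := h.logForm.log_zero (k := 0) he (by decide)
  have h12 := h.logForm.log_zero (k := 2) he (by decide)
  match j, hc, hc0, hE with
  | 0, hc, _, hE =>
    have e1 := hE 1 (by decide)
    have e2 := hE 2 (by decide)
    simp only [mulVec_update_zero, h00, h02, h11, h20, h22, h10, h12] at e1 e2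
    have c1 : c 1 = 0 := by
      by_contra hne
      have h3 : M 0 0 1 * c 1 + c 2 = 0 := by
        have : c 1 * (M 0 0 1 * c 1 + c 2) = 0 := by linear_combination -e1
        exact (mul_eq_zero.1 this).resolve_left hne
      have : M 0 2 1 * c 1 = 0 := by linear_combination e2 + c 2 * h3
      exact (mul_ne_zero h21 hne) this
    have c2 : c 2 = 0 := by
      rw [c1] at e2
      have : c 2 ^ 2 = 0 := by linear_combination -e2
      exact pow_eq_zero_iff two_ne_zero |>.1 this
    congr 1
    funext i
    fin_cases i
    exacts [hc, c1, c2]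
  | 1, hc, hc0, hE =>
    exfalso
    have c0 := hc0 (by decide)
    have e2 := hE 2 (by decide)
    simp only [mulVec_update_one, h11, h20, h22, h10, h12, c0] at e2
    exact h21 (by linear_combination e2)
  | 2, hc, hc0, hE =>
    exfalso
    have c0 := hc0 (by decide)
    have e0 := hE 0 (by decide)
    have e1 := hE 1 (by decide)
    simp only [mulVec_update_two, h00, h02, h11, h20, h22, h10, h12, c0] at e0 e1
    have c1 : c 1 = 0 := by
      have : M 0 2 1 * c 1 ^ 2 = 0 := by linear_combination -e1
      exact pow_eq_zero_iff two_ne_zero |>.1 ((mul_eq_zero.1 this).resolve_left h21)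
    rw [c1] at e0
    exact one_ne_zero (α := ℂ) (by linear_combination e0)

theorem LogBlowUp.mem_line (h : LogBlowUp f π g p β g' u ψ e U M) {a : ℂ} (ha : a ≠ 0)
    (hM : M 0 = !![0, 0, 0; 0, 0, 0; 0, a, 0]) {q : X'} (hq : β q = p) (hs : IsSingularAt g' q) :
    (∃ t, q = (ψ 0).symm ![0, 0, t]) ∨ ∃ t, q = (ψ 2).symm ![t, 0, 0] := by
  obtain ⟨j, c, hc, rfl⟩ := h.isBlowUp.exists_pointChart_eq h.coord h.charts hq
  have hE := h.isEigenDir hc (h.not_nonsing hq hs)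
  match j, hc, hE with
  | 0, hc, hE =>
    have e2 := hE 2 (by decide)
    simp [mulVec_update_zero, hM, ha] at e2
    exact Or.inl ⟨c 2, by rw [← vec_eq hc e2 rfl]⟩
  | 1, hc, hE =>
    have e2 := hE 2 (by decide)
    simp [mulVec_update_one, hM, ha] at e2
  | 2, hc, hE =>
    have e1 := hE 1 (by decide)
    simp [mulVec_update_two, hM, ha] at e1
    exact Or.inr ⟨c 0, by rw [← vec_eq rfl e1 hc]⟩

end Eigen

/-! ### The line of the third exceptional divisor -/

/-- The line with equations `x = y = 0` in the chart `u` and `y = z = 0` in the chart `v`. -/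
def lineCentre {X : Threefold} (u v : OpenPartialHomeomorph X C3) : Set X :=
  {q | q ∈ u.source ∧ u q 0 = 0 ∧ u q 1 = 0} ∪ {q | q ∈ v.source ∧ v q 1 = 0 ∧ v q 2 = 0}

section Line

variable {X X' : Threefold} {β : X' → X} {p : X} {w : OpenPartialHomeomorph X C3}
  {u v : OpenPartialHomeomorph X' C3}

theorem isAdaptedChart_lineCentre_left (hβ : IsBlowUp 3 {p} β) (hw : IsCoordAt w p)
    (hu : IsPointChart β w 0 u) (hv : IsPointChart β w 2 v) :
    IsAdaptedChart (lineCentre u v) {0, 1} u := by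
  refine ⟨hu.mem, fun x hx => ?_⟩
  simp only [Finset.mem_insert, Finset.mem_singleton, forall_eq_or_imp, forall_eq]
  refine ⟨?_, fun h => Or.inl ⟨hx, h⟩⟩
  rintro (h | ⟨hxv, h1, h2⟩)
  · exact h.2
  have ht := v.map_source hxv
  have h0 : Function.update (v x) 2 1 0 ≠ 0 := by
    intro h0
    have := hv.notMem_source hβ hw hu ht h0
    rw [v.left_inv hxv] at this
    exact this hx
  obtain ⟨h3, h4⟩ := hv.change hβ hw hu ht h0
  rw [v.left_inv hxv] at h4
  have h5 : u x = blChange 2 0 (v x) := by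
    rw [← u.right_inv h3, ← h4]
  rw [h5]
  simp [blChange, h1, h2]

theorem isAdaptedChart_lineCentre_right (hβ : IsBlowUp 3 {p} β) (hw : IsCoordAt w p)
    (hu : IsPointChart β w 0 u) (hv : IsPointChart β w 2 v) :
    IsAdaptedChart (lineCentre u v) {1, 2} v := by
  refine ⟨hv.mem, fun x hx => ?_⟩
  simp only [Finset.mem_insert, Finset.mem_singleton, forall_eq_or_imp, forall_eq]
  refine ⟨?_, fun h => Or.inr ⟨hx, h⟩⟩
  rintro (⟨hxu, h1, h2⟩ | h)
  · have ht := u.map_source hxu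
    have h0 : Function.update (u x) 0 1 2 ≠ 0 := by
      intro h0
      have := hu.notMem_source hβ hw hv ht h0
      rw [u.left_inv hxu] at this
      exact this hx
    obtain ⟨h3, h4⟩ := hu.change hβ hw hv ht h0
    rw [u.left_inv hxu] at h4
    have h5 : v x = blChange 0 2 (u x) := by
      rw [← v.right_inv h3, ← h4]
    rw [h5]
    simp [blChange, h1, h2]
  · exact h.2

theorem mem_lineCentre (hβ : IsBlowUp 3 {p} β) (hw : IsCoordAt w p)
    (hu : IsPointChart β w 0 u) (hv : IsPointChart β w 2 v) {q : X'} (hq : q ∈ lineCentre u v) :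
    q ∈ v.source ∨ q ∈ u.source ∧ u q = 0 := by
  rcases hq with ⟨hq, h0, h1⟩ | h
  · have ht := u.map_source hq
    by_cases h2 : u q 2 = 0
    · refine Or.inr ⟨hq, ?_⟩
      funext i
      fin_cases i
      exacts [h0, h1, h2]
    · left
      obtain ⟨h3, h4⟩ := hu.change hβ hw hv ht (by simpa using h2)
      rw [u.left_inv hq] at h4
      rw [h4]
      exact v.map_target h3
  · exact Or.inl h.1

theorem map_lineCentre (hw : IsCoordAt w p)
    (hu : IsPointChart β w 0 u) (hv : IsPointChart β w 2 v) {q : X'} (hq : q ∈ lineCentre u v) :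
    β q = p := by
  rcases hq with ⟨hq, h0, -⟩ | ⟨hq, -, h2⟩
  · have := (hu.eq_center hw (u.map_source hq)).2 h0
    rwa [u.left_inv hq] at this
  · have := (hv.eq_center hw (v.map_source hq)).2 h2
    rwa [v.left_inv hq] at this

theorem IsBlowUp.exists_affineChart_eq {k : ℕ} {Z : Set X} (hβ : IsBlowUp k Z β)
    {I : Finset (Fin 3)} {y : OpenPartialHomeomorph X C3} (hI : I.card = k)
    (hy : IsAdaptedChart Z I y) {ψ : Fin 3 → OpenPartialHomeomorph X' C3}
    (hψ : ∀ j ∈ I, IsAffineChart β y I j (ψ j)) {q : X'} (hq : β q ∈ Z) (hqy : β q ∈ y.source) :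
    ∃ j ∈ I, ∃ c, q = (ψ j).symm c ∧ c j = 0 ∧ y (β q) = stdBlowUp I j c := by
  obtain ⟨j, hj, φ, hφ, hqφ⟩ := hβ.cover I y hI hy q hqy
  have ht := φ.map_source hqφ
  have h1 : y (β q) = stdBlowUp I j (φ q) := by
    have h2 := hφ.2.2 _ ht
    rw [φ.left_inv hqφ] at h2
    rw [h2, y.right_inv]
    rwa [hφ.2.1] at ht
  refine ⟨j, hj, φ q, (hβ.affineChart_symm_eq hφ (hψ j hj) hqφ).symm, ?_, h1⟩
  have h3 := (hy.2 _ hqy).1 hq j hj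
  rwa [h1, stdBlowUp_same] at h3

end Line

section

variable {f : C3 → C3} {P Q R : FPS}

section SecondBlowUp

variable {X₁ X₂ : Threefold} {β₁ : X₁ → Threefold.affine} {β₂ : X₂ → X₁}
  {u₁ : OpenPartialHomeomorph X₁ C3} {u₂ : OpenPartialHomeomorph X₂ C3}

theorem IsPointChart.mem_target_of_forall {X X' : Threefold} {β : X' → X}
    {u : OpenPartialHomeomorph X C3} {j : Fin 3} {ψ : OpenPartialHomeomorph X' C3}
    (h : IsPointChart β u j ψ) (hu : ∀ w, w ∈ u.target) (w : C3) : w ∈ ψ.target :=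
  (h.target w).2 (hu _)

theorem IsInFamily.secondBlowUp (hf : IsInFamily f P Q R)
    (hR : MvPowerSeries.coeff (Finsupp.single (1 : Fin 3) 4) R ≠ 0)
    (h1 : IsBlowUp 3 ({(0 : C3)} : Set Threefold.affine) β₁)
    (hu1 : IsPointChart β₁ (OpenPartialHomeomorph.refl C3) 1 u₁)
    (h2 : IsBlowUp 3 {u₁.symm 0} β₂) (hu2 : IsPointChart β₂ u₁ 0 u₂) :
    IsLiftable (X := X₂) f (fun x => β₁ (β₂ x)) ∧
      ∀ g, IsLift (X := X₂) f (fun x => β₁ (β₂ x)) g →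
        IsTameOff (X := X₂) (fun x => β₁ (β₂ x)) g {u₂.symm 0} := by
  have t1 : ∀ w, w ∈ u₁.target := hu1.mem_target_of_forall fun w => Set.mem_univ w
  have c1 := hu1.isCoordAt t1
  have z1 : β₁ (u₁.symm 0) = (0 : C3) := (hu1.eq_center isCoordAt_refl (t1 0)).2 rfl
  have hX1 := hf.isLiftable_blowUp h1
  obtain ⟨g₁, hg₁⟩ := hX1.exists_isLift
  obtain ⟨T, hT, hs1⟩ := hf.isTyped_firstBlowUp h1 hg₁ hu1
  have ht1 : IsTameOff (X := X₁) β₁ g₁ {u₁.symm 0} := ⟨T, hT, fun q hq => hs1 q hq.1 hq.2⟩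
  obtain ⟨U, M, hM, m00, m02, m11, m20, m21, m22⟩ := hf.base_point hR h1 hg₁ hu1
  have hgerm : GermIn (LogType fun _ _ => True) g₁ (u₁.symm 0) :=
    ⟨hX1.fix hg₁ z1, u₁, c1, _, U, M, hM, trivial⟩
  have hX2 := hX1.pointBlowUp hg₁ z1 hgerm.tangent h2
  refine ⟨hX2, fun g₂ hg₂ => ?_⟩
  obtain ⟨ψ, hψ⟩ := h2.exists_pointCharts c1
  have L : LogBlowUp f (X := X₁) β₁ g₁ (u₁.symm 0) β₂ g₂ u₁ (Function.update ψ 0 u₂) _ U M :=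
    ⟨hX1, hg₁, z1, c1, hM, h2, hX2, hg₂, IsPointChart.update hψ hu2⟩
  refine ht1.blowUp hX1 hg₁ h2 le_rfl hX2 hg₂ Set.finite_empty fun q hq _ hs => Or.inl ?_
  have := L.eq_of_nilpotent (by simp) m00 m02 m11 m20 m21 m22 hq hs
  simpa using this

theorem IsInFamily.secondBase_point (hf : IsInFamily f P Q R)
    (hu1 : IsPointChart β₁ (OpenPartialHomeomorph.refl C3) 1 u₁)
    (hu2 : IsPointChart β₂ u₁ 0 u₂) (hX : IsLiftable (X := X₂) f (fun x => β₁ (β₂ x)))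
    {g : X₂ → X₂} (hg : IsLift (X := X₂) f (fun x => β₁ (β₂ x)) g) :
    ∃ U M, IsLogForm (fun w => u₂ (g (u₂.symm w))) ![2, 2, 0] U M ∧
      M 0 = !![0, 0, 0; 0, 0, 0; 0, MvPowerSeries.coeff (Finsupp.single (1 : Fin 3) 4) R, 0] := by
  have t1 : ∀ w, w ∈ u₁.target := hu1.mem_target_of_forall fun w => Set.mem_univ w
  have t2 := hu2.mem_target_of_forall t1
  obtain ⟨K, hK, hKR⟩ := hf.exists_chart 1
  have hμ : ∀ w ∈ u₂.target, β₁ (β₂ (u₂.symm w)) = bl 1 ![w 0, w 0 * w 1, w 0 * w 2] := by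
    intro w hw
    rw [hu2.eq w hw, hu1.eq _ (t1 _)]
    change bl 1 (bl 0 w) = _
    congr 1
    funext i
    fin_cases i <;> simp [bl] <;> ring
  obtain ⟨B, m₀, m₁, hB, h0, h1', hBc, h0c, h1c, hL⟩ := (hK 0 rfl).localLift_x
    (π := fun x => β₁ (β₂ x)) hu2.mem (t2 0) hμ rfl
  have hz : β₁ (β₂ (u₂.symm 0)) = (0 : C3) := by
    rw [hμ 0 (t2 0), bl_eq_zero (by simp)]
  have hF := (hX.expression hg hL hz).mono fun w hw => hw.symm
  have hlog := isLogForm_toricField (n := ![2, 2, 0]) ⟨0, by simp⟩ rfl hB h0 h1'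
    (m2 := fun _ => 0) analyticAt_const (fun w => rfl)
  refine ⟨_, _, hlog.congr hF, ?_⟩
  simp [hBc, h0c, h1c, hKR]

end SecondBlowUp

theorem IsInFamily.thirdBlowUp (hf : IsInFamily f P Q R)
    (hR : MvPowerSeries.coeff (Finsupp.single (1 : Fin 3) 4) R ≠ 0)
    {X₁ X₂ X₃ : Threefold} {β₁ : X₁ → Threefold.affine} {β₂ : X₂ → X₁} {β₃ : X₃ → X₂}
    {u₁ : OpenPartialHomeomorph X₁ C3} {u₂ : OpenPartialHomeomorph X₂ C3}
    {u₃ v₃ : OpenPartialHomeomorph X₃ C3}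
    (h1 : IsBlowUp 3 ({(0 : C3)} : Set Threefold.affine) β₁)
    (hu1 : IsPointChart β₁ (OpenPartialHomeomorph.refl C3) 1 u₁)
    (h2 : IsBlowUp 3 {u₁.symm 0} β₂) (hu2 : IsPointChart β₂ u₁ 0 u₂)
    (h3 : IsBlowUp 3 {u₂.symm 0} β₃) (hu3 : IsPointChart β₃ u₂ 0 u₃)
    (hv3 : IsPointChart β₃ u₂ 2 v₃) :
    IsLiftable (X := X₃) f (fun x => β₁ (β₂ (β₃ x))) ∧
      ∀ g, IsLift (X := X₃) f (fun x => β₁ (β₂ (β₃ x))) g →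
        IsTameOff (X := X₃) (fun x => β₁ (β₂ (β₃ x))) g (lineCentre u₃ v₃) := by
  have t1 : ∀ w, w ∈ u₁.target := hu1.mem_target_of_forall fun w => Set.mem_univ w
  have t2 := hu2.mem_target_of_forall t1
  have c2 := hu2.isCoordAt t2
  obtain ⟨hX2, hT2⟩ := hf.secondBlowUp hR h1 hu1 h2 hu2
  obtain ⟨g₂, hg₂⟩ := hX2.exists_isLift
  have z1 : β₁ (u₁.symm 0) = (0 : C3) := (hu1.eq_center isCoordAt_refl (t1 0)).2 rfl
  have z2 : β₁ (β₂ (u₂.symm 0)) = (0 : C3) := by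
    rw [(hu2.eq_center (hu1.isCoordAt t1) (t2 0)).2 rfl, z1]
  obtain ⟨U, M, hM, hM0⟩ := hf.secondBase_point hu1 hu2 hX2 hg₂
  have hgerm : GermIn (LogType fun _ _ => True) g₂ (u₂.symm 0) :=
    ⟨hX2.fix hg₂ z2, u₂, c2, _, U, M, hM, trivial⟩
  have hX3 := hX2.pointBlowUp hg₂ z2 hgerm.tangent h3
  refine ⟨hX3, fun g₃ hg₃ => ?_⟩
  obtain ⟨ψ, hψ⟩ := h3.exists_pointCharts c2
  have L : LogBlowUp f (X := X₂) (fun x => β₁ (β₂ x)) g₂ (u₂.symm 0) β₃ g₃ u₂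
      (Function.update (Function.update ψ 0 u₃) 2 v₃) _ U M :=
    ⟨hX2, hg₂, z2, c2, hM, h3, hX3, hg₃, IsPointChart.update (IsPointChart.update hψ hu3) hv3⟩
  refine (hT2 g₂ hg₂).blowUp hX2 hg₂ h3 le_rfl hX3 hg₃ Set.finite_empty fun q hq _ hs => Or.inl ?_
  rcases L.mem_line hR hM0 hq hs with ⟨t, ht⟩ | ⟨t, ht⟩
  · have ht : q = u₃.symm ![0, 0, t] := by simpa using ht
    have h4 := hu3.mem_target_of_forall t2 ![0, 0, t]
    refine Or.inl ⟨ht ▸ u₃.map_target h4, ?_⟩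
    rw [ht, u₃.right_inv h4]
    simp
  · have ht : q = v₃.symm ![t, 0, 0] := by simpa using ht
    have h4 := hv3.mem_target_of_forall t2 ![t, 0, 0]
    refine Or.inr ⟨ht ▸ v₃.map_target h4, ?_⟩
    rw [ht, v₃.right_inv h4]
    simp

theorem IsResolutionModel.isTame (hf : IsInFamily f P Q R) (hgen : IsGeneric P R) {X : Threefold}
    {π : X → C3} (hπ : IsResolutionModel X π) :
    IsLiftable f π ∧ ∀ g, IsLift f π g → IsTame π g := by
  obtain ⟨X₁, X₂, X₃, β₁, β₂, β₃, β₄, u₁, u₂, u₃, v₃, h1, hu1, h2, hu2, h3, hu3, hv3, h4, rfl⟩ := hπ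
  rw [isPointChart_iff] at hu1 hu2 hu3 hv3
  have t1 : ∀ w, w ∈ u₁.target := hu1.mem_target_of_forall fun w => Set.mem_univ w
  have t2 := hu2.mem_target_of_forall t1
  have c2 := hu2.isCoordAt t2
  have t3 := hu3.mem_target_of_forall t2
  have t3' := hv3.mem_target_of_forall t2
  change IsBlowUp 2 (lineCentre u₃ v₃) β₄ at h4
  obtain ⟨hX3, hT3⟩ := hf.thirdBlowUp hgen.1 h1 hu1 h2 hu2 h3 hu3 hv3
  obtain ⟨g₃, hg₃⟩ := hX3.exists_isLift
  have au := isAdaptedChart_lineCentre_left h3 c2 hu3 hv3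
  have av := isAdaptedChart_lineCentre_right h3 c2 hu3 hv3
  have : Nonempty (OpenPartialHomeomorph X C3) :=
    (h4.affine {0, 1} u₃ (by simp) au 0 (by simp)).nonempty
  choose! φ hφ using h4.affine {0, 1} u₃ (by simp) au
  choose! χ hχ using h4.affine {1, 2} v₃ (by simp) av
  have tφ : ∀ j ∈ ({0, 1} : Finset (Fin 3)), ∀ w, w ∈ (φ j).target := fun j hj w => by
    rw [(hφ j hj).2.1]
    exact t3 _
  have tχ : ∀ j ∈ ({1, 2} : Finset (Fin 3)), ∀ w, w ∈ (χ j).target := fun j hj w => by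
    rw [(hχ j hj).2.1]
    exact t3' _
  have eφ : ∀ j ∈ ({0, 1} : Finset (Fin 3)), ∀ w, β₁ (β₂ (β₃ (β₄ ((φ j).symm w)))) =
      bl 1 (bl 0 (bl 0 (stdBlowUp {0, 1} j w))) := fun j hj w => by
    rw [(hφ j hj).2.2 w (tφ j hj w), hu3.eq _ (t3 _), hu2.eq _ (t2 _), hu1.eq _ (t1 _)]
    rfl
  have eχ : ∀ j ∈ ({1, 2} : Finset (Fin 3)), ∀ w, β₁ (β₂ (β₃ (β₄ ((χ j).symm w)))) =
      bl 1 (bl 0 (bl 2 (stdBlowUp {1, 2} j w))) := fun j hj w => by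
    rw [(hχ j hj).2.2 w (tχ j hj w), hv3.eq _ (t3' _), hu2.eq _ (t2 _), hu1.eq _ (t1 _)]
    rfl
  have μxx : ∀ w ∈ (φ 0).target, β₁ (β₂ (β₃ (β₄ ((φ 0).symm w)))) =
      bl 1 ![w 0, w 0 ^ 3 * w 1, w 0 ^ 2 * w 2] := fun w _ => by
    rw [eφ 0 (by simp)]
    congr 1
    funext i
    fin_cases i <;> simp [bl, stdBlowUp] <;> ring
  have μxy : ∀ w ∈ (φ 1).target, β₁ (β₂ (β₃ (β₄ ((φ 1).symm w)))) =
      bl 1 ![w 0 * w 1, w 0 ^ 2 * w 1 ^ 3, w 0 ^ 2 * w 1 ^ 2 * w 2] := fun w _ => by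
    rw [eφ 1 (by simp)]
    congr 1
    funext i
    fin_cases i <;> simp [bl, stdBlowUp] <;> ring
  have μzz : ∀ w ∈ (χ 2).target, β₁ (β₂ (β₃ (β₄ ((χ 2).symm w)))) =
      bl 1 ![w 0 * w 2, w 0 * w 1 * w 2 ^ 3, w 0 * w 2 ^ 2] := fun w _ => by
    rw [eχ 2 (by simp)]
    congr 1
    funext i
    fin_cases i <;> simp [bl, stdBlowUp] <;> ring
  have μzy : ∀ w ∈ (χ 1).target, β₁ (β₂ (β₃ (β₄ ((χ 1).symm w)))) =
      bl 1 ![w 0 * w 1 * w 2, w 0 * w 1 ^ 3 * w 2 ^ 2, w 0 * w 1 ^ 2 * w 2 ^ 2] := fun w _ => by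
    rw [eχ 1 (by simp)]
    congr 1
    funext i
    fin_cases i <;> simp [bl, stdBlowUp] <;> ring
  have hcover : ∀ q, β₄ q ∈ lineCentre u₃ v₃ → ∃ c, c ∈ (φ 0).target ∧ c ∈ (φ 1).target ∧
      c ∈ (χ 1).target ∧ c ∈ (χ 2).target ∧
      ((q = (φ 0).symm c ∧ c 0 = 0 ∧ c 2 = 0) ∨ (q = (φ 1).symm c ∧ c 1 = 0 ∧ c 2 = 0) ∨
        (q = (χ 1).symm c ∧ c 1 = 0) ∨ (q = (χ 2).symm c ∧ c 2 = 0)) := by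
    intro q hq
    rcases mem_lineCentre h3 c2 hu3 hv3 hq with hv | ⟨hu, hu0⟩
    · obtain ⟨j, hj, c, rfl, hc, -⟩ := h4.exists_affineChart_eq (by simp) av hχ hq hv
      refine ⟨c, tφ 0 (by simp) c, tφ 1 (by simp) c, tχ 1 (by simp) c, tχ 2 (by simp) c, ?_⟩
      simp only [Finset.mem_insert, Finset.mem_singleton] at hj
      rcases hj with rfl | rfl
      · exact Or.inr (Or.inr (Or.inl ⟨rfl, hc⟩))
      · exact Or.inr (Or.inr (Or.inr ⟨rfl, hc⟩))
    · obtain ⟨j, hj, c, rfl, hc, he⟩ := h4.exists_affineChart_eq (by simp) au hφ hq hu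
      refine ⟨c, tφ 0 (by simp) c, tφ 1 (by simp) c, tχ 1 (by simp) c, tχ 2 (by simp) c, ?_⟩
      have hc2 : c 2 = 0 := by
        have := congrFun (hu0.symm.trans he) 2
        simpa [stdBlowUp] using this.symm
      simp only [Finset.mem_insert, Finset.mem_singleton] at hj
      rcases hj with rfl | rfl
      · exact Or.inl ⟨rfl, hc, hc2⟩
      · exact Or.inr (Or.inl ⟨rfl, hc, hc2⟩)
  obtain ⟨K, hK, hKR⟩ := hf.exists_chart 1
  have hK := hK 0 rfl
  have hR : K 0 2 ≠ 0 := by rw [hKR]; exact hgen.1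
  have z2 : β₁ (β₂ (u₂.symm 0)) = (0 : C3) := by
    rw [(hu2.eq_center (hu1.isCoordAt t1) (t2 0)).2 rfl]
    exact (hu1.eq_center isCoordAt_refl (t1 0)).2 rfl
  have hX : IsLiftable (X := X) f (fun x => β₁ (β₂ (β₃ (β₄ x)))) := by
    refine hX3.blowUp h4 (by norm_num) (fun z hz => ?_) fun q hq => ?_
    · change β₁ (β₂ (β₃ z)) = 0
      rw [map_lineCentre c2 hu3 hv3 hz, z2]
    · obtain ⟨c, t0, t1, s1, s2, ⟨rfl, e0, e2⟩ | ⟨rfl, e1, e2⟩ | ⟨rfl, e1⟩ | ⟨rfl, e2⟩⟩ := hcover q hq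
      · obtain ⟨B, m₁, m₂, -, -, -, -, -, -, hL⟩ := hK.localLift_xx
          (π := fun x => β₁ (β₂ (β₃ (β₄ x)))) (hφ 0 (by simp)).1 t0 μxx e0 e2
        exact ⟨_, _, _, hL, rfl⟩
      · obtain ⟨B, D, -, -, -, hL⟩ := hK.localLift_xy
          (π := fun x => β₁ (β₂ (β₃ (β₄ x)))) (hφ 1 (by simp)).1 t1 μxy e1 e2
        exact ⟨_, _, _, hL, rfl⟩
      · obtain ⟨B, -, -, hL⟩ := hK.localLift_zy
          (π := fun x => β₁ (β₂ (β₃ (β₄ x)))) (hχ 1 (by simp)).1 s1 μzy e1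
        exact ⟨_, _, _, hL, rfl⟩
      · obtain ⟨B, -, -, hL⟩ := hK.localLift_zz
          (π := fun x => β₁ (β₂ (β₃ (β₄ x)))) (hχ 2 (by simp)).1 s2 μzz e2
        exact ⟨_, _, _, hL, rfl⟩
  refine ⟨hX, fun g hg => IsTameOff.isTame ?_⟩
  refine (hT3 g₃ hg₃).blowUp hX3 hg₃ h4 (by norm_num) hX hg
    (T₀ := {(φ 0).symm ![0, 0, 0], (χ 1).symm ![0, 0, 0], (χ 1).symm ![0, 0, 2 * K 0 2],
      (χ 2).symm ![0, 0, 0], (χ 2).symm ![0, (2 * K 0 2)⁻¹, 0], (χ 2).symm ![2, 0, 0]})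
    (by simp) fun q hq _ hs => Or.inr ?_
  obtain ⟨c, t0, t1, s1, s2, ⟨rfl, e0, e2⟩ | ⟨rfl, e1, e2⟩ | ⟨rfl, e1⟩ | ⟨rfl, e2⟩⟩ := hcover q hq
  · obtain ⟨rfl, h⟩ := hK.singular_xx (π := fun x => β₁ (β₂ (β₃ (β₄ x)))) hR (hφ 0 (by simp)).1
      t0 μxx e0 e2 hX hg hs
    exact ⟨by simp, h⟩
  · exact absurd hs (hK.not_singular_xy (π := fun x => β₁ (β₂ (β₃ (β₄ x)))) hR (hφ 1 (by simp)).1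
      t1 μxy e1 e2 hX hg)
  · obtain ⟨rfl | rfl, h⟩ := hK.singular_zy (π := fun x => β₁ (β₂ (β₃ (β₄ x)))) hR
      (hχ 1 (by simp)).1 s1 μzy e1 hX hg hs
    all_goals exact ⟨by simp, h⟩
  · obtain ⟨rfl | rfl | rfl, h⟩ := hK.singular_zz (π := fun x => β₁ (β₂ (β₃ (β₄ x)))) hR
      (hχ 2 (by simp)).1 s2 μzz e2 hX hg hs
    all_goals exact ⟨by simp, h⟩

end

theorem IsTame.pattern {f : C3 → C3} {X : Threefold} {π : X → C3} {g : X → X} (hg : IsLift f π g)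
    (ht : IsTame π g) {C : Set X} (hC : IsPositiveDimComponent (singularLocus π g) C) :
    IsSmoothRationalCurve C ∧ (IsPatternOfType SimpleCornerForm SimpleCornerForm C g ∨
      IsPatternOfType SpinningCornerForm HalfCornerForm C g) := by
  obtain ⟨ht1, T, K, hT, hK, hTK, hKC⟩ := ht
  obtain ⟨h1, h2, h3⟩ := hKC C (hC.mem hT hK hTK fun D hD => ⟨(hKC D hD).1, (hKC D hD).2.1⟩)
  have hpat : IsPattern C g := by
    obtain ⟨U, hU, hπU, hgU, -⟩ := hg
    exact ⟨h1, ⟨U, hU, fun q hq => hπU (h2 hq).1, hgU⟩, fun q hq => (ht1 q (h2 hq)).tangent,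
      fun q hq => (h2 hq).2⟩
  refine ⟨h1, ?_⟩
  rcases h3 with hA | ⟨hB, hF⟩
  · have hs : ∀ q ∈ C, GermIn SimpleCornerForm g q := fun q hq => (hA q hq).simpleCorner
    refine Or.inl ⟨hpat, ?_, fun q hq _ => hs q hq⟩
    convert Set.finite_empty
    exact Set.eq_empty_of_forall_notMem fun q hq => hq.2 (hs q hq.1)
  · refine Or.inr ⟨hpat, hF.subset fun q hq => ⟨hq.1, fun h => hq.2 h.halfCorner⟩, fun q hq hn => ?_⟩
    exact ((hB q hq).resolve_right fun h => hn h.halfCorner).spinningCorner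

theorem IsAdaptedPointModification.isTame {f : C3 → C3} {P Q R : FPS} (hf : IsInFamily f P Q R)
    (hgen : IsGeneric P R) {X : Threefold} {π : X → C3} (hπ : IsAdaptedPointModification f X π) :
    IsLiftable f π ∧ ∀ g, IsLift f π g → IsTame π g := by
  induction hπ with
  | base h => exact h.isTame hf hgen
  | blowUp _ hg hp hβ ih => exact (ih.2 _ hg).blowUp ih.1 hg hp hβ

end TangentToId
end

open TangentToId
theorem proposition4 (f : C3 → C3) (P Q R : FPS) (hf : IsInFamily f P Q R) (hgen : IsGeneric P R)
    (X : Threefold) (π : X → C3) (hπ : IsAdaptedPointModification f X π) :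
    (∃ g : X → X, IsLift f π g) ∧
    ∀ g : X → X, IsLift f π g →
      ∀ C : Set X, IsPositiveDimComponent (singularLocus π g) C →
        IsSmoothRationalCurve C ∧
        (IsPatternOfType SimpleCornerForm SimpleCornerForm C g ∨
          IsPatternOfType SpinningCornerForm HalfCornerForm C g) := by
  obtain ⟨h1, h2⟩ := hπ.isTame hf hgen
  exact ⟨h1.exists_isLift, fun g hg C hC => (h2 g hg).pattern hg hC⟩
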